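/- **Setting.** Let $t=(t_1,t_2,\dots)$, $s=(s_1,s_2,\dots)$ be complex sequences with $\sum|t_i|<\infty$, $\sum|s_i|<\infty$; all partial derivatives are complex. Put $V(z)=\sum_{i\ge1}(t_iz^i-s_iz^{-i})$, $$\langle f,g\rangle=\oint_{S^1}\frac{dz}{2\pi i z}f(z)g(z^{-1})e^{V(z)},\qquad m_\infty=(\langle z^k,z^\ell\rangle)_{k,\ell\ge0},\qquad \tau_n=\det(\langle z^k,z^\ell\rangle)_{0\le k,\ell\le n-1},\qquad h_n=\frac{\tau_{n+1}}{\tau_n},$$ $\tau_0=1$. Here $\partial\log f$ means $\partial f/f$ (any local branch of the logarithm). Let $\mathbf s_n$ be the elementary Schur polynomials, $e^{\sum t_iz^i}=\sum_n\mathbf s_n(t)z^n$ ($\mathbf s_n=0$ for $n<0$), and $\mathbf s_\lambda(t)=\det(\mathbf s_{\lambda_i-i+j}(t))_{1\le i,j\le\hat\lambda_1}$ for a Young diagram $\lambda$, with $\hat\lambda_1$ its number of rows. Let $\Lambda$ be the shift matrix, $(\Lambda v)_n=v_{n+1}$. Where all $\tau_n\ne0$, there is a unique pair $S_1$ (lower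 triangular with unit diagonal), $S_2$ (upper triangular) of semi-infinite matrices with $S_1m_\infty=S_2$, that is $m_\infty=S_1^{-1}S_2$; $S_2$ has diagonal $h=\mathrm{diag}(h_0,h_1,\dots)$. Put $L_1=S_1\Lambda S_1^{-1}$, $L_2=S_2\Lambda^\top S_2^{-1}$, and, with $\chi(z)=(1,z,z^2,\dots)^\top$, $p^{(1)}_n(z)=(S_1\chi(z))_n$, $p_n^{(2)}(z)=(hS_2^{\top-1}\chi(z))_n$; these are monic of degree $n$ with $\langle p^{(1)}_n,p^{(2)}_m\rangle=\delta_{nm}h_n$. For a matrix $P$, $P_+$ is its upper triangular part with the diagonal and $P_-$ its strictly lower triangular part. **Theorem.** For each $n\ge0$, $\tau_n$ is analytic on $\ell^1\times\ell^1$ and, with $$I_n=\int_{(S^1)^n}|\Delta_n(z)|^2\prod_{k=1}^n e^{V(z_k)}\frac{dz_k}{2\pi i z_k},\qquad I_0=1,$$ where $\Delta_n$ is the Vandermonde determinant, and $dM$ the Haar probability measure on $U(n)$, $$\tau_n=\frac1{n!}I_n=\int_{U(n)}e^{\sum_{i\ge1}\mathrm{Tr}(t_iM^i-s_i\bar M^i)}dM=\sum_{\lambda:\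 \hat\lambda_1\le n}\mathbf s_\lambda(t)\,\mathbf s_\lambda(-s).$$ **(i) Virasoro constraints.** For $k\in\mathbb Z$ define operators in $t$ (indices $i,j\ge1$) by $J^{(0)}_k=\delta_{0k}$, $J^{(1)}_k=\frac{\partial}{\partial t_k}+(-k)t_{-k}$ (a term with an index $\le0$ is $0$), $$J^{(2)}_k=\sum_{i+j=k}\frac{\partial^2}{\partial t_i\partial t_j}+2\sum_{-i+j=k}it_i\frac{\partial}{\partial t_j}+\sum_{-i-j=k}it_i\,jt_j,$$ $\mathbb J^{(1)}_{k,n}(t)=J_k^{(1)}+nJ_k^{(0)}$, $\mathbb J^{(2)}_{k,n}(t)=\frac12\bigl(J_k^{(2)}+(2n+k+1)J_k^{(1)}+n(n+1)J_k^{(0)}\bigr)$, let $\mathbb J^{(i)}_{k,n}(-s)$ arise by replacing $t$ by $-s$, and put $$\mathcal D^\theta_{k,n}=\mathbb J^{(2)}_{k,n}(t)-\mathbb J^{(2)}_{-k,n}(-s)-k\bigl(\theta\,\mathbb J^{(1)}_{k,n}(t)+(1-\theta)\mathbb J^{(1)}_{-k,n}(-s)\bigr).$$ If $\sum i|t_i|<\infty$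 and $\sum i|s_i|<\infty$, then the sums in $\mathcal D^\theta_{k,n}I_n$ converge for $k\in\{-1,0,1\}$ and $\mathcal D^0_{-1,n}I_n=0$, $\mathcal D^\theta_{0,n}I_n=0$ for all $\theta\in\mathbb C$, $\mathcal D^1_{1,n}I_n=0$. On polynomials in the $t_i,s_i$ these operators satisfy $[\mathcal D_{1,n}^1,\mathcal D_{-1,n}^0]=2\mathcal D_{0,n}^\theta$, $[\mathcal D_{1,n}^1,\mathcal D_{0,n}^\theta]=\mathcal D_{1,n}^1$, $[\mathcal D_{0,n}^\theta,\mathcal D_{-1,n}^0]=\mathcal D_{-1,n}^0$. **(ii) 2d-Toda.** Where all $\tau_n\neq0$, for $i=1,2$ and $k\ge1$, $$\frac{\partial L_i}{\partial t_k}=[(L_1^k)_+,L_i],\qquad \frac{\partial L_i}{\partial s_k}=[(L_2^k)_-,L_i].$$ For $n\ge1$, where $\tau_n\neq0$ (and, in the second identity, $\tau_{n-1}\ne0$), $$\frac{\partial^2\log\tau_n}{\partial s_1\partial t_1}=-\frac{\tau_{n-1}\tau_{n+1}}{\tau_n^2},\qquad \frac{\partial^2\log\tau_n}{\partial s_2\partial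 t_1}=-2\,\frac{\partial}{\partial s_1}\log\frac{\tau_n}{\tau_{n-1}}\cdot\frac{\partial^2\log\tau_n}{\partial s_1\partial t_1}-\frac{\partial^3\log\tau_n}{\partial s_1^2\partial t_1}.$$ Local branches $q_n=\log(\tau_{n+1}/\tau_n)$ satisfy the discrete sinh-Gordon equation $$\frac{\partial^2q_n}{\partial t_1\partial s_1}=e^{q_n-q_{n-1}}-e^{q_{n+1}-q_n}\qquad(n\ge0;\ e^{q_0-q_{-1}}:=0).$$ Moreover, for any nowhere vanishing analytic functions $\tau_0=1,\tau_1,\tau_2,\dots$ of $(t_1,s_1)$ in an open subset of $\mathbb C^2$, and continuous branches $q_n=\log(\tau_{n+1}/\tau_n)$ there, the first identity for all $n\ge1$ is equivalent to this equation for all $n\ge0$. **(iii) Toeplitz lattice.** Where all $\tau_n\ne0$, put $x_n=p_n^{(1)}(0)$, $y_n=p^{(2)}_n(0)$. Then $x_0=y_0=1$, $h_n/h_{n-1}=1-x_ny_n$ for $n\ge1$, and for $a,b\ge0$ $$(h^{-1}L_1h)_{ab}=\begin{cases}-x_{a+1}y_b,&b\le a\\1-x_{a+1}y_{a+1},&b=a+1\\0,&b>a+1\end{cases}\qquad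 (L_2)_{ab}=\begin{cases}-x_ay_{b+1},&a\le b\\1-x_ay_a,&a=b+1\\0,&a>b+1.\end{cases}$$ Also $$x_n=\frac1{\tau_n}\int_{U(n)}\mathbf s_n\bigl(-\mathrm{Tr}M,-\tfrac12\mathrm{Tr}M^2,\dots\bigr)e^{\sum\mathrm{Tr}(t_iM^i-s_i\bar M^i)}dM=\frac{\mathbf s_n\bigl(-\frac{\partial}{\partial t_1},-\frac12\frac{\partial}{\partial t_2},\dots\bigr)\tau_n}{\tau_n},$$ $$y_n=\frac1{\tau_n}\int_{U(n)}\mathbf s_n\bigl(-\mathrm{Tr}\bar M,-\tfrac12\mathrm{Tr}\bar M^2,\dots\bigr)e^{\sum\mathrm{Tr}(t_iM^i-s_i\bar M^i)}dM=\frac{\mathbf s_n\bigl(\frac{\partial}{\partial s_1},\frac12\frac{\partial}{\partial s_2},\dots\bigr)\tau_n}{\tau_n}.$$ Let $H_i^{(k)}=-\frac1i\mathrm{Tr}L_k^i$ ($i\ge1$, $k=1,2$) be the formal infinite sum of polynomials in the variables $x_n,y_n$ ($n\ge1$; $x_0=y_0=1$) obtained from the matrices above; each variable occurs in only finitely many of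 its terms, so its partial derivatives are polynomials. For $n\ge1$, $$\frac{\partial x_n}{\partial t_i}=(1-x_ny_n)\frac{\partial H_i^{(1)}}{\partial y_n},\quad \frac{\partial y_n}{\partial t_i}=-(1-x_ny_n)\frac{\partial H_i^{(1)}}{\partial x_n},\quad \frac{\partial x_n}{\partial s_i}=(1-x_ny_n)\frac{\partial H_i^{(2)}}{\partial y_n},\quad \frac{\partial y_n}{\partial s_i}=-(1-x_ny_n)\frac{\partial H_i^{(2)}}{\partial x_n},$$ with $x_n(0,0)=y_n(0,0)=0$ for $n\ge1$. For the Poisson bracket $\{F,G\}=\sum_{n\ge1}(1-x_ny_n)\bigl(\frac{\partial F}{\partial x_n}\frac{\partial G}{\partial y_n}-\frac{\partial F}{\partial y_n}\frac{\partial G}{\partial x_n}\bigr)$ of the symplectic form $\sum(1-x_ny_n)^{-1}dx_n\wedge dy_n$ (a formal power series; each monomial occurs in finitely many terms of the sum), $$\{H^{(1)}_i,H^{(1)}_j\}=0,\qquad\{H^{(2)}_i,H^{(2)}_j\}=0,\qquad\{H^{(1)}_i,H^{(2)}_j\}=\delta_{ij},$$ so the Hamiltonians are in involution up to constants. Finally,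 for $n\ge0$, where $\tau_n\tau_{n+1}\ne0$ (Hisakado), $$\Bigl(1+\frac{\partial^2\log\tau_{n+1}}{\partial s_1\partial t_1}\Bigr)\Bigl(1+\frac{\partial^2\log\tau_n}{\partial s_1\partial t_1}\Bigr)=-\frac{\partial}{\partial t_1}\log\frac{\tau_{n+1}}{\tau_n}\cdot\frac{\partial}{\partial s_1}\log\frac{\tau_{n+1}}{\tau_n}.$$ -/

import Mathlib

open MeasureTheory Filter Topology
open scoped Real

noncomputable section

namespace ToeplitzLattice

/-! ### Times and partial derivatives -/

/-- A sequence of times `t = (t₁, t₂, …)`. -/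
abbrev Times : Type := ℕ+ → ℂ

/-- `∂g/∂t_k` for a function of one sequence of times. -/
def pd (k : ℕ+) (g : Times → ℂ) (t : Times) : ℂ :=
  deriv (fun u : ℂ => g (Function.update t k u)) (t k)

/-- `∂f/∂t_k` for a function of two sequences of times. -/
def pdT (k : ℕ+) (f : Times → Times → ℂ) (t s : Times) : ℂ := pd k (fun w => f w s) t

/-- `∂f/∂s_k` for a function of two sequences of times. -/
def pdS (k : ℕ+) (f : Times → Times → ℂ) (t s : Times) : ℂ := pd k (fun w => f t w) s

/-- `∂(log f)/∂t_k`, for any local branch of `log f` (where `f ≠ 0`). -/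
def dlogT (k : ℕ+) (f : Times → Times → ℂ) (t s : Times) : ℂ := pdT k f t s / f t s

/-- `∂(log f)/∂s_k`, for any local branch of `log f` (where `f ≠ 0`). -/
def dlogS (k : ℕ+) (f : Times → Times → ℂ) (t s : Times) : ℂ := pdS k f t s / f t s

/-! ### The inner product on the circle, the moment matrix, the tau functions -/

/-- The exponent `∑ (t_i z^i - s_i z^{-i})`. -/
def V (t s : Times) (z : ℂ) : ℂ := ∑' i : ℕ+, (t i * z ^ (i : ℕ) - s i * z⁻¹ ^ (i : ℕ))

/-- `⟨f, g⟩_{t,s} = ∮ dz/(2πiz) f(z) g(z⁻¹) e^{∑ (t_i z^i - s_i z^{-i})}`. -/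
def ip (t s : Times) (f g : ℂ → ℂ) : ℂ :=
  (2 * π * Complex.I)⁻¹ * ∮ z in C(0, 1), z⁻¹ * (f z * g z⁻¹ * Complex.exp (V t s z))

/-- The semi-infinite moment matrix `(⟨z^k, z^l⟩)_{k,l ≥ 0}`. -/
def mom (t s : Times) : Matrix ℕ ℕ ℂ := fun k l => ip t s (fun z => z ^ k) (fun z => z ^ l)

/-- The upper left `n × n` block of a semi-infinite matrix. -/
def trunc {R : Type*} (n : ℕ) (A : Matrix ℕ ℕ R) : Matrix (Fin n) (Fin n) R :=
  fun i j => A i j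

/-- `τ_n = det m_n`. -/
def tau (n : ℕ) (t s : Times) : ℂ := (trunc n (mom t s)).det

/-- `h_n = τ_{n+1} / τ_n`. -/
def h (n : ℕ) (t s : Times) : ℂ := tau (n + 1) t s / tau n t s

/-- The `n`-fold circle integral
`I_n = ∫_{(S¹)ⁿ} |Δ_n(z)|² ∏_k e^{∑ (t_i z_k^i - s_i z_k^{-i})} dz_k/(2πi z_k)`. -/
def circleI (n : ℕ) (t s : Times) : ℂ :=
  ((2 * π * Complex.I) ^ n)⁻¹ *
    ∯ z in T((0 : Fin n → ℂ), (1 : Fin n → ℝ)),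
      ((‖∏ k : Fin n, ∏ l ∈ Finset.Ioi k, (z l - z k)‖ ^ 2 : ℝ) : ℂ) *
        ∏ k : Fin n, (Complex.exp (V t s (z k)) / z k)

/-! ### Haar measure on `U(n)` -/

instance instMeasurableSpaceU (n : ℕ) : MeasurableSpace (Matrix.unitaryGroup (Fin n) ℂ) :=
  borel _

instance instBorelSpaceU (n : ℕ) : BorelSpace (Matrix.unitaryGroup (Fin n) ℂ) := ⟨rfl⟩

instance instCompactSpaceU (n : ℕ) : CompactSpace (Matrix.unitaryGroup (Fin n) ℂ) := by
  have hsub : {A : Matrix (Fin n) (Fin n) ℂ | A ∈ Matrix.unitaryGroup (Fin n) ℂ} ⊆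
      Set.pi Set.univ (fun _ => Set.pi Set.univ (fun _ => Metric.closedBall (0 : ℂ) 1)) := by
    intro A hA i _ j _
    simpa using entry_norm_bound_of_unitary hA i j
  have hcl : IsClosed {A : Matrix (Fin n) (Fin n) ℂ | A ∈ Matrix.unitaryGroup (Fin n) ℂ} := by
    simp only [Matrix.mem_unitaryGroup_iff]
    exact isClosed_eq (by fun_prop) continuous_const
  have hK : IsCompact (Set.pi Set.univ (fun _ : Fin n => Set.pi Set.univ
      (fun _ : Fin n => Metric.closedBall (0 : ℂ) 1))) :=
    isCompact_univ_pi fun _ => isCompact_univ_pi fun _ => isCompact_closedBall _ _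
  exact isCompact_iff_compactSpace.mp (hK.of_isClosed_subset hcl hsub)

/-- The Haar measure of total mass one on `U(n)`. -/
def haarU (n : ℕ) : Measure (Matrix.unitaryGroup (Fin n) ℂ) := Measure.haarMeasure ⊤

/-- The trace `Tr M^i`. -/
def trPow {n : ℕ} (M : Matrix.unitaryGroup (Fin n) ℂ) (i : ℕ) : ℂ :=
  ((M : Matrix (Fin n) (Fin n) ℂ) ^ i).trace

/-- The trace `Tr M̄^i`, with `M̄` the entrywise complex conjugate. -/
def trPowConj {n : ℕ} (M : Matrix.unitaryGroup (Fin n) ℂ) (i : ℕ) : ℂ :=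
  (((M : Matrix (Fin n) (Fin n) ℂ).map (starRingEnd ℂ)) ^ i).trace

/-- The density `e^{∑ Tr (t_i M^i - s_i M̄^i)}`. -/
def weightU {n : ℕ} (t s : Times) (M : Matrix.unitaryGroup (Fin n) ℂ) : ℂ :=
  Complex.exp (∑' i : ℕ+, (t i * trPow M i - s i * trPowConj M i))

/-! ### Schur polynomials in the times -/

/-- The elementary Schur polynomials `s_n`: the coefficient of `z^n` in
`e^{∑ t_i z^i} = ∑_k (∑ t_i z^i)^k / k!` (only `k ≤ n` contributes to `z^n`). -/
def elemSchur (n : ℕ) : MvPolynomial ℕ+ ℂ :=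
  ∑ k ∈ Finset.range (n + 1), MvPolynomial.C ((k.factorial : ℂ)⁻¹) *
    PowerSeries.coeff n
      ((PowerSeries.mk fun i => if hi : 0 < i then
        (MvPolynomial.X (⟨i, hi⟩ : ℕ+) : MvPolynomial ℕ+ ℂ) else 0) ^ k)

/-- The Schur polynomial `s_λ(t) = det (s_{λ_i - i + j}(t))`, with `s_m = 0` for `m < 0`. -/
def schur (lam : YoungDiagram) (t : Times) : ℂ :=
  Matrix.det (fun i j : Fin (lam.colLen 0) =>
    if (i : ℕ) ≤ lam.rowLen i + j then
      MvPolynomial.eval t (elemSchur (lam.rowLen i + j - i)) else 0)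

/-- The differential operator `p(D₁, D₂, …)` for a polynomial `p`, applied to `f`; each monomial
acts as the composition of the corresponding `D_i`, in increasing order of the indices. -/
def diffOp (p : MvPolynomial ℕ+ ℂ) (D : ℕ+ → (Times → Times → ℂ) → (Times → Times → ℂ))
    (f : Times → Times → ℂ) (t s : Times) : ℂ :=
  ∑ m ∈ p.support, p.coeff m * (((Finsupp.toMultiset m).sort (· ≤ ·)).foldr D f) t s

/-! ### Heisenberg and Virasoro operators (for `β = 1`) -/

/-- `∂g/∂t_j`, zero for `j ≤ 0`. -/
def pdZ (j : ℤ) (g : Times → ℂ) (t : Times) : ℂ :=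
  if hj : 0 < j then pd ⟨j.toNat, by omega⟩ g t else 0

/-- `t_j`, zero for `j ≤ 0`. -/
def tZ (j : ℤ) (t : Times) : ℂ :=
  if hj : 0 < j then t ⟨j.toNat, by omega⟩ else 0

/-- `J_k^{(1)} = ∂/∂t_k + (-k) t_{-k}`. -/
def J1 (k : ℤ) (g : Times → ℂ) (t : Times) : ℂ :=
  pdZ k g t + (-k : ℂ) * tZ (-k) t * g t

/-- `J_k^{(2)} = ∑_{i+j=k} ∂²/∂t_i∂t_j + 2 ∑_{-i+j=k} i t_i ∂/∂t_j + ∑_{-i-j=k} i t_i j t_j`,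
all indices `i, j` being positive. -/
def J2 (k : ℤ) (g : Times → ℂ) (t : Times) : ℂ :=
  ∑ i ∈ Finset.Ioo 0 k, pdZ i (pdZ (k - i) g) t
    + 2 * ∑' i : ℕ+, (i : ℂ) * t i * pdZ (k + (i : ℤ)) g t
    + ∑ i ∈ Finset.Ioo 0 (-k), ((i : ℂ) * tZ i t) * (((-k - i : ℤ) : ℂ) * tZ (-k - i) t) * g t

/-- `J_k^{(0)} = δ_{0k}`. -/
def J0 (k : ℤ) : ℂ := if k = 0 then 1 else 0

/-- `𝕁_{k,n}^{(1)} = J_k^{(1)} + n J_k^{(0)}`. -/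
def JJ1 (k : ℤ) (n : ℕ) (g : Times → ℂ) (t : Times) : ℂ := J1 k g t + n * J0 k * g t

/-- `𝕁_{k,n}^{(2)} = (J_k^{(2)} + (2n+k+1) J_k^{(1)} + n(n+1) J_k^{(0)}) / 2`. -/
def JJ2 (k : ℤ) (n : ℕ) (g : Times → ℂ) (t : Times) : ℂ :=
  (1 / 2) * (J2 k g t + (2 * n + k + 1) * J1 k g t + n * (n + 1) * J0 k * g t)

/-- `D_{k,n}^θ = 𝕁_{k,n}^{(2)}(t) - 𝕁_{-k,n}^{(2)}(-s)
  - k (θ 𝕁_{k,n}^{(1)}(t) + (1-θ) 𝕁_{-k,n}^{(1)}(-s))`;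
an operator in `-s` is the operator in `w` after the substitution `w = -s`. -/
def D (k : ℤ) (θ : ℂ) (n : ℕ) (f : Times → Times → ℂ) (t s : Times) : ℂ :=
  JJ2 k n (fun w => f w s) t - JJ2 (-k) n (fun w => f t (-w)) (-s)
    - k * (θ * JJ1 k n (fun w => f w s) t + (1 - θ) * JJ1 (-k) n (fun w => f t (-w)) (-s))

/-- Convergence of the two infinite sums occurring in `D_{k,n}^θ f` at `(t, s)`. -/
def DConverges (k : ℤ) (f : Times → Times → ℂ) (t s : Times) : Prop :=
  (Summable fun i : ℕ+ => (i : ℂ) * t i * pdZ (k + (i : ℤ)) (fun w => f w s) t) ∧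
  (Summable fun i : ℕ+ => (i : ℂ) * (-s) i * pdZ (-k + (i : ℤ)) (fun w => f t (-w)) (-s))

/-- The function of `(t, s)` given by a polynomial in finitely many `t_i`, `s_i`. -/
def polyFun (p : MvPolynomial (ℕ+ ⊕ ℕ+) ℂ) (t s : Times) : ℂ :=
  MvPolynomial.eval (Sum.elim t s) p

/-! ### Semi-infinite matrices -/

section Matrices

variable {R : Type*}

/-- The product of semi-infinite matrices; in all products below, each entry is a sum with only
finitely many nonzero terms. -/
def imul [CommRing R] (A B : Matrix ℕ ℕ R) : Matrix ℕ ℕ R := fun i j => ∑ᶠ l : ℕ, A i l * B l j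

/-- Powers of a semi-infinite matrix. -/
def ipow [CommRing R] (A : Matrix ℕ ℕ R) : ℕ → Matrix ℕ ℕ R
  | 0 => 1
  | n + 1 => imul (ipow A n) A

/-- The commutator `[A, B]`. -/
def icomm [CommRing R] (A B : Matrix ℕ ℕ R) : Matrix ℕ ℕ R := imul A B - imul B A

/-- The upper triangular part, including the diagonal. -/
def plusPart [CommRing R] (A : Matrix ℕ ℕ R) : Matrix ℕ ℕ R :=
  fun i j => if i ≤ j then A i j else 0

/-- The strictly lower triangular part. -/
def minusPart [CommRing R] (A : Matrix ℕ ℕ R) : Matrix ℕ ℕ R :=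
  fun i j => if j < i then A i j else 0

/-- The shift matrix `Λ`, `(Λ v)_n = v_{n+1}`. -/
def shift (R : Type*) [CommRing R] : Matrix ℕ ℕ R := fun i j => if j = i + 1 then 1 else 0

/-- The inverse of a (lower or upper) triangular semi-infinite matrix, whose finite blocks are the
inverses of the finite blocks. -/
def triInv [CommRing R] (A : Matrix ℕ ℕ R) : Matrix ℕ ℕ R := fun i j =>
  (trunc (max i j + 1) A)⁻¹ ⟨i, by omega⟩ ⟨j, by omega⟩

end Matrices

/-- `A` is lower triangular with ones on the diagonal. -/
def LowerUnipotent (A : Matrix ℕ ℕ ℂ) : Prop := (∀ i, A i i = 1) ∧ ∀ i j, i < j → A i j = 0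

/-- `A` is upper triangular. -/
def Upper (A : Matrix ℕ ℕ ℂ) : Prop := ∀ i j, j < i → A i j = 0

/-- The lower triangular factor `S₁` of `m_∞ = S₁⁻¹ S₂`: its `n`-th row solves the linear system
saying that `S₁ m_∞` vanishes to the left of the diagonal. -/
def S1 (t s : Times) : Matrix ℕ ℕ ℂ := fun n j =>
  if hj : j < n then -∑ k : Fin n, mom t s n k * (trunc n (mom t s))⁻¹ k ⟨j, hj⟩
  else if j = n then 1 else 0

/-- The upper triangular factor `S₂ = S₁ m_∞` (whose entries below the diagonal vanish wherever the
factorization exists). -/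
def S2 (t s : Times) : Matrix ℕ ℕ ℂ := plusPart (imul (S1 t s) (mom t s))

/-- `L₁ = S₁ Λ S₁⁻¹`. -/
def L1 (t s : Times) : Matrix ℕ ℕ ℂ := imul (imul (S1 t s) (shift ℂ)) (triInv (S1 t s))

/-- `L₂ = S₂ Λᵀ S₂⁻¹`. -/
def L2 (t s : Times) : Matrix ℕ ℕ ℂ :=
  imul (imul (S2 t s) (shift ℂ).transpose) (triInv (S2 t s))

/-- `p_n^{(1)}(t,s;z) = (S₁ χ(z))_n`, with `χ(z) = (1, z, z², …)`. -/
def p1 (n : ℕ) (t s : Times) : Polynomial ℂ :=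
  ∑ j ∈ Finset.range (n + 1), Polynomial.C (S1 t s n j) * Polynomial.X ^ j

/-- `p_n^{(2)}(t,s;z) = (h (S₂ᵀ)⁻¹ χ(z))_n`. -/
def p2 (n : ℕ) (t s : Times) : Polynomial ℂ :=
  ∑ j ∈ Finset.range (n + 1), Polynomial.C (h n t s * triInv (S2 t s) j n) * Polynomial.X ^ j

/-- `x_n = p_n^{(1)}(t,s;0)`. -/
def x (n : ℕ) (t s : Times) : ℂ := (p1 n t s).eval 0

/-- `y_n = p_n^{(2)}(t,s;0)`. -/
def y (n : ℕ) (t s : Times) : ℂ := (p2 n t s).eval 0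

/-! ### The rank two matrices and the Hamiltonian structure -/

/-- The matrix with entries `-x_{a+1} y_b` on and below the diagonal and `1 - x_{a+1} y_{a+1}` just
above the diagonal (the shape of `h⁻¹ L₁ h`). -/
def rankTwo1 {R : Type*} [CommRing R] (x y : ℕ → R) : Matrix ℕ ℕ R := fun a b =>
  if b ≤ a then -(x (a + 1) * y b) else if b = a + 1 then 1 - x (a + 1) * y (a + 1) else 0

/-- The matrix with entries `-x_a y_{b+1}` on and above the diagonal and `1 - x_a y_a` just below
the diagonal (the shape of `L₂`). -/
def rankTwo2 {R : Type*} [CommRing R] (x y : ℕ → R) : Matrix ℕ ℕ R := fun a b =>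
  if a ≤ b then -(x a * y (b + 1)) else if a = b + 1 then 1 - x a * y a else 0

/-- Polynomials in the phase space variables `x_n` (`Sum.inl n`) and `y_n` (`Sum.inr n`), `n ≥ 1`. -/
abbrev PhasePoly : Type := MvPolynomial (ℕ+ ⊕ ℕ+) ℂ

/-- The coordinate `x_n`, with `x_0 = 1`. -/
def xVar (n : ℕ) : PhasePoly := if hn : 0 < n then MvPolynomial.X (Sum.inl ⟨n, hn⟩) else 1

/-- The coordinate `y_n`, with `y_0 = 1`. -/
def yVar (n : ℕ) : PhasePoly := if hn : 0 < n then MvPolynomial.X (Sum.inr ⟨n, hn⟩) else 1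

/-- The terms of the formal infinite sum `H_i^{(1)} = -(1/i) Tr L₁^i = ∑_a -(1/i) (L₁^i)_{aa}`
(conjugating `L₁` by a diagonal matrix does not change the diagonal entries of its powers). -/
def H1 (i : ℕ+) (a : ℕ) : PhasePoly :=
  MvPolynomial.C (-(1 / (i : ℂ))) * ipow (rankTwo1 xVar yVar) i a a

/-- The terms of the formal infinite sum `H_i^{(2)} = -(1/i) Tr L₂^i = ∑_a -(1/i) (L₂^i)_{aa}`. -/
def H2 (i : ℕ+) (a : ℕ) : PhasePoly :=
  MvPolynomial.C (-(1 / (i : ℂ))) * ipow (rankTwo2 xVar yVar) i a a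

/-- Each variable occurs in only finitely many terms of the formal sum `∑_a F_a`. -/
def LocallyFinite (F : ℕ → PhasePoly) : Prop :=
  ∀ v : ℕ+ ⊕ ℕ+, {a : ℕ | MvPolynomial.pderiv v (F a) ≠ 0}.Finite

/-- The partial derivative `∂F/∂v` of a formal sum `F = ∑_a F_a`, term by term. -/
def dForm (F : ℕ → PhasePoly) (v : ℕ+ ⊕ ℕ+) : PhasePoly :=
  ∑ᶠ a : ℕ, MvPolynomial.pderiv v (F a)

/-- The `n`-th term of the Poisson bracket `{F, G}` below. -/
def bracketTerm (F G : ℕ → PhasePoly) (n : ℕ+) : PhasePoly :=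
  (1 - xVar n * yVar n) * (dForm F (Sum.inl n) * dForm G (Sum.inr n)
    - dForm F (Sum.inr n) * dForm G (Sum.inl n))

/-- Each monomial occurs in only finitely many terms of `{F, G}`. -/
def BracketConverges (F G : ℕ → PhasePoly) : Prop :=
  ∀ d : (ℕ+ ⊕ ℕ+) →₀ ℕ, {n : ℕ+ | (bracketTerm F G n).coeff d ≠ 0}.Finite

/-- The Poisson bracket of the symplectic form `ω = ∑ (1 - x_n y_n)⁻¹ dx_n ∧ dy_n`,
`{F, G} = ∑_n (1 - x_n y_n) (∂F/∂x_n ∂G/∂y_n - ∂F/∂y_n ∂G/∂x_n)`, a formal power series in the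
variables `x_n, y_n`, `n ≥ 1`; this is `ω(X_F, X_G)` with `ω(X_F, ·) = dF`. -/
def bracket (F G : ℕ → PhasePoly) : MvPowerSeries (ℕ+ ⊕ ℕ+) ℂ :=
  fun d => ∑ᶠ n : ℕ+, (bracketTerm F G n).coeff d

/-- The value at `x_n = x_n(t,s)`, `y_n = y_n(t,s)` of a polynomial on phase space. -/
def atXY (t s : Times) (p : PhasePoly) : ℂ :=
  MvPolynomial.eval (Sum.elim (fun n : ℕ+ => x n t s) (fun n : ℕ+ => y n t s)) p

/-! ### The first Toda equation and the discrete sinh-Gordon equation in `(t₁, s₁)` -/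

/-- `∂F/∂u` for a function of `(u, v)`. -/
def dU (F : ℂ × ℂ → ℂ) (w : ℂ × ℂ) : ℂ := deriv (fun u => F (u, w.2)) w.1

/-- `∂F/∂v` for a function of `(u, v)`. -/
def dV (F : ℂ × ℂ → ℂ) (w : ℂ × ℂ) : ℂ := deriv (fun v => F (w.1, v)) w.2

/-- `∂²(log f_n)/∂v∂u = -f_{n-1} f_{n+1} / f_n²` at `w`, for `n ≥ 1`. -/
def TodaAt (f : ℕ → ℂ × ℂ → ℂ) (n : ℕ) (w : ℂ × ℂ) : Prop :=
  dV (fun w' => dU (f n) w' / f n w') w = -(f (n - 1) w * f (n + 1) w / f n w ^ 2)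

/-- `∂²q_n/∂u∂v = e^{q_n - q_{n-1}} - e^{q_{n+1} - q_n}` at `w`, the first exponential being `0`
for `n = 0`. -/
def SinhGordonAt (q : ℕ → ℂ × ℂ → ℂ) (n : ℕ) (w : ℂ × ℂ) : Prop :=
  dU (dV (q n)) w = (if n = 0 then 0 else Complex.exp (q n w - q (n - 1) w))
    - Complex.exp (q (n + 1) w - q n w)

/-- `τ_n` as a function of `(t₁, s₁)`, the other times being those of `(t, s)`. -/
def tauSlice (t s : Times) (n : ℕ) (w : ℂ × ℂ) : ℂ :=
  tau n (Function.update t 1 w.1) (Function.update s 1 w.2)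

end ToeplitzLattice

end

/-! Everything is expressed through the moments `mu` of the weight `e^V` on the circle. The weight
is an exponential in the Banach algebra of continuous functions, so `∂/∂t_k` raises the index of a
moment by `k` and `∂/∂s_k` lowers it by `k` with a minus sign. For the moment matrix `m` this reads
`∂m/∂t_k = Λ^k m` and `∂m/∂s_k = -m (Λᵀ)^k`.

Toda lattice. Differentiating `S₁ m = S₂` writes `L₁^k` (or `L₂^k`) as the difference of an upper
and a strictly lower triangular matrix, namely the logarithmic derivatives of `S₂` and `S₁`. The
splitting is unique, so these are the triangular parts, and conjugating the shift gives the Lax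
equations (`entryDeriv_of_flow`, `flow_left`, `flow_right`). The identities for single `τ_n` need
only one or two nonvanishing minors. They come from Cramer's rule applied to the linear system of
one row of `S₁` (`lowerFactor_row_right`, `toda_equation`, `second_toda_equation`). The sinh-Gordon
equation is the difference of two consecutive Toda identities.

Toeplitz structure. Constancy along diagonals gives the Szegő recursion `lowerFactor_succ` and `h_n
/ h_{n-1} = 1 - x_n y_n` (`one_sub_mul_det`). Summing the recursion, as in the Christoffel–Darboux
formula, puts multiplication by `z` into rank two form (`lowerFactor_conj_shift`,
`upperFactor_conj_shift`). Hisakado's identity follows by writing both sides as `x_n y_n x_{n+1}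
y_{n+1}`.

Hamiltonian structure. The gradient of a trace of powers of the rank two matrix `M` is a partial row
or column sum of a power of `M`. That the corner trace of `[M^j, M] = 0` only sees entries across
the corner turns `(1 - x_n y_n)` times the gradient into the triangular sums of the flows
(`mul_gradX`, `mul_gradY`, `mul_sum_ipow_rankTwo1`). For the brackets all but finitely many
variables are set to zero, which does not affect a given coefficient. The bracket, summed up to a
large index, is then a single boundary entry of a product (`sum_bracket_of_lax`), where the matrices
are pure shifts. The entry is `0` for two Hamiltonians of the same kind. For different kinds the
flow is realized by the strictly lower part of a power of the conjugated second matrix, which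
inverts `M` up to a rank one defect, and the entry is `δ_ij`.

Integrals and sums. Andréief's identity gives `I_n = n! τ_n`. Expanding the moments in elementary
Schur polynomials and applying an infinite Cauchy–Binet formula gives the sum over Young diagrams.
The Haar integral requires Weyl's integration formula for class functions. Polynomials in the traces
satisfy the same loop equations on `U(n)` (invariance of Haar measure, `loop_equation`) and on the
torus with density `|Δ|²` (divergence identity, `sum_euler_evalL`). Modulo the loop equations every
such polynomial is a constant. Indeed the radial Laplacian maps into their span, preserves
finite-dimensional spaces of bounded weight, has only constants in its kernel and satisfies `ker T²
= ker T` (`exists_evalL_eq_const_add`). Uniform closure extends the formula to the exponential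
weight (`weyl_integration`). Since `s_n(-p_1, -p_2/2, …)` is `(-1)^n` times the product of the
eigenvalues, the formulas for `x_n` and `y_n` follow from Cramer's rule.

Virasoro constraints. Integrating the derivative of `z^k e^V` over the circle gives a linear
recursion for the moments. Contracting it with the adjugate of the moment matrix gives the
constraints for `k = -1, 0, 1`, because shifting rows or columns by one step produces repeated rows
or columns except at the edge (`tauEuler_one`, `tauEuler_neg_one`). On polynomials the operators are
derivations plus multiplications, and commutators of derivations are checked on the variables. -/

namespace ToeplitzLattice

/-! ### Algebra of semi-infinite matrices with finite rows or columns -/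

section SemiInfinite

open Finset

variable {R : Type*} [CommRing R]

/-- Every row has finitely many nonzero entries. -/
def RowFin (A : Matrix ℕ ℕ R) : Prop := ∀ i, ∃ N, ∀ j, N ≤ j → A i j = 0

/-- Every column has finitely many nonzero entries. -/
def ColFin (A : Matrix ℕ ℕ R) : Prop := ∀ j, ∃ N, ∀ i, N ≤ i → A i j = 0

theorem finsum_eq_sum_range {M : Type*} [AddCommMonoid M] {f : ℕ → M} {N : ℕ}
    (hf : ∀ l, N ≤ l → f l = 0) : ∑ᶠ l, f l = ∑ l ∈ range N, f l := by
  apply finsum_eq_sum_of_support_subset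
  intro l hl
  simp only [coe_range, Set.mem_Iio]
  by_contra hc
  exact hl (hf l (by omega))

theorem imul_apply_of_row {A B : Matrix ℕ ℕ R} {i : ℕ} (j : ℕ) {N : ℕ}
    (hA : ∀ l, N ≤ l → A i l = 0) : imul A B i j = ∑ l ∈ range N, A i l * B l j :=
  finsum_eq_sum_range fun l hl => by rw [hA l hl, zero_mul]

theorem imul_apply_of_col {A B : Matrix ℕ ℕ R} (i : ℕ) {j : ℕ} {N : ℕ}
    (hB : ∀ l, N ≤ l → B l j = 0) : imul A B i j = ∑ l ∈ range N, A i l * B l j :=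
  finsum_eq_sum_range fun l hl => by rw [hB l hl, mul_zero]

theorem transpose_imul (A B : Matrix ℕ ℕ R) :
    (imul A B).transpose = imul B.transpose A.transpose := by
  ext i j
  simp only [imul, Matrix.transpose_apply]
  exact finsum_congr fun l => mul_comm _ _

theorem colFin_iff {A : Matrix ℕ ℕ R} : ColFin A ↔ RowFin A.transpose := Iff.rfl

theorem RowFin.colFin_transpose {A : Matrix ℕ ℕ R} (hA : RowFin A) : ColFin A.transpose := hA

theorem RowFin.bound {A : Matrix ℕ ℕ R} (hA : RowFin A) (n : ℕ) :
    ∃ N, ∀ i, i < n → ∀ j, N ≤ j → A i j = 0 := by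
  choose f hf using hA
  refine ⟨(range n).sup f, fun i hi j hj => hf i j (le_trans ?_ hj)⟩
  exact le_sup (f := f) (mem_range.2 hi)

/-- Products of semi-infinite matrices are not associative in general. Finite rows in the two left
factors make each entry a finite double sum. The column and the mixed versions below are needed as
well: `S1` and `L1` have finite rows, `S2` and `L2` finite columns, and the moment matrix has
neither. -/
theorem imul_assoc_row {A B C : Matrix ℕ ℕ R} (hA : RowFin A) (hB : RowFin B) :
    imul (imul A B) C = imul A (imul B C) := by
  ext i j
  obtain ⟨N, hN⟩ := hA i
  obtain ⟨L, hL⟩ := hB.bound N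
  have h1 : ∀ l, L ≤ l → imul A B i l = 0 := fun l hl => by
    rw [imul_apply_of_row _ hN]
    exact sum_eq_zero fun k hk => by rw [hL k (mem_range.1 hk) l hl, mul_zero]
  rw [imul_apply_of_row _ h1, imul_apply_of_row _ hN]
  simp_rw [imul_apply_of_row _ hN, sum_mul]
  rw [sum_comm]
  refine sum_congr rfl fun k hk => ?_
  rw [imul_apply_of_row _ (hL k (mem_range.1 hk)), mul_sum]
  exact sum_congr rfl fun l _ => mul_assoc _ _ _

theorem imul_assoc_col {A B C : Matrix ℕ ℕ R} (hB : ColFin B) (hC : ColFin C) :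
    imul (imul A B) C = imul A (imul B C) := by
  apply Matrix.transpose_injective
  rw [transpose_imul, transpose_imul, transpose_imul, transpose_imul]
  exact (imul_assoc_row (colFin_iff.1 hC) (colFin_iff.1 hB)).symm

theorem imul_assoc_row_col {A B C : Matrix ℕ ℕ R} (hA : RowFin A) (hC : ColFin C) :
    imul (imul A B) C = imul A (imul B C) := by
  ext i j
  obtain ⟨N, hN⟩ := hA i
  obtain ⟨L, hL⟩ := hC j
  rw [imul_apply_of_col _ hL, imul_apply_of_row _ hN]
  simp_rw [imul_apply_of_row _ hN, imul_apply_of_col _ hL, sum_mul, mul_sum]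
  rw [sum_comm]
  exact sum_congr rfl fun k _ => sum_congr rfl fun l _ => mul_assoc _ _ _

theorem RowFin.imul {A B : Matrix ℕ ℕ R} (hA : RowFin A) (hB : RowFin B) :
    RowFin (imul A B) := by
  intro i
  obtain ⟨N, hN⟩ := hA i
  obtain ⟨L, hL⟩ := hB.bound N
  refine ⟨L, fun l hl => ?_⟩
  rw [imul_apply_of_row _ hN]
  exact sum_eq_zero fun k hk => by rw [hL k (mem_range.1 hk) l hl, mul_zero]

theorem ColFin.imul {A B : Matrix ℕ ℕ R} (hA : ColFin A) (hB : ColFin B) :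
    ColFin (imul A B) := by
  rw [colFin_iff, transpose_imul]
  exact RowFin.imul (colFin_iff.1 hB) (colFin_iff.1 hA)

theorem RowFin.sub {A B : Matrix ℕ ℕ R} (hA : RowFin A) (hB : RowFin B) : RowFin (A - B) := by
  intro i
  obtain ⟨N, hN⟩ := hA i
  obtain ⟨L, hL⟩ := hB i
  exact ⟨max N L, fun j hj => by
    rw [Matrix.sub_apply, hN j (by omega), hL j (by omega), sub_zero]⟩

theorem RowFin.neg {A : Matrix ℕ ℕ R} (hA : RowFin A) : RowFin (-A) := by
  intro i
  obtain ⟨N, hN⟩ := hA i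
  exact ⟨N, fun j hj => by rw [Matrix.neg_apply, hN j hj, neg_zero]⟩

theorem rowFin_of_le {A : Matrix ℕ ℕ R} (k : ℕ) (hA : ∀ i j, i + k < j → A i j = 0) :
    RowFin A := fun i => ⟨i + k + 1, fun j hj => hA i j (by omega)⟩

theorem colFin_of_le {A : Matrix ℕ ℕ R} (k : ℕ) (hA : ∀ i j, j + k < i → A i j = 0) :
    ColFin A := fun j => ⟨j + k + 1, fun i hi => hA i j (by omega)⟩

theorem rowFin_one : RowFin (1 : Matrix ℕ ℕ R) :=
  rowFin_of_le 0 fun i j hij => Matrix.one_apply_ne (by omega)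

theorem colFin_one : ColFin (1 : Matrix ℕ ℕ R) :=
  colFin_of_le 0 fun i j hij => Matrix.one_apply_ne (by omega)

theorem one_imul (A : Matrix ℕ ℕ R) : imul 1 A = A := by
  ext i j
  rw [imul_apply_of_row (N := i + 1) _ fun l hl => Matrix.one_apply_ne (by omega),
    sum_eq_single i]
  · simp
  · intro b _ hb
    rw [Matrix.one_apply_ne (Ne.symm hb), zero_mul]
  · intro hi
    simp at hi

theorem imul_one (A : Matrix ℕ ℕ R) : imul A 1 = A := by
  apply Matrix.transpose_injective
  rw [transpose_imul, Matrix.transpose_one, one_imul]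

theorem imul_sub_row {A B C : Matrix ℕ ℕ R} (hA : RowFin A) :
    imul A (B - C) = imul A B - imul A C := by
  ext i j
  obtain ⟨N, hN⟩ := hA i
  simp_rw [Matrix.sub_apply, imul_apply_of_row _ hN, Matrix.sub_apply, mul_sub, sum_sub_distrib]

theorem imul_sub_col {A B C : Matrix ℕ ℕ R} (hB : ColFin B) (hC : ColFin C) :
    imul A (B - C) = imul A B - imul A C := by
  ext i j
  obtain ⟨N, hN⟩ := hB j
  obtain ⟨L, hL⟩ := hC j
  rw [Matrix.sub_apply, imul_apply_of_col (N := max N L) _ fun l hl => hN l (by omega),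
    imul_apply_of_col (N := max N L) _ fun l hl => hL l (by omega), imul_apply_of_col
    (N := max N L) _ fun l hl => by rw [Matrix.sub_apply, hN l (by omega), hL l (by omega),
      sub_zero]]
  simp_rw [Matrix.sub_apply, mul_sub, sum_sub_distrib]

theorem sub_imul_col {A B C : Matrix ℕ ℕ R} (hC : ColFin C) :
    imul (A - B) C = imul A C - imul B C := by
  apply Matrix.transpose_injective
  rw [transpose_imul, Matrix.transpose_sub, Matrix.transpose_sub, transpose_imul, transpose_imul,
    imul_sub_row (colFin_iff.1 hC)]

theorem sub_imul_row {A B C : Matrix ℕ ℕ R} (hA : RowFin A) (hB : RowFin B) :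
    imul (A - B) C = imul A C - imul B C := by
  apply Matrix.transpose_injective
  rw [transpose_imul, Matrix.transpose_sub, Matrix.transpose_sub, transpose_imul, transpose_imul,
    imul_sub_col hA.colFin_transpose hB.colFin_transpose]

theorem neg_imul (A B : Matrix ℕ ℕ R) : imul (-A) B = -imul A B := by
  ext i j
  simp [imul, finsum_neg_distrib]

theorem imul_neg (A B : Matrix ℕ ℕ R) : imul A (-B) = -imul A B := by
  ext i j
  simp [imul, finsum_neg_distrib]

theorem RowFin.ipow {A : Matrix ℕ ℕ R} (hA : RowFin A) (n : ℕ) : RowFin (ipow A n) := by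
  induction n with
  | zero => exact rowFin_one
  | succ n ih => exact ih.imul hA

theorem ColFin.ipow {A : Matrix ℕ ℕ R} (hA : ColFin A) (n : ℕ) : ColFin (ipow A n) := by
  induction n with
  | zero => exact colFin_one
  | succ n ih => exact ih.imul hA

theorem ipow_succ (A : Matrix ℕ ℕ R) (n : ℕ) : ipow A (n + 1) = imul (ipow A n) A := rfl

theorem ipow_zero (A : Matrix ℕ ℕ R) : ipow A 0 = 1 := rfl

theorem RowFin.ipow_succ' {A : Matrix ℕ ℕ R} (hA : RowFin A) (n : ℕ) :
    ToeplitzLattice.ipow A (n + 1) = ToeplitzLattice.imul A (ToeplitzLattice.ipow A n) := by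
  induction n with
  | zero => rw [ipow_succ, ipow_zero, one_imul, imul_one]
  | succ n ih => rw [ipow_succ, ih, imul_assoc_row hA (hA.ipow n), ← ipow_succ, ← ih]

theorem ColFin.ipow_succ' {A : Matrix ℕ ℕ R} (hA : ColFin A) (n : ℕ) :
    ToeplitzLattice.ipow A (n + 1) = ToeplitzLattice.imul A (ToeplitzLattice.ipow A n) := by
  induction n with
  | zero => rw [ipow_succ, ipow_zero, one_imul, imul_one]
  | succ n ih => rw [ipow_succ, ih, imul_assoc_col (hA.ipow n) hA, ← ipow_succ, ← ih]

theorem RowFin.ipow_add {A : Matrix ℕ ℕ R} (hA : RowFin A) (m n : ℕ) :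
    ToeplitzLattice.ipow A (m + n)
      = ToeplitzLattice.imul (ToeplitzLattice.ipow A m) (ToeplitzLattice.ipow A n) := by
  induction n with
  | zero => rw [add_zero, ipow_zero, imul_one]
  | succ n ih => rw [← add_assoc, ipow_succ, ih, ipow_succ, imul_assoc_row (hA.ipow m) (hA.ipow n)]

theorem RowFin.transpose_ipow {A : Matrix ℕ ℕ R} (hA : RowFin A) (n : ℕ) :
    (ToeplitzLattice.ipow A n).transpose = ToeplitzLattice.ipow A.transpose n := by
  induction n with
  | zero => rw [ipow_zero, ipow_zero, Matrix.transpose_one]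
  | succ n ih => rw [hA.ipow_succ', transpose_imul, ih, ipow_succ]

theorem map_imul_of_row {S : Type*} [CommRing S] (φ : R →+* S) {A B : Matrix ℕ ℕ R}
    (hA : RowFin A) : (imul A B).map φ = imul (A.map φ) (B.map φ) := by
  ext i j
  obtain ⟨N, hN⟩ := hA i
  rw [Matrix.map_apply, imul_apply_of_row _ hN, map_sum, imul_apply_of_row (N := N)]
  · simp
  · intro l hl
    rw [Matrix.map_apply, hN l hl, map_zero]

theorem map_ipow_of_row {S : Type*} [CommRing S] (φ : R →+* S) {A : Matrix ℕ ℕ R}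
    (hA : RowFin A) (n : ℕ) : (ipow A n).map φ = ipow (A.map φ) n := by
  induction n with
  | zero => rw [ipow_zero, ipow_zero]; exact Matrix.map_one _ (map_zero φ) (map_one φ)
  | succ n ih => rw [ipow_succ, ipow_succ, map_imul_of_row φ (hA.ipow n), ih]

/-- The trace of the upper left block of a commutator only involves entries across the corner. -/
theorem sum_range_comm_diag {A B : Matrix ℕ ℕ R} {N L : ℕ} (hNL : N ≤ L)
    (hA : ∀ a, a < N → ∀ b, L ≤ b → A a b = 0) (hB : ∀ a, a < N → ∀ b, L ≤ b → B a b = 0) :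
    ∑ a ∈ range N, (imul A B a a - imul B A a a)
      = ∑ a ∈ range N, ∑ b ∈ Ico N L, (A a b * B b a - B a b * A b a) := by
  have h1 : ∀ a ∈ range N, imul A B a a - imul B A a a
      = ∑ b ∈ range N, (A a b * B b a - B a b * A b a)
        + ∑ b ∈ Ico N L, (A a b * B b a - B a b * A b a) := by
    intro a ha
    rw [imul_apply_of_row _ (hA a (mem_range.1 ha)), imul_apply_of_row _ (hB a (mem_range.1 ha)),
      ← sum_sub_distrib, sum_range_add_sum_Ico _ hNL]
  rw [sum_congr rfl h1, sum_add_distrib]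
  have h2 : ∑ a ∈ range N, ∑ b ∈ range N, (A a b * B b a - B a b * A b a) = 0 := by
    simp_rw [sum_sub_distrib]
    rw [sub_eq_zero, sum_comm]
    exact sum_congr rfl fun a _ => sum_congr rfl fun b _ => mul_comm _ _
  rw [h2, zero_add]

/-- Cyclicity of the trace when one factor has finitely many nonzero columns. -/
theorem finsum_diag_comm {A F : Matrix ℕ ℕ R} (hA : RowFin A) {N : ℕ}
    (hF : ∀ a b, N ≤ b → F a b = 0) :
    (∀ a, N ≤ a → imul A F a a = 0) ∧ {a | imul F A a a ≠ 0}.Finite ∧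
      ∑ᶠ a, imul A F a a = ∑ᶠ a, imul F A a a := by
  obtain ⟨L, hL⟩ := hA.bound N
  have h1 : ∀ a, N ≤ a → imul A F a a = 0 := fun a ha => by
    rw [imul]
    simp_rw [hF _ a ha, mul_zero, finsum_zero]
  have h2 : ∀ a, L ≤ a → imul F A a a = 0 := fun a ha => by
    rw [imul_apply_of_row _ (hF a)]
    exact sum_eq_zero fun l hl => by rw [hL l (mem_range.1 hl) a ha, mul_zero]
  refine ⟨h1, (Set.finite_Iio L).subset fun a ha => ?_, ?_⟩
  · by_contra hc
    exact ha (h2 a (not_lt.1 hc))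
  · rw [finsum_eq_sum_range h1, finsum_eq_sum_range h2]
    rw [sum_congr rfl fun a ha => imul_apply_of_row a (hL a (mem_range.1 ha)),
      sum_congr rfl fun a _ => imul_apply_of_row a (hF a), sum_comm]
    exact sum_congr rfl fun a _ => sum_congr rfl fun b _ => mul_comm _ _

end SemiInfinite

end ToeplitzLattice

namespace ToeplitzLattice

/-! ### Rank two matrices: gradients, fluxes and Lax flows -/

section RankTwo

open Finset

variable {R : Type*} [CommRing R]

theorem rankTwo1_le (x y : ℕ → R) {a b : ℕ} (hab : b ≤ a) :
    rankTwo1 x y a b = -(x (a + 1) * y b) := if_pos hab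

theorem rankTwo1_succ (x y : ℕ → R) (a : ℕ) :
    rankTwo1 x y a (a + 1) = 1 - x (a + 1) * y (a + 1) := by simp [rankTwo1]

theorem rankTwo1_gt (x y : ℕ → R) {a b : ℕ} (hab : a + 1 < b) : rankTwo1 x y a b = 0 := by
  rw [rankTwo1, if_neg (by omega), if_neg (by omega)]

theorem rankTwo2_eq_transpose (x y : ℕ → R) : rankTwo2 x y = (rankTwo1 y x).transpose := by
  ext a b
  simp only [rankTwo2, rankTwo1, Matrix.transpose_apply]
  split_ifs <;> first | ring1 | (subst_vars; ring1)

theorem rowFin_rankTwo1 (x y : ℕ → R) : RowFin (rankTwo1 x y) :=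
  rowFin_of_le 1 fun _ _ hij => rankTwo1_gt x y hij

theorem map_rankTwo1 {S : Type*} [CommRing S] (φ : R →+* S) (x y : ℕ → R) :
    (rankTwo1 x y).map φ = rankTwo1 (fun n => φ (x n)) (fun n => φ (y n)) := by
  ext a b
  simp only [rankTwo1, Matrix.map_apply]
  split_ifs <;> simp

/-- `∂H/∂y_{m+1}` in terms of the power `P` of the rank two matrix. -/
noncomputable def gradY (x : ℕ → R) (P : Matrix ℕ ℕ R) (m : ℕ) : R :=
  ∑ᶠ c, if m ≤ c then P (m + 1) c * x (c + 1) else 0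

/-- `∂H/∂x_{m+1}` in terms of the power `P` of the rank two matrix. -/
def gradX (y : ℕ → R) (P : Matrix ℕ ℕ R) (m : ℕ) : R := ∑ c ∈ range (m + 2), y c * P c m

/-- The part of `∑_c Q_{mc} x_{c+1}` above the diagonal. -/
noncomputable def rowFlow (x : ℕ → R) (Q : Matrix ℕ ℕ R) (m : ℕ) : R :=
  ∑ᶠ c, if m < c then Q m c * x (c + 1) else 0

/-- The part of `∑_c y_c Q_{cm}` above the diagonal. -/
def colFlow (y : ℕ → R) (Q : Matrix ℕ ℕ R) (m : ℕ) : R := ∑ c ∈ range m, y c * Q c m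

theorem finsum_ite_le_eq_sum_Ico {M : Type*} [AddCommMonoid M] {f : ℕ → M} (m : ℕ) {L : ℕ}
    (hf : ∀ c, L ≤ c → f c = 0) : (∑ᶠ c, if m ≤ c then f c else 0) = ∑ c ∈ Ico m L, f c := by
  rw [finsum_eq_sum_range (N := L) (fun l hl => by rw [hf l hl, ite_self]), ← sum_filter]
  congr 1
  ext c
  simp only [mem_filter, mem_range, mem_Ico]
  omega

theorem gradY_eq {x : ℕ → R} {P : Matrix ℕ ℕ R} {m L : ℕ}
    (hP : ∀ c, L ≤ c → P (m + 1) c * x (c + 1) = 0) :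
    gradY x P m = ∑ c ∈ Ico m L, P (m + 1) c * x (c + 1) :=
  finsum_ite_le_eq_sum_Ico m hP

theorem rowFlow_eq {x : ℕ → R} {Q : Matrix ℕ ℕ R} {m L : ℕ}
    (hP : ∀ c, L ≤ c → Q m c * x (c + 1) = 0) :
    rowFlow x Q m = ∑ c ∈ Ico (m + 1) L, Q m c * x (c + 1) :=
  finsum_ite_le_eq_sum_Ico (m + 1) hP

/-- The corner trace of the vanishing commutator only involves entries across the corner. To the
right of the corner the rank two matrix has the single entry at `(m, m + 1)`, and below it its
entries factor as `-x y`. -/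
theorem flux_eq {x y : ℕ → R} {P : Matrix ℕ ℕ R} (hP : imul P (rankTwo1 x y) = imul (rankTwo1 x y) P)
    {m L : ℕ} (hm : m + 2 ≤ L) (hL : ∀ a, a < m + 1 → ∀ b, L ≤ b → P a b = 0) :
    ∑ a ∈ range (m + 1), ∑ b ∈ Ico (m + 1) L, y a * P a b * x (b + 1)
      = -((1 - x (m + 1) * y (m + 1)) * P (m + 1) m) := by
  have key := sum_range_comm_diag (A := P) (B := rankTwo1 x y) (N := m + 1) (L := L) (by omega) hL
    (fun a ha b hb => rankTwo1_gt x y (by omega))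
  rw [hP] at key
  simp only [sub_self, sum_const_zero] at key
  have h2 : ∑ a ∈ range (m + 1), ∑ b ∈ Ico (m + 1) L, rankTwo1 x y a b * P b a
      = (1 - x (m + 1) * y (m + 1)) * P (m + 1) m := by
    rw [sum_eq_single m, sum_eq_single (m + 1), rankTwo1_succ]
    · intro b hb hb'
      rw [mem_Ico] at hb
      rw [rankTwo1_gt x y (by omega), zero_mul]
    · intro hb
      rw [mem_Ico] at hb
      omega
    · intro a ha ha'
      rw [mem_range] at ha
      refine sum_eq_zero fun b hb => ?_
      rw [mem_Ico] at hb
      rw [rankTwo1_gt x y (by omega), zero_mul]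
    · simp
  have h1 : ∑ a ∈ range (m + 1), ∑ b ∈ Ico (m + 1) L, P a b * rankTwo1 x y b a
      = -∑ a ∈ range (m + 1), ∑ b ∈ Ico (m + 1) L, y a * P a b * x (b + 1) := by
    rw [← sum_neg_distrib]
    refine sum_congr rfl fun a ha => ?_
    rw [← sum_neg_distrib]
    refine sum_congr rfl fun b hb => ?_
    rw [mem_Ico] at hb
    rw [mem_range] at ha
    rw [rankTwo1_le x y (by omega)]
    ring
  simp_rw [sum_sub_distrib] at key
  rw [h1, h2] at key
  linear_combination key

theorem imul_rankTwo1_apply (x y : ℕ → R) (P : Matrix ℕ ℕ R) (m c : ℕ) :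
    imul (rankTwo1 x y) P m c = (1 - x (m + 1) * y (m + 1)) * P (m + 1) c
      - x (m + 1) * ∑ l ∈ range (m + 1), y l * P l c := by
  rw [imul_apply_of_row (N := m + 2) _ fun l hl => rankTwo1_gt x y (by omega), sum_range_succ,
    rankTwo1_succ, mul_sum, sum_congr rfl fun l hl => by
      rw [rankTwo1_le x y (Nat.lt_succ_iff.1 (mem_range.1 hl))]]
  simp_rw [neg_mul, sum_neg_distrib, mul_assoc]
  ring

theorem imul_rankTwo1_apply_succ (x y : ℕ → R) {P : Matrix ℕ ℕ R} {c m L : ℕ} (hm : m + 1 ≤ L)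
    (hL : ∀ b, L ≤ b → P c b = 0) :
    imul P (rankTwo1 x y) c (m + 1) = P c m * (1 - x (m + 1) * y (m + 1))
      - y (m + 1) * ∑ l ∈ Ico (m + 1) L, P c l * x (l + 1) := by
  rw [imul_apply_of_row _ hL, ← sum_range_add_sum_Ico _ hm, sum_range_succ, rankTwo1_succ,
    sum_eq_zero fun l hl => by rw [rankTwo1_gt x y (by have := mem_range.1 hl; omega), mul_zero],
    zero_add, sub_eq_add_neg (P c m * _), mul_sum, ← sum_neg_distrib]
  congr 1
  refine sum_congr rfl fun l hl => ?_
  rw [rankTwo1_le x y (mem_Ico.1 hl).1]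
  ring

/-- Row `m` of the product with the rank two matrix already contains all terms of the gradient
except `c = m`. The remaining double sum is the flux of `flux_eq`, which supplies exactly that term.
In `mul_gradX` the same flux supplies the term `c = m + 1`. -/
theorem mul_gradY {x y : ℕ → R} {P : Matrix ℕ ℕ R} (hR : RowFin P)
    (hP : imul P (rankTwo1 x y) = imul (rankTwo1 x y) P) (m : ℕ) :
    (1 - x (m + 1) * y (m + 1)) * gradY x P m = rowFlow x (imul P (rankTwo1 x y)) m := by
  obtain ⟨L, hL⟩ := hR.bound (m + 2)
  obtain ⟨K, hK⟩ : ∃ K, K = max L (m + 2) := ⟨_, rfl⟩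
  have hL' : ∀ a, a < m + 2 → ∀ b, K ≤ b → P a b = 0 := fun a ha b hb => hL a ha b (by omega)
  have hfl := flux_eq hP (m := m) (L := K) (by omega) fun a ha => hL' a (by omega)
  rw [gradY_eq (L := K) fun c hc => by rw [hL' _ (by omega) c hc, zero_mul], hP,
    rowFlow_eq (L := K) fun c hc => by
      rw [imul_rankTwo1_apply, hL' _ (by omega) c hc, sum_eq_zero fun l hl => by
        rw [hL' l (by have := mem_range.1 hl; omega) c hc, mul_zero]]; ring,
    sum_eq_sum_Ico_succ_bot (by omega)]
  have e : ∑ c ∈ Ico (m + 1) K, imul (rankTwo1 x y) P m c * x (c + 1)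
      = (1 - x (m + 1) * y (m + 1)) * ∑ c ∈ Ico (m + 1) K, P (m + 1) c * x (c + 1)
        - x (m + 1) * ∑ a ∈ range (m + 1), ∑ b ∈ Ico (m + 1) K, y a * P a b * x (b + 1) := by
    rw [sum_comm, mul_sum, mul_sum, ← sum_sub_distrib]
    refine sum_congr rfl fun c _ => ?_
    rw [imul_rankTwo1_apply, ← sum_mul]
    ring
  rw [e, hfl]
  ring

theorem mul_gradX {x y : ℕ → R} {P : Matrix ℕ ℕ R} (hR : RowFin P)
    (hP : imul P (rankTwo1 x y) = imul (rankTwo1 x y) P) (m : ℕ) :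
    (1 - x (m + 1) * y (m + 1)) * gradX y P m = colFlow y (imul P (rankTwo1 x y)) (m + 1) := by
  obtain ⟨L, hL⟩ := hR.bound (m + 2)
  obtain ⟨K, hK⟩ : ∃ K, K = max L (m + 2) := ⟨_, rfl⟩
  have hL' : ∀ a, a < m + 2 → ∀ b, K ≤ b → P a b = 0 := fun a ha b hb => hL a ha b (by omega)
  have hfl := flux_eq hP (m := m) (L := K) (by omega) fun a ha => hL' a (by omega)
  have e : colFlow y (imul P (rankTwo1 x y)) (m + 1)
      = (1 - x (m + 1) * y (m + 1)) * ∑ c ∈ range (m + 1), y c * P c m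
        - y (m + 1) * ∑ a ∈ range (m + 1), ∑ b ∈ Ico (m + 1) K, y a * P a b * x (b + 1) := by
    rw [colFlow, mul_sum, mul_sum, ← sum_sub_distrib]
    refine sum_congr rfl fun c hc => ?_
    rw [imul_rankTwo1_apply_succ x y (L := K) (by omega)
      (hL' c (by have := mem_range.1 hc; omega))]
    simp_rw [mul_assoc]
    rw [← mul_sum]
    ring
  rw [e, hfl, gradX, sum_range_succ]
  ring

/-- The strictly upper triangular part. -/
def upperPart (Q : Matrix ℕ ℕ R) : Matrix ℕ ℕ R := fun a b => if a < b then Q a b else 0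

theorem RowFin.upperPart {Q : Matrix ℕ ℕ R} (hQ : RowFin Q) :
    RowFin (ToeplitzLattice.upperPart Q) := fun i => by
  obtain ⟨N, hN⟩ := hQ i
  exact ⟨N, fun j hj => by rw [ToeplitzLattice.upperPart, hN j hj, ite_self]⟩

/-- For `b ≤ a + 1` both products only meet entries of the rank two matrix on or below its diagonal.
There the entries factor, so each product splits into a row factor times a column factor. -/
theorem comm_upperPart_le {x y : ℕ → R} {Q : Matrix ℕ ℕ R} {a b L : ℕ} (hab : b ≤ a + 1)
    (hL : ∀ c, L ≤ c → Q a c = 0) :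
    imul (upperPart Q) (rankTwo1 x y) a b - imul (rankTwo1 x y) (upperPart Q) a b
      = -(y b * rowFlow x Q a) + x (a + 1) * colFlow y Q b := by
  have h1 : imul (upperPart Q) (rankTwo1 x y) a b = -(y b * rowFlow x Q a) := by
    rw [imul_apply_of_row (N := max L (a + 1)) _ fun l hl => by
        rw [upperPart, hL l (by omega), ite_self],
      rowFlow_eq (L := max L (a + 1)) fun c hc => by rw [hL c (by omega), zero_mul],
      ← sum_range_add_sum_Ico _ (le_max_right L (a + 1)), sum_eq_zero fun l hl => by
        rw [upperPart, if_neg (by have := mem_range.1 hl; omega), zero_mul], zero_add, mul_sum,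
      ← sum_neg_distrib]
    refine sum_congr rfl fun l hl => ?_
    rw [mem_Ico] at hl
    rw [upperPart, if_pos (by omega), rankTwo1_le x y (by omega)]
    ring
  have h2 : imul (rankTwo1 x y) (upperPart Q) a b = -(x (a + 1) * colFlow y Q b) := by
    rw [imul_apply_of_col (N := b) _ fun l hl => by rw [upperPart, if_neg (by omega)], colFlow,
      mul_sum, ← sum_neg_distrib]
    refine sum_congr rfl fun l hl => ?_
    rw [mem_range] at hl
    rw [upperPart, if_pos hl, rankTwo1_le x y (by omega)]
    ring
  rw [h1, h2, sub_neg_eq_add]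

theorem comm_lower_gt {x y : ℕ → R} {Q : Matrix ℕ ℕ R} (hQ : ∀ a b, a < b → Q a b = 0) {a b : ℕ}
    (hab : a + 1 < b) :
    imul Q (rankTwo1 x y) a b - imul (rankTwo1 x y) Q a b = 0 := by
  rw [imul_apply_of_row (N := a + 1) _ fun l hl => hQ a l (by omega),
    imul_apply_of_row (N := a + 2) _ fun l hl => rankTwo1_gt x y (by omega),
    sum_eq_zero fun l hl => by rw [rankTwo1_gt x y (by have := mem_range.1 hl; omega), mul_zero],
    sum_eq_zero fun l hl => by rw [hQ l b (by have := mem_range.1 hl; omega), mul_zero], sub_zero]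

/-- Up to the first superdiagonal the commutator factors. Beyond it, since `Q` commutes with the
rank two matrix, it equals minus the commutator of the lower part of `Q`, which vanishes there by
`comm_lower_gt`. -/
theorem comm_upperPart {x y : ℕ → R} {Q : Matrix ℕ ℕ R} (hR : RowFin Q)
    (hQ : imul Q (rankTwo1 x y) = imul (rankTwo1 x y) Q) (a b : ℕ) :
    imul (upperPart Q) (rankTwo1 x y) a b - imul (rankTwo1 x y) (upperPart Q) a b
      = if b ≤ a + 1 then -(y b * rowFlow x Q a) + x (a + 1) * colFlow y Q b else 0 := by
  split_ifs with hab
  · obtain ⟨L, hL⟩ := hR a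
    exact comm_upperPart_le hab hL
  · have h1 := comm_lower_gt (x := x) (y := y) (Q := Q - upperPart Q)
      (fun a b hab => by simp [upperPart, hab]) (a := a) (b := b) (by omega)
    rw [sub_imul_row hR hR.upperPart, imul_sub_row (rowFin_rankTwo1 x y), hQ] at h1
    simp only [Matrix.sub_apply] at h1
    linear_combination -h1

/-- The trace of the derivative along a flow of Lax type is a boundary term. -/
theorem sum_bracket_of_lax {x y : ℕ → R} {K : ℕ} (hx : ∀ m, K + 1 ≤ m → x m = 0)
    {P W : Matrix ℕ ℕ R} (hPR : RowFin P) (hP : imul P (rankTwo1 x y) = imul (rankTwo1 x y) P)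
    (hWR : RowFin W) {α β : ℕ → R} (hβ : β 0 = 0)
    (hW : ∀ a b, imul W (rankTwo1 x y) a b - imul (rankTwo1 x y) W a b
      = if b ≤ a + 1 then -(y b * α a) + x (a + 1) * β b else 0) :
    ∑ m ∈ range (K + 1), (gradX y P m * α m - gradY x P m * β (m + 1))
      = imul W P (K + 1) K := by
  have hM := rowFin_rankTwo1 x y
  have hZ := hWR.imul hPR
  obtain ⟨L0, hL0⟩ := hZ.bound (K + 1)
  obtain ⟨L, hL⟩ : ∃ L, L = max L0 (K + 2) := ⟨_, rfl⟩
  -- The corner trace of `[WP, M]` is evaluated twice. Across the corner, where the `x` vanish past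
  -- `K`, one boundary entry survives. On the other hand `[WP, M] = [W, M] P`, whose diagonal is
  -- given by `hW`.
  have key := sum_range_comm_diag (A := imul W P) (B := rankTwo1 x y) (N := K + 1) (L := L)
    (by omega) (fun a ha b hb => hL0 a ha b (by omega))
    (fun a ha b hb => rankTwo1_gt x y (by omega))
  have e1 : ∑ a ∈ range (K + 1), ∑ b ∈ Ico (K + 1) L,
      (imul W P a b * rankTwo1 x y b a - rankTwo1 x y a b * imul W P b a)
      = -imul W P (K + 1) K := by
    rw [sum_eq_single K, sum_eq_single (K + 1), rankTwo1_succ, rankTwo1_le x y (by omega),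
      hx (K + 1) le_rfl, hx (K + 1 + 1) (by omega)]
    · ring
    · intro b hb hb'
      rw [mem_Ico] at hb
      rw [rankTwo1_gt x y (a := K) (by omega), rankTwo1_le x y (by omega), hx (b + 1) (by omega)]
      ring
    · intro hb
      rw [mem_Ico] at hb
      omega
    · intro a ha ha'
      rw [mem_range] at ha
      refine sum_eq_zero fun b hb => ?_
      rw [mem_Ico] at hb
      rw [rankTwo1_gt x y (a := a) (by omega), rankTwo1_le x y (by omega), hx (b + 1) (by omega)]
      ring
    · simp
  have e2 : ∀ a, imul (imul W P) (rankTwo1 x y) a a - imul (rankTwo1 x y) (imul W P) a a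
      = ∑ b ∈ range (a + 2), (-(y b * α a) + x (a + 1) * β b) * P b a := by
    intro a
    rw [imul_assoc_row hWR hPR, hP, ← imul_assoc_row hWR hM, ← imul_assoc_row hM hWR,
      ← Matrix.sub_apply, ← sub_imul_row (hWR.imul hM) (hM.imul hWR),
      imul_apply_of_row (N := a + 2) _ fun l hl => by
        rw [Matrix.sub_apply, hW, if_neg (by omega)]]
    refine sum_congr rfl fun b hb => ?_
    rw [mem_range] at hb
    rw [Matrix.sub_apply, hW, if_pos (by omega)]
  rw [e1, sum_congr rfl fun a _ => e2 a] at key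
  have e3 : ∀ a, ∑ b ∈ range (a + 2), (-(y b * α a) + x (a + 1) * β b) * P b a
      = -(gradX y P a * α a) + ∑ m ∈ Ico 0 (a + 1), β (m + 1) * (P (m + 1) a * x (a + 1)) := by
    intro a
    simp_rw [add_mul, sum_add_distrib]
    rw [gradX, sum_mul, ← sum_neg_distrib]
    congr 1
    · exact sum_congr rfl fun b _ => by ring
    · rw [sum_range_succ', hβ, mul_zero, zero_mul, add_zero, range_eq_Ico]
      exact sum_congr rfl fun b _ => by ring
  rw [sum_congr rfl fun a _ => e3 a, sum_add_distrib, range_eq_Ico, ← sum_Ico_Ico_comm] at key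
  rw [← neg_inj, ← key, range_eq_Ico, ← sum_neg_distrib, ← sum_add_distrib]
  refine sum_congr rfl fun m _ => ?_
  rw [gradY_eq (L := K + 1) fun c hc => by rw [hx (c + 1) (by omega), mul_zero], ← mul_sum]
  ring

end RankTwo

/-! ### Derivatives of traces of powers -/

section Gradient

open Finset

variable {k R : Type*} [CommRing k] [CommRing R] [Algebra k R]

theorem map_derivation_imul (d : Derivation k R R) {A B : Matrix ℕ ℕ R} (hA : RowFin A) :
    (imul A B).map d = imul (A.map d) B + imul A (B.map d) := by
  ext i j
  obtain ⟨N, hN⟩ := hA i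
  rw [Matrix.add_apply, Matrix.map_apply, imul_apply_of_row _ hN, imul_apply_of_row _ hN,
    imul_apply_of_row (A := A.map d) (N := N) _ fun l hl => by rw [Matrix.map_apply, hN l hl,
      map_zero], map_sum, ← sum_add_distrib]
  refine sum_congr rfl fun l _ => ?_
  rw [Derivation.leibniz, Matrix.map_apply, Matrix.map_apply, smul_eq_mul, smul_eq_mul]
  ring

theorem RowFin.map_derivation (d : Derivation k R R) {A : Matrix ℕ ℕ R} (hA : RowFin A) :
    RowFin (A.map d) := fun i => by
  obtain ⟨N, hN⟩ := hA i
  exact ⟨N, fun j hj => by rw [Matrix.map_apply, hN j hj, map_zero]⟩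

/-- The extra factor `M^l` is what makes the induction close: each step moves one `M` to the right
and uses cyclicity of the trace. Cyclicity of an infinite trace is legitimate because `(dM) M^l` has
finitely many nonzero columns. -/
theorem trace_derivation_ipow (d : Derivation k R R) {M : Matrix ℕ ℕ R} (hM : RowFin M)
    (hE : ∀ l, ∃ N, ∀ a b, N ≤ b → imul (M.map d) (ipow M l) a b = 0) (i l : ℕ) :
    {a | imul ((ipow M i).map d) (ipow M l) a a ≠ 0}.Finite ∧
      ∑ᶠ a, imul ((ipow M i).map d) (ipow M l) a a
        = i * ∑ᶠ a, imul (M.map d) (ipow M (i + l - 1)) a a := by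
  induction i generalizing l with
  | zero =>
    have h0 : (ipow M 0).map d = 0 := by
      ext a b
      rw [ipow_zero, Matrix.map_apply, Matrix.one_apply]
      split_ifs <;> simp
    rw [h0]
    simp [imul]
  | succ i ih =>
    have hEr := hM.map_derivation d
    have h1 : imul ((ipow M (i + 1)).map d) (ipow M l)
        = imul ((ipow M i).map d) (ipow M (l + 1))
          + imul (ipow M i) (imul (M.map d) (ipow M l)) := by
      have hr := (hM.ipow i).map_derivation d
      rw [ipow_succ, map_derivation_imul d (hM.ipow i), hM.ipow_succ' l,
        ← imul_assoc_row hr hM, ← imul_assoc_row (hM.ipow i) hEr,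
        ← sub_neg_eq_add (imul _ M), sub_imul_row (hr.imul hM) ((hM.ipow i).imul hEr).neg,
        neg_imul, sub_neg_eq_add]
    obtain ⟨N, hN⟩ := hE l
    obtain ⟨c1, c2, c3⟩ := finsum_diag_comm (hM.ipow i) hN
    obtain ⟨i1, i2⟩ := ih (l + 1)
    have c1' : {a | imul (ipow M i) (imul (M.map d) (ipow M l)) a a ≠ 0}.Finite :=
      (Set.finite_Iio N).subset fun a ha => by
        by_contra hc
        exact ha (c1 a (not_lt.1 hc))
    rw [h1]
    refine ⟨(i1.union c1').subset fun a ha => ?_, ?_⟩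
    · by_contra hc
      simp only [Set.mem_union, Set.mem_ofPred_eq, not_or, not_not] at hc
      exact ha (by rw [Matrix.add_apply, hc.1, hc.2, add_zero])
    · simp only [Matrix.add_apply]
      rw [finsum_add_distrib i1 c1', i2, c3, imul_assoc_row hEr (hM.ipow l), ← hM.ipow_add]
      rw [show i + (l + 1) - 1 = l + i by omega, show i + 1 + l - 1 = l + i by omega]
      push_cast
      ring

/-- The derivative in a coordinate `x_{m+1}` of the trace of a power. -/
theorem trace_derivation_ipow_x (d : Derivation k R R) (x y : ℕ → R) (m : ℕ)
    (hdx : ∀ n, d (x n) = if n = m + 1 then 1 else 0) (hdy : ∀ n, d (y n) = 0) (i : ℕ) :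
    {a | d (ipow (rankTwo1 x y) i a a) ≠ 0}.Finite ∧
      ∑ᶠ a, d (ipow (rankTwo1 x y) i a a)
        = -(i * gradX y (ipow (rankTwo1 x y) (i - 1)) m) := by
  have hM := rowFin_rankTwo1 x y
  have hE : ∀ a b, (rankTwo1 x y).map d a b = if a = m ∧ b ≤ m + 1 then -y b else 0 := by
    intro a b
    rw [Matrix.map_apply, rankTwo1]
    split_ifs with h1 h2 h2 h3 h3 <;>
      simp only [map_neg, map_sub, Derivation.leibniz, hdx, hdy, smul_eq_mul, map_zero,
        Derivation.map_one_eq_zero] <;> first | omega | skip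
    · rw [if_pos (by omega)]; ring
    · rw [if_neg (by omega)]; ring
    · rw [if_pos (by omega), show a + 1 = b by omega]; ring
    · rw [if_neg (by omega)]; ring
  have hF : ∀ l, ∃ N, ∀ a b, N ≤ b → imul ((rankTwo1 x y).map d) (ipow (rankTwo1 x y) l) a b = 0 := by
    intro l
    obtain ⟨N, hN⟩ := (hM.ipow l).bound (m + 2)
    refine ⟨N, fun a b hb => ?_⟩
    rw [imul_apply_of_row (N := m + 2) _ fun l hl => by rw [hE, if_neg (by omega)]]
    exact sum_eq_zero fun l hl => by rw [hN l (mem_range.1 hl) b hb, mul_zero]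
  obtain ⟨h1, h2⟩ := trace_derivation_ipow d hM hF i 0
  rw [ipow_zero, imul_one] at h1 h2
  refine ⟨h1, h2.trans ?_⟩
  rw [add_zero, finsum_eq_single _ m, imul_apply_of_row (N := m + 2) _ fun l hl => by
    rw [hE, if_neg (by omega)], gradX, ← mul_neg, ← sum_neg_distrib]
  · congr 1
    refine sum_congr rfl fun c hc => ?_
    rw [hE, if_pos ⟨rfl, by have := mem_range.1 hc; omega⟩]
    ring
  · intro a ha
    rw [imul_apply_of_row (N := 0) _ fun l hl => by rw [hE, if_neg (by omega)], range_zero,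
      sum_empty]

/-- The derivative in a coordinate `y_{m+1}` of the trace of a power. -/
theorem trace_derivation_ipow_y (d : Derivation k R R) (x y : ℕ → R) (m : ℕ)
    (hdx : ∀ n, d (x n) = 0) (hdy : ∀ n, d (y n) = if n = m + 1 then 1 else 0) (i : ℕ) :
    {a | d (ipow (rankTwo1 x y) i a a) ≠ 0}.Finite ∧
      ∑ᶠ a, d (ipow (rankTwo1 x y) i a a)
        = -(i * gradY x (ipow (rankTwo1 x y) (i - 1)) m) := by
  have hM := rowFin_rankTwo1 x y
  have hE : ∀ a b, (rankTwo1 x y).map d a b = if b = m + 1 ∧ m ≤ a then -x (a + 1) else 0 := by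
    intro a b
    rw [Matrix.map_apply, rankTwo1]
    split_ifs with h1 h2 h2 h3 h3 <;>
      simp only [map_neg, map_sub, Derivation.leibniz, hdx, hdy, smul_eq_mul, map_zero,
        Derivation.map_one_eq_zero] <;> first | omega | skip
    · rw [if_pos (by omega)]; ring
    · rw [if_neg (by omega)]; ring
    · rw [if_pos (by omega)]; ring
    · rw [if_neg (by omega)]; ring
  have hI : ∀ l a b, imul ((rankTwo1 x y).map d) (ipow (rankTwo1 x y) l) a b
      = (if m ≤ a then -x (a + 1) else 0) * ipow (rankTwo1 x y) l (m + 1) b := by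
    intro l a b
    rw [imul, finsum_eq_single _ (m + 1)]
    · rw [hE]; simp
    · intro c hc
      rw [hE, if_neg (by omega), zero_mul]
  have hF : ∀ l, ∃ N, ∀ a b, N ≤ b → imul ((rankTwo1 x y).map d) (ipow (rankTwo1 x y) l) a b = 0 := by
    intro l
    obtain ⟨N, hN⟩ := (hM.ipow l) (m + 1)
    exact ⟨N, fun a b hb => by rw [hI, hN b hb, mul_zero]⟩
  obtain ⟨h1, h2⟩ := trace_derivation_ipow d hM hF i 0
  rw [ipow_zero, imul_one] at h1 h2
  refine ⟨h1, h2.trans ?_⟩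
  rw [add_zero, gradY, ← mul_neg, ← finsum_neg_distrib]
  congr 1
  refine finsum_congr fun a => ?_
  rw [hI]
  split_ifs <;> ring

end Gradient

end ToeplitzLattice

namespace ToeplitzLattice

/-! ### The two rank two matrices as mutual inverses, up to rank one -/

section FiniteSupport

open Finset

variable {K : Type*} [Field K]

/-- The product `∏_{m=1}^n (1 - x_m y_m)`. -/
def normProd (x y : ℕ → K) (n : ℕ) : K := ∏ m ∈ range n, (1 - x (m + 1) * y (m + 1))

theorem normProd_succ (x y : ℕ → K) (n : ℕ) :
    normProd x y (n + 1) = normProd x y n * (1 - x (n + 1) * y (n + 1)) := prod_range_succ _ _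

theorem normProd_ne_zero {x y : ℕ → K} (hv : ∀ n, 1 - x (n + 1) * y (n + 1) ≠ 0) (n : ℕ) :
    normProd x y n ≠ 0 := prod_ne_zero_iff.2 fun m _ => hv m

theorem normProd_eq {x y : ℕ → K} {s : ℕ} (hx : ∀ m, s + 1 ≤ m → x m = 0) {n : ℕ} (hn : s ≤ n) :
    normProd x y n = normProd x y s := by
  induction n, hn using Nat.le_induction with
  | base => rfl
  | succ n hn ih => rw [normProd_succ, ih, hx (n + 1) (by omega), zero_mul, sub_zero, mul_one]

/-- Conjugation of a matrix by a diagonal matrix, `H⁻¹ A H`. -/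
def diagConj (H : ℕ → K) (A : Matrix ℕ ℕ K) : Matrix ℕ ℕ K := fun a b => (H a)⁻¹ * A a b * H b

theorem imul_diagConj {H : ℕ → K} (hH : ∀ n, H n ≠ 0) (A B : Matrix ℕ ℕ K) :
    imul (diagConj H A) (diagConj H B) = diagConj H (imul A B) := by
  ext a b
  simp only [imul, diagConj]
  rw [mul_finsum, finsum_mul]
  exact finsum_congr fun c => by have := hH c; field_simp

theorem diagConj_one {H : ℕ → K} (hH : ∀ n, H n ≠ 0) : diagConj H 1 = 1 := by
  ext a b
  simp only [diagConj, Matrix.one_apply]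
  split_ifs with hab
  · subst hab; have := hH a; field_simp
  · simp

theorem diagConj_ipow {H : ℕ → K} (hH : ∀ n, H n ≠ 0) (A : Matrix ℕ ℕ K) (n : ℕ) :
    ipow (diagConj H A) n = diagConj H (ipow A n) := by
  induction n with
  | zero => rw [ipow_zero, ipow_zero, diagConj_one hH]
  | succ n ih => rw [ipow_succ, ih, imul_diagConj hH, ipow_succ]

theorem RowFin.diagConj (H : ℕ → K) {A : Matrix ℕ ℕ K} (hA : RowFin A) :
    RowFin (ToeplitzLattice.diagConj H A) := fun i => by
  obtain ⟨N, hN⟩ := hA i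
  exact ⟨N, fun j hj => by rw [ToeplitzLattice.diagConj, hN j hj, mul_zero, zero_mul]⟩

theorem rankTwo2_le (x y : ℕ → K) {a b : ℕ} (hab : a ≤ b) :
    rankTwo2 x y a b = -(x a * y (b + 1)) := if_pos hab

theorem rankTwo2_succ (x y : ℕ → K) (b : ℕ) :
    rankTwo2 x y (b + 1) b = 1 - x (b + 1) * y (b + 1) := by simp [rankTwo2]

theorem rankTwo2_gt (x y : ℕ → K) {a b : ℕ} (hab : b + 1 < a) : rankTwo2 x y a b = 0 := by
  rw [rankTwo2, if_neg (by omega), if_neg (by omega)]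

variable {x y : ℕ → K} (hx0 : x 0 = 1) (hy0 : y 0 = 1) (hv : ∀ n, 1 - x (n + 1) * y (n + 1) ≠ 0)

include hx0 hy0 hv in
-- The sum telescopes because consecutive values of `normProd` differ by the factor `1 - x y`. This
-- and `sum_rankTwo2_mul` evaluate all products of the two kinds of matrices.
theorem sum_mul_rankTwo2 (a b : ℕ) :
    ∑ l ∈ range (a + 1), y l * (normProd x y l)⁻¹ * rankTwo2 x y l b
      = if a ≤ b then -(y (b + 1) * (normProd x y a)⁻¹) else 0 := by
  induction a with
  | zero => simp [hx0, hy0, rankTwo2_le, normProd]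
  | succ a ih =>
    have h1 := normProd_ne_zero hv a
    have h2 := hv a
    rw [sum_range_succ, ih]
    have h3 := mul_inv_cancel₀ h2
    rcases lt_trichotomy a b with hab | hab | hab
    · rw [if_pos hab.le, if_pos (by omega), rankTwo2_le x y (by omega), normProd_succ, mul_inv]
      linear_combination (normProd x y a)⁻¹ * y (b + 1) * h3
    · subst hab
      rw [if_pos le_rfl, if_neg (by omega), rankTwo2_succ, normProd_succ, mul_inv]
      linear_combination (normProd x y a)⁻¹ * y (a + 1) * h3
    · rw [if_neg (by omega), if_neg (by omega), rankTwo2_gt x y (by omega), mul_zero, add_zero]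

theorem sum_rankTwo2_mul (d a : ℕ) {L : ℕ} (hL : a ≤ L) :
    ∑ c ∈ Ico a L, rankTwo2 x y d c * (normProd x y c * x (c + 1))
      = (if d ≤ L then normProd x y L * x d else 0) - if d ≤ a then normProd x y a * x d else 0 := by
  induction L, hL using Nat.le_induction with
  | base => simp
  | succ L hL ih =>
    rw [sum_Ico_succ_top hL, ih]
    rcases lt_trichotomy d (L + 1) with hd | hd | hd
    · rw [if_pos (show d ≤ L by omega), if_pos (show d ≤ L + 1 by omega),
        rankTwo2_le x y (by omega), normProd_succ]
      ring
    · subst hd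
      rw [if_neg (by omega), if_pos le_rfl, if_neg (by omega), rankTwo2_succ, normProd_succ]
      ring
    · rw [if_neg (show ¬d ≤ L by omega), if_neg (show ¬d ≤ L + 1 by omega),
        rankTwo2_gt x y (by omega)]
      ring

include hx0 hy0 hv in
-- This is the algebraic form of `L₁ L₂ = 1`, which for a Toeplitz moment matrix expresses `Λ m Λᵀ =
-- m`. The products `normProd` play the role of `h_n / h_0`. No finiteness of the support is needed
-- in this order.
theorem imul_rankTwo1_diagConj :
    imul (rankTwo1 x y) (diagConj (normProd x y) (rankTwo2 x y)) = 1 := by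
  ext a b
  have h1 := normProd_ne_zero hv a
  have h2 := hv a
  have h3 : ∑ l ∈ range (a + 1), y l * diagConj (normProd x y) (rankTwo2 x y) l b
      = (if a ≤ b then -(y (b + 1) * (normProd x y a)⁻¹) else 0) * normProd x y b := by
    rw [← sum_mul_rankTwo2 hx0 hy0 hv, sum_mul]
    exact sum_congr rfl fun l _ => by rw [diagConj]; ring
  rw [imul_rankTwo1_apply, h3, diagConj, normProd_succ]
  rcases lt_trichotomy a b with hab | hab | hab
  · rw [if_pos hab.le, rankTwo2_le x y (by omega), Matrix.one_apply_ne (by omega)]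
    field_simp
    ring
  · subst hab
    rw [if_pos le_rfl, rankTwo2_succ, Matrix.one_apply_eq]
    field_simp
    ring
  · rw [if_neg (by omega), rankTwo2_gt x y (by omega), Matrix.one_apply_ne (by omega)]
    ring

variable {s : ℕ} (hx : ∀ m, s + 1 ≤ m → x m = 0) (hy : ∀ m, s + 1 ≤ m → y m = 0)

include hy in
theorem rowFin_rankTwo2 : RowFin (rankTwo2 x y) := fun i => ⟨max (s + 1) i, fun j hj => by
  rw [rankTwo2_le x y (by omega), hy (j + 1) (by omega), mul_zero, neg_zero]⟩

include hx in
theorem sum_rankTwo2_mul_of_le (d a : ℕ) {L : ℕ} (hL : a ≤ L) (hs : s ≤ L) :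
    ∑ c ∈ Ico a L, rankTwo2 x y d c * (normProd x y c * x (c + 1))
      = normProd x y s * x d - if d ≤ a then normProd x y a * x d else 0 := by
  rw [sum_rankTwo2_mul d a hL, normProd_eq hx hs]
  congr 1
  split_ifs with h
  · rfl
  · rw [hx d (by omega), mul_zero]

include hx0 hy0 hv hx hy in
-- In the opposite order the inverse property fails by a rank one matrix. With the variables
-- vanishing past `s` the telescoping sums end at `normProd x y s`, which makes the defect explicit.
theorem imul_diagConj_rankTwo1 (a b : ℕ) :
    imul (diagConj (normProd x y) (rankTwo2 x y)) (rankTwo1 x y) a b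
      = (1 : Matrix ℕ ℕ K) a b - normProd x y s * (normProd x y a)⁻¹ * x a * y b := by
  obtain ⟨L, hL⟩ : ∃ L, L = max (s + 1) (max a b) + 1 := ⟨_, rfl⟩
  have h1 := normProd_ne_zero hv a
  have hrow : ∀ l, L ≤ l → diagConj (normProd x y) (rankTwo2 x y) a l = 0 := fun l hl => by
    rw [diagConj, rankTwo2_le x y (by omega), hy (l + 1) (by omega)]; ring
  have key := sum_rankTwo2_mul_of_le (x := x) (y := y) hx a b (L := L) (by omega) (by omega)
  have e1 : ∑ l ∈ Ico b L, diagConj (normProd x y) (rankTwo2 x y) a l * rankTwo1 x y l b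
      = -((normProd x y a)⁻¹ * y b) * ∑ c ∈ Ico b L, rankTwo2 x y a c * (normProd x y c * x (c + 1)) := by
    rw [mul_sum]
    refine sum_congr rfl fun l hl => ?_
    rw [rankTwo1_le x y (mem_Ico.1 hl).1, diagConj]
    ring
  cases b with
  | zero =>
    rw [imul_apply_of_row _ hrow, range_eq_Ico, e1, key, hy0]
    rcases Nat.eq_zero_or_pos a with ha | ha
    · subst ha
      rw [if_pos le_rfl, Matrix.one_apply_eq, hx0]
      field_simp
      ring
    · rw [if_neg (by omega), Matrix.one_apply_ne (by omega)]
      ring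
  | succ m =>
    rw [imul_apply_of_row _ hrow, ← sum_range_add_sum_Ico _ (show m + 1 ≤ L by omega), e1, key,
      sum_range_succ, sum_eq_zero fun l hl => by
        rw [rankTwo1_gt x y (by have := mem_range.1 hl; omega), mul_zero], rankTwo1_succ, diagConj,
      zero_add]
    rcases lt_trichotomy a (m + 1) with ha | ha | ha
    · rw [if_pos (by omega), rankTwo2_le x y (by omega), Matrix.one_apply_ne (by omega),
        normProd_succ]
      ring
    · subst ha
      rw [if_pos le_rfl, rankTwo2_succ, Matrix.one_apply_eq]
      have h3 := normProd_succ x y m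
      have h4 := normProd_ne_zero hv m
      have h5 := hv m
      rw [h3]
      field_simp
      ring
    · rw [if_neg (by omega), rankTwo2_gt x y (by omega), Matrix.one_apply_ne (by omega)]
      ring

include hx0 hy0 hv hy in
theorem colFlow_diagConj (j m : ℕ) :
    colFlow y (diagConj (normProd x y) (ipow (rankTwo2 x y) (j + 1))) (m + 1)
      = -((1 - x (m + 1) * y (m + 1)) * gradY y (ipow (rankTwo2 x y) j).transpose m) := by
  have hR := rowFin_rankTwo2 (x := x) hy
  have hm := normProd_ne_zero hv m
  obtain ⟨L0, hL0⟩ := hR.bound (m + 1)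
  obtain ⟨L, hL⟩ : ∃ L, L = max L0 (max (s + 1) m) := ⟨_, rfl⟩
  have hrow : ∀ a, a < m + 1 → ∀ l, L ≤ l → rankTwo2 x y a l = 0 := fun a ha l hl =>
    hL0 a ha l (by omega)
  rw [gradY_eq (L := L) fun c hc => by rw [hy (c + 1) (by omega), mul_zero], colFlow]
  have e1 : ∀ c ∈ range (m + 1), y c * diagConj (normProd x y) (ipow (rankTwo2 x y) (j + 1)) c (m + 1)
      = ∑ l ∈ range L, y c * (normProd x y c)⁻¹ * rankTwo2 x y c l
          * (ipow (rankTwo2 x y) j l (m + 1) * normProd x y (m + 1)) := by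
    intro c hc
    rw [diagConj, hR.ipow_succ', imul_apply_of_row _ (hrow c (mem_range.1 hc)), mul_sum, sum_mul,
      mul_sum]
    exact sum_congr rfl fun l _ => by ring
  rw [sum_congr rfl e1, sum_comm]
  simp_rw [← sum_mul, sum_mul_rankTwo2 hx0 hy0 hv]
  rw [← sum_range_add_sum_Ico _ (show m ≤ L by omega), sum_eq_zero fun l hl => by
    rw [if_neg (by have := mem_range.1 hl; omega), zero_mul], zero_add, mul_sum, ← sum_neg_distrib]
  refine sum_congr rfl fun c hc => ?_
  rw [if_pos (mem_Ico.1 hc).1, normProd_succ, Matrix.transpose_apply]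
  field_simp

include hv hx in
theorem rowFlow_diagConj (j a : ℕ) {L : ℕ} (hLs : s + 1 ≤ L) (hLa : a + 1 < L)
    (hLP : ∀ d, L ≤ d → ipow (rankTwo2 x y) j a d = 0)
    (hLQ : ∀ d, L ≤ d → ipow (rankTwo2 x y) (j + 1) a d = 0) :
    rowFlow x (diagConj (normProd x y) (ipow (rankTwo2 x y) (j + 1))) a
      = normProd x y s * (normProd x y a)⁻¹ * ∑ d ∈ range L, ipow (rankTwo2 x y) j a d * x d
        - (1 - x (a + 1) * y (a + 1)) * gradX x (ipow (rankTwo2 x y) j).transpose a := by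
  have ha := normProd_ne_zero hv a
  rw [rowFlow_eq (L := L) fun c hc => by rw [diagConj, hLQ c hc]; ring]
  have e1 : ∀ c ∈ Ico (a + 1) L, diagConj (normProd x y) (ipow (rankTwo2 x y) (j + 1)) a c * x (c + 1)
      = ∑ d ∈ range L, (normProd x y a)⁻¹ * ipow (rankTwo2 x y) j a d
          * (rankTwo2 x y d c * (normProd x y c * x (c + 1))) := by
    intro c hc
    rw [diagConj, ipow_succ, imul_apply_of_row _ hLP, mul_sum, sum_mul, sum_mul]
    exact sum_congr rfl fun l _ => by ring
  rw [sum_congr rfl e1, sum_comm]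
  simp_rw [← mul_sum, sum_rankTwo2_mul_of_le (x := x) (y := y) hx _ (a + 1) hLa.le (show s ≤ L by omega),
    mul_sub, sum_sub_distrib]
  congr 1
  · rw [mul_sum]
    exact sum_congr rfl fun d _ => by ring
  · rw [gradX, ← sum_range_add_sum_Ico _ (show a + 2 ≤ L by omega), sum_congr rfl fun d hd => by
      rw [if_pos (by have := mem_range.1 hd; omega)], sum_eq_zero (s := Ico _ _) fun d hd => by
      rw [if_neg (by have := mem_Ico.1 hd; omega), mul_zero], add_zero, mul_sum]
    refine sum_congr rfl fun d _ => ?_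
    rw [normProd_succ, Matrix.transpose_apply]
    field_simp

/-- The flow of `H^{(2)}_{j+1}` acts on the rank two matrix of the first kind by a commutator. -/
def lowerConj (H : ℕ → K) (Q : Matrix ℕ ℕ K) : Matrix ℕ ℕ K := diagConj H Q - upperPart (diagConj H Q)

include hx0 hy0 hv hx hy in
-- The strictly upper part contributes the terms of `comm_upperPart_le`. For the whole conjugated
-- power, multiplication by the rank two matrix from the left removes one factor exactly, and from
-- the right it leaves the rank one defect. The defect cancels the leading term of
-- `rowFlow_diagConj`, and what remains is the gradient.
theorem comm_lowerConj (j a b : ℕ) :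
    imul (lowerConj (normProd x y) (ipow (rankTwo2 x y) (j + 1))) (rankTwo1 x y) a b
        - imul (rankTwo1 x y) (lowerConj (normProd x y) (ipow (rankTwo2 x y) (j + 1))) a b
      = if b ≤ a + 1 then
          -(y b * ((1 - x (a + 1) * y (a + 1)) * gradX x (ipow (rankTwo2 x y) j).transpose a))
            + x (a + 1) * (if b = 0 then 0 else
              (1 - x b * y b) * gradY y (ipow (rankTwo2 x y) j).transpose (b - 1)) else 0 := by
  have hR := rowFin_rankTwo2 (x := x) hy
  have hN := normProd_ne_zero hv
  have hM := rowFin_rankTwo1 x y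
  split_ifs with hab hb0
  rotate_left 2
  · exact comm_lower_gt (fun c d hcd => by simp [lowerConj, upperPart, hcd]) (by omega)
  all_goals
    obtain ⟨L0, hL0⟩ := hR.ipow j a
    obtain ⟨L1, hL1⟩ := hR.ipow (j + 1) a
    obtain ⟨L, hL⟩ : ∃ L, L = max (max L0 L1) (max (s + 1) (a + 2)) := ⟨_, rfl⟩
    have hLP : ∀ d, L ≤ d → ipow (rankTwo2 x y) j a d = 0 := fun d hd => hL0 d (by omega)
    have hLQ : ∀ d, L ≤ d → ipow (rankTwo2 x y) (j + 1) a d = 0 := fun d hd => hL1 d (by omega)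
    have hQr := (hR.ipow (j + 1)).diagConj (normProd x y)
    rw [lowerConj, sub_imul_row hQr hQr.upperPart, imul_sub_row hM, Matrix.sub_apply,
      Matrix.sub_apply, sub_sub_sub_comm, comm_upperPart_le hab (L := L) fun c hc => by
        rw [diagConj, hLQ c hc]; ring, rowFlow_diagConj hv hx j a (by omega) (by omega) hLP hLQ]
    have e1 : imul (rankTwo1 x y) (diagConj (normProd x y) (ipow (rankTwo2 x y) (j + 1)))
        = diagConj (normProd x y) (ipow (rankTwo2 x y) j) := by
      rw [hR.ipow_succ', ← imul_diagConj hN, ← imul_assoc_row hM (hR.diagConj _),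
        imul_rankTwo1_diagConj hx0 hy0 hv, one_imul]
    have e2 : imul (diagConj (normProd x y) (ipow (rankTwo2 x y) (j + 1))) (rankTwo1 x y) a b
        = diagConj (normProd x y) (ipow (rankTwo2 x y) j) a b
          - normProd x y s * (normProd x y a)⁻¹ * (∑ d ∈ range L, ipow (rankTwo2 x y) j a d * x d)
            * y b := by
      have hrow : ∀ l, L ≤ l → diagConj (normProd x y) (ipow (rankTwo2 x y) j) a l = 0 :=
        fun l hl => by rw [diagConj, hLP l hl]; ring
      rw [ipow_succ, ← imul_diagConj hN, imul_assoc_row ((hR.ipow j).diagConj _) (hR.diagConj _),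
        imul_apply_of_row _ hrow]
      simp_rw [imul_diagConj_rankTwo1 hx0 hy0 hv hx hy, mul_sub, sum_sub_distrib]
      congr 1
      · rw [← imul_apply_of_row _ hrow, imul_one]
      · rw [mul_sum, sum_mul]
        refine sum_congr rfl fun d _ => ?_
        have := hN d
        rw [diagConj]
        field_simp
    rw [e1, e2]
  · subst hb0
    rw [colFlow, range_zero, sum_empty]
    ring
  · obtain ⟨m, rfl⟩ : ∃ m, b = m + 1 := ⟨b - 1, by omega⟩
    rw [colFlow_diagConj hx0 hy0 hv hy, Nat.add_sub_cancel]
    ring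

include hx in
-- Past the support of the variables the matrix is the pure shift. Together with
-- `ipow_rankTwo2_of_le` this determines the boundary terms of the brackets.
theorem ipow_rankTwo1_of_le (k : ℕ) {a : ℕ} (ha : s ≤ a) (b : ℕ) :
    ipow (rankTwo1 x y) k a b = if b = a + k then 1 else 0 := by
  induction k generalizing a with
  | zero => simp [ipow_zero, Matrix.one_apply, eq_comm]
  | succ k ih =>
    rw [(rowFin_rankTwo1 x y).ipow_succ', imul_rankTwo1_apply, hx (a + 1) (by omega),
      ih (by omega), zero_mul, zero_mul, sub_zero, sub_zero, one_mul]
    congr 1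
    simp only [eq_iff_iff]
    omega

include hx hy in
theorem ipow_rankTwo2_of_le (k : ℕ) {a : ℕ} (ha : s + k ≤ a) (b : ℕ) :
    ipow (rankTwo2 x y) k a b = if b + k = a then 1 else 0 := by
  induction k generalizing a with
  | zero => simp [ipow_zero, Matrix.one_apply, eq_comm]
  | succ k ih =>
    obtain ⟨a, rfl⟩ : ∃ c, a = c + 1 := ⟨a - 1, by omega⟩
    rw [(rowFin_rankTwo2 (x := x) hy).ipow_succ', imul, finsum_eq_single _ a]
    · rw [rankTwo2_succ, hx (a + 1) (by omega), ih (by omega), zero_mul, sub_zero, one_mul]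
      congr 1
      simp only [eq_iff_iff]
      omega
    · intro c hc
      rcases lt_or_gt_of_ne hc with h | h
      · rw [rankTwo2_gt x y (by omega), zero_mul]
      · rw [rankTwo2_le x y (by omega), hx (a + 1) (by omega)]; ring

end FiniteSupport

section FiniteSupportBrackets

open Finset

variable {K : Type*} [Field K] {x y : ℕ → K} {s : ℕ} (hx : ∀ m, s + 1 ≤ m → x m = 0)
  (hy : ∀ m, s + 1 ≤ m → y m = 0)

include hx in
-- The boundary term vanishes: `W` is strictly upper triangular, so it leads from row `N + 1` to
-- larger indices, and past the support the power of the rank two matrix shifts further up, never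
-- back to column `N`.
theorem sum_bracket_same (i j : ℕ) {N : ℕ} (hN : s ≤ N) :
    ∑ m ∈ range (N + 1), (1 - x (m + 1) * y (m + 1)) *
      (gradX y (ipow (rankTwo1 x y) i) m * gradY x (ipow (rankTwo1 x y) j) m
        - gradY x (ipow (rankTwo1 x y) i) m * gradX y (ipow (rankTwo1 x y) j) m) = 0 := by
  have hM := rowFin_rankTwo1 x y
  have hc : ∀ k, imul (ipow (rankTwo1 x y) k) (rankTwo1 x y)
      = imul (rankTwo1 x y) (ipow (rankTwo1 x y) k) := fun k => by rw [← ipow_succ, hM.ipow_succ']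
  have key := sum_bracket_of_lax (x := x) (y := y) (K := N) (fun m hm => hx m (by omega))
    (hM.ipow i) (hc i) (hM.ipow (j + 1)).upperPart (β := colFlow y (ipow (rankTwo1 x y) (j + 1)))
    (by simp [colFlow]) (comm_upperPart (hM.ipow (j + 1)) (hc (j + 1)))
  rw [imul, finsum_eq_zero_of_forall_eq_zero] at key
  · rw [← key]
    refine sum_congr rfl fun m _ => ?_
    rw [ipow_succ, ← mul_gradX (hM.ipow j) (hc j), ← mul_gradY (hM.ipow j) (hc j)]
    ring
  · intro c
    rw [upperPart]
    split_ifs with h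
    · rw [ipow_rankTwo1_of_le hx i (by omega), if_neg (by omega), mul_zero]
    · rw [zero_mul]

include hx hy in
-- At the boundary both factors are pure shifts. The lower one goes from `N + 1` down by `j + 1` to
-- `N - j`, and the other one goes up by `i`, so that column `N` is reached exactly when `i = j`.
-- The normalizing products are already constant there and cancel.
theorem sum_bracket_mixed (hx0 : x 0 = 1) (hy0 : y 0 = 1)
    (hv : ∀ n, 1 - x (n + 1) * y (n + 1) ≠ 0) (i j : ℕ) {N : ℕ} (hN : s + j + 1 ≤ N) :
    ∑ m ∈ range (N + 1), (1 - x (m + 1) * y (m + 1)) *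
      (gradX y (ipow (rankTwo1 x y) i) m * gradX x (ipow (rankTwo1 y x) j) m
        - gradY x (ipow (rankTwo1 x y) i) m * gradY y (ipow (rankTwo1 y x) j) m)
      = if i = j then 1 else 0 := by
  have hM := rowFin_rankTwo1 x y
  have hR := rowFin_rankTwo2 (x := x) hy
  have hc : imul (ipow (rankTwo1 x y) i) (rankTwo1 x y)
      = imul (rankTwo1 x y) (ipow (rankTwo1 x y) i) := by rw [← ipow_succ, hM.ipow_succ']
  have hT : (ipow (rankTwo2 x y) j).transpose = ipow (rankTwo1 y x) j := by
    rw [hR.transpose_ipow, rankTwo2_eq_transpose, Matrix.transpose_transpose]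
  have hQ := (hR.ipow (j + 1)).diagConj (normProd x y)
  have key := sum_bracket_of_lax (x := x) (y := y) (K := N) (fun m hm => hx m (by omega))
    (hM.ipow i) hc (W := lowerConj (normProd x y) (ipow (rankTwo2 x y) (j + 1)))
    (hQ.sub hQ.upperPart) (β := fun b => if b = 0 then 0 else
      (1 - x b * y b) * gradY y (ipow (rankTwo2 x y) j).transpose (b - 1)) (by simp)
    (comm_lowerConj hx0 hy0 hv hx hy j)
  rw [imul, finsum_eq_single _ (N - j)] at key
  · rw [lowerConj, Matrix.sub_apply, upperPart, if_neg (by omega), diagConj,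
      ipow_rankTwo2_of_le hx hy _ (by omega), if_pos (by omega), normProd_eq hx (n := N + 1) (by omega),
      normProd_eq hx (n := N - j) (by omega), ipow_rankTwo1_of_le hx i (by omega), sub_zero, mul_one,
      inv_mul_cancel₀ (normProd_ne_zero hv s), one_mul] at key
    have e : (if i = j then (1 : K) else 0) = if N = N - j + i then 1 else 0 := by
      congr 1
      simp only [eq_iff_iff]
      omega
    rw [e, ← key]
    refine sum_congr rfl fun m _ => ?_
    rw [if_neg (by omega), hT, Nat.add_sub_cancel]
    ring
  · intro c hc
    rw [lowerConj, Matrix.sub_apply, upperPart]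
    split_ifs with h
    · rw [sub_self, zero_mul]
    · rw [diagConj, ipow_rankTwo2_of_le hx hy _ (by omega), if_neg (by omega)]
      ring

end FiniteSupportBrackets

/-! ### The Hamiltonians as formal sums and their Poisson brackets -/

section Formal

open Finset MvPolynomial

theorem xVar_zero : xVar 0 = 1 := rfl

theorem yVar_zero : yVar 0 = 1 := rfl

theorem xVar_succ (m : ℕ) : xVar (m + 1) = X (Sum.inl m.succPNat) := rfl

theorem yVar_succ (m : ℕ) : yVar (m + 1) = X (Sum.inr m.succPNat) := rfl

theorem pderiv_inl_xVar (m n : ℕ) :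
    pderiv (Sum.inl m.succPNat) (xVar n) = if n = m + 1 then 1 else 0 := by
  cases n with
  | zero => simp [xVar_zero]
  | succ n =>
    rw [xVar_succ, pderiv_X, Pi.single_apply]
    simp [Nat.succPNat_inj, eq_comm]

theorem pderiv_inl_yVar (m n : ℕ) : pderiv (Sum.inl m.succPNat) (yVar n) = 0 := by
  cases n with
  | zero => simp [yVar_zero]
  | succ n => rw [yVar_succ, pderiv_X, Pi.single_apply]; simp

theorem pderiv_inr_xVar (m n : ℕ) : pderiv (Sum.inr m.succPNat) (xVar n) = 0 := by
  cases n with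
  | zero => simp [xVar_zero]
  | succ n => rw [xVar_succ, pderiv_X, Pi.single_apply]; simp

theorem pderiv_inr_yVar (m n : ℕ) :
    pderiv (Sum.inr m.succPNat) (yVar n) = if n = m + 1 then 1 else 0 := by
  cases n with
  | zero => simp [yVar_zero]
  | succ n =>
    rw [yVar_succ, pderiv_X, Pi.single_apply]
    simp [Nat.succPNat_inj, eq_comm]

theorem ipow_rankTwo2_diag {R : Type*} [CommRing R] (x y : ℕ → R) (i a : ℕ) :
    ipow (rankTwo2 x y) i a a = ipow (rankTwo1 y x) i a a := by
  rw [rankTwo2_eq_transpose, ← (rowFin_rankTwo1 y x).transpose_ipow, Matrix.transpose_apply]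

theorem locallyFinite_and_dForm {v : ℕ+ ⊕ ℕ+} {i : ℕ+} {f : ℕ → PhasePoly} {g : PhasePoly}
    (hf : {a | pderiv v (f a) ≠ 0}.Finite ∧ ∑ᶠ a, pderiv v (f a) = -((i : ℕ) * g)) :
    {a | pderiv v (C (-(1 / (i : ℂ))) * f a) ≠ 0}.Finite ∧
      dForm (fun a => C (-(1 / (i : ℂ))) * f a) v = g := by
  have h1 : ∀ a, pderiv v (C (-(1 / (i : ℂ))) * f a) = C (-(1 / (i : ℂ))) * pderiv v (f a) :=
    fun a => pderiv_C_mul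
  simp_rw [dForm, h1]
  refine ⟨hf.1.subset fun a ha hc => ha (by rw [hc, mul_zero]), ?_⟩
  rw [← mul_finsum, hf.2]
  have hi : ((i : ℕ) : PhasePoly) = C ((i : ℕ) : ℂ) := by simp
  have hi0 : ((i : ℕ) : ℂ) ≠ 0 := by exact_mod_cast i.ne_zero
  rw [hi, mul_neg, ← mul_assoc, ← C_mul, neg_mul, one_div, inv_mul_cancel₀ hi0]
  simp

theorem dForm_H1_inl (i : ℕ+) (m : ℕ) :
    {a | pderiv (Sum.inl m.succPNat) (H1 i a) ≠ 0}.Finite ∧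
      dForm (H1 i) (Sum.inl m.succPNat)
        = gradX yVar (ipow (rankTwo1 xVar yVar) ((i : ℕ) - 1)) m :=
  locallyFinite_and_dForm (trace_derivation_ipow_x (pderiv (Sum.inl m.succPNat)) xVar yVar m
    (pderiv_inl_xVar m) (pderiv_inl_yVar m) i)

theorem dForm_H1_inr (i : ℕ+) (m : ℕ) :
    {a | pderiv (Sum.inr m.succPNat) (H1 i a) ≠ 0}.Finite ∧
      dForm (H1 i) (Sum.inr m.succPNat)
        = gradY xVar (ipow (rankTwo1 xVar yVar) ((i : ℕ) - 1)) m :=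
  locallyFinite_and_dForm (trace_derivation_ipow_y (pderiv (Sum.inr m.succPNat)) xVar yVar m
    (pderiv_inr_xVar m) (pderiv_inr_yVar m) i)

theorem H2_eq (i : ℕ+) :
    H2 i = fun a => C (-(1 / (i : ℂ))) * ipow (rankTwo1 yVar xVar) i a a := by
  ext1 a
  rw [H2, ipow_rankTwo2_diag]

theorem dForm_H2_inl (i : ℕ+) (m : ℕ) :
    {a | pderiv (Sum.inl m.succPNat) (H2 i a) ≠ 0}.Finite ∧
      dForm (H2 i) (Sum.inl m.succPNat)
        = gradY yVar (ipow (rankTwo1 yVar xVar) ((i : ℕ) - 1)) m := by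
  rw [H2_eq]
  exact locallyFinite_and_dForm (trace_derivation_ipow_y (pderiv (Sum.inl m.succPNat)) yVar xVar m
    (pderiv_inl_yVar m) (pderiv_inl_xVar m) i)

theorem dForm_H2_inr (i : ℕ+) (m : ℕ) :
    {a | pderiv (Sum.inr m.succPNat) (H2 i a) ≠ 0}.Finite ∧
      dForm (H2 i) (Sum.inr m.succPNat)
        = gradX xVar (ipow (rankTwo1 yVar xVar) ((i : ℕ) - 1)) m := by
  rw [H2_eq]
  exact locallyFinite_and_dForm (trace_derivation_ipow_x (pderiv (Sum.inr m.succPNat)) yVar xVar m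
    (pderiv_inr_yVar m) (pderiv_inr_xVar m) i)

theorem locallyFinite_H (i : ℕ+) : LocallyFinite (H1 i) ∧ LocallyFinite (H2 i) := by
  constructor <;> rintro (n | n) <;> obtain ⟨m, rfl⟩ : ∃ m : ℕ, n = m.succPNat :=
    ⟨n.natPred, by simp⟩
  · exact (dForm_H1_inl i m).1
  · exact (dForm_H1_inr i m).1
  · exact (dForm_H2_inl i m).1
  · exact (dForm_H2_inr i m).1

/-- The index of a phase space variable. -/
def varIndex (v : ℕ+ ⊕ ℕ+) : ℕ := Sum.elim (fun n : ℕ+ => (n : ℕ)) (fun n : ℕ+ => (n : ℕ)) v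

/-- The substitution `x_m = y_m = 0` for `m > s`. -/
noncomputable def truncVars (s : ℕ) : PhasePoly →ₐ[ℂ] PhasePoly :=
  aeval fun v => if varIndex v ≤ s then X v else 0

theorem coeff_truncVars {s : ℕ} {d : (ℕ+ ⊕ ℕ+) →₀ ℕ} (hd : ∀ v ∈ d.support, varIndex v ≤ s)
    (p : PhasePoly) : (truncVars s p).coeff d = p.coeff d := by
  induction p using MvPolynomial.induction_on' with
  | add p q hp hq => rw [map_add, coeff_add, coeff_add, hp, hq]
  | monomial e c =>
    by_cases he : ∀ v ∈ e.support, varIndex v ≤ s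
    · have : truncVars s (monomial e c) = monomial e c := by
        rw [truncVars, aeval_monomial, monomial_eq, algebraMap_eq]
        congr 1
        exact Finsupp.prod_congr fun v hv => by rw [if_pos (he v hv)]
      rw [this]
    · push Not at he
      obtain ⟨v, hv, hvs⟩ := he
      have : truncVars s (monomial e c) = 0 := by
        rw [truncVars, aeval_monomial, Finsupp.prod, prod_eq_zero hv, mul_zero]
        rw [if_neg (by omega), zero_pow (Finsupp.mem_support_iff.1 hv)]
      rw [this, coeff_zero, coeff_monomial, if_neg]
      rintro rfl
      have := hd v hv
      omega

/-- A coefficient at a monomial in variables of index at most `s` can be read off after killing all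
other variables. If the truncated partial sums are eventually constant, the later terms do not
contribute to this coefficient, which gives both convergence and the value. -/
theorem bracket_of_truncVars {F G : ℕ → PhasePoly} {c : ℂ}
    (hsum : ∀ s, ∃ N₀, ∀ N, N₀ ≤ N →
      truncVars s (∑ m ∈ range (N + 1), bracketTerm F G m.succPNat) = C c) :
    BracketConverges F G ∧ bracket F G = MvPowerSeries.C c := by
  have key : ∀ d, ∃ N₀, (∀ m, N₀ ≤ m → (bracketTerm F G m.succPNat).coeff d = 0) ∧
      ∑ m ∈ range N₀, (bracketTerm F G m.succPNat).coeff d = (C c : PhasePoly).coeff d := by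
    intro d
    obtain ⟨N₀, hN⟩ := hsum (d.support.sup varIndex)
    have h1 : ∀ N, N₀ + 1 ≤ N → ∑ m ∈ range N, (bracketTerm F G m.succPNat).coeff d
        = (C c : PhasePoly).coeff d := by
      intro N hN0
      obtain ⟨N, rfl⟩ : ∃ k, N = k + 1 := ⟨N - 1, by omega⟩
      rw [← hN N (by omega), coeff_truncVars (fun v hv => le_sup (f := varIndex) hv), coeff_sum]
    refine ⟨N₀ + 1, fun m hm => ?_, h1 _ le_rfl⟩
    have h2 := h1 (m + 1) (by omega)
    rw [sum_range_succ, h1 m hm] at h2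
    exact left_eq_add.1 h2.symm
  constructor
  · intro d
    obtain ⟨N₀, h1, -⟩ := key d
    refine (Set.finite_Iic (N₀.succPNat)).subset fun n hn => ?_
    obtain ⟨m, rfl⟩ : ∃ m : ℕ, n = m.succPNat := ⟨n.natPred, by simp⟩
    by_contra hc
    refine hn (h1 m ?_)
    rw [Set.mem_Iic, Nat.succPNat_le_succPNat] at hc
    omega
  · ext d
    obtain ⟨N₀, h1, h2⟩ := key d
    rw [MvPowerSeries.coeff_C]
    change ∑ᶠ n : ℕ+, (bracketTerm F G n).coeff d = _
    rw [← finsum_comp_equiv (Equiv.pnatEquivNat.symm)]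
    change ∑ᶠ m : ℕ, (bracketTerm F G m.succPNat).coeff d = _
    rw [finsum_eq_sum_range (N := N₀) h1]
    refine h2.trans ?_
    rw [coeff_C]
    simp only [eq_comm]

theorem map_gradX {R S : Type*} [CommRing R] [CommRing S] (φ : R →+* S) (x y : ℕ → R) (i m : ℕ) :
    φ (gradX y (ipow (rankTwo1 x y) i) m) = gradX (fun n => φ (y n))
      (ipow (rankTwo1 (fun n => φ (x n)) fun n => φ (y n)) i) m := by
  rw [← map_rankTwo1, ← map_ipow_of_row φ (rowFin_rankTwo1 x y), gradX, gradX, map_sum]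
  simp

theorem map_gradY {R S : Type*} [CommRing R] [CommRing S] (φ : R →+* S) (x y : ℕ → R) (i m : ℕ) :
    φ (gradY x (ipow (rankTwo1 x y) i) m) = gradY (fun n => φ (x n))
      (ipow (rankTwo1 (fun n => φ (x n)) fun n => φ (y n)) i) m := by
  obtain ⟨L, hL⟩ := (rowFin_rankTwo1 x y).ipow i (m + 1)
  rw [← map_rankTwo1, ← map_ipow_of_row φ (rowFin_rankTwo1 x y),
    gradY_eq (L := L) fun c hc => by rw [hL c hc, zero_mul],
    gradY_eq (L := L) fun c hc => by rw [Matrix.map_apply, hL c hc, map_zero, zero_mul], map_sum]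
  simp

theorem truncVars_xVar_eq_zero {s m : ℕ} (hm : s + 1 ≤ m) : truncVars s (xVar m) = 0 := by
  obtain ⟨m, rfl⟩ : ∃ k, m = k + 1 := ⟨m - 1, by omega⟩
  rw [xVar_succ, truncVars, aeval_X, if_neg]
  simp [varIndex]
  omega

theorem truncVars_yVar_eq_zero {s m : ℕ} (hm : s + 1 ≤ m) : truncVars s (yVar m) = 0 := by
  obtain ⟨m, rfl⟩ : ∃ k, m = k + 1 := ⟨m - 1, by omega⟩
  rw [yVar_succ, truncVars, aeval_X, if_neg]
  simp [varIndex]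
  omega

/-- The substitution `truncVars`, with values in the field of rational functions. -/
noncomputable def truncFrac (s : ℕ) : PhasePoly →+* FractionRing PhasePoly :=
  (algebraMap PhasePoly (FractionRing PhasePoly)).comp (truncVars s).toRingHom

/-- The mixed bracket is computed over a field in which the factors `1 - x y` are invertible. For
the truncated polynomials this holds in the fraction field, since each factor takes the value `1` at
the origin. -/
theorem truncFrac_sub_ne_zero (s m : ℕ) :
    1 - truncFrac s (xVar (m + 1)) * truncFrac s (yVar (m + 1)) ≠ 0 := by
  rw [← map_mul, ← map_one (truncFrac s), ← map_sub]
  intro h0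
  have h1 : truncVars s (1 - xVar (m + 1) * yVar (m + 1)) = 0 :=
    (IsFractionRing.injective PhasePoly (FractionRing PhasePoly)) (h0.trans (map_zero _).symm)
  have h2 := congrArg (MvPolynomial.eval (fun _ => (0 : ℂ))) h1
  rw [xVar_succ, yVar_succ, map_sub, map_mul, truncVars, aeval_X, aeval_X] at h2
  simp only [map_sub, map_one, map_mul] at h2
  split_ifs at h2 <;> simp at h2

theorem truncVars_eq_of_truncFrac {s : ℕ} {p : PhasePoly} {c : ℂ}
    (hp : truncFrac s p = truncFrac s (C c)) : truncVars s p = C c := by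
  have h1 : truncVars s p = truncVars s (C c) :=
    IsFractionRing.injective PhasePoly (FractionRing PhasePoly) hp
  rw [h1]
  exact (truncVars s).commutes c

theorem bracket_H1_H1 (i j : ℕ+) :
    BracketConverges (H1 i) (H1 j) ∧ bracket (H1 i) (H1 j) = MvPowerSeries.C 0 := by
  refine bracket_of_truncVars fun s => ⟨s, fun N hN => truncVars_eq_of_truncFrac ?_⟩
  rw [C_0, map_zero, map_sum]
  simp_rw [bracketTerm, (dForm_H1_inl _ _).2, (dForm_H1_inr _ _).2, map_mul, map_sub, map_mul,
    map_gradX, map_gradY, map_one, Nat.succPNat_coe, Nat.succ_eq_add_one]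
  refine sum_bracket_same (s := s) (fun m hm => ?_) _ _ hN
  rw [truncFrac, RingHom.comp_apply]
  exact (congrArg _ (truncVars_xVar_eq_zero hm)).trans (map_zero _)

theorem bracket_H2_H2 (i j : ℕ+) :
    BracketConverges (H2 i) (H2 j) ∧ bracket (H2 i) (H2 j) = MvPowerSeries.C 0 := by
  refine bracket_of_truncVars fun s => ⟨s, fun N hN => truncVars_eq_of_truncFrac ?_⟩
  rw [C_0, map_zero, map_sum]
  simp_rw [bracketTerm, (dForm_H2_inl _ _).2, (dForm_H2_inr _ _).2, map_mul, map_sub, map_mul,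
    map_gradX, map_gradY, map_one, Nat.succPNat_coe, Nat.succ_eq_add_one]
  -- Exchanging the roles of `x` and `y` turns one kind of Hamiltonian into the other and reverses
  -- the sign of the bracket.
  rw [← neg_eq_zero, ← sum_bracket_same (x := fun n => truncFrac s (yVar n))
    (y := fun n => truncFrac s (xVar n)) (s := s) (fun m hm => ?_) ((i : ℕ) - 1) ((j : ℕ) - 1) hN,
    ← sum_neg_distrib]
  · exact sum_congr rfl fun m _ => by ring
  · rw [truncFrac, RingHom.comp_apply]
    exact (congrArg _ (truncVars_yVar_eq_zero hm)).trans (map_zero _)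

theorem bracket_H1_H2 (i j : ℕ+) : BracketConverges (H1 i) (H2 j) ∧
    bracket (H1 i) (H2 j) = MvPowerSeries.C (if i = j then 1 else 0) := by
  -- The threshold leaves room for the second shift to go down `j` steps from `N + 1` without
  -- entering the support.
  refine bracket_of_truncVars fun s => ⟨s + j, fun N hN => truncVars_eq_of_truncFrac ?_⟩
  rw [map_sum]
  simp_rw [bracketTerm, (dForm_H1_inl _ _).2, (dForm_H1_inr _ _).2, (dForm_H2_inl _ _).2,
    (dForm_H2_inr _ _).2, map_mul, map_sub, map_mul,
    map_gradX, map_gradY, map_one, Nat.succPNat_coe, Nat.succ_eq_add_one]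
  have hj := j.pos
  have hi := i.pos
  rw [sum_bracket_mixed (x := fun n => truncFrac s (xVar n)) (y := fun n => truncFrac s (yVar n))
    (s := s) (fun m hm => ?_) (fun m hm => ?_) ?_ ?_ (truncFrac_sub_ne_zero s) _ _
    (by omega)]
  · have e : (i : ℕ) - 1 = (j : ℕ) - 1 ↔ i = j := by
      rw [← PNat.coe_inj]; omega
    simp only [e]
    split_ifs <;> simp
  · simp only [xVar_zero, map_one]
  · simp only [yVar_zero, map_one]
  · rw [truncFrac, RingHom.comp_apply]
    exact (congrArg _ (truncVars_xVar_eq_zero hm)).trans (map_zero _)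
  · rw [truncFrac, RingHom.comp_apply]
    exact (congrArg _ (truncVars_yVar_eq_zero hm)).trans (map_zero _)

end Formal

end ToeplitzLattice

/-! ### Exponential weights in `C(X, ℂ)`, for the circle and for `U(n)` joined with the torus -/

namespace ToeplitzLattice

/-- Absolute summability of the times. -/
def SummableTimes (t : Times) : Prop := Summable fun i => ‖t i‖

theorem norm_update (t : Times) (k : ℕ+) (u : ℂ) :
    (fun i => ‖Function.update t k u i‖) = Function.update (fun i => ‖t i‖) k ‖u‖ := by
  ext i
  by_cases hi : i = k
  · subst hi; simp
  · simp [hi]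

theorem SummableTimes.update {t : Times} (ht : SummableTimes t) (k : ℕ+) (u : ℂ) :
    SummableTimes (Function.update t k u) := by
  rw [SummableTimes, norm_update]
  exact Summable.update ht k _

theorem SummableTimes.neg {t : Times} (ht : SummableTimes t) : SummableTimes (-t) := by
  simpa [SummableTimes] using ht

section Weight

variable {X : Type*} [TopologicalSpace X] [CompactSpace X]

/-- The exponent `∑ (t_i b_i - s_i c_i)`. -/
noncomputable def pot (b c : ℕ+ → C(X, ℂ)) (t s : Times) : C(X, ℂ) :=
  ∑' i, (t i • b i - s i • c i)

/-- The weight `exp ∑ (t_i b_i - s_i c_i)`. -/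
noncomputable def wt (b c : ℕ+ → C(X, ℂ)) (t s : Times) : C(X, ℂ) := NormedSpace.exp (pot b c t s)

variable {b c : ℕ+ → C(X, ℂ)} {B : ℝ} (hb : ∀ i, ‖b i‖ ≤ B) (hc : ∀ i, ‖c i‖ ≤ B) {t s : Times}

theorem summable_smul_of_bounded {b : ℕ+ → C(X, ℂ)} (hb : ∀ i, ‖b i‖ ≤ B) (ht : SummableTimes t) :
    Summable fun i => t i • b i :=
  Summable.of_norm_bounded (Summable.mul_right B ht) fun i => by
    rw [norm_smul]
    exact mul_le_mul_of_nonneg_left (hb i) (norm_nonneg _)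

include hb hc in
theorem summable_pot (ht : SummableTimes t) (hs : SummableTimes s) :
    Summable fun i => t i • b i - s i • c i :=
  (summable_smul_of_bounded hb ht).sub (summable_smul_of_bounded hc hs)

include hb hc in
-- A single time enters the exponent affinely, so partial derivatives of the weight reduce to the
-- exponential along a line in a commutative Banach algebra.
theorem pot_update_left (ht : SummableTimes t) (hs : SummableTimes s) (k : ℕ+) (u : ℂ) :
    pot b c (Function.update t k u) s = pot b c t s + (u - t k) • b k := by
  rw [pot, pot, (summable_pot hb hc (ht.update k u) hs).tsum_eq_add_tsum_ite k,
    (summable_pot hb hc ht hs).tsum_eq_add_tsum_ite k, Function.update_self]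
  have : ∀ i, (if i = k then 0 else Function.update t k u i • b i - s i • c i)
      = if i = k then 0 else t i • b i - s i • c i := fun i => by
    split_ifs with h
    · rfl
    · rw [Function.update_of_ne h]
  simp_rw [this, sub_smul]
  abel

include hb hc in
theorem pot_update_right (ht : SummableTimes t) (hs : SummableTimes s) (k : ℕ+) (u : ℂ) :
    pot b c t (Function.update s k u) = pot b c t s + (u - s k) • (-c k) := by
  rw [pot, pot, (summable_pot hb hc ht (hs.update k u)).tsum_eq_add_tsum_ite k,
    (summable_pot hb hc ht hs).tsum_eq_add_tsum_ite k, Function.update_self]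
  have : ∀ i, (if i = k then 0 else t i • b i - Function.update s k u i • c i)
      = if i = k then 0 else t i • b i - s i • c i := fun i => by
    split_ifs with h
    · rfl
    · rw [Function.update_of_ne h]
  simp_rw [this, smul_neg, sub_smul]
  abel

theorem exp_apply (f : C(X, ℂ)) (x : X) : (NormedSpace.exp f : C(X, ℂ)) x = Complex.exp (f x) := by
  have := NormedSpace.map_exp (ContinuousMap.evalAlgHom ℂ ℂ x)
    (ContinuousMap.evalCLM ℂ x).continuous f
  rw [Complex.exp_eq_exp_ℂ]
  exact this

include hb hc in
theorem wt_apply (ht : SummableTimes t) (hs : SummableTimes s) (x : X) :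
    wt b c t s x = Complex.exp (∑' i, (t i * b i x - s i * c i x)) := by
  rw [wt, exp_apply, pot, ← ContinuousMap.tsum_apply (summable_pot hb hc ht hs)]
  rfl

theorem hasDerivAt_exp_line (A C : C(X, ℂ)) (a : ℂ) :
    HasDerivAt (fun u : ℂ => (NormedSpace.exp (A + (u - a) • C) : C(X, ℂ)))
      (C * NormedSpace.exp A) a := by
  have h1 := (hasDerivAt_exp_smul_const C (0 : ℂ))
  have h2 : HasDerivAt (fun u : ℂ => u - a) 1 a := (hasDerivAt_id a).sub_const a
  have h3 : HasDerivAt (fun u : ℂ => (NormedSpace.exp ((u - a) • C) : C(X, ℂ)))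
      ((1 : ℂ) • (NormedSpace.exp ((0 : ℂ) • C) * C)) a :=
    HasDerivAt.scomp_of_eq a h1 h2 (by simp)
  have h4 := h3.const_mul (NormedSpace.exp A : C(X, ℂ))
  simp only [zero_smul, NormedSpace.exp_zero, one_mul, one_smul] at h4
  rw [mul_comm] at h4
  refine h4.congr_of_eventuallyEq (Eventually.of_forall fun u => ?_)
  exact NormedSpace.exp_add

include hb hc in
theorem hasDerivAt_wt_left (ht : SummableTimes t) (hs : SummableTimes s) (k : ℕ+) :
    HasDerivAt (fun u => wt b c (Function.update t k u) s) (b k * wt b c t s) (t k) := by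
  simp_rw [wt, pot_update_left hb hc ht hs]
  exact hasDerivAt_exp_line _ _ _

include hb hc in
theorem hasDerivAt_wt_right (ht : SummableTimes t) (hs : SummableTimes s) (k : ℕ+) :
    HasDerivAt (fun u => wt b c t (Function.update s k u)) (-(c k * wt b c t s)) (s k) := by
  simp_rw [wt, pot_update_right hb hc ht hs, ← _root_.neg_mul]
  exact hasDerivAt_exp_line _ _ _

theorem lp_summable (p : lp (fun _ : ℕ+ => ℂ) 1) : SummableTimes (p : ℕ+ → ℂ) := by
  have := (memℓp_gen_iff (by simp)).1 (lp.memℓp p)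
  simpa [SummableTimes] using this

theorem lp_norm (p : lp (fun _ : ℕ+ => ℂ) 1) : ‖p‖ = ∑' i, ‖(p : ℕ+ → ℂ) i‖ := by
  rw [lp.norm_eq_tsum_rpow (by simp)]
  simp

/-- The map `t ↦ ∑ t_i b_i` on `ℓ¹`. -/
noncomputable def sumCLM (b : ℕ+ → C(X, ℂ)) (B : ℝ) (hb : ∀ i, ‖b i‖ ≤ B) :
    lp (fun _ : ℕ+ => ℂ) 1 →L[ℂ] C(X, ℂ) :=
  LinearMap.mkContinuous
    { toFun := fun p => ∑' i, (p : ℕ+ → ℂ) i • b i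
      map_add' := fun p q => by
        rw [← (summable_smul_of_bounded hb (lp_summable p)).tsum_add
          (summable_smul_of_bounded hb (lp_summable q))]
        exact tsum_congr fun i => by rw [← add_smul]; rfl
      map_smul' := fun r p => by
        rw [RingHom.id_apply, ← (summable_smul_of_bounded hb (lp_summable p)).tsum_const_smul]
        exact tsum_congr fun i => by rw [smul_smul]; rfl } B fun p => by
    have h1 : Summable fun i => ‖(p : ℕ+ → ℂ) i • b i‖ :=
      Summable.of_nonneg_of_le (fun _ => norm_nonneg _) (fun i => by
        rw [norm_smul]
        exact mul_le_mul_of_nonneg_left (hb i) (norm_nonneg _))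
        (Summable.mul_right B (lp_summable p))
    refine (norm_tsum_le_tsum_norm h1).trans ?_
    rw [lp_norm, ← tsum_mul_left]
    refine h1.tsum_le_tsum (fun i => ?_) (Summable.mul_left B (lp_summable p))
    rw [norm_smul, mul_comm]
    exact mul_le_mul_of_nonneg_right (hb i) (norm_nonneg _)

include hb hc in
-- The exponent is a continuous linear function on `ℓ¹ × ℓ¹`, because the `b i` and `c i` are
-- uniformly bounded, and the exponential of a Banach algebra is analytic.
theorem analyticAt_wt (p : lp (fun _ : ℕ+ => ℂ) 1 × lp (fun _ : ℕ+ => ℂ) 1) :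
    AnalyticAt ℂ (fun p : lp (fun _ : ℕ+ => ℂ) 1 × lp (fun _ : ℕ+ => ℂ) 1 =>
      wt b c (p.1 : ℕ+ → ℂ) (p.2 : ℕ+ → ℂ)) p := by
  have h1 : (fun p : lp (fun _ : ℕ+ => ℂ) 1 × lp (fun _ : ℕ+ => ℂ) 1 =>
      wt b c (p.1 : ℕ+ → ℂ) (p.2 : ℕ+ → ℂ)) = fun p => NormedSpace.exp
        (((sumCLM b B hb).comp (ContinuousLinearMap.fst ℂ (lp (fun _ : ℕ+ => ℂ) 1)
          (lp (fun _ : ℕ+ => ℂ) 1)) - (sumCLM c B hc).comp (ContinuousLinearMap.snd ℂ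
          (lp (fun _ : ℕ+ => ℂ) 1) (lp (fun _ : ℕ+ => ℂ) 1)) :
          lp (fun _ : ℕ+ => ℂ) 1 × lp (fun _ : ℕ+ => ℂ) 1 →L[ℂ] C(X, ℂ)) p) := by
    ext1 p
    rw [wt, pot, (summable_smul_of_bounded hb (lp_summable p.1)).tsum_sub
      (summable_smul_of_bounded hc (lp_summable p.2))]
    rfl
  rw [h1]
  exact AnalyticAt.comp (NormedSpace.exp_analytic _) (ContinuousLinearMap.analyticAt _ _)

end Weight

/-! ### Moments of the weight on the circle -/

section CircleMoments

/-- The function `z ↦ z^j` on the unit circle. -/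
noncomputable def zp (j : ℤ) : C(Circle, ℂ) :=
  ⟨fun z => ((z ^ j : Circle) : ℂ), continuous_subtype_val.comp (continuous_zpow j)⟩

theorem zp_apply (j : ℤ) (z : Circle) : zp j z = (z : ℂ) ^ j := Circle.coe_zpow z j

theorem zp_add (i j : ℤ) : zp (i + j) = zp i * zp j := by
  ext z
  simp only [zp, ContinuousMap.coe_mk, ContinuousMap.mul_apply, zpow_add, Circle.coe_mul]

theorem zp_zero : zp 0 = 1 := by ext z; simp [zp]

theorem norm_zp_le (j : ℤ) : ‖zp j‖ ≤ 1 :=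
  (ContinuousMap.norm_le _ zero_le_one).2 fun z => by simp [zp_apply, Circle.norm_coe]

/-- The average over the unit circle. -/
noncomputable def mean : C(Circle, ℂ) →L[ℂ] ℂ :=
  LinearMap.mkContinuous
    { toFun := fun f => (2 * π : ℂ)⁻¹ * ∫ θ in (0 : ℝ)..2 * π, f (Circle.exp θ)
      map_add' := fun f g => by
        simp only [ContinuousMap.add_apply]
        rw [intervalIntegral.integral_add, mul_add] <;>
          exact Continuous.intervalIntegrable (by fun_prop) _ _
      map_smul' := fun r f => by
        simp only [ContinuousMap.smul_apply, smul_eq_mul, RingHom.id_apply]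
        rw [intervalIntegral.integral_const_mul]
        ring } 1 fun f => by
    have h1 : ‖∫ θ in (0 : ℝ)..2 * π, f (Circle.exp θ)‖ ≤ ‖f‖ * |2 * π - 0| :=
      intervalIntegral.norm_integral_le_of_norm_le_const fun θ _ => f.norm_coe_le_norm _
    change ‖(2 * π : ℂ)⁻¹ * ∫ θ in (0 : ℝ)..2 * π, f (Circle.exp θ)‖ ≤ _
    have h2 : ‖(2 * π : ℂ)⁻¹‖ = (2 * π)⁻¹ := by
      rw [norm_inv]; congr 1; rw [norm_mul]; simp [abs_of_pos Real.pi_pos]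
    rw [norm_mul, h2]
    rw [sub_zero, abs_of_pos Real.two_pi_pos] at h1
    calc (2 * π)⁻¹ * ‖∫ θ in (0 : ℝ)..2 * π, f (Circle.exp θ)‖
        ≤ (2 * π)⁻¹ * (‖f‖ * (2 * π)) := mul_le_mul_of_nonneg_left h1 (by positivity)
      _ = 1 * ‖f‖ := by field_simp

theorem mean_apply (f : C(Circle, ℂ)) :
    mean f = (2 * π : ℂ)⁻¹ * ∫ θ in (0 : ℝ)..2 * π, f (Circle.exp θ) := rfl

theorem mean_zp (j : ℤ) : mean (zp j) = if j = 0 then 1 else 0 := by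
  have hpi : (π : ℂ) ≠ 0 := by exact_mod_cast Real.pi_ne_zero
  rw [mean_apply]
  split_ifs with hj
  · subst hj
    simp only [zp_zero, ContinuousMap.one_apply, intervalIntegral.integral_const, sub_zero,
      Complex.real_smul, mul_one]
    push_cast
    field_simp
  · have h1 : ∀ θ : ℝ, zp j (Circle.exp θ) = Complex.exp ((j * Complex.I) * θ) := fun θ => by
      rw [zp_apply, Circle.coe_exp, ← Complex.exp_int_mul]
      ring_nf
    simp_rw [h1]
    rw [integral_exp_mul_complex (mul_ne_zero (by exact_mod_cast hj) Complex.I_ne_zero)]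
    have h2 : Complex.exp (j * Complex.I * ((2 * π : ℝ) : ℂ)) = 1 := by
      rw [Complex.exp_eq_one_iff]
      exact ⟨j, by push_cast; ring⟩
    rw [h2]
    simp

/-- Composition with the inversion of the circle. -/
noncomputable def invComp (f : C(Circle, ℂ)) : C(Circle, ℂ) := f.comp ⟨fun z => z⁻¹, continuous_inv⟩

theorem mean_invComp (f : C(Circle, ℂ)) : mean (invComp f) = mean f := by
  rw [mean_apply, mean_apply]
  congr 1
  have h1 : ∀ θ : ℝ, invComp f (Circle.exp θ) = f (Circle.exp (2 * π - θ)) := fun θ => by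
    simp only [invComp, ContinuousMap.comp_apply, ContinuousMap.coe_mk]
    congr 1
    rw [← Circle.exp_neg, Circle.exp_sub, Circle.exp_two_pi, Circle.exp_neg, one_div]
  simp_rw [h1]
  rw [intervalIntegral.integral_comp_sub_left (fun θ => f (Circle.exp θ))]
  simp

/-- The weight `e^{V}` on the unit circle. -/
noncomputable def wtC (t s : Times) : C(Circle, ℂ) :=
  wt (fun i => zp (i : ℕ)) (fun i => zp (-(i : ℕ))) t s

theorem wtC_apply {t s : Times} (ht : SummableTimes t) (hs : SummableTimes s) (z : Circle) :
    wtC t s z = Complex.exp (V t s z) := by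
  rw [wtC, wt_apply (fun _ => norm_zp_le _) (fun _ => norm_zp_le _) ht hs]
  congr 1
  refine tsum_congr fun i => ?_
  simp [zp_apply]

/-- The moments `∮ z^j e^{V(z)} dz / (2πiz)`. -/
noncomputable def mu (t s : Times) (j : ℤ) : ℂ := mean (zp j * wtC t s)

theorem ip_eq (t s : Times) (f g : ℂ → ℂ) :
    ip t s f g = (2 * π : ℂ)⁻¹ * ∫ θ in (0 : ℝ)..2 * π,
      f (Circle.exp θ) * g (Circle.exp θ : ℂ)⁻¹ * Complex.exp (V t s (Circle.exp θ)) := by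
  have hpi : (π : ℂ) ≠ 0 := by exact_mod_cast Real.pi_ne_zero
  have hI := Complex.I_ne_zero
  rw [ip, circleIntegral]
  have h1 : ∀ θ : ℝ, deriv (circleMap 0 1) θ • ((circleMap 0 1 θ)⁻¹ * (f (circleMap 0 1 θ)
      * g (circleMap 0 1 θ)⁻¹ * Complex.exp (V t s (circleMap 0 1 θ))))
      = Complex.I * (f (Circle.exp θ) * g (Circle.exp θ : ℂ)⁻¹
        * Complex.exp (V t s (Circle.exp θ))) := by
    intro θ
    have h2 : circleMap 0 1 θ = (Circle.exp θ : ℂ) := by simp [circleMap]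
    have h3 : (Circle.exp θ : ℂ) ≠ 0 := Circle.coe_ne_zero _
    rw [deriv_circleMap, h2, smul_eq_mul]
    field_simp
  simp_rw [h1]
  rw [intervalIntegral.integral_const_mul, ← mul_assoc]
  congr 1
  field_simp

variable {t s : Times}

theorem mom_eq (ht : SummableTimes t) (hs : SummableTimes s) (k l : ℕ) :
    mom t s k l = mu t s ((k : ℤ) - l) := by
  rw [mom, ip_eq, mu, mean_apply]
  congr 1
  refine intervalIntegral.integral_congr fun θ _ => ?_
  rw [ContinuousMap.mul_apply, wtC_apply ht hs, zp_apply, zpow_sub₀ (Circle.coe_ne_zero _)]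
  simp [div_eq_mul_inv]

theorem ip_polynomial (ht : SummableTimes t) (hs : SummableTimes s) (p q : Polynomial ℂ) {m n : ℕ}
    (hp : p.natDegree < m) (hq : q.natDegree < n) :
    ip t s (fun z => p.eval z) (fun z => q.eval z)
      = ∑ k ∈ Finset.range m, ∑ l ∈ Finset.range n, p.coeff k * q.coeff l * mom t s k l := by
  have h1 : ip t s (fun z => p.eval z) (fun z => q.eval z)
      = mean ((∑ k ∈ Finset.range m, ∑ l ∈ Finset.range n,
        (p.coeff k * q.coeff l) • zp ((k : ℤ) - l)) * wtC t s) := by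
    rw [ip_eq, mean_apply]
    congr 1
    refine intervalIntegral.integral_congr fun θ _ => ?_
    simp only [ContinuousMap.mul_apply, ContinuousMap.coe_sum, Finset.sum_apply,
      ContinuousMap.smul_apply, wtC_apply ht hs, zp_apply]
    rw [Polynomial.eval_eq_sum_range' hp, Polynomial.eval_eq_sum_range' hq, Finset.sum_mul_sum]
    congr 1
    refine Finset.sum_congr rfl fun k _ => Finset.sum_congr rfl fun l _ => ?_
    rw [zpow_sub₀ (Circle.coe_ne_zero _), smul_eq_mul, zpow_natCast, zpow_natCast, inv_pow]
    ring
  rw [h1, Finset.sum_mul, map_sum]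
  refine Finset.sum_congr rfl fun k _ => ?_
  rw [Finset.sum_mul, map_sum]
  refine Finset.sum_congr rfl fun l _ => ?_
  rw [smul_mul_assoc, map_smul, smul_eq_mul, mom_eq ht hs, mu]

/-- Differentiation brings down a factor `z^k`. The resulting index shift is the source of all flows
below. -/
theorem hasDerivAt_mu_left (ht : SummableTimes t) (hs : SummableTimes s) (k : ℕ+) (j : ℤ) :
    HasDerivAt (fun u => mu (Function.update t k u) s j) (mu t s (j + k)) (t k) := by
  have h1 := hasDerivAt_wt_left (b := fun i => zp (i : ℕ)) (c := fun i => zp (-(i : ℕ)))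
    (fun _ => norm_zp_le _) (fun _ => norm_zp_le _) ht hs k
  have h2 := mean.hasFDerivAt.comp_hasDerivAt _ (h1.const_mul (zp j))
  rw [← mul_assoc, ← zp_add] at h2
  exact h2

theorem hasDerivAt_mu_right (ht : SummableTimes t) (hs : SummableTimes s) (k : ℕ+) (j : ℤ) :
    HasDerivAt (fun u => mu t (Function.update s k u) j) (-mu t s (j - k)) (s k) := by
  have h1 := hasDerivAt_wt_right (b := fun i => zp (i : ℕ)) (c := fun i => zp (-(i : ℕ)))
    (fun _ => norm_zp_le _) (fun _ => norm_zp_le _) ht hs k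
  have h2 := mean.hasFDerivAt.comp_hasDerivAt _ (h1.const_mul (zp j))
  rw [_root_.mul_neg, ← mul_assoc, ← zp_add, map_neg, ← sub_eq_add_neg] at h2
  exact h2

/-- The inversion `z ↦ z⁻¹` preserves the mean and exchanges `t` with `-s`. This symmetry transposes
the moment matrix, so that statements about `s`, `y_n` and the second polynomials reduce to those
about `t`, `x_n` and the first ones. -/
theorem mu_neg_neg (ht : SummableTimes t) (hs : SummableTimes s) (j : ℤ) :
    mu (-s) (-t) j = mu t s (-j) := by
  have h1 : zp j * wtC (-s) (-t) = invComp (zp (-j) * wtC t s) := by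
    ext z
    simp only [invComp, ContinuousMap.mul_apply, ContinuousMap.comp_apply, ContinuousMap.coe_mk]
    rw [wtC_apply hs.neg ht.neg, wtC_apply ht hs, zp_apply, zp_apply]
    congr 1
    · simp
    · congr 1
      refine tsum_congr fun i => ?_
      simp only [Pi.neg_apply, Circle.coe_inv, inv_inv]
      ring
  rw [mu, h1, mean_invComp, mu]

theorem norm_mu_le (t s : Times) (j : ℤ) : ‖mu t s j‖ ≤ ‖mean‖ * ‖wtC t s‖ := by
  refine (mean.le_opNorm _).trans (mul_le_mul_of_nonneg_left ?_ (norm_nonneg _))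
  calc ‖zp j * wtC t s‖ ≤ ‖zp j‖ * ‖wtC t s‖ := norm_mul_le _ _
    _ ≤ 1 * ‖wtC t s‖ := mul_le_mul_of_nonneg_right (norm_zp_le j) (norm_nonneg _)
    _ = ‖wtC t s‖ := one_mul _

theorem analyticAt_mu (j : ℤ) (p : lp (fun _ : ℕ+ => ℂ) 1 × lp (fun _ : ℕ+ => ℂ) 1) :
    AnalyticAt ℂ (fun p : lp (fun _ : ℕ+ => ℂ) 1 × lp (fun _ : ℕ+ => ℂ) 1 =>
      mu (p.1 : ℕ+ → ℂ) (p.2 : ℕ+ → ℂ) j) p :=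
  (mean.analyticAt _).comp (analyticAt_const.mul
    (analyticAt_wt (fun _ => norm_zp_le _) (fun _ => norm_zp_le _) p))

theorem mu_zero_zero (j : ℤ) : mu 0 0 j = if j = 0 then 1 else 0 := by
  have : wtC 0 0 = 1 := by simp [wtC, wt, pot]
  rw [mu, this, mul_one, mean_zp]

theorem tau_eq (ht : SummableTimes t) (hs : SummableTimes s) (n : ℕ) :
    tau n t s = Matrix.det (Matrix.of fun k l : Fin n => mu t s ((k : ℕ) - (l : ℕ) : ℤ)) := by
  rw [tau]
  congr 1
  ext k l
  exact mom_eq ht hs k l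

theorem analyticOnNhd_tau (n : ℕ) :
    AnalyticOnNhd ℂ (fun p : lp (fun _ : ℕ+ => ℂ) 1 × lp (fun _ : ℕ+ => ℂ) 1 =>
      tau n (p.1 : ℕ+ → ℂ) (p.2 : ℕ+ → ℂ)) Set.univ := by
  intro p _
  have : (fun p : lp (fun _ : ℕ+ => ℂ) 1 × lp (fun _ : ℕ+ => ℂ) 1 =>
      tau n (p.1 : ℕ+ → ℂ) (p.2 : ℕ+ → ℂ)) = fun p => ∑ σ : Equiv.Perm (Fin n),
        ((Equiv.Perm.sign σ : ℤ) : ℂ) * ∏ i, mu (p.1 : ℕ+ → ℂ) (p.2 : ℕ+ → ℂ)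
          ((σ i : ℕ) - (i : ℕ) : ℤ) := by
    ext1 p
    rw [tau_eq (lp_summable p.1) (lp_summable p.2), Matrix.det_apply']
    rfl
  rw [this]
  exact Finset.analyticAt_fun_sum _ fun σ _ => analyticAt_const.mul
    (Finset.analyticAt_fun_prod _ fun i _ => analyticAt_mu _ p)

theorem mom_neg_neg (ht : SummableTimes t) (hs : SummableTimes s) :
    mom (-s) (-t) = (mom t s).transpose := by
  ext k l
  rw [Matrix.transpose_apply, mom_eq hs.neg ht.neg, mom_eq ht hs, mu_neg_neg ht hs, neg_sub]

theorem tau_neg_neg (ht : SummableTimes t) (hs : SummableTimes s) (n : ℕ) :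
    tau n (-s) (-t) = tau n t s := by
  rw [tau, mom_neg_neg ht hs, tau, ← Matrix.det_transpose]
  rfl

end CircleMoments

end ToeplitzLattice

namespace ToeplitzLattice

/-! ### Cramer's rule, the lower factor and the Szegő recursion -/

section LinearSystems

open Finset Matrix

variable {K : Type*} [Field K]

/-- Cramer's rule for row vectors: the new row is a combination of the rows of `A`, and only the
term with row `j` itself has nonzero determinant. -/
theorem det_updateRow_of_vecMul {ι : Type*} [Fintype ι] [DecidableEq ι] {A : Matrix ι ι K}
    {w v : ι → K} (hw : ∀ l, ∑ j, w j * A j l = v l) (j : ι) :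
    (A.updateRow j v).det = w j * A.det := by
  have : v = ∑ k, w k • A k := by
    ext l
    rw [← hw l]
    simp
  rw [this, det_updateRow_sum, smul_eq_mul]

theorem det_updateRow_single_last {n : ℕ} (A : Matrix (Fin (n + 1)) (Fin (n + 1)) K) (c : K) :
    (A.updateRow (Fin.last n) (Pi.single (Fin.last n) c)).det
      = c * (A.submatrix Fin.castSucc Fin.castSucc).det := by
  have : (Pi.single (Fin.last n) c : Fin (n + 1) → K) = c • Pi.single (Fin.last n) 1 := by
    rw [← Pi.single_smul, smul_eq_mul, mul_one]
  rw [this, det_updateRow_smul, ← adjugate_apply, adjugate_fin_succ_eq_det_submatrix]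
  have h2 : (-1 : K) ^ (((Fin.last n : Fin (n + 1)) : ℕ) + (Fin.last n : Fin (n + 1))) = 1 := by
    rw [← two_mul, pow_mul]; simp
  rw [h2, one_mul, Fin.succAbove_last]

theorem det_updateRow_single_zero {n : ℕ} (A : Matrix (Fin (n + 1)) (Fin (n + 1)) K) (c : K) :
    (A.updateRow 0 (Pi.single 0 c)).det = c * (A.submatrix Fin.succ Fin.succ).det := by
  have : (Pi.single 0 c : Fin (n + 1) → K) = c • Pi.single 0 1 := by
    rw [← Pi.single_smul, smul_eq_mul, mul_one]
  rw [this, det_updateRow_smul, ← adjugate_apply, adjugate_fin_succ_eq_det_submatrix]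
  simp

/-- The rows of the lower unipotent factor of a semi-infinite matrix. -/
noncomputable def lowerFactor (m : Matrix ℕ ℕ K) : Matrix ℕ ℕ K := fun n j =>
  if hj : j < n then -∑ k : Fin n, m n k * (trunc n m)⁻¹ k ⟨j, hj⟩
  else if j = n then 1 else 0

theorem lowerFactor_self (m : Matrix ℕ ℕ K) (n : ℕ) : lowerFactor m n n = 1 := by
  simp [lowerFactor]

theorem lowerFactor_gt (m : Matrix ℕ ℕ K) {n j : ℕ} (hj : n < j) : lowerFactor m n j = 0 := by
  rw [lowerFactor, dif_neg (by omega), if_neg (by omega)]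

variable {m : Matrix ℕ ℕ K} {n : ℕ}

theorem sum_lowerFactor_mul (hn : (trunc n m).det ≠ 0) {l : ℕ} (hl : l < n) :
    ∑ j ∈ range (n + 1), lowerFactor m n j * m j l = 0 := by
  rw [sum_range_succ, lowerFactor_self, one_mul, sum_range]
  have h1 : ∀ j : Fin n, lowerFactor m n j * m j l
      = -∑ k : Fin n, m n k * ((trunc n m)⁻¹ k j * trunc n m j ⟨l, hl⟩) := by
    intro j
    rw [lowerFactor, dif_pos j.2, _root_.neg_mul, sum_mul]
    congr 1
    exact sum_congr rfl fun k _ => mul_assoc _ _ _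
  simp_rw [h1]
  rw [sum_neg_distrib, sum_comm]
  simp_rw [← mul_sum]
  have h2 : ∀ k : Fin n, ∑ j, (trunc n m)⁻¹ k j * trunc n m j ⟨l, hl⟩
      = (1 : Matrix (Fin n) (Fin n) K) k ⟨l, hl⟩ := fun k => by
    rw [← nonsing_inv_mul (trunc n m) (isUnit_iff_ne_zero.2 hn), mul_apply]
  simp_rw [h2, one_apply]
  simp

theorem eq_zero_of_sum_mul_eq_zero (hn : (trunc n m).det ≠ 0) {w : ℕ → K}
    (hw : ∀ l, l < n → ∑ j ∈ range n, w j * m j l = 0) {j : ℕ} (hj : j < n) : w j = 0 := by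
  have h1 := det_updateRow_of_vecMul (A := trunc n m) (w := fun i => w i) (v := 0)
    (fun l => by rw [Pi.zero_apply, ← hw l l.2, sum_range]; rfl) ⟨j, hj⟩
  rw [det_eq_zero_of_row_eq_zero ⟨j, hj⟩ (by simp)] at h1
  exact (mul_eq_zero.1 h1.symm).resolve_right hn

/-- Bordered determinants as linear combinations of the entries of the last column. -/
theorem det_border (hn : (trunc n m).det ≠ 0) (p : ℕ) :
    (Matrix.of fun j l : Fin (n + 1) => m j (if (l : ℕ) < n then l else p)).det
      = (trunc n m).det * ∑ j ∈ range (n + 1), lowerFactor m n j * m j p := by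
  set A : Matrix (Fin (n + 1)) (Fin (n + 1)) K :=
    Matrix.of fun j l => m j (if (l : ℕ) < n then l else p) with hA
  have h1 := det_updateRow_of_vecMul (A := A) (w := fun i => lowerFactor m n i)
    (v := Pi.single (Fin.last n) (∑ j ∈ range (n + 1), lowerFactor m n j * m j p)) (fun l => by
      by_cases hl : (l : ℕ) < n
      · rw [Pi.single_eq_of_ne (by intro h; rw [h] at hl; simp at hl), ← sum_lowerFactor_mul hn hl,
          sum_range]
        simp [hA, hl]
      · obtain rfl : l = Fin.last n := Fin.ext (by have := l.2; simp; omega)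
        rw [Pi.single_eq_same, sum_range]
        simp [hA]) (Fin.last n)
  rw [det_updateRow_single_last, Fin.val_last, lowerFactor_self, one_mul] at h1
  rw [← h1, mul_comm]
  congr 2
  ext i j
  simp [hA, trunc]

theorem sum_lowerFactor_mul_self (hn : (trunc n m).det ≠ 0) :
    (trunc n m).det * ∑ j ∈ range (n + 1), lowerFactor m n j * m j n = (trunc (n + 1) m).det := by
  rw [← det_border hn n]
  congr 1
  ext i j
  simp only [of_apply, trunc]
  congr 1
  split_ifs with h
  · rfl
  · have := j.2; omega

theorem det_trunc_transpose (m : Matrix ℕ ℕ K) (n : ℕ) :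
    (trunc n m.transpose).det = (trunc n m).det := by
  rw [← det_transpose (trunc n m)]
  rfl

section Toeplitz

variable {f : ℤ → K} (hm : ∀ k l : ℕ, m k l = f ((k : ℤ) - l))

include hm in
omit [Field K] in
theorem toeplitz_succ (k l : ℕ) : m (k + 1) (l + 1) = m k l := by
  rw [hm, hm]
  congr 1
  push_cast
  ring

include hm in
-- Reversing the order of both indices transposes a finite Toeplitz block. Hence the reversed
-- coefficients of the dual polynomial satisfy orthogonality relations for the original matrix.
theorem sum_reversed (n l : ℕ) (hl : l ≤ n) :
    ∑ j ∈ range (n + 1), lowerFactor m.transpose n (n - j) * m j l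
      = ∑ j ∈ range (n + 1), lowerFactor m.transpose n j * m.transpose j (n - l) := by
  rw [← sum_range_reflect]
  refine sum_congr rfl fun j hj => ?_
  rw [mem_range] at hj
  rw [show n + 1 - 1 - j = n - j by omega, show n - (n - j) = j by omega, transpose_apply, hm, hm]
  congr 2
  omega

include hm in
/-- The Szegő recursion. -/
theorem lowerFactor_succ (hn : (trunc n m).det ≠ 0) (hn1 : (trunc (n + 1) m).det ≠ 0) {j : ℕ}
    (hj : j ≤ n) :
    lowerFactor m (n + 1) j = (if j = 0 then 0 else lowerFactor m n (j - 1))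
      + lowerFactor m (n + 1) 0 * lowerFactor m.transpose n (n - j) := by
  -- The difference of the two sides vanishes at `0` and is orthogonal to the columns `1, …, n`. By
  -- the Toeplitz property its shifted tail solves a homogeneous system with the nonsingular block
  -- of size `n`.
  set w : ℕ → K := fun i => lowerFactor m (n + 1) i - ((if i = 0 then 0 else lowerFactor m n (i - 1))
      + lowerFactor m (n + 1) 0 * lowerFactor m.transpose n (n - i)) with hw
  have hw0 : w 0 = 0 := by simp [hw, lowerFactor_self]
  have hn' : (trunc n m.transpose).det ≠ 0 := by rwa [det_trunc_transpose]
  have key : ∀ l, l < n → ∑ i ∈ range n, w (i + 1) * m i l = 0 := by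
    intro l hl
    have e1 : ∑ i ∈ range (n + 1), w i * m i (l + 1) = 0 := by
      simp_rw [hw, sub_mul, add_mul, sum_sub_distrib, sum_add_distrib]
      have a1 := sum_lowerFactor_mul hn1 (l := l + 1) (by omega)
      rw [sum_range_succ, lowerFactor_self, one_mul] at a1
      have a2 := sum_lowerFactor_mul hn (l := l) hl
      rw [sum_range_succ, lowerFactor_self, one_mul] at a2
      have a3 : ∑ i ∈ range (n + 1), (if i = 0 then 0 else lowerFactor m n (i - 1)) * m i (l + 1)
          = ∑ i ∈ range n, lowerFactor m n i * m i l := by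
        rw [sum_range_succ']
        simp [toeplitz_succ hm]
      have a4 : ∑ i ∈ range (n + 1), lowerFactor m (n + 1) 0 * lowerFactor m.transpose n (n - i)
          * m i (l + 1) = 0 := by
        simp_rw [mul_assoc, ← mul_sum]
        rw [sum_reversed hm n (l + 1) (by omega), sum_lowerFactor_mul hn' (by omega), mul_zero]
      rw [a3, a4]
      rw [toeplitz_succ hm] at a1
      linear_combination a1 - a2
    rw [sum_range_succ', hw0, zero_mul, add_zero] at e1
    simpa [toeplitz_succ hm] using e1
  have hj0 : w j = 0 := by
    cases j with
    | zero => exact hw0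
    | succ j => exact eq_zero_of_sum_mul_eq_zero hn (w := fun i => w (i + 1)) key (by omega)
  exact sub_eq_zero.1 hj0

include hm in
-- Subtract from the reversed dual polynomial of degree `n + 1` the multiple of the direct one that
-- cancels the top coefficient. The result is orthogonal to all columns but the first, where the
-- pairing is the quotient of the minors of sizes `n + 2` and `n + 1`. Cramer's rule for its
-- constant coefficient `1 - x y` gives the identity.
theorem one_sub_mul_det (hn1 : (trunc (n + 1) m).det ≠ 0) :
    (1 - lowerFactor m (n + 1) 0 * lowerFactor m.transpose (n + 1) 0) * (trunc (n + 1) m).det ^ 2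
      = (trunc (n + 2) m).det * (trunc n m).det := by
  have hn' : (trunc (n + 1) m.transpose).det ≠ 0 := by rwa [det_trunc_transpose]
  have hc := sum_lowerFactor_mul_self hn'
  rw [det_trunc_transpose, det_trunc_transpose] at hc
  set c := ∑ j ∈ range (n + 1 + 1), lowerFactor m.transpose (n + 1) j * m.transpose j (n + 1)
  set w : ℕ → K := fun i => lowerFactor m.transpose (n + 1) (n + 1 - i)
    - lowerFactor m.transpose (n + 1) 0 * lowerFactor m (n + 1) i with hw
  have hwn : w (n + 1) = 0 := by simp [hw, lowerFactor_self]
  have hw0 : w 0 = 1 - lowerFactor m (n + 1) 0 * lowerFactor m.transpose (n + 1) 0 := by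
    simp [hw, lowerFactor_self, mul_comm]
  have key : ∀ l : Fin (n + 1), ∑ i : Fin (n + 1), w i * trunc (n + 1) m i l
      = (Pi.single 0 c : Fin (n + 1) → K) l := by
    intro l
    have e1 : ∑ i ∈ range (n + 1 + 1), w i * m i l = if (l : ℕ) = 0 then c else 0 := by
      simp_rw [hw, sub_mul, sum_sub_distrib, mul_assoc, ← mul_sum]
      rw [sum_lowerFactor_mul hn1 l.2, mul_zero, sub_zero, sum_reversed hm _ _ (by omega)]
      split_ifs with h
      · rw [h, Nat.sub_zero]
      · exact sum_lowerFactor_mul hn' (by omega)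
    rw [sum_range_succ, hwn, zero_mul, add_zero, sum_range] at e1
    refine e1.trans ?_
    rw [Pi.single_apply]
    by_cases h0 : (l : ℕ) = 0
    · rw [if_pos h0, if_pos (Fin.ext h0)]
    · rw [if_neg h0, if_neg fun h => h0 (by rw [h]; rfl)]
  have h1 := det_updateRow_of_vecMul (w := fun i : Fin (n + 1) => w i) key 0
  have h2 : (trunc (n + 1) m).submatrix Fin.succ Fin.succ = trunc n m := by
    ext i j
    simp [trunc, toeplitz_succ hm]
  rw [det_updateRow_single_zero, h2, Fin.val_zero, hw0] at h1
  linear_combination (trunc n m).det * hc - (trunc (n + 1) m).det * h1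

end Toeplitz

end LinearSystems

/-! ### Inverses of triangular matrices -/

section Triangular

open Finset Matrix

variable {K : Type*} [Field K]

/-- Lower triangular semi-infinite matrices. -/
def Lower (A : Matrix ℕ ℕ K) : Prop := ∀ i j, i < j → A i j = 0

theorem Lower.rowFin {A : Matrix ℕ ℕ K} (hA : Lower A) : RowFin A :=
  rowFin_of_le 0 fun i j h => hA i j (by omega)

theorem Lower.trunc_imul {A : Matrix ℕ ℕ K} (hA : Lower A) (B : Matrix ℕ ℕ K) (n : ℕ) :
    trunc n (imul A B) = trunc n A * trunc n B := by
  ext i j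
  rw [trunc, imul_apply_of_row (N := n) _ fun l hl => hA i l (by omega), mul_apply, sum_range]
  rfl

theorem Lower.imul {A B : Matrix ℕ ℕ K} (hA : Lower A) (hB : Lower B) : Lower (imul A B) := by
  intro i j hij
  rw [imul_apply_of_row (N := i + 1) _ fun l hl => hA i l (by omega)]
  refine sum_eq_zero fun l hl => ?_
  rw [hB l j (by have := mem_range.1 hl; omega), mul_zero]

theorem trunc_inv_castLE {A : Matrix ℕ ℕ K} (hA : Lower A) {n N : ℕ} (hN : n ≤ N)
    (hd : (trunc N A).det ≠ 0) (i j : Fin n) :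
    (trunc N A)⁻¹ (Fin.castLE hN i) (Fin.castLE hN j) = (trunc n A)⁻¹ i j := by
  have h1 : trunc n A * ((trunc N A)⁻¹.submatrix (Fin.castLE hN) (Fin.castLE hN)) = 1 := by
    ext i j
    have h2 := congrFun (congrFun (mul_nonsing_inv (trunc N A) (isUnit_iff_ne_zero.2 hd))
      (Fin.castLE hN i)) (Fin.castLE hN j)
    rw [mul_apply] at h2 ⊢
    have h3 : ∀ g : ℕ → K, (∀ l, n ≤ l → g l = 0) → ∑ l : Fin N, g l = ∑ l : Fin n, g l := by
      intro g hg
      rw [← sum_range, ← sum_range, ← sum_range_add_sum_Ico g hN,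
        sum_eq_zero fun l hl => hg l (mem_Ico.1 hl).1, add_zero]
    have h4 := h3 (fun l => if hl : l < N then A i l * (trunc N A)⁻¹ ⟨l, hl⟩ (Fin.castLE hN j) else 0)
      fun l hl => by
        split_ifs
        · rw [hA i l (by omega), zero_mul]
        · rfl
    have h5 : (1 : Matrix (Fin N) (Fin N) K) (Fin.castLE hN i) (Fin.castLE hN j)
        = (1 : Matrix (Fin n) (Fin n) K) i j := by
      simp [one_apply]
    rw [← h5, ← h2]
    refine Eq.trans ?_ (h4.symm.trans ?_)
    · refine sum_congr rfl fun l _ => ?_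
      rw [dif_pos (by omega)]
      rfl
    · refine sum_congr rfl fun l _ => ?_
      rw [dif_pos l.2]
      rfl
  rw [inv_eq_right_inv h1]
  rfl

theorem triInv_transpose (A : Matrix ℕ ℕ K) : triInv A.transpose = (triInv A).transpose := by
  ext i j
  rw [transpose_apply, triInv, triInv]
  have h1 : ∀ N M (h : N = M) (a b : ℕ) (ha : a < N) (hb : b < N) (ha' : a < M) (hb' : b < M),
      (trunc N A.transpose)⁻¹ ⟨a, ha⟩ ⟨b, hb⟩ = (trunc M A)⁻¹ ⟨b, hb'⟩ ⟨a, ha'⟩ := by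
    rintro N _ rfl a b ha hb ha' hb'
    change ((trunc N A).transpose)⁻¹ ⟨a, ha⟩ ⟨b, hb⟩ = _
    rw [← transpose_nonsing_inv, transpose_apply]
  exact h1 _ _ (by rw [max_comm]) _ _ _ _ _ _

/-- Truncation is multiplicative when the left factor is lower triangular. The statement therefore
reduces to finite blocks, where a right inverse is two-sided. -/
theorem triInv_eq_of_lower {A B : Matrix ℕ ℕ K} (hA : Lower A) (hB : Lower B) (hAB : imul A B = 1) :
    triInv A = B ∧ imul B A = 1 := by
  have h1 : ∀ n, trunc n A * trunc n B = 1 := fun n => by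
    rw [← hA.trunc_imul, hAB]
    ext i j
    simp [trunc, one_apply, Fin.ext_iff]
  constructor
  · ext i j
    rw [triInv, inv_eq_right_inv (h1 _)]
    rfl
  · ext i j
    have h2 : (trunc (max i j + 1) (imul B A)) ⟨i, by omega⟩ ⟨j, by omega⟩
        = (1 : Matrix ℕ ℕ K) i j := by
      rw [hB.trunc_imul, mul_eq_one_comm.1 (h1 _)]
      simp [one_apply]
    exact h2

theorem triInv_eq_of_upper {A B : Matrix ℕ ℕ K} (hA : Lower A.transpose) (hB : Lower B.transpose)
    (hAB : imul A B = 1) : triInv A = B ∧ imul B A = 1 := by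
  have h0 : imul B.transpose A.transpose = 1 := by rw [← transpose_imul, hAB, transpose_one]
  obtain ⟨h1, h2⟩ := triInv_eq_of_lower hB hA h0
  have h2' : imul B A = 1 := by
    apply transpose_injective
    rw [transpose_imul, h2, transpose_one]
  have h3 : imul A.transpose B.transpose = 1 := h2
  have h4 := (triInv_eq_of_lower hA hB h3).1
  rw [triInv_transpose] at h4
  exact ⟨transpose_injective h4, h2'⟩

end Triangular

end ToeplitzLattice

namespace ToeplitzLattice

/-! ### The triangular factorization and the rank two form of the Lax matrices -/

section Factorization

open Finset Matrix

variable {K : Type*} [Field K]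

theorem lower_lowerFactor (m : Matrix ℕ ℕ K) : Lower (lowerFactor m) :=
  fun _ _ hij => lowerFactor_gt m hij

/-- The upper triangular factor of a semi-infinite matrix. -/
noncomputable def upperFactor (m : Matrix ℕ ℕ K) : Matrix ℕ ℕ K := imul (lowerFactor m) m

theorem upperFactor_apply (m : Matrix ℕ ℕ K) (n l : ℕ) :
    upperFactor m n l = ∑ j ∈ range (n + 1), lowerFactor m n j * m j l :=
  imul_apply_of_row _ fun _ hj => lowerFactor_gt m hj

/-- The quotients of successive leading minors. -/
noncomputable def pivot (m : Matrix ℕ ℕ K) (n : ℕ) : K := (trunc (n + 1) m).det / (trunc n m).det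

theorem pivot_transpose (m : Matrix ℕ ℕ K) (n : ℕ) : pivot m.transpose n = pivot m n := by
  rw [pivot, pivot, det_trunc_transpose, det_trunc_transpose]

section

variable {m : Matrix ℕ ℕ K} (hd : ∀ n, (trunc n m).det ≠ 0)

theorem upperFactor_lt {n : ℕ} (hd : (trunc n m).det ≠ 0) {l : ℕ} (hl : l < n) :
    upperFactor m n l = 0 := by
  rw [upperFactor_apply, sum_lowerFactor_mul hd hl]

theorem upperFactor_self {n : ℕ} (hd : (trunc n m).det ≠ 0) : upperFactor m n n = pivot m n := by
  rw [upperFactor_apply, pivot, ← sum_lowerFactor_mul_self hd, mul_div_cancel_left₀ _ hd]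

include hd

theorem pivot_ne_zero (n : ℕ) : pivot m n ≠ 0 := div_ne_zero (hd _) (hd _)

theorem lower_transpose_upperFactor : Lower (upperFactor m).transpose :=
  fun _ _ hij => upperFactor_lt (hd _) hij

theorem colFin_upperFactor : ColFin (upperFactor m) :=
  colFin_of_le 0 fun i j h => upperFactor_lt (hd i) (by omega)

omit hd in
theorem rowFin_lowerFactor (m : Matrix ℕ ℕ K) : RowFin (lowerFactor m) :=
  (lower_lowerFactor m).rowFin

/-- The product `S₁ m S̃₁ᵀ`, with `S̃₁` the lower factor of the transpose, is upper triangular when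
bracketed from the left and lower triangular when bracketed from the right, hence diagonal. This is
biorthogonality, and it yields an explicit inverse of the upper factor. -/
theorem upperFactor_imul_lowerFactor :
    imul (upperFactor m) (lowerFactor m.transpose).transpose = Matrix.diagonal (pivot m) := by
  have hd' : ∀ n, (trunc n m.transpose).det ≠ 0 := fun n => by
    rw [det_trunc_transpose]; exact hd n
  have h1 : imul (upperFactor m) (lowerFactor m.transpose).transpose
      = imul (lowerFactor m) (upperFactor m.transpose).transpose := by
    rw [upperFactor, upperFactor, transpose_imul, transpose_transpose]
    exact imul_assoc_row_col (rowFin_lowerFactor m)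
      (rowFin_lowerFactor m.transpose).colFin_transpose
  have h2 : ∀ i j, imul (upperFactor m) (lowerFactor m.transpose).transpose i j
      = ∑ l ∈ range (j + 1), upperFactor m i l * lowerFactor m.transpose j l := fun i j =>
    imul_apply_of_col _ fun l hl => lowerFactor_gt _ hl
  ext i j
  rcases lt_trichotomy i j with hij | rfl | hij
  · rw [h1, diagonal_apply_ne _ hij.ne, imul_apply_of_row (N := i + 1) _ fun l hl =>
      lowerFactor_gt _ hl]
    refine sum_eq_zero fun l hl => ?_
    rw [transpose_apply, upperFactor_lt (hd' j) (by have := mem_range.1 hl; omega), mul_zero]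
  · rw [h2, diagonal_apply_eq, sum_range_succ, lowerFactor_self, mul_one, upperFactor_self (hd i),
      sum_eq_zero fun l hl => by rw [upperFactor_lt (hd i) (mem_range.1 hl), zero_mul], zero_add]
  · rw [h2, diagonal_apply_ne _ hij.ne']
    refine sum_eq_zero fun l hl => ?_
    rw [upperFactor_lt (hd i) (by have := mem_range.1 hl; omega), zero_mul]

theorem triInv_upperFactor :
    (∀ i j, triInv (upperFactor m) i j = lowerFactor m.transpose j i * (pivot m j)⁻¹) ∧
      imul (upperFactor m) (triInv (upperFactor m)) = 1 ∧
      imul (triInv (upperFactor m)) (upperFactor m) = 1 := by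
  obtain ⟨B, hB⟩ : ∃ B : Matrix ℕ ℕ K,
      B = fun i j => lowerFactor m.transpose j i * (pivot m j)⁻¹ := ⟨_, rfl⟩
  have h1 : imul (upperFactor m) B = 1 := by
    ext i j
    have h2 := congrFun (congrFun (upperFactor_imul_lowerFactor hd) i) j
    have h3 : imul (upperFactor m) B i j
        = imul (upperFactor m) (lowerFactor m.transpose).transpose i j * (pivot m j)⁻¹ := by
      rw [imul, imul, finsum_mul]
      simp only [hB, transpose_apply, mul_assoc]
    rw [h3, h2]
    by_cases hij : i = j
    · subst hij
      rw [diagonal_apply_eq, one_apply_eq, mul_inv_cancel₀ (pivot_ne_zero hd i)]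
    · rw [diagonal_apply_ne _ hij, one_apply_ne hij, zero_mul]
  have h4 := triInv_eq_of_upper (lower_transpose_upperFactor hd) (B := B) (fun i j hij => by
    rw [transpose_apply, hB]
    simp only
    rw [lowerFactor_gt _ hij, zero_mul]) h1
  refine ⟨fun i j => by rw [h4.1, hB], ?_, ?_⟩
  · rw [h4.1, h1]
  · rw [h4.1, h4.2]

/-- The inverse is `m S₂⁻¹`. By the formula for `S₂⁻¹` its entries are those of the transposed upper
factor of `mᵀ` divided by the pivots, which makes it lower triangular. -/
theorem triInv_lowerFactor : Lower (triInv (lowerFactor m)) ∧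
    imul (lowerFactor m) (triInv (lowerFactor m)) = 1 ∧
      imul (triInv (lowerFactor m)) (lowerFactor m) = 1 := by
  have hd' : ∀ n, (trunc n m.transpose).det ≠ 0 := fun n => by
    rw [det_trunc_transpose]; exact hd n
  have h1 : imul (lowerFactor m) (imul m (triInv (upperFactor m))) = 1 := by
    rw [← imul_assoc_row_col (rowFin_lowerFactor m), ← upperFactor, (triInv_upperFactor hd).2.1]
    exact fun j => ⟨j + 1, fun i hi => by
      rw [(triInv_upperFactor hd).1, lowerFactor_gt _ hi, zero_mul]⟩
  have h2 : Lower (imul m (triInv (upperFactor m))) := fun i j hij => by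
    have h3 : imul m (triInv (upperFactor m)) i j
        = (upperFactor m.transpose) j i * (pivot m j)⁻¹ := by
      have h5 := (triInv_upperFactor hd).1
      generalize triInv (upperFactor m) = T at h5 ⊢
      simp only [upperFactor, imul]
      rw [finsum_mul]
      refine finsum_congr fun l => ?_
      rw [h5, transpose_apply]
      ring
    rw [h3, upperFactor_lt (hd' j) hij, zero_mul]
  have h4 := triInv_eq_of_lower (lower_lowerFactor m) h2 h1
  rw [h4.1]
  exact ⟨h2, h1, h4.2⟩

theorem eq_triInv_imul : m = imul (triInv (lowerFactor m)) (upperFactor m) := by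
  rw [upperFactor, ← imul_assoc_row (triInv_lowerFactor hd).1.rowFin (rowFin_lowerFactor m),
    (triInv_lowerFactor hd).2.2, one_imul]

theorem factorization_unique {A : Matrix ℕ ℕ K} (hA : Lower A) (hA1 : ∀ i, A i i = 1)
    (hB : ∀ i j, j < i → imul A m i j = 0) : A = lowerFactor m := by
  ext n j
  rcases lt_trichotomy j n with hj | rfl | hj
  · refine sub_eq_zero.1 (eq_zero_of_sum_mul_eq_zero (hd n)
      (w := fun j => A n j - lowerFactor m n j) (fun l hl => ?_) hj)
    have h1 := hB n l hl
    rw [imul_apply_of_row (N := n + 1) _ fun l hl => hA n l hl, sum_range_succ, hA1] at h1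
    have h2 := sum_lowerFactor_mul (hd n) hl
    rw [sum_range_succ, lowerFactor_self] at h2
    simp_rw [sub_mul, sum_sub_distrib]
    linear_combination h1 - h2
  · rw [hA1, lowerFactor_self]
  · rw [hA n j hj, lowerFactor_gt m hj]

end

section Toeplitz

variable {m : Matrix ℕ ℕ K} {f : ℤ → K} (hm : ∀ k l : ℕ, m k l = f ((k : ℤ) - l))
  (hd : ∀ n, (trunc n m).det ≠ 0)

include hm in
omit [Field K] in
theorem toeplitz_transpose (k l : ℕ) : m.transpose k l = (fun j => f (-j)) ((k : ℤ) - l) := by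
  rw [transpose_apply, hm, ← neg_sub]

include hm hd

theorem pivot_succ (n : ℕ) : pivot m (n + 1)
    = pivot m n * (1 - lowerFactor m (n + 1) 0 * lowerFactor m.transpose (n + 1) 0) := by
  have h1 := one_sub_mul_det hm (hd (n + 1))
  rw [pivot, pivot]
  have h2 := hd n
  have h3 := hd (n + 1)
  field_simp
  linear_combination -h1

theorem lowerFactor_succ_sub (n j : ℕ) (hj : j ≤ n) :
    lowerFactor m (n + 1) j = (if j = 0 then 0 else lowerFactor m n (j - 1))
      + lowerFactor m (n + 1) 0 * lowerFactor m.transpose n (n - j) := by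
  exact lowerFactor_succ hm (hd n) (hd (n + 1)) hj

/-- This is the Christoffel–Darboux formula with one argument at the origin: the kernel sum is the
reversed dual polynomial divided by its norm. The induction step is the Szegő recursion for the
matrix and for its transpose, together with `pivot_succ`. -/
theorem sum_dual_mul_lowerFactor (a j : ℕ) :
    ∑ b ∈ range (a + 1), lowerFactor m.transpose b 0 * (pivot m b)⁻¹ * lowerFactor m b j
      = if j ≤ a then lowerFactor m.transpose a (a - j) * (pivot m a)⁻¹ else 0 := by
  have hm' := toeplitz_transpose hm
  have hd' : ∀ n, (trunc n m.transpose).det ≠ 0 := fun n => by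
    rw [det_trunc_transpose]; exact hd n
  induction a with
  | zero =>
    rw [zero_add, sum_range_one, lowerFactor_self]
    split_ifs with h
    · obtain rfl : j = 0 := by omega
      rw [lowerFactor_self, Nat.sub_zero, lowerFactor_self]; ring
    · rw [lowerFactor_gt _ (by omega), mul_zero]
  | succ a ih =>
    rw [sum_range_succ, ih]
    have h1 := pivot_succ hm hd a
    have h2 := pivot_ne_zero hd a
    have h3 := pivot_ne_zero hd (a + 1)
    by_cases hj : j ≤ a
    · rw [if_pos hj, if_pos (by omega)]
      have h4 := lowerFactor_succ_sub hm hd a j hj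
      have h5 : lowerFactor m.transpose (a + 1) (a + 1 - j) = lowerFactor m.transpose a (a - j)
          + lowerFactor m.transpose (a + 1) 0 * (if j = 0 then 0 else lowerFactor m a (j - 1)) := by
        rcases Nat.eq_zero_or_pos j with rfl | hj0
        · simp [lowerFactor_self]
        · rw [lowerFactor_succ_sub (f := fun j => f (-j)) hm' hd' a (a + 1 - j) (by omega), if_neg (by omega),
            if_neg (by omega), show a + 1 - j - 1 = a - j by omega, transpose_transpose,
            show a - (a + 1 - j) = j - 1 by omega]
      field_simp
      rw [h5, h4, h1]
      ring
    · rw [if_neg hj, zero_add]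
      by_cases hj' : j = a + 1
      · subst hj'
        rw [if_pos le_rfl, lowerFactor_self, Nat.sub_self, mul_one]
      · rw [if_neg (by omega), lowerFactor_gt m (n := a + 1) (j := j) (by omega), mul_zero]

/-- Multiplication by `z` in the basis of the orthogonal polynomials. -/
theorem lowerFactor_imul_shift :
    imul (lowerFactor m) (shift K) = imul (diagConj (fun n => (pivot m n)⁻¹)
      (rankTwo1 (fun n => lowerFactor m n 0) (fun n => lowerFactor m.transpose n 0)))
      (lowerFactor m) := by
  ext a j
  have h1 := pivot_succ hm hd a
  have h2 := pivot_ne_zero hd a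
  have h3 := pivot_ne_zero hd (a + 1)
  have e1 : imul (lowerFactor m) (shift K) a j = if j = 0 then 0 else lowerFactor m a (j - 1) := by
    rw [imul_apply_of_col (B := shift K) (N := j) _ fun l hl => if_neg (by omega)]
    cases j with
    | zero => simp
    | succ j =>
      rw [sum_range_succ, shift, if_pos rfl, mul_one, sum_eq_zero, zero_add, if_neg (by omega)]
      · simp
      · intro l hl
        rw [shift, if_neg (by have := mem_range.1 hl; omega), mul_zero]
  rw [e1, imul_apply_of_row (N := a + 2) _ fun l hl => by
    rw [diagConj, rankTwo1_gt _ _ (by omega), mul_zero, zero_mul], sum_range_succ, diagConj,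
    rankTwo1_succ]
  have e2 : ∑ b ∈ range (a + 1), diagConj (fun n => (pivot m n)⁻¹)
      (rankTwo1 (fun n => lowerFactor m n 0) (fun n => lowerFactor m.transpose n 0)) a b
        * lowerFactor m b j = -(lowerFactor m (a + 1) 0 * pivot m a) *
          if j ≤ a then lowerFactor m.transpose a (a - j) * (pivot m a)⁻¹ else 0 := by
    rw [← sum_dual_mul_lowerFactor hm hd, mul_sum]
    refine sum_congr rfl fun b hb => ?_
    rw [diagConj, rankTwo1_le _ _ (by have := mem_range.1 hb; omega), inv_inv]
    ring
  have e3 : (pivot m a)⁻¹⁻¹ * (1 - lowerFactor m (a + 1) 0 * lowerFactor m.transpose (a + 1) 0)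
      * (pivot m (a + 1))⁻¹ = 1 := by
    rw [inv_inv, ← h1, mul_inv_cancel₀ h3]
  rw [e2, e3, one_mul]
  by_cases hj : j ≤ a
  · rw [if_pos hj, lowerFactor_succ_sub hm hd a j hj]
    field_simp
    ring
  · rw [if_neg hj, mul_zero, zero_add, if_neg (by omega)]
    by_cases hj' : j = a + 1
    · subst hj'
      rw [lowerFactor_self, Nat.add_sub_cancel, lowerFactor_self]
    · rw [lowerFactor_gt _ (by omega), lowerFactor_gt _ (by omega)]

theorem lowerFactor_conj_shift :
    imul (imul (lowerFactor m) (shift K)) (triInv (lowerFactor m))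
      = diagConj (fun n => (pivot m n)⁻¹)
        (rankTwo1 (fun n => lowerFactor m n 0) (fun n => lowerFactor m.transpose n 0)) := by
  rw [lowerFactor_imul_shift hm hd, imul_assoc_row ((rowFin_rankTwo1 _ _).diagConj _)
    (rowFin_lowerFactor m), (triInv_lowerFactor hd).2.1, imul_one]

/-- Since `S₂⁻¹` consists of the rescaled dual polynomials, the assertion is the transpose of
`lowerFactor_imul_shift` for `mᵀ`. The rescaling by the pivots absorbs the diagonal conjugation. -/
theorem upperFactor_conj_shift :
    imul (imul (upperFactor m) (shift K).transpose) (triInv (upperFactor m))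
      = rankTwo2 (fun n => lowerFactor m n 0) (fun n => lowerFactor m.transpose n 0) := by
  have hm' := toeplitz_transpose hm
  have hd' : ∀ n, (trunc n m.transpose).det ≠ 0 := fun n => by
    rw [det_trunc_transpose]; exact hd n
  have hcol : ColFin (triInv (upperFactor m)) := fun j => ⟨j + 1, fun i hi => by
      rw [(triInv_upperFactor hd).1, lowerFactor_gt _ hi, zero_mul]⟩
  have hsh : RowFin (shift K) := rowFin_of_le 1 fun i j h => if_neg (by omega)
  have h1 : imul (shift K).transpose (triInv (upperFactor m))
      = imul (triInv (upperFactor m))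
        (rankTwo2 (fun n => lowerFactor m n 0) (fun n => lowerFactor m.transpose n 0)) := by
    ext i j
    have h2 := congrFun (congrFun (lowerFactor_imul_shift (f := fun j => f (-j)) hm' hd') j) i
    have h3 : imul (shift K).transpose (triInv (upperFactor m)) i j
        = imul (lowerFactor m.transpose) (shift K) j i * (pivot m j)⁻¹ := by
      rw [imul, imul, finsum_mul]
      refine finsum_congr fun l => ?_
      rw [(triInv_upperFactor hd).1, transpose_apply]
      ring
    rw [h3, h2, imul, imul, finsum_mul]
    refine finsum_congr fun l => ?_
    have h4 := pivot_ne_zero hd j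
    have h5 := pivot_ne_zero hd l
    rw [(triInv_upperFactor hd).1, rankTwo2_eq_transpose, transpose_apply, diagConj,
      pivot_transpose, pivot_transpose, transpose_transpose]
    field_simp
  rw [imul_assoc_col hsh.colFin_transpose hcol, h1, ← imul_assoc_col hcol,
    (triInv_upperFactor hd).2.1, one_imul]
  rw [rankTwo2_eq_transpose]
  exact (rowFin_rankTwo1 _ _).colFin_transpose

end Toeplitz

end Factorization

/-! ### Bi-orthogonal polynomials and the variables `x_n`, `y_n` -/

section BiorthogonalPolynomials

open Finset

theorem S1_eq (t s : Times) : S1 t s = lowerFactor (mom t s) := rfl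

theorem h_eq (t s : Times) (n : ℕ) : h n t s = pivot (mom t s) n := rfl

variable {t s : Times}

theorem S2_eq (hd : ∀ n, tau n t s ≠ 0) : S2 t s = upperFactor (mom t s) := by
  ext i j
  rw [S2, plusPart]
  split_ifs with hij
  · rfl
  · rw [upperFactor_lt (hd i) (by omega)]

theorem mom_toeplitz (ht : SummableTimes t) (hs : SummableTimes s) (k l : ℕ) :
    mom t s k l = mu t s ((k : ℤ) - l) := mom_eq ht hs k l

theorem p1_coeff (n j : ℕ) (t s : Times) : (p1 n t s).coeff j = S1 t s n j := by
  simp only [p1, Polynomial.finsetSum_coeff, Polynomial.coeff_C_mul, Polynomial.coeff_X_pow]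
  simp only [mul_ite, mul_one, mul_zero, sum_ite_eq, mem_range]
  split_ifs with hj
  · rfl
  · rw [S1_eq, lowerFactor_gt _ (by omega)]

theorem p1_natDegree_lt (n : ℕ) (t s : Times) : (p1 n t s).natDegree < n + 1 := by
  refine Nat.lt_succ_of_le (Polynomial.natDegree_le_iff_coeff_eq_zero.2 fun j hj => ?_)
  rw [p1_coeff, S1_eq, lowerFactor_gt _ hj]

theorem p1_natDegree (n : ℕ) (t s : Times) : (p1 n t s).natDegree = n := by
  refine le_antisymm (Nat.lt_succ_iff.1 (p1_natDegree_lt n t s)) (Polynomial.le_natDegree_of_ne_zero ?_)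
  rw [p1_coeff, S1_eq, lowerFactor_self]
  exact one_ne_zero

theorem p1_monic (n : ℕ) (t s : Times) : (p1 n t s).Monic := by
  rw [Polynomial.Monic, Polynomial.leadingCoeff, p1_natDegree, p1_coeff, S1_eq, lowerFactor_self]

theorem x_eq (n : ℕ) (t s : Times) : x n t s = S1 t s n 0 := by
  rw [x, ← Polynomial.coeff_zero_eq_eval_zero, p1_coeff]

theorem S1_neg_neg (ht : SummableTimes t) (hs : SummableTimes s) :
    S1 (-s) (-t) = lowerFactor (mom t s).transpose := by
  rw [S1_eq, mom_neg_neg ht hs]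

theorem triInv_S2_apply (ht : SummableTimes t) (hs : SummableTimes s) (hd : ∀ n, tau n t s ≠ 0)
    (i j : ℕ) : triInv (S2 t s) i j = S1 (-s) (-t) j i * (h j t s)⁻¹ := by
  rw [S2_eq hd, (triInv_upperFactor hd).1, S1_neg_neg ht hs, h_eq]

theorem h_ne_zero (hd : ∀ n, tau n t s ≠ 0) (n : ℕ) : h n t s ≠ 0 := div_ne_zero (hd _) (hd _)

/-- Up to division by `h`, the columns of `S₂⁻¹` are the rows of the lower factor of the transposed
moment matrix, that is, of the moment matrix at the times `(-s, -t)`. -/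
theorem p2_eq (ht : SummableTimes t) (hs : SummableTimes s) (hd : ∀ n, tau n t s ≠ 0) (n : ℕ) :
    p2 n t s = p1 n (-s) (-t) := by
  rw [p2, p1]
  refine sum_congr rfl fun j _ => ?_
  rw [triInv_S2_apply ht hs hd]
  congr 2
  have := h_ne_zero hd n
  field_simp

theorem y_eq_x (ht : SummableTimes t) (hs : SummableTimes s) (hd : ∀ n, tau n t s ≠ 0) (n : ℕ) :
    y n t s = x n (-s) (-t) := by
  rw [y, p2_eq ht hs hd, x]

theorem y_eq (ht : SummableTimes t) (hs : SummableTimes s) (hd : ∀ n, tau n t s ≠ 0) (n : ℕ) :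
    y n t s = lowerFactor (mom t s).transpose n 0 := by
  rw [y_eq_x ht hs hd, x_eq, S1_neg_neg ht hs]

theorem lowerUnipotent_S1 (t s : Times) : LowerUnipotent (S1 t s) :=
  ⟨fun i => lowerFactor_self _ i, fun _ _ hij => lowerFactor_gt _ hij⟩

theorem ip_p1_p2 (ht : SummableTimes t) (hs : SummableTimes s) (hd : ∀ n, tau n t s ≠ 0)
    (n m : ℕ) : ip t s (fun z => (p1 n t s).eval z) (fun z => (p2 m t s).eval z)
      = if n = m then h n t s else 0 := by
  rw [p2_eq ht hs hd, ip_polynomial ht hs _ _ (p1_natDegree_lt n t s) (p1_natDegree_lt m _ _)]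
  have h1 := congrFun (congrFun (upperFactor_imul_lowerFactor (m := mom t s) hd) n) m
  rw [Matrix.diagonal_apply, ← h_eq] at h1
  rw [← h1, imul_apply_of_col (B := (lowerFactor (mom t s).transpose).transpose) (j := m)
    (N := m + 1) _ fun l hl => lowerFactor_gt (n := m) (j := l) _ hl, sum_comm]
  refine sum_congr rfl fun l _ => ?_
  rw [upperFactor_apply, sum_mul]
  refine sum_congr rfl fun k _ => ?_
  rw [p1_coeff, p1_coeff, S1_neg_neg ht hs, S1_eq, Matrix.transpose_apply]
  ring

theorem factorization (ht : SummableTimes t) (hs : SummableTimes s) (hd : ∀ n, tau n t s ≠ 0) :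
    LowerUnipotent (S1 t s) ∧ Upper (S2 t s) ∧ (∀ n, S2 t s n n = h n t s) ∧
      imul (S1 t s) (triInv (S1 t s)) = 1 ∧ imul (triInv (S1 t s)) (S1 t s) = 1 ∧
      imul (S2 t s) (triInv (S2 t s)) = 1 ∧ imul (triInv (S2 t s)) (S2 t s) = 1 ∧
      imul (S1 t s) (mom t s) = S2 t s ∧ mom t s = imul (triInv (S1 t s)) (S2 t s) ∧
      (∀ A B : Matrix ℕ ℕ ℂ, LowerUnipotent A → Upper B → imul A (mom t s) = B →
        A = S1 t s ∧ B = S2 t s) ∧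
      (∀ n, (p1 n t s).Monic ∧ (p1 n t s).natDegree = n ∧
        (p2 n t s).Monic ∧ (p2 n t s).natDegree = n) ∧
      (∀ n m, ip t s (fun z => (p1 n t s).eval z) (fun z => (p2 m t s).eval z)
        = if n = m then h n t s else 0) := by
  have h2 := S2_eq hd
  refine ⟨lowerUnipotent_S1 t s, fun i j hij => ?_, fun n => ?_, (triInv_lowerFactor hd).2.1,
    (triInv_lowerFactor hd).2.2, ?_, ?_, h2.symm, ?_, fun A B hA hB hAB => ?_,
    fun n => ⟨p1_monic n t s, p1_natDegree n t s, ?_, ?_⟩, ip_p1_p2 ht hs hd⟩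
  · rw [h2, upperFactor_lt (hd i) hij]
  · rw [h2, upperFactor_self (hd n), h_eq]
  · rw [h2, (triInv_upperFactor hd).2.1]
  · rw [h2, (triInv_upperFactor hd).2.2]
  · rw [h2]; exact eq_triInv_imul hd
  · have h3 : A = S1 t s := factorization_unique hd hA.2 hA.1 fun i j hij => by
      rw [hAB]; exact hB i j hij
    exact ⟨h3, by rw [← hAB, h3]; exact h2.symm⟩
  · rw [p2_eq ht hs hd]; exact p1_monic n _ _
  · rw [p2_eq ht hs hd]; exact p1_natDegree n _ _

theorem L1_eq (ht : SummableTimes t) (hs : SummableTimes s) (hd : ∀ n, tau n t s ≠ 0) :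
    L1 t s = diagConj (fun n => (h n t s)⁻¹) (rankTwo1 (fun n => x n t s) (fun n => y n t s)) := by
  have h1 := lowerFactor_conj_shift (mom_toeplitz ht hs) hd
  rw [L1, S1_eq, h1]
  simp only [x_eq, y_eq ht hs hd, S1_eq, h_eq]

theorem L2_eq (ht : SummableTimes t) (hs : SummableTimes s) (hd : ∀ n, tau n t s ≠ 0) :
    L2 t s = rankTwo2 (fun n => x n t s) (fun n => y n t s) := by
  have h1 := upperFactor_conj_shift (mom_toeplitz ht hs) hd
  rw [L2, S2_eq hd, h1]
  simp only [x_eq, y_eq ht hs hd, S1_eq]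

theorem h_inv_mul_L1_mul_h (ht : SummableTimes t) (hs : SummableTimes s)
    (hd : ∀ n, tau n t s ≠ 0) (a b : ℕ) : (h a t s)⁻¹ * L1 t s a b * h b t s
      = rankTwo1 (fun n => x n t s) (fun n => y n t s) a b := by
  have h1 := h_ne_zero hd a
  have h2 := h_ne_zero hd b
  rw [L1_eq ht hs hd, diagConj]
  field_simp

theorem h_succ_div (ht : SummableTimes t) (hs : SummableTimes s) (hd : ∀ n, tau n t s ≠ 0)
    (n : ℕ) : h (n + 1) t s / h n t s = 1 - x (n + 1) t s * y (n + 1) t s := by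
  have h1 := pivot_succ (mom_toeplitz ht hs) hd n
  rw [← h_eq, ← h_eq] at h1
  rw [h1, mul_div_cancel_left₀ _ (h_ne_zero hd n), x_eq, y_eq ht hs hd, S1_eq]

theorem x_zero (t s : Times) : x 0 t s = 1 := by rw [x_eq, S1_eq, lowerFactor_self]

theorem y_zero (ht : SummableTimes t) (hs : SummableTimes s) (hd : ∀ n, tau n t s ≠ 0) :
    y 0 t s = 1 := by rw [y_eq_x ht hs hd, x_zero]

theorem summableTimes_zero : SummableTimes 0 := by simp [SummableTimes]

theorem mom_zero_zero : mom 0 0 = 1 := by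
  ext k l
  rw [mom_eq summableTimes_zero summableTimes_zero, mu_zero_zero, Matrix.one_apply]
  congr 1
  rw [eq_iff_iff]
  omega

theorem tau_zero_zero (n : ℕ) : tau n 0 0 = 1 := by
  rw [tau, mom_zero_zero]
  have : trunc n (1 : Matrix ℕ ℕ ℂ) = 1 := by
    ext i j
    simp [trunc, Matrix.one_apply, Fin.ext_iff]
  rw [this, Matrix.det_one]

theorem x_y_zero_zero {n : ℕ} (hn : 1 ≤ n) : x n 0 0 = 0 ∧ y n 0 0 = 0 := by
  have h1 : x n 0 0 = 0 := by
    rw [x_eq, S1, dif_pos (by omega), mom_zero_zero, neg_eq_zero]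
    refine sum_eq_zero fun k _ => ?_
    rw [Matrix.one_apply_ne (by have := k.2; omega), zero_mul]
  refine ⟨h1, ?_⟩
  rw [y_eq_x summableTimes_zero summableTimes_zero fun n => by
    rw [tau_zero_zero]; exact one_ne_zero]
  simpa using h1

end BiorthogonalPolynomials

end ToeplitzLattice

namespace ToeplitzLattice

/-! ### Entrywise derivatives of determinants, inverses and triangular factors -/

section EntrywiseDerivatives

open Finset Matrix

theorem hasDerivAt_det {n : ℕ} {M : ℂ → Matrix (Fin n) (Fin n) ℂ} {M' : Matrix (Fin n) (Fin n) ℂ}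
    {u : ℂ} (hM : ∀ i j, HasDerivAt (fun w => M w i j) (M' i j) u) :
    HasDerivAt (fun w => (M w).det) (∑ r, ((M u).updateRow r (M' r)).det) u := by
  simp_rw [← det_transpose (M _), ← det_transpose ((M u).updateRow _ _), det_apply']
  rw [sum_comm]
  refine HasDerivAt.fun_sum fun σ _ => ?_
  simp_rw [← mul_sum]
  refine HasDerivAt.const_mul _ ?_
  have h1 := HasDerivAt.fun_finsetProd (u := univ) (f := fun i w => (M w).transpose (σ i) i)
    (f' := fun i => M' i (σ i)) (x := u) fun i _ => hM i (σ i)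
  convert h1 using 1
  refine sum_congr rfl fun r _ => ?_
  rw [← mul_prod_erase univ _ (mem_univ r), smul_eq_mul, mul_comm]
  congr 1
  · refine prod_congr rfl fun i hi => ?_
    rw [transpose_apply, updateRow_ne (ne_of_mem_erase hi), transpose_apply]
  · rw [transpose_apply, updateRow_self]

theorem differentiableAt_det {n : ℕ} {M : ℂ → Matrix (Fin n) (Fin n) ℂ} {u : ℂ}
    (hM : ∀ i j, DifferentiableAt ℂ (fun w => M w i j) u) :
    DifferentiableAt ℂ (fun w => (M w).det) u :=
  (hasDerivAt_det (M' := fun i j => deriv (fun w => M w i j) u)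
    fun i j => (hM i j).hasDerivAt).differentiableAt

/-- Cramer's formula shows that the entries of the inverse are differentiable. The value is then
forced by differentiating `M M⁻¹ = 1` near the point. -/
theorem hasDerivAt_nonsing_inv {n : ℕ} {M : ℂ → Matrix (Fin n) (Fin n) ℂ}
    {M' : Matrix (Fin n) (Fin n) ℂ} {u : ℂ}
    (hM : ∀ i j, HasDerivAt (fun w => M w i j) (M' i j) u) (hd : (M u).det ≠ 0) (i j : Fin n) :
    HasDerivAt (fun w => (M w)⁻¹ i j) ((-((M u)⁻¹ * M' * (M u)⁻¹)) i j) u := by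
  have hdet := differentiableAt_det fun i j => (hM i j).differentiableAt
  have h1 : ∀ i j, DifferentiableAt ℂ (fun w => (M w)⁻¹ i j) u := fun i j => by
    simp_rw [Matrix.inv_def, Matrix.smul_apply, Ring.inverse_eq_inv', smul_eq_mul, adjugate_apply]
    refine (hdet.inv hd).mul (differentiableAt_det fun a b => ?_)
    simp_rw [updateRow_apply]
    split_ifs
    · exact differentiableAt_const _
    · exact (hM a b).differentiableAt
  obtain ⟨D, hD⟩ : ∃ D : Matrix (Fin n) (Fin n) ℂ, D = fun i j => deriv (fun w => (M w)⁻¹ i j) u :=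
    ⟨_, rfl⟩
  have h2 : ∀ i j, HasDerivAt (fun w => (M w)⁻¹ i j) (D i j) u := fun i j => by
    rw [hD]; exact (h1 i j).hasDerivAt
  have h3 : M' * (M u)⁻¹ + M u * D = 0 := by
    ext i j
    have h4 : HasDerivAt (fun w => (M w * (M w)⁻¹) i j) ((M' * (M u)⁻¹ + M u * D) i j) u := by
      simp_rw [Matrix.add_apply, mul_apply, ← sum_add_distrib]
      exact HasDerivAt.fun_sum fun k _ => (hM i k).mul (h2 k j)
    refine h4.unique ?_
    have h5 : (fun w => (M w * (M w)⁻¹) i j) =ᶠ[𝓝 u] fun _ => (1 : Matrix (Fin n) (Fin n) ℂ) i j := by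
      filter_upwards [hdet.continuousAt.eventually_ne hd] with w hw
      rw [mul_nonsing_inv _ (isUnit_iff_ne_zero.2 hw)]
    exact h5.hasDerivAt_iff.2 (hasDerivAt_const _ _)
  have h6 : D = -((M u)⁻¹ * M' * (M u)⁻¹) := by
    have h7 := congrArg (fun X => (M u)⁻¹ * X) h3
    simp only [Matrix.mul_add, Matrix.mul_zero] at h7
    rw [← Matrix.mul_assoc, ← Matrix.mul_assoc, nonsing_inv_mul _ (isUnit_iff_ne_zero.2 hd),
      Matrix.one_mul] at h7
    exact (neg_eq_of_add_eq_zero_right h7).symm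
  rw [← h6]
  exact h2 i j

/-- Entrywise derivatives of semi-infinite matrices. -/
def EntryDeriv (F : ℂ → Matrix ℕ ℕ ℂ) (F' : Matrix ℕ ℕ ℂ) (u : ℂ) : Prop :=
  ∀ i j, HasDerivAt (fun w => F w i j) (F' i j) u

variable {F G : ℂ → Matrix ℕ ℕ ℂ} {F' G' : Matrix ℕ ℕ ℂ} {u : ℂ}

theorem EntryDeriv.transpose (hF : EntryDeriv F F' u) :
    EntryDeriv (fun w => (F w).transpose) F'.transpose u := fun i j => hF j i

theorem EntryDeriv.eq_zero (hF : EntryDeriv F F' u) {i j : ℕ} {c : ℂ} (h0 : ∀ w, F w i j = c) :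
    F' i j = 0 := by
  refine (hF i j).unique ?_
  simp_rw [h0]
  exact hasDerivAt_const _ _

theorem EntryDeriv.imul_row (hF : EntryDeriv F F' u) (hG : EntryDeriv G G' u)
    (hr : ∀ i, ∃ N, ∀ w l, N ≤ l → F w i l = 0) :
    EntryDeriv (fun w => imul (F w) (G w)) (imul F' (G u) + imul (F u) G') u := by
  intro i j
  obtain ⟨N, hN⟩ := hr i
  have h1 : ∀ w, imul (F w) (G w) i j = ∑ l ∈ range N, F w i l * G w l j := fun w =>
    imul_apply_of_row _ (hN w)
  simp_rw [h1]
  rw [Matrix.add_apply, imul_apply_of_row (A := F') (N := N) _ fun l hl => hF.eq_zero (hN · l hl),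
    imul_apply_of_row _ (hN u), ← sum_add_distrib]
  exact HasDerivAt.fun_sum fun l _ => (hF i l).mul (hG l j)

theorem EntryDeriv.imul_col (hF : EntryDeriv F F' u) (hG : EntryDeriv G G' u)
    (hc : ∀ j, ∃ N, ∀ w l, N ≤ l → G w l j = 0) :
    EntryDeriv (fun w => imul (F w) (G w)) (imul F' (G u) + imul (F u) G') u := by
  have h1 := (hG.transpose.imul_row hF.transpose hc).transpose
  simp only [← transpose_imul, transpose_add, transpose_transpose] at h1
  rwa [add_comm] at h1

theorem trunc_triInv {A : Matrix ℕ ℕ ℂ} (hA : Lower A) {N : ℕ} (hd : (trunc N A).det ≠ 0) :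
    trunc N (triInv A) = (trunc N A)⁻¹ := by
  ext i j
  exact (trunc_inv_castLE hA (show max (i : ℕ) j + 1 ≤ N by omega) hd ⟨i, by omega⟩
    ⟨j, by omega⟩).symm

theorem lower_triInv {A : Matrix ℕ ℕ ℂ} (hA : Lower A) : Lower (triInv A) := by
  intro i j hij
  by_cases hd : IsUnit (trunc (max i j + 1) A).det
  · have : BlockTriangular (trunc (max i j + 1) A) OrderDual.toDual := fun a b hab => hA a b hab
    let _ := (trunc (max i j + 1) A).invertibleOfIsUnitDet hd
    exact blockTriangular_inv_of_blockTriangular this hij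
  · rw [triInv, nonsing_inv_apply_not_isUnit _ hd, Matrix.zero_apply]

theorem upper_triInv {A : Matrix ℕ ℕ ℂ} (hA : Lower A.transpose) : Lower (triInv A).transpose := by
  rw [← triInv_transpose]
  exact lower_triInv hA

theorem EntryDeriv.triInv_lower (hF : EntryDeriv F F' u) (hl : ∀ w, Lower (F w))
    (hd : ∀ n, (trunc n (F u)).det ≠ 0) :
    EntryDeriv (fun w => triInv (F w))
      (-(imul (imul (triInv (F u)) F') (triInv (F u)))) u := by
  intro i j
  have h1 := hasDerivAt_nonsing_inv (M := fun w => trunc (max i j + 1) (F w))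
    (M' := trunc (max i j + 1) F') (fun a b => hF a b) (hd _) ⟨i, by omega⟩ ⟨j, by omega⟩
  rw [← trunc_triInv (hl u) (hd _), ← (lower_triInv (hl u)).trunc_imul, ← Lower.trunc_imul] at h1
  · exact h1
  · exact (lower_triInv (hl u)).imul fun a b hab => hF.eq_zero fun w => hl w a b hab

theorem EntryDeriv.triInv_upper (hF : EntryDeriv F F' u) (hl : ∀ w, Lower (F w).transpose)
    (hd : ∀ n, (trunc n (F u)).det ≠ 0) :
    EntryDeriv (fun w => triInv (F w))
      (-(imul (imul (triInv (F u)) F') (triInv (F u)))) u := by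
  have h1 := (hF.transpose.triInv_lower hl fun n => by
    rw [det_trunc_transpose]; exact hd n).transpose
  have h2 : ∀ w, (triInv (F w).transpose).transpose = triInv (F w) := fun w => by
    rw [triInv_transpose, transpose_transpose]
  simp only [transpose_neg, transpose_imul, transpose_transpose, h2] at h1
  convert h1 using 2
  refine imul_assoc_col ?_ ?_
  · exact (Lower.rowFin (A := F'.transpose) fun a b hab =>
      hF.eq_zero fun w => hl w a b hab).colFin_transpose
  · exact (upper_triInv (hl u)).rowFin.colFin_transpose

end EntrywiseDerivatives

section FactorDerivatives

open Finset Matrix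

theorem lowerFactor_mul_det {K : Type*} [Field K] {m : Matrix ℕ ℕ K} {n : ℕ}
    (hd : (trunc n m).det ≠ 0) (j : Fin n) :
    lowerFactor m n j * (trunc n m).det = ((trunc n m).updateRow j fun l => -m n l).det := by
  refine (det_updateRow_of_vecMul (w := fun j : Fin n => lowerFactor m n j) (fun l => ?_) j).symm
  have h1 := sum_lowerFactor_mul hd l.2
  rw [sum_range_succ, lowerFactor_self, one_mul, sum_range] at h1
  exact eq_neg_of_add_eq_zero_left h1

variable {m : ℂ → Matrix ℕ ℕ ℂ} {m' : Matrix ℕ ℕ ℂ} {u : ℂ} (hm : EntryDeriv m m' u)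

include hm

theorem continuousAt_det_trunc (n : ℕ) : ContinuousAt (fun w => (trunc n (m w)).det) u :=
  (differentiableAt_det fun i j => (hm i j).differentiableAt).continuousAt

theorem differentiableAt_lowerFactor {n : ℕ} (hd : (trunc n (m u)).det ≠ 0) (j : ℕ) :
    DifferentiableAt ℂ (fun w => lowerFactor (m w) n j) u := by
  rcases lt_trichotomy j n with hj | rfl | hj
  · have h1 : (fun w => lowerFactor (m w) n j) =ᶠ[𝓝 u] fun w =>
        ((trunc n (m w)).updateRow ⟨j, hj⟩ fun l => -m w n l).det / (trunc n (m w)).det := by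
      filter_upwards [(continuousAt_det_trunc hm n).eventually_ne hd] with w hw
      rw [← lowerFactor_mul_det hw ⟨j, hj⟩, mul_div_cancel_right₀ _ hw]
    refine h1.differentiableAt_iff.2 (DifferentiableAt.fun_div (differentiableAt_det fun a b => ?_)
      (differentiableAt_det fun i j => (hm i j).differentiableAt) hd)
    simp_rw [updateRow_apply]
    split_ifs
    · exact (hm n b).differentiableAt.neg
    · exact (hm a b).differentiableAt
  · simp_rw [lowerFactor_self]
    exact differentiableAt_const _
  · simp_rw [lowerFactor_gt _ hj]
    exact differentiableAt_const _

/-- Near a point where the single minor of size `n` is nonzero, the entries of row `n` of the upper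
factor left of the diagonal vanish identically, so their derivatives do too. This is a linear system
for the derivative of row `n` of the lower factor. Requiring only one minor is what allows the Toda
identities under pointwise hypotheses. -/
theorem hasDerivAt_lowerFactor_row {n : ℕ} (hd : (trunc n (m u)).det ≠ 0) :
    ∃ a : ℕ → ℂ, (∀ j, HasDerivAt (fun w => lowerFactor (m w) n j) (a j) u) ∧
      (∀ j, n ≤ j → a j = 0) ∧
      (∀ l, HasDerivAt (fun w => upperFactor (m w) n l)
        (∑ j ∈ range n, a j * m u j l + ∑ j ∈ range (n + 1), lowerFactor (m u) n j * m' j l) u) ∧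
      ∀ l, l < n → ∑ j ∈ range n, a j * m u j l
        + ∑ j ∈ range (n + 1), lowerFactor (m u) n j * m' j l = 0 := by
  obtain ⟨a, ha⟩ : ∃ a : ℕ → ℂ, a = fun j => deriv (fun w => lowerFactor (m w) n j) u := ⟨_, rfl⟩
  have h1 : ∀ j, HasDerivAt (fun w => lowerFactor (m w) n j) (a j) u := fun j => by
    rw [ha]; exact (differentiableAt_lowerFactor hm hd j).hasDerivAt
  have h2 : ∀ j, n ≤ j → a j = 0 := fun j hj => by
    refine (h1 j).unique ?_
    rcases hj.eq_or_lt with rfl | hj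
    · simp_rw [lowerFactor_self]; exact hasDerivAt_const _ _
    · simp_rw [lowerFactor_gt _ hj]; exact hasDerivAt_const _ _
  have h3 : ∀ l, HasDerivAt (fun w => upperFactor (m w) n l)
        (∑ j ∈ range n, a j * m u j l + ∑ j ∈ range (n + 1), lowerFactor (m u) n j * m' j l) u := by
    intro l
    simp_rw [upperFactor_apply]
    have h4 : ∑ j ∈ range n, a j * m u j l = ∑ j ∈ range (n + 1), a j * m u j l := by
      rw [sum_range_succ, h2 n le_rfl, zero_mul, add_zero]
    rw [h4, ← sum_add_distrib]
    exact HasDerivAt.fun_sum fun j _ => (h1 j).mul (hm j l)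
  refine ⟨a, h1, h2, h3, fun l hl => (h3 l).unique ?_⟩
  have h5 : (fun w => upperFactor (m w) n l) =ᶠ[𝓝 u] fun _ => 0 := by
    filter_upwards [(continuousAt_det_trunc hm n).eventually_ne hd] with w hw
    exact upperFactor_lt hw hl
  exact h5.hasDerivAt_iff.2 (hasDerivAt_const _ _)

/-- The upper triangular factor, truncated so as to be upper triangular at every point. -/
theorem entryDeriv_factors (hd : ∀ n, (trunc n (m u)).det ≠ 0) :
    ∃ A B : Matrix ℕ ℕ ℂ, EntryDeriv (fun w => lowerFactor (m w)) A u ∧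
      EntryDeriv (fun w => plusPart (upperFactor (m w))) B u ∧
      (∀ i j, i ≤ j → A i j = 0) ∧ (∀ i j, j < i → B i j = 0) ∧
      B = imul A (m u) + imul (lowerFactor (m u)) m' := by
  -- Each row is treated with its own minor. A common neighbourhood on which all minors are nonzero
  -- is not available, hence also the truncation of the upper factor.
  choose a h1 h2 h3 h4 using fun n => hasDerivAt_lowerFactor_row hm (hd n)
  have h5 : ∀ n l, (imul a (m u) + imul (lowerFactor (m u)) m') n l = ∑ j ∈ range n, a n j * m u j l
      + ∑ j ∈ range (n + 1), lowerFactor (m u) n j * m' j l := fun n l => by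
    rw [Matrix.add_apply, imul_apply_of_row (A := a) _ fun l hl => h2 n l hl, imul_apply_of_row _
      fun l hl => lowerFactor_gt _ hl]
  refine ⟨a, _, h1, fun n l => ?_, h2, fun i j hij => ?_, rfl⟩
  · rw [h5]
    simp only [plusPart]
    split_ifs with hl
    · exact h3 n l
    · rw [h4 n l (by omega)]
      exact hasDerivAt_const _ _
  · rw [h5, h4 i j hij]

end FactorDerivatives

/-! ### The Lax equations of the 2d-Toda lattice -/

section Lax

open Finset Matrix

theorem rowFin_shift : RowFin (shift ℂ) := rowFin_of_le 1 fun _ _ h => if_neg (by omega)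

theorem EntryDeriv.const (A : Matrix ℕ ℕ ℂ) (u : ℂ) : EntryDeriv (fun _ => A) 0 u :=
  fun _ _ => hasDerivAt_const _ _

theorem imul_zero (A : Matrix ℕ ℕ ℂ) : imul A 0 = 0 := by
  ext i j
  simp [imul]

variable {F : ℂ → Matrix ℕ ℕ ℂ} {F' : Matrix ℕ ℕ ℂ} {u : ℂ}

theorem EntryDeriv.conj_lower (hF : EntryDeriv F F' u) (hl : ∀ w, Lower (F w))
    (hd : ∀ n, (trunc n (F u)).det ≠ 0) (hinv : imul (triInv (F u)) (F u) = 1) :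
    EntryDeriv (fun w => imul (imul (F w) (shift ℂ)) (triInv (F w)))
      (icomm (imul F' (triInv (F u))) (imul (imul (F u) (shift ℂ)) (triInv (F u)))) u := by
  have hF' : RowFin F' := Lower.rowFin fun a b hab => hF.eq_zero fun w => hl w a b hab
  have h1 := hF.imul_row (EntryDeriv.const (shift ℂ) u) fun i =>
    ⟨i + 1, fun w l hl' => hl w i l (by omega)⟩
  have hS := (hl u).rowFin
  have hT := (lower_triInv (hl u)).rowFin
  rw [imul_zero, add_zero] at h1
  have h2 := h1.imul_row (hF.triInv_lower hl hd) fun i => ⟨i + 2, fun w l hl' => by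
    rw [imul_apply_of_row (N := i + 1) _ fun l hl' => hl w i l (by omega)]
    refine sum_eq_zero fun k hk => ?_
    rw [shift, if_neg (by have := mem_range.1 hk; omega), mul_zero]⟩
  convert h2 using 1
  have hSh := rowFin_shift
  rw [icomm, imul_neg, ← sub_eq_add_neg]
  congr 1
  · rw [← imul_assoc_row (hF'.imul hT) (hS.imul hSh), ← imul_assoc_row (hF'.imul hT) hS,
      imul_assoc_row hF' hT, hinv, imul_one]
  · rw [imul_assoc_row (hT) hF', ← imul_assoc_row (hS.imul hSh) hT]

theorem EntryDeriv.conj_upper (hF : EntryDeriv F F' u) (hl : ∀ w, Lower (F w).transpose)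
    (hd : ∀ n, (trunc n (F u)).det ≠ 0) (hinv : imul (triInv (F u)) (F u) = 1) :
    EntryDeriv (fun w => imul (imul (F w) (shift ℂ).transpose) (triInv (F w)))
      (icomm (imul F' (triInv (F u))) (imul (imul (F u) (shift ℂ).transpose) (triInv (F u)))) u := by
  have hF' : ColFin F' := (Lower.rowFin (A := F'.transpose) fun a b hab =>
    hF.eq_zero fun w => hl w a b hab).colFin_transpose
  have hSh := rowFin_shift.colFin_transpose
  have h1 := hF.imul_col (EntryDeriv.const (shift ℂ).transpose u) fun j =>
    ⟨j + 2, fun w l hl' => by rw [transpose_apply, shift, if_neg (by omega)]⟩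
  have hS : ColFin (F u) := (hl u).rowFin.colFin_transpose
  have hT : ColFin (triInv (F u)) := (upper_triInv (hl u)).rowFin.colFin_transpose
  rw [imul_zero, add_zero] at h1
  have h2 := h1.imul_col (hF.triInv_upper hl hd) fun j => ⟨j + 1, fun w l hl' =>
    upper_triInv (hl w) j l (by omega)⟩
  convert h2 using 1
  rw [icomm, imul_neg, ← sub_eq_add_neg]
  congr 1
  · rw [← imul_assoc_col (hS.imul hSh) hT, ← imul_assoc_col hS hSh,
      imul_assoc_col hT hS, hinv, imul_one]
  · rw [imul_assoc_col hF' hT, ← imul_assoc_col hT (hF'.imul hT)]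

theorem imul_ipow_shift {S L : Matrix ℕ ℕ ℂ} (hS : RowFin S) (hL : RowFin L)
    (h : imul S (shift ℂ) = imul L S) (k : ℕ) :
    imul S (ipow (shift ℂ) k) = imul (ipow L k) S := by
  induction k with
  | zero => rw [ipow_zero, ipow_zero, one_imul, imul_one]
  | succ k ih =>
    rw [rowFin_shift.ipow_succ', ← imul_assoc_row hS rowFin_shift, h, imul_assoc_row hL hS, ih,
      ← imul_assoc_row hL (hL.ipow k), ← hL.ipow_succ']

theorem imul_ipow_shift_transpose {S L : Matrix ℕ ℕ ℂ} (hS : ColFin S) (hL : ColFin L)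
    (h : imul S (shift ℂ).transpose = imul L S) (k : ℕ) :
    imul S (ipow (shift ℂ).transpose k) = imul (ipow L k) S := by
  have hSh := rowFin_shift.colFin_transpose
  induction k with
  | zero => rw [ipow_zero, ipow_zero, one_imul, imul_one]
  | succ k ih =>
    rw [hSh.ipow_succ', ← imul_assoc_col hSh (hSh.ipow k), h, imul_assoc_col hS (hSh.ipow k), ih,
      ← imul_assoc_col (hL.ipow k) hS, ← hL.ipow_succ']

theorem ipow_shift_imul (k : ℕ) (m : Matrix ℕ ℕ ℂ) (i j : ℕ) :
    imul (ipow (shift ℂ) k) m i j = m (i + k) j := by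
  induction k generalizing m with
  | zero => rw [ipow_zero, one_imul, add_zero]
  | succ k ih =>
    rw [ipow_succ, imul_assoc_row (rowFin_shift.ipow k) rowFin_shift, ih,
      imul_apply_of_row (N := i + k + 2) _ fun l hl => if_neg (by omega), sum_range_succ, shift,
      if_pos rfl, one_mul, sum_eq_zero, zero_add, add_assoc]
    intro l hl
    rw [shift, if_neg (by have := mem_range.1 hl; omega), zero_mul]

theorem imul_ipow_shift_transpose_apply (k : ℕ) (m : Matrix ℕ ℕ ℂ) (i j : ℕ) :
    imul m (ipow (shift ℂ).transpose k) i j = m i (j + k) := by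
  rw [← rowFin_shift.transpose_ipow]
  have := congrFun (congrFun (transpose_imul (ipow (shift ℂ) k) m.transpose) i) j
  rw [transpose_transpose] at this
  rw [← this, transpose_apply, ipow_shift_imul, transpose_apply]

/-- The decomposition of a matrix into an upper triangular and a strictly lower triangular part is
unique. This converts the factorization into explicit flows. -/
theorem parts_eq {X Y P : Matrix ℕ ℕ ℂ} (hX : ∀ i j, i ≤ j → X i j = 0)
    (hY : ∀ i j, j < i → Y i j = 0) (h : Y = X + P) : plusPart P = Y ∧ minusPart P = -X := by
  constructor <;> ext i j <;> have h1 := congrFun (congrFun h i) j <;> rw [Matrix.add_apply] at h1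
  · rw [plusPart]
    split_ifs with hij
    · rw [h1, hX i j hij, zero_add]
    · rw [hY i j (by omega)]
  · rw [minusPart, Matrix.neg_apply]
    split_ifs with hij
    · rw [hY i j hij] at h1; linear_combination -h1
    · rw [hX i j (by omega), neg_zero]

variable {t s : Times}

theorem rowFin_L1 (ht : SummableTimes t) (hs : SummableTimes s) (hd : ∀ n, tau n t s ≠ 0) :
    RowFin (L1 t s) := by
  rw [L1_eq ht hs hd]
  exact (rowFin_rankTwo1 _ _).diagConj _

theorem colFin_L2 (ht : SummableTimes t) (hs : SummableTimes s) (hd : ∀ n, tau n t s ≠ 0) :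
    ColFin (L2 t s) := by
  rw [L2_eq ht hs hd, rankTwo2_eq_transpose]
  exact (rowFin_rankTwo1 _ _).colFin_transpose

theorem rowFin_S1 (t s : Times) : RowFin (S1 t s) := rowFin_lowerFactor _

theorem S1_inv (hd : ∀ n, tau n t s ≠ 0) : Lower (triInv (S1 t s)) ∧
    imul (S1 t s) (triInv (S1 t s)) = 1 ∧ imul (triInv (S1 t s)) (S1 t s) = 1 :=
  triInv_lowerFactor hd

theorem S2_eq_imul (hd : ∀ n, tau n t s ≠ 0) : S2 t s = imul (S1 t s) (mom t s) := S2_eq hd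

theorem S1_imul_shift (hd : ∀ n, tau n t s ≠ 0) :
    imul (S1 t s) (shift ℂ) = imul (L1 t s) (S1 t s) := by
  have h1 := S1_inv hd
  rw [L1, imul_assoc_row ((rowFin_S1 t s).imul rowFin_shift) h1.1.rowFin, h1.2.2, imul_one]

theorem colFin_S2 (hd : ∀ n, tau n t s ≠ 0) : ColFin (S2 t s) := by
  rw [S2_eq hd]
  exact colFin_upperFactor hd

theorem colFin_triInv_S2 (hd : ∀ n, tau n t s ≠ 0) : ColFin (triInv (S2 t s)) := by
  rw [S2_eq hd]
  exact (upper_triInv (lower_transpose_upperFactor hd)).rowFin.colFin_transpose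

theorem S2_inv (hd : ∀ n, tau n t s ≠ 0) :
    imul (S2 t s) (triInv (S2 t s)) = 1 ∧ imul (triInv (S2 t s)) (S2 t s) = 1 := by
  rw [S2_eq hd]
  exact (triInv_upperFactor hd).2

theorem S2_imul_shift (hd : ∀ n, tau n t s ≠ 0) :
    imul (S2 t s) (shift ℂ).transpose = imul (L2 t s) (S2 t s) := by
  rw [L2, imul_assoc_col (colFin_triInv_S2 hd) (colFin_S2 hd), (S2_inv hd).2, imul_one]

theorem entryDeriv_mom_left (ht : SummableTimes t) (hs : SummableTimes s) (k : ℕ+) :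
    EntryDeriv (fun u => mom (Function.update t k u) s) (imul (ipow (shift ℂ) k) (mom t s)) (t k) := by
  intro i j
  rw [ipow_shift_imul, mom_eq ht hs]
  simp_rw [mom_eq (ht.update k _) hs]
  convert hasDerivAt_mu_left ht hs k _ using 2
  push_cast
  ring

theorem entryDeriv_mom_right (ht : SummableTimes t) (hs : SummableTimes s) (k : ℕ+) :
    EntryDeriv (fun u => mom t (Function.update s k u))
      (-imul (mom t s) (ipow (shift ℂ).transpose k)) (s k) := by
  intro i j
  rw [Matrix.neg_apply, imul_ipow_shift_transpose_apply, mom_eq ht hs]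
  simp_rw [mom_eq ht (hs.update k _)]
  convert hasDerivAt_mu_right ht hs k _ using 3
  push_cast
  ring

/-- Both factors and both Lax matrices along a flow. -/
theorem entryDeriv_of_flow {T S : ℂ → Times} {u : ℂ} (hT : T u = t) (hS : S u = s)
    {m' : Matrix ℕ ℕ ℂ} (hm : EntryDeriv (fun w => mom (T w) (S w)) m' u)
    (hd : ∀ n, tau n t s ≠ 0) :
    ∃ X Y : Matrix ℕ ℕ ℂ, EntryDeriv (fun w => S1 (T w) (S w)) (imul X (S1 t s)) u ∧
      EntryDeriv (fun w => S2 (T w) (S w)) (imul Y (S2 t s)) u ∧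
      EntryDeriv (fun w => L1 (T w) (S w)) (icomm X (L1 t s)) u ∧
      EntryDeriv (fun w => L2 (T w) (S w)) (icomm Y (L2 t s)) u ∧
      (∀ i j, i ≤ j → X i j = 0) ∧ (∀ i j, j < i → Y i j = 0) ∧
      imul Y (S2 t s) = imul X (S2 t s) + imul (S1 t s) m' := by
  subst hT hS
  set t := T u
  set s := S u
  obtain ⟨A, B, hA, hB, hA0, hB0, hAB⟩ := entryDeriv_factors hm hd
  have h1 : Lower (triInv (S1 t s)) ∧ imul (S1 t s) (triInv (S1 t s)) = 1 ∧
    imul (triInv (S1 t s)) (S1 t s) = 1 := S1_inv hd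
  have hA' : RowFin A := Lower.rowFin fun i j hij => hA0 i j hij.le
  have hB' : ColFin B := colFin_of_le 0 fun i j h => hB0 i j (by omega)
  have e1 : imul (imul A (triInv (S1 t s))) (S1 t s) = A := by
    rw [imul_assoc_row hA' h1.1.rowFin, h1.2.2, imul_one]
  have e2 : imul (imul B (triInv (S2 t s))) (S2 t s) = B := by
    rw [imul_assoc_col (colFin_triInv_S2 hd) (colFin_S2 hd), (S2_inv hd).2, imul_one]
  have hS2l : ∀ w, Lower (S2 (T w) (S w)).transpose := fun w i j hij => if_neg (by omega)
  refine ⟨imul A (triInv (S1 t s)), imul B (triInv (S2 t s)), ?_, ?_, ?_, ?_, ?_, ?_, ?_⟩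
  · rw [e1]; exact hA
  · rw [e2]; exact hB
  · refine EntryDeriv.conj_lower (F := fun w => S1 (T w) (S w)) hA
      (fun w => lower_lowerFactor _) (fun n => ?_) h1.2.2
    have : trunc n (S1 t s) * trunc n (triInv (S1 t s)) = 1 := by
      have hlow : Lower (S1 t s) := lower_lowerFactor _
      rw [← hlow.trunc_imul, h1.2.1]
      ext i j
      simp [trunc, Matrix.one_apply, Fin.ext_iff]
    exact left_ne_zero_of_mul_eq_one (show (trunc n (S1 t s)).det
      * (trunc n (triInv (S1 t s))).det = 1 by rw [← det_mul, this, det_one])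
  · refine EntryDeriv.conj_upper (F := fun w => S2 (T w) (S w)) hB hS2l (fun n => ?_) (S2_inv hd).2
    have : trunc n (triInv (S2 t s)).transpose * trunc n (S2 t s).transpose = 1 := by
      rw [← (upper_triInv (hS2l u)).trunc_imul, ← transpose_imul, (S2_inv hd).1]
      ext i j
      simp [trunc, Matrix.one_apply, Fin.ext_iff, eq_comm]
    have h3 := right_ne_zero_of_mul_eq_one (show (trunc n (triInv (S2 t s)).transpose).det
      * (trunc n (S2 t s).transpose).det = 1 by rw [← det_mul, this, det_one])
    rwa [det_trunc_transpose] at h3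
  · intro i j hij
    rw [imul_apply_of_row (N := i) _ fun l hl => hA0 i l hl]
    refine sum_eq_zero fun l hl => ?_
    rw [h1.1 l j (by have := mem_range.1 hl; omega), mul_zero]
  · intro i j hij
    rw [imul_apply_of_col (N := j + 1) _ fun l hl => upper_triInv (hS2l u) j l (by omega)]
    refine sum_eq_zero fun l hl => ?_
    rw [hB0 i l (by have := mem_range.1 hl; omega), zero_mul]
  · rw [e2, hAB, S2_eq_imul hd, ← imul_assoc_row (hA'.imul h1.1.rowFin) (rowFin_S1 t s), e1]
    rfl

variable (ht : SummableTimes t) (hs : SummableTimes s) (hd : ∀ n, tau n t s ≠ 0)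

include ht hs hd

/-- Writing the derivatives of the factors as `X S₁` and `Y S₂`, the relation `S₁ m = S₂` gives `Y
S₂ = X S₂ + S₁ Λ^k m = (X + L₁^k) S₂`. Thus `Y - X = L₁^k` with `Y` upper and `X` strictly lower
triangular. In `flow_right` the sign is reversed and `L₂^k = X - Y`. -/
theorem flow_left (k : ℕ+) :
    EntryDeriv (fun u => S1 (Function.update t k u) s)
      (imul (-minusPart (ipow (L1 t s) k)) (S1 t s)) (t k) ∧
    EntryDeriv (fun u => S2 (Function.update t k u) s)
      (imul (plusPart (ipow (L1 t s) k)) (S2 t s)) (t k) ∧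
    EntryDeriv (fun u => L1 (Function.update t k u) s)
      (icomm (plusPart (ipow (L1 t s) k)) (L1 t s)) (t k) ∧
    EntryDeriv (fun u => L2 (Function.update t k u) s)
      (icomm (plusPart (ipow (L1 t s) k)) (L2 t s)) (t k) := by
  obtain ⟨X, Y, h1, h2, h3, h4, hX, hY, hXY⟩ := entryDeriv_of_flow (t := t) (s := s)
    (T := fun u => Function.update t k u) (S := fun _ => s) (u := t k) (by simp) rfl
    (entryDeriv_mom_left ht hs k) hd
  have hL := rowFin_L1 ht hs hd
  have hX' : RowFin X := Lower.rowFin fun i j hij => hX i j hij.le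
  have e1 : Y = X + ipow (L1 t s) k := by
    have e2 : imul (S1 t s) (imul (ipow (shift ℂ) k) (mom t s))
        = imul (ipow (L1 t s) k) (S2 t s) := by
      rw [← imul_assoc_row (rowFin_S1 t s) (rowFin_shift.ipow k),
        imul_ipow_shift (rowFin_S1 t s) hL (S1_imul_shift hd), imul_assoc_row (hL.ipow k)
        (rowFin_S1 t s), S2_eq_imul hd]
    have e3 := congrArg (fun Z => imul Z (triInv (S2 t s))) hXY
    have e4 : imul X (S2 t s) + imul (S1 t s) (imul (ipow (shift ℂ) k) (mom t s))
        = imul (X + ipow (L1 t s) k) (S2 t s) := by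
      rw [e2]
      have := sub_imul_row (A := X) (B := -ipow (L1 t s) k) (C := S2 t s) hX' (hL.ipow k).neg
      rw [sub_neg_eq_add, neg_imul, sub_neg_eq_add] at this
      exact this.symm
    rw [e4, imul_assoc_col (colFin_S2 hd) (colFin_triInv_S2 hd), imul_assoc_col (colFin_S2 hd)
      (colFin_triInv_S2 hd), (S2_inv hd).1, imul_one, imul_one] at e3
    exact e3
  obtain ⟨e5, e6⟩ := parts_eq hX hY e1
  rw [e5, e6, neg_neg]
  refine ⟨h1, h2, ?_, h4⟩
  -- The power `L₁^k` commutes with `L₁`, so that the strictly lower part with a minus sign may be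
  -- replaced by the upper part.
  have e7 : icomm Y (L1 t s) = icomm X (L1 t s) := by
    rw [e1]
    have e8 := sub_imul_row (A := X) (B := -ipow (L1 t s) k) (C := L1 t s) hX' (hL.ipow k).neg
    have e9 := imul_sub_row (A := L1 t s) (B := X) (C := -ipow (L1 t s) k) hL
    rw [sub_neg_eq_add, neg_imul, sub_neg_eq_add] at e8
    rw [sub_neg_eq_add, imul_neg, sub_neg_eq_add] at e9
    rw [icomm, icomm, e8, e9, ← ipow_succ, ← hL.ipow_succ']
    abel
  rw [e7]
  exact h3

theorem flow_right (k : ℕ+) :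
    EntryDeriv (fun u => S1 t (Function.update s k u))
      (imul (minusPart (ipow (L2 t s) k)) (S1 t s)) (s k) ∧
    EntryDeriv (fun u => S2 t (Function.update s k u))
      (imul (-plusPart (ipow (L2 t s) k)) (S2 t s)) (s k) ∧
    EntryDeriv (fun u => L1 t (Function.update s k u))
      (icomm (minusPart (ipow (L2 t s) k)) (L1 t s)) (s k) ∧
    EntryDeriv (fun u => L2 t (Function.update s k u))
      (icomm (minusPart (ipow (L2 t s) k)) (L2 t s)) (s k) := by
  obtain ⟨X, Y, h1, h2, h3, h4, hX, hY, hXY⟩ := entryDeriv_of_flow (t := t) (s := s)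
    (T := fun _ => t) (S := fun u => Function.update s k u) (u := s k) rfl (by simp)
    (entryDeriv_mom_right ht hs k) hd
  have hL := colFin_L2 ht hs hd
  have hY' : ColFin Y := colFin_of_le 0 fun i j h => hY i j (by omega)
  have e1 : Y = X - ipow (L2 t s) k := by
    have e2 : imul (S1 t s) (imul (mom t s) (ipow (shift ℂ).transpose k))
        = imul (ipow (L2 t s) k) (S2 t s) := by
      rw [← imul_assoc_row_col (rowFin_S1 t s) (rowFin_shift.colFin_transpose.ipow k),
        ← S2_eq_imul hd, imul_ipow_shift_transpose (colFin_S2 hd) hL (S2_imul_shift hd)]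
    have e3 := congrArg (fun Z => imul Z (triInv (S2 t s))) hXY
    rw [imul_neg, ← sub_eq_add_neg, e2, ← sub_imul_col (colFin_S2 hd),
      imul_assoc_col (colFin_S2 hd) (colFin_triInv_S2 hd), imul_assoc_col (colFin_S2 hd)
      (colFin_triInv_S2 hd), (S2_inv hd).1, imul_one, imul_one] at e3
    exact e3
  obtain ⟨e5, e6⟩ := parts_eq (X := -X) (Y := -Y) (P := ipow (L2 t s) k)
    (fun i j hij => by rw [Matrix.neg_apply, hX i j hij, neg_zero])
    (fun i j hij => by rw [Matrix.neg_apply, hY i j hij, neg_zero]) (by rw [e1]; abel)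
  rw [e5, e6, neg_neg, neg_neg]
  refine ⟨h1, h2, h3, ?_⟩
  have e7 : X = Y - -ipow (L2 t s) k := by rw [e1]; abel
  have e10 : ColFin (-ipow (L2 t s) k) := RowFin.neg (hL.ipow k)
  have e8 := sub_imul_col (A := Y) (B := -ipow (L2 t s) k) (C := L2 t s) hL
  have e9 := imul_sub_col (A := L2 t s) (B := Y) (C := -ipow (L2 t s) k) hY' e10
  have e11 : icomm X (L2 t s) = icomm Y (L2 t s) := by
    rw [icomm, icomm, e7, e8, e9, neg_imul, imul_neg, ← ipow_succ, ← hL.ipow_succ']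
    abel
  rw [e11]
  exact h4

theorem toda_lattice (k : ℕ+) (a b : ℕ) :
    HasDerivAt (fun u => L1 (Function.update t k u) s a b)
      (icomm (plusPart (ipow (L1 t s) k)) (L1 t s) a b) (t k) ∧
    HasDerivAt (fun u => L2 (Function.update t k u) s a b)
      (icomm (plusPart (ipow (L1 t s) k)) (L2 t s) a b) (t k) ∧
    HasDerivAt (fun u => L1 t (Function.update s k u) a b)
      (icomm (minusPart (ipow (L2 t s) k)) (L1 t s) a b) (s k) ∧
    HasDerivAt (fun u => L2 t (Function.update s k u) a b)
      (icomm (minusPart (ipow (L2 t s) k)) (L2 t s) a b) (s k) :=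
  ⟨(flow_left ht hs hd k).2.2.1 a b, (flow_left ht hs hd k).2.2.2 a b,
    (flow_right ht hs hd k).2.2.1 a b, (flow_right ht hs hd k).2.2.2 a b⟩

end Lax

end ToeplitzLattice

namespace ToeplitzLattice

/-! ### The Toeplitz lattice as a Hamiltonian flow -/

section Flows

open Finset Matrix

section

variable {K : Type*} [Field K]

/-- The matrix all of whose columns are the vector `x_c / H_c` truncated after `c = m`. -/
def truncCol (x H : ℕ → K) (m : ℕ) : Matrix ℕ ℕ K :=
  fun c _ => if c ≤ m then x c * (H c)⁻¹ else 0

variable {x y H : ℕ → K} (hx0 : x 0 = 1) (hy0 : y 0 = 1)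
  (hH : ∀ n, H n ≠ 0) (hs : ∀ n, H (n + 1) = H n * (1 - x (n + 1) * y (n + 1)))

include hx0 hy0 hH hs

/-- This is the Christoffel–Darboux kernel at the origin. It telescopes because `x y / H` at an
index is the difference of consecutive values of `1 / H`. -/
theorem sum_mul_div_norm (a : ℕ) : ∑ c ∈ range (a + 1), y c * (x c * (H c)⁻¹) = (H a)⁻¹ := by
  induction a with
  | zero => simp [hx0, hy0]
  | succ a ih =>
    rw [sum_range_succ, ih]
    have h1 := hH a
    have h2 := hH (a + 1)
    have h3 := hs a
    field_simp
    rw [h3]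
    ring

/-- The vector `x_c / H_c` is formally annihilated by the rank two matrix. Truncating it after the
index `m` leaves only the rows `a ≥ m`. -/
theorem imul_rankTwo1_truncated (m a : ℕ) :
    imul (rankTwo1 x y) (truncCol x H m) a 0
      = if m ≤ a then -(x (a + 1) * (H m)⁻¹) else 0 := by
  rw [imul_apply_of_row (N := a + 2) _ fun l hl => rankTwo1_gt x y (by omega), sum_range_succ,
    rankTwo1_succ]
  simp only [truncCol]
  have h1 : ∑ c ∈ range (a + 1), rankTwo1 x y a c * (if c ≤ m then x c * (H c)⁻¹ else 0)
      = -x (a + 1) * ∑ c ∈ range (a + 1), if c ≤ m then y c * (x c * (H c)⁻¹) else 0 := by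
    rw [mul_sum]
    refine sum_congr rfl fun c hc => ?_
    rw [rankTwo1_le x y (by have := mem_range.1 hc; omega)]
    split_ifs <;> ring
  rw [h1]
  by_cases ha : a < m
  · have h2 : ∀ c ∈ range (a + 1), (if c ≤ m then y c * (x c * (H c)⁻¹) else 0)
        = y c * (x c * (H c)⁻¹) := fun c hc => if_pos (by have := mem_range.1 hc; omega)
    rw [sum_congr rfl h2, sum_mul_div_norm hx0 hy0 hH hs, if_pos (by omega), if_neg (by omega)]
    have h1 := hH a
    have h2 := hH (a + 1)
    have h3 := hs a
    field_simp
    rw [h3]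
    ring
  · rw [if_neg (by omega), if_pos (by omega), ← sum_filter]
    have h2 : (range (a + 1)).filter (· ≤ m) = range (m + 1) := by
      ext c
      simp only [mem_filter, mem_range]
      omega
    rw [h2, sum_mul_div_norm hx0 hy0 hH hs]
    ring

/-- The flow of `x` (and of `y` in the other times) is a sum over the strictly lower part of a
power, whereas the gradient is a sum over the entries to the right. Peeling one factor off the power
and applying it to the truncated null vector converts one into the other. -/
theorem mul_sum_ipow_rankTwo1 (j m : ℕ) :
    H (m + 1) * ∑ c ∈ range (m + 1), ipow (rankTwo1 x y) (j + 1) (m + 1) c * (x c * (H c)⁻¹)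
      = -((1 - x (m + 1) * y (m + 1)) * gradY x (ipow (rankTwo1 x y) j) m) := by
  have hR := rowFin_rankTwo1 x y
  have h1 := congrFun (congrFun (imul_assoc_row (A := ipow (rankTwo1 x y) j)
    (C := truncCol x H m) (hR.ipow j) hR) (m + 1)) 0
  obtain ⟨L0, hL0⟩ := (hR.ipow j) (m + 1)
  obtain ⟨L, hL⟩ : ∃ L, L = max L0 (m + 1) := ⟨_, rfl⟩
  have hL1 : ∀ l, L ≤ l → ipow (rankTwo1 x y) j (m + 1) l = 0 := fun l hl => hL0 l (by omega)
  rw [← ipow_succ, imul_apply_of_col (B := truncCol x H m) (N := m + 1) _ fun l hl =>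
    if_neg (by omega), imul_apply_of_row _ hL1] at h1
  have h2 : ∑ c ∈ range (m + 1), ipow (rankTwo1 x y) (j + 1) (m + 1) c * (x c * (H c)⁻¹)
      = ∑ c ∈ range (m + 1), ipow (rankTwo1 x y) (j + 1) (m + 1) c
        * truncCol x H m c 0 :=
    sum_congr rfl fun c hc => by rw [truncCol, if_pos (by have := mem_range.1 hc; omega)]
  rw [h2, h1, gradY_eq (L := L) fun c hc => by rw [hL1 c hc, zero_mul]]
  simp_rw [imul_rankTwo1_truncated hx0 hy0 hH hs, mul_ite, mul_zero]
  rw [← sum_filter]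
  have h3 : (range L).filter (m ≤ ·) = Ico m L := by
    ext c
    simp only [mem_filter, mem_range, mem_Ico]
    omega
  rw [h3, hs, mul_sum, mul_sum, ← sum_neg_distrib]
  refine sum_congr rfl fun c _ => ?_
  have := hH m
  field_simp

end

variable {t s : Times} (ht : SummableTimes t) (hs : SummableTimes s) (hd : ∀ n, tau n t s ≠ 0)

include ht hs hd

theorem h_succ (n : ℕ) : h (n + 1) t s = h n t s * (1 - x (n + 1) t s * y (n + 1) t s) := by
  rw [← h_succ_div ht hs hd, mul_div_cancel₀ _ (h_ne_zero hd n)]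

theorem y_eq_triInv (n : ℕ) : y n t s = h n t s * triInv (S2 t s) 0 n := by
  rw [y_eq_x ht hs hd, x_eq, triInv_S2_apply ht hs hd]
  have := h_ne_zero hd n
  field_simp

theorem ipow_L1_apply (k a b : ℕ) : ipow (L1 t s) k a b = h a t s
    * ipow (rankTwo1 (fun n => x n t s) (fun n => y n t s)) k a b * (h b t s)⁻¹ := by
  rw [L1_eq ht hs hd, diagConj_ipow fun n => inv_ne_zero (h_ne_zero hd n), diagConj, inv_inv]

theorem ipow_L2_apply (k a b : ℕ) : ipow (L2 t s) k a b
    = ipow (rankTwo1 (fun n => y n t s) (fun n => x n t s)) k b a := by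
  rw [L2_eq ht hs hd, rankTwo2_eq_transpose, ← (rowFin_rankTwo1 _ _).transpose_ipow,
    transpose_apply]

omit ht hs hd in
theorem y_def (n : ℕ) (t s : Times) : y n t s = h n t s * triInv (S2 t s) 0 n := by
  rw [y, ← Polynomial.coeff_zero_eq_eval_zero, p2]
  simp only [Polynomial.finsetSum_coeff, Polynomial.coeff_C_mul, Polynomial.coeff_X_pow]
  simp

/-- The derivative of `y` along a flow `∂S₂ = Y S₂` with `Y` upper triangular. -/
theorem hasDerivAt_y {T S : ℂ → Times} {u : ℂ} (hT : T u = t) (hS : S u = s) {Y : Matrix ℕ ℕ ℂ}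
    (hY : ∀ i j, j < i → Y i j = 0)
    (hcont : ∀ n, ∀ᶠ w in 𝓝 u, tau n (T w) (S w) ≠ 0)
    (hF : EntryDeriv (fun w => S2 (T w) (S w)) (imul Y (S2 t s)) u) (n : ℕ) :
    HasDerivAt (fun w => y n (T w) (S w))
      (-(h n t s * ∑ c ∈ range n, y c t s * (h c t s)⁻¹ * Y c n)) u := by
  have h1 : ∀ w, Lower (S2 (T w) (S w)).transpose := fun w i j hij => if_neg (by omega)
  have hdet : ∀ n, (trunc n (S2 (T u) (S u))).det ≠ 0 := by
    intro n
    have : trunc n (triInv (S2 t s)).transpose * trunc n (S2 t s).transpose = 1 := by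
      rw [← (upper_triInv (hT ▸ hS ▸ h1 u)).trunc_imul, ← transpose_imul, (S2_inv hd).1]
      ext i j
      simp [trunc, Matrix.one_apply, Fin.ext_iff, eq_comm]
    have h3 := right_ne_zero_of_mul_eq_one (show (trunc n (triInv (S2 t s)).transpose).det
      * (trunc n (S2 t s).transpose).det = 1 by rw [← det_mul, this, det_one])
    rwa [det_trunc_transpose, ← hT, ← hS] at h3
  have h2 := hF.triInv_upper h1 hdet 0 n
  -- Only the diagonal entry of `Y` contributes to the derivative of `h_n`. It cancels the term `c =
  -- n` in the derivative of the inverse, which is why the final sum stops before `n`.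
  have h3 : HasDerivAt (fun w => h n (T w) (S w)) (Y n n * h n t s) u := by
    have h4 := hF n n
    rw [imul_apply_of_col (N := n + 1) _ fun l hl => hT ▸ hS ▸ h1 u n l (by omega), sum_range_succ,
      sum_eq_zero fun l hl => by rw [hY n l (mem_range.1 hl), zero_mul], zero_add] at h4
    have h5 : S2 t s n n = h n t s := by rw [S2_eq hd, upperFactor_self (hd n), h_eq]
    rw [h5] at h4
    refine h4.congr_of_eventuallyEq ?_
    filter_upwards [hcont n] with w hw
    have h6 : S2 (T w) (S w) n n = upperFactor (mom (T w) (S w)) n n := if_pos le_rfl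
    rw [h6, upperFactor_self hw, h_eq]
  have h7 : (-imul (imul (triInv (S2 (T u) (S u))) (imul Y (S2 t s))) (triInv (S2 (T u) (S u)))) 0 n
      = -∑ c ∈ range (n + 1), y c t s * (h c t s)⁻¹ * Y c n := by
    have hYc : ColFin Y := colFin_of_le 0 fun i j hij => hY i j (by omega)
    rw [hT, hS, imul_assoc_col (hYc.imul (colFin_S2 hd)) (colFin_triInv_S2 hd),
      imul_assoc_col (colFin_S2 hd) (colFin_triInv_S2 hd), (S2_inv hd).1, imul_one,
      Matrix.neg_apply, imul_apply_of_col (N := n + 1) _ fun l hl => hY l n (by omega)]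
    congr 1
    refine sum_congr rfl fun c _ => ?_
    rw [y_eq_triInv ht hs hd]
    have := h_ne_zero hd c
    field_simp
  rw [h7] at h2
  have h10 : (fun w => y n (T w) (S w))
      = fun w => h n (T w) (S w) * triInv (S2 (T w) (S w)) 0 n := funext fun w => y_def n _ _
  rw [h10]
  refine (h3.mul h2).congr_deriv ?_
  have h8 := y_eq_triInv ht hs hd n
  have h9 := mul_inv_cancel₀ (h_ne_zero hd n)
  simp only [hT, hS]
  rw [sum_range_succ]
  linear_combination -Y n n * h8 - y n t s * Y n n * h9

theorem eventually_tau_left (k : ℕ+) (n : ℕ) :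
    ∀ᶠ w in 𝓝 (t k), tau n (Function.update t k w) s ≠ 0 := by
  have h1 := continuousAt_det_trunc (entryDeriv_mom_left ht hs k) n
  refine h1.eventually_ne ?_
  rw [Function.update_eq_self]
  exact hd n

theorem eventually_tau_right (k : ℕ+) (n : ℕ) :
    ∀ᶠ w in 𝓝 (s k), tau n t (Function.update s k w) ≠ 0 := by
  have h1 := continuousAt_det_trunc (entryDeriv_mom_right ht hs k) n
  refine h1.eventually_ne ?_
  rw [Function.update_eq_self]
  exact hd n

theorem atXY_xVar_yVar (n : ℕ) :
    MvPolynomial.eval (Sum.elim (fun n : ℕ+ => x n t s) (fun n : ℕ+ => y n t s)) (xVar n) = x n t s ∧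
    MvPolynomial.eval (Sum.elim (fun n : ℕ+ => x n t s) (fun n : ℕ+ => y n t s)) (yVar n)
      = y n t s := by
  cases n with
  | zero => simp [xVar, yVar, x_zero, y_zero ht hs hd]
  | succ n => simp only [xVar, yVar, Nat.zero_lt_succ, dif_pos, MvPolynomial.eval_X]; exact ⟨rfl, rfl⟩

/-- The flow of `x` is column `0` of the flow of `S₁`, and that of `y` is row `0` of the flow of
`S₂⁻¹`. Sums over the strictly upper part of a power are handled by `mul_gradX`, those over the
strictly lower part by `mul_sum_ipow_rankTwo1`. For the times `s` the same two identities apply with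
`x` and `y` exchanged, `L₂` being the transpose of such a matrix. -/
theorem toeplitz_lattice (i n : ℕ+) :
    HasDerivAt (fun u => x n (Function.update t i u) s)
      ((1 - x n t s * y n t s) * atXY t s (dForm (H1 i) (Sum.inr n))) (t i) ∧
    HasDerivAt (fun u => y n (Function.update t i u) s)
      (-(1 - x n t s * y n t s) * atXY t s (dForm (H1 i) (Sum.inl n))) (t i) ∧
    HasDerivAt (fun u => x n t (Function.update s i u))
      ((1 - x n t s * y n t s) * atXY t s (dForm (H2 i) (Sum.inr n))) (s i) ∧
    HasDerivAt (fun u => y n t (Function.update s i u))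
      (-(1 - x n t s * y n t s) * atXY t s (dForm (H2 i) (Sum.inl n))) (s i) := by
  obtain ⟨m, rfl⟩ : ∃ m : ℕ, n = m.succPNat := ⟨n.natPred, by simp⟩
  obtain ⟨j, rfl⟩ : ∃ j : ℕ, i = j.succPNat := ⟨i.natPred, by simp⟩
  have hR := fun x y : ℕ → ℂ => rowFin_rankTwo1 x y
  have hcomm : ∀ x y : ℕ → ℂ, imul (ipow (rankTwo1 x y) j) (rankTwo1 x y)
      = imul (rankTwo1 x y) (ipow (rankTwo1 x y) j) := fun x y => by
    rw [← ipow_succ, (hR x y).ipow_succ']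
  have hx0 := x_zero t s
  have hy0 := y_zero ht hs hd
  have hxy := atXY_xVar_yVar ht hs hd
  have hj : ((j.succPNat : ℕ+) : ℕ) - 1 = j := by simp
  obtain ⟨a1, a2, -, -⟩ := flow_left ht hs hd j.succPNat
  obtain ⟨b1, b2, -, -⟩ := flow_right ht hs hd j.succPNat
  simp only [Nat.succPNat_coe, Nat.succ_eq_add_one] at a1 a2 b1 b2 ⊢
  have e1 := (dForm_H1_inr j.succPNat m).2
  have e2 := (dForm_H1_inl j.succPNat m).2
  have e3 := (dForm_H2_inr j.succPNat m).2
  have e4 := (dForm_H2_inl j.succPNat m).2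
  rw [hj] at e1 e2 e3 e4
  rw [atXY, atXY, atXY, atXY, e1, e2, e3, e4, map_gradY, map_gradX, map_gradX, map_gradY]
  simp only [(hxy _).1, (hxy _).2]
  simp_rw [x_eq] at a1 b1 hx0 ⊢
  refine ⟨?_, ?_, ?_, ?_⟩
  · convert a1 (m + 1) 0 using 1
    have h1 := mul_sum_ipow_rankTwo1 (x := fun n => S1 t s n 0) (y := fun n => y n t s)
      (H := fun n => h n t s) hx0 hy0 (h_ne_zero hd) (fun n => by
        rw [h_succ ht hs hd, x_eq]) j m
    rw [← neg_eq_iff_eq_neg.2 h1, imul_apply_of_row (N := m + 1) _ fun l hl => by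
      rw [Matrix.neg_apply, minusPart, if_neg (by omega), neg_zero], mul_sum, ← sum_neg_distrib]
    refine sum_congr rfl fun c hc => ?_
    rw [Matrix.neg_apply, minusPart, if_pos (mem_range.1 hc), ipow_L1_apply ht hs hd]
    simp_rw [x_eq]
    ring
  · convert hasDerivAt_y ht hs hd (T := fun u => Function.update t j.succPNat u) (S := fun _ => s)
      (by simp) rfl (Y := plusPart (ipow (L1 t s) (j + 1))) (fun i j hij => if_neg (by omega))
      (eventually_tau_left ht hs hd _) a2 (m + 1) using 1
    have h1 := mul_gradX ((hR (fun n => S1 t s n 0) (fun n => y n t s)).ipow j) (hcomm _ _) m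
    rw [neg_mul, h1, ← ipow_succ, colFlow, mul_sum]
    congr 1
    refine sum_congr rfl fun c hc => ?_
    rw [plusPart, if_pos (mem_range.1 hc).le, ipow_L1_apply ht hs hd]
    simp_rw [x_eq]
    have := h_ne_zero hd c
    have := h_ne_zero hd (m + 1)
    field_simp
  · convert b1 (m + 1) 0 using 1
    have h1 := mul_gradX ((hR (fun n => y n t s) (fun n => S1 t s n 0)).ipow j) (hcomm _ _) m
    rw [mul_comm (S1 t s (m + 1) 0), h1, ← ipow_succ, colFlow,
      imul_apply_of_row (N := m + 1) _ fun l hl => by rw [minusPart, if_neg (by omega)]]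
    refine sum_congr rfl fun c hc => ?_
    rw [minusPart, if_pos (mem_range.1 hc), ipow_L2_apply ht hs hd]
    simp_rw [x_eq]
    ring
  · convert hasDerivAt_y ht hs hd (T := fun _ => t) (S := fun u => Function.update s j.succPNat u)
      rfl (by simp) (Y := -plusPart (ipow (L2 t s) (j + 1)))
      (fun i j hij => by rw [Matrix.neg_apply, plusPart, if_neg (by omega), neg_zero])
      (eventually_tau_right ht hs hd _) b2 (m + 1) using 1
    have h1 := mul_sum_ipow_rankTwo1 (x := fun n => y n t s) (y := fun n => S1 t s n 0)
      (H := fun n => h n t s) hy0 hx0 (h_ne_zero hd) (fun n => by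
        rw [h_succ ht hs hd, x_eq]; ring) j m
    rw [neg_mul, mul_comm (S1 t s (m + 1) 0), ← h1, mul_sum, mul_sum, ← sum_neg_distrib]
    refine sum_congr rfl fun c hc => ?_
    rw [Matrix.neg_apply, plusPart, if_pos (mem_range.1 hc).le, ipow_L2_apply ht hs hd]
    simp_rw [x_eq]
    ring

end Flows

/-! ### Derivatives of the tau functions and the Toda identities -/

section LogDerivatives

open Finset Matrix

variable {t s : Times} (ht : SummableTimes t) (hs : SummableTimes s)

include ht hs

theorem hasDerivAt_tau_left (k : ℕ+) (n : ℕ) :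
    HasDerivAt (fun u => tau n (Function.update t k u) s)
      (∑ r : Fin n, ((trunc n (mom t s)).updateRow r fun l => mom t s (r + k) l).det) (t k) := by
  have h1 := hasDerivAt_det (M := fun u => trunc n (mom (Function.update t k u) s))
    (M' := trunc n (imul (ipow (shift ℂ) k) (mom t s)))
    fun i j => entryDeriv_mom_left ht hs k i j
  rw [Function.update_eq_self] at h1
  refine h1.congr_deriv (sum_congr rfl fun r _ => ?_)
  congr 2
  ext l
  rw [trunc, ipow_shift_imul]

theorem hasDerivAt_tau_right (k : ℕ+) (n : ℕ) :
    HasDerivAt (fun u => tau n t (Function.update s k u))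
      (-∑ r : Fin n, ((trunc n (mom t s).transpose).updateRow r
        fun l => (mom t s).transpose (r + k) l).det) (s k) := by
  have h1 := hasDerivAt_det
    (M := fun u => trunc n (mom t (Function.update s k u)).transpose)
    (M' := trunc n (-imul (mom t s) (ipow (shift ℂ).transpose k)).transpose)
    fun i j => (entryDeriv_mom_right ht hs k).transpose i j
  simp_rw [det_trunc_transpose, Function.update_eq_self] at h1
  refine h1.congr_deriv ?_
  rw [← sum_neg_distrib]
  refine sum_congr rfl fun r _ => ?_
  have h2 : trunc n (-imul (mom t s) (ipow (shift ℂ).transpose k)).transpose r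
      = (-1 : ℂ) • fun l : Fin n => (mom t s).transpose (r + k) l := by
    ext l
    rw [trunc, transpose_apply, Matrix.neg_apply, imul_ipow_shift_transpose_apply, Pi.smul_apply,
      transpose_apply, smul_eq_mul, neg_one_mul]
  rw [h2, det_updateRow_smul, neg_one_mul]

end LogDerivatives

end ToeplitzLattice

namespace ToeplitzLattice

section TauIdentities

open Finset Matrix

/-- Replacing row `r` by row `r + 1` produces a repeated row unless `r` is the last one. The
surviving determinant is evaluated by Cramer's rule. -/
theorem sum_det_updateRow_succ {K : Type*} [Field K] {m : Matrix ℕ ℕ K} {n : ℕ}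
    (hd : (trunc (n + 1) m).det ≠ 0) :
    ∑ r : Fin (n + 1), ((trunc (n + 1) m).updateRow r fun l => m (r + 1) l).det
      = -lowerFactor m (n + 1) n * (trunc (n + 1) m).det := by
  rw [sum_eq_single (Fin.last n)]
  · have h1 := lowerFactor_mul_det hd (Fin.last n)
    have h2 : (fun l : Fin (n + 1) => -m (n + 1) l) = (-1 : K) • fun l : Fin (n + 1) => m (n + 1) l := by
      ext l
      simp
    rw [h2, det_updateRow_smul, Fin.val_last] at h1
    rw [Fin.val_last]
    linear_combination h1
  · intro r _ hr
    have hr' : (r : ℕ) < n := lt_of_le_of_ne (Nat.lt_succ_iff.1 r.2) fun h => hr (Fin.ext h)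
    refine det_zero_of_row_eq (i := r) (j := ⟨r + 1, by omega⟩) (by simp [Fin.ext_iff]) ?_
    ext l
    rw [updateRow_self, updateRow_ne (by simp [Fin.ext_iff])]
    rfl
  · simp

variable {t s : Times} (ht : SummableTimes t) (hs : SummableTimes s)

omit ht hs in
theorem tau_zero (t s : Times) : tau 0 t s = 1 := det_isEmpty

/-- `∂ log τ_n / ∂t₁` as an entry of the lower triangular factor. -/
noncomputable def subdiag (m : Matrix ℕ ℕ ℂ) : ℕ → ℂ
  | 0 => 0
  | n + 1 => lowerFactor m (n + 1) n

include ht hs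

theorem hasDerivAt_tau_left_one {n : ℕ} (hd : tau n t s ≠ 0) :
    HasDerivAt (fun u => tau n (Function.update t 1 u) s)
      (-subdiag (mom t s) n * tau n t s) (t 1) := by
  cases n with
  | zero =>
    simp_rw [tau_zero, subdiag]
    simpa using hasDerivAt_const (t 1) (1 : ℂ)
  | succ n =>
    refine (hasDerivAt_tau_left ht hs 1 (n + 1)).congr_deriv ?_
    exact sum_det_updateRow_succ hd

theorem hasDerivAt_tau_right_one {n : ℕ} (hd : tau n t s ≠ 0) :
    HasDerivAt (fun u => tau n t (Function.update s 1 u))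
      (subdiag (mom t s).transpose n * tau n t s) (s 1) := by
  cases n with
  | zero =>
    simp_rw [tau_zero, subdiag]
    simpa using hasDerivAt_const (s 1) (1 : ℂ)
  | succ n =>
    refine (hasDerivAt_tau_right ht hs 1 (n + 1)).congr_deriv ?_
    have h1 := sum_det_updateRow_succ (m := (mom t s).transpose) (n := n)
      (by rw [det_trunc_transpose]; exact hd)
    rw [det_trunc_transpose] at h1
    rw [subdiag, tau]
    simp only [PNat.one_coe]
    linear_combination -h1

theorem dlogT_one {n : ℕ} (hd : tau n t s ≠ 0) :
    dlogT 1 (tau n) t s = -subdiag (mom t s) n := by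
  rw [dlogT, pdT, pd, (hasDerivAt_tau_left_one ht hs hd).deriv, mul_div_cancel_right₀ _ hd]

theorem eventually_tau_ne_right (k : ℕ+) {n : ℕ} (hd : tau n t s ≠ 0) :
    ∀ᶠ w in 𝓝 (s k), tau n t (Function.update s k w) ≠ 0 :=
  ((hasDerivAt_tau_right ht hs k n).continuousAt).eventually_ne (by
    rwa [Function.update_eq_self])

theorem pdS_dlogT_one (k : ℕ+) {n : ℕ} (hd : tau n t s ≠ 0) :
    pdS k (dlogT 1 (tau n)) t s
      = deriv (fun u => -subdiag (mom t (Function.update s k u)) n) (s k) := by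
  refine EventuallyEq.deriv_eq ?_
  filter_upwards [eventually_tau_ne_right ht hs k hd] with w hw
  exact dlogT_one ht (hs.update k w) hw

/-- The rows of the lower factor move by the linear system with the shifted upper factor. -/
theorem lowerFactor_row_right (k : ℕ+) {n : ℕ} (hd : tau n t s ≠ 0) :
    ∃ a : ℕ → ℂ,
      (∀ j, HasDerivAt (fun w => lowerFactor (mom t (Function.update s k w)) n j) (a j) (s k)) ∧
      ∀ l, l < n → ∑ j ∈ range n, a j * mom t s j l = upperFactor (mom t s) n (l + k) := by
  obtain ⟨a, h1, -, -, h4⟩ := hasDerivAt_lowerFactor_row (entryDeriv_mom_right ht hs k) (n := n)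
    (by rw [Function.update_eq_self]; exact hd)
  refine ⟨a, h1, fun l hl => ?_⟩
  have h5 := h4 l hl
  rw [Function.update_eq_self] at h5
  rw [upperFactor_apply, eq_neg_of_add_eq_zero_left h5, ← sum_neg_distrib]
  refine sum_congr rfl fun j _ => ?_
  rw [Matrix.neg_apply, imul_ipow_shift_transpose_apply]
  ring

/-- By `dlogT_one`, what has to be differentiated is the entry of the lower factor next to the
diagonal. The right-hand side of the linear system for the derivative of its row is the row of the
upper factor shifted by one, which vanishes except in the last column, where it is the pivot.
Cramer's rule for the last unknown gives the quotient of tau functions. -/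
theorem toda_equation {n : ℕ} (hd : tau (n + 1) t s ≠ 0) :
    pdS 1 (dlogT 1 (tau (n + 1))) t s
      = -(tau n t s * tau (n + 2) t s / tau (n + 1) t s ^ 2) := by
  obtain ⟨a, h1, h2⟩ := lowerFactor_row_right ht hs 1 hd
  rw [pdS_dlogT_one ht hs 1 hd]
  simp only [subdiag]
  rw [(h1 n).fun_neg.deriv]
  have h3 := det_updateRow_of_vecMul (A := trunc (n + 1) (mom t s)) (w := fun j => a j)
    (v := Pi.single (Fin.last n) (pivot (mom t s) (n + 1))) (fun l => by
      have h4 := h2 l l.2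
      rw [sum_range] at h4
      refine h4.trans ?_
      by_cases hl : l = Fin.last n
      · subst hl
        rw [Pi.single_eq_same]
        exact upperFactor_self hd
      · rw [Pi.single_eq_of_ne hl]
        refine upperFactor_lt hd ?_
        have : (l : ℕ) ≠ n := fun h => hl (Fin.ext h)
        have := l.2
        simp only [PNat.one_coe]
        omega) (Fin.last n)
  rw [det_updateRow_single_last, Fin.val_last] at h3
  have h5 : a n * tau (n + 1) t s = tau (n + 2) t s / tau (n + 1) t s * tau n t s := h3.symm
  rw [neg_inj, eq_div_iff (pow_ne_zero 2 hd), pow_two, ← mul_assoc, h5]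
  field_simp

/-- Again only the shift of the last column survives. The resulting bordered determinant is the
entry of the upper factor next to its diagonal. -/
theorem hasDerivAt_tau_right_border {n : ℕ} (hd : tau n t s ≠ 0) :
    HasDerivAt (fun u => tau (n + 1) t (Function.update s 1 u))
      (-(tau n t s * upperFactor (mom t s) n (n + 1))) (s 1) := by
  refine (hasDerivAt_tau_right ht hs 1 (n + 1)).congr_deriv ?_
  rw [neg_inj, upperFactor_apply, tau, ← det_border hd, sum_eq_single (Fin.last n)]
  · rw [← det_transpose]
    congr 1
    ext i j
    rw [transpose_apply, updateRow_apply, of_apply]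
    by_cases hj : j = Fin.last n
    · subst hj
      simp
    · have hj' : (j : ℕ) < n := lt_of_le_of_ne (Nat.lt_succ_iff.1 j.2) fun h => hj (Fin.ext h)
      rw [if_neg hj, if_pos hj']
      rfl
  · intro r _ hr
    have hr' : (r : ℕ) < n := lt_of_le_of_ne (Nat.lt_succ_iff.1 r.2) fun h => hr (Fin.ext h)
    refine det_zero_of_row_eq (i := r) (j := ⟨r + 1, by omega⟩) (by simp [Fin.ext_iff]) ?_
    ext l
    rw [updateRow_self, updateRow_ne (by simp [Fin.ext_iff])]
    rfl
  · simp

/-- Both sides are expressed through tau functions, the subdiagonal entries `b`, `c` of the dual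
lower factor and the first entry `g` of the upper factor beyond its diagonal. The third derivative
is obtained by differentiating the first Toda identity once more, and there `g` enters through
`hasDerivAt_tau_right_border`. -/
theorem second_toda_equation {n : ℕ} (hd : tau (n + 1) t s ≠ 0) (hd0 : tau n t s ≠ 0) :
    pdS 2 (dlogT 1 (tau (n + 1))) t s
      = -2 * dlogS 1 (fun t' s' => tau (n + 1) t' s' / tau n t' s') t s
          * pdS 1 (dlogT 1 (tau (n + 1))) t s
        - pdS 1 (pdS 1 (dlogT 1 (tau (n + 1)))) t s := by
  obtain ⟨a, h1, h2⟩ := lowerFactor_row_right ht hs 2 hd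
  have e1 := hasDerivAt_tau_right_one ht hs hd0
  have e2 := hasDerivAt_tau_right_one ht hs hd
  have e3 := hasDerivAt_tau_right_border ht hs hd
  set g := upperFactor (mom t s) (n + 1) (n + 1 + 1)
  set b := subdiag (mom t s).transpose n with hb
  set c := subdiag (mom t s).transpose (n + 1)
  have hup : Function.update s 1 (s 1) = s := Function.update_eq_self _ _
  have f1 : pdS 1 (pdS 1 (dlogT 1 (tau (n + 1)))) t s
      = -((b * tau n t s * tau (n + 2) t s - tau n t s * (tau (n + 1) t s * g))
          * tau (n + 1) t s ^ 2 - tau n t s * tau (n + 2) t s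
            * (2 * tau (n + 1) t s * (c * tau (n + 1) t s))) / (tau (n + 1) t s ^ 2) ^ 2 := by
    have h3 : pdS 1 (pdS 1 (dlogT 1 (tau (n + 1)))) t s = deriv (fun u =>
        -(tau n t (Function.update s 1 u) * tau (n + 2) t (Function.update s 1 u)
          / tau (n + 1) t (Function.update s 1 u) ^ 2)) (s 1) := by
      refine EventuallyEq.deriv_eq ?_
      filter_upwards [eventually_tau_ne_right ht hs 1 hd] with w hw
      exact toda_equation ht (hs.update 1 w) hw
    have h4 := ((e1.mul e3).div (e2.pow 2) (by simpa [hup] using hd)).neg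
    rw [h3]
    refine h4.deriv.trans ?_
    simp only [Pi.mul_apply, Pi.pow_apply, hup]
    rw [← neg_div]
    congr 1
    push_cast
    ring
  have f2 : dlogS 1 (fun t' s' => tau (n + 1) t' s' / tau n t' s') t s = c - b := by
    have h3 := e2.div e1 (by simpa [hup] using hd0)
    rw [dlogS, pdS, pd]
    refine (congrArg (· / (tau (n + 1) t s / tau n t s)) h3.deriv).trans ?_
    simp only [hup]
    field_simp
  have f3 : pdS 2 (dlogT 1 (tau (n + 1))) t s = -a n := by
    rw [pdS_dlogT_one ht hs 2 hd]
    exact (h1 n).neg.deriv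
  -- Pair the linear system for `a` with the coefficients of the dual polynomial of degree `n`. By
  -- biorthogonality only `a n` survives on the left. On the right the shift by two reaches the
  -- upper triangle only for `l = n - 1` and `l = n`.
  have f4 : a n * pivot (mom t s) n = pivot (mom t s) (n + 1) * b + g := by
    have hdt : (trunc n (mom t s).transpose).det ≠ 0 := by rwa [det_trunc_transpose]
    have h3 : ∑ l ∈ range (n + 1), (∑ j ∈ range (n + 1), a j * mom t s j l)
        * lowerFactor (mom t s).transpose n l = a n * pivot (mom t s) n := by
      simp_rw [sum_mul]
      rw [sum_comm, sum_range_succ, sum_eq_zero, zero_add]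
      · rw [← pivot_transpose, ← upperFactor_self hdt, upperFactor_apply, mul_sum]
        refine sum_congr rfl fun l _ => ?_
        rw [transpose_apply]
        ring
      · intro j hj
        have h4 := upperFactor_lt hdt (mem_range.1 hj)
        rw [upperFactor_apply] at h4
        have h5 := congrArg (a j * ·) h4
        simp only [mul_zero, mul_sum] at h5
        rw [← h5]
        refine sum_congr rfl fun l _ => ?_
        rw [transpose_apply]
        ring
    have h4 : ∀ l ∈ range (n + 1), (∑ j ∈ range (n + 1), a j * mom t s j l)
        * lowerFactor (mom t s).transpose n l
          = upperFactor (mom t s) (n + 1) (l + 2) * lowerFactor (mom t s).transpose n l :=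
      fun l hl => by rw [h2 l (mem_range.1 hl)]; rfl
    rw [← h3, sum_congr rfl h4, sum_range_succ, lowerFactor_self, mul_one]
    congr 1
    rw [hb]
    cases n with
    | zero => simp [subdiag]
    | succ n =>
      rw [sum_range_succ, sum_eq_zero, zero_add]
      · rw [subdiag, upperFactor_self hd]
      · intro l hl
        rw [upperFactor_lt hd (by have := mem_range.1 hl; omega), zero_mul]
  rw [f1, f2, f3, toda_equation ht hs hd]
  have f5 : a n * (tau (n + 1) t s / tau n t s) = tau (n + 2) t s / tau (n + 1) t s * b + g := f4
  have f6 : a n = (tau (n + 2) t s / tau (n + 1) t s * b + g) * (tau n t s / tau (n + 1) t s) := by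
    rw [← f5]
    field_simp
  rw [f6]
  field_simp
  ring

theorem toeplitz_mom (n : ℕ) (hd : tau n t s ≠ 0) (hd1 : tau (n + 1) t s ≠ 0) :
    subdiag (mom t s) (n + 1) = subdiag (mom t s) n
      + lowerFactor (mom t s) (n + 1) 0 * lowerFactor (mom t s).transpose n 0 := by
  have h1 := lowerFactor_succ (mom_toeplitz ht hs) hd hd1 le_rfl
  rw [Nat.sub_self] at h1
  rw [subdiag, h1]
  cases n with
  | zero => rfl
  | succ n => rfl

/-- The right-hand side is `x_n y_n`. The first Toda identity expresses the mixed derivative by the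
same quotient of tau functions that equals `1 - x_n y_n`. -/
theorem one_add_pdS_dlogT {n : ℕ} (hd : tau n t s ≠ 0) :
    1 + pdS 1 (dlogT 1 (tau n)) t s
      = lowerFactor (mom t s) n 0 * lowerFactor (mom t s).transpose n 0 := by
  cases n with
  | zero =>
    rw [pdS_dlogT_one ht hs 1 hd, lowerFactor_self, lowerFactor_self]
    simp [subdiag]
  | succ n =>
    have h1 := one_sub_mul_det (mom_toeplitz ht hs) hd
    have h2 : (1 - lowerFactor (mom t s) (n + 1) 0 * lowerFactor (mom t s).transpose (n + 1) 0)
      * tau (n + 1) t s ^ 2 = tau (n + 2) t s * tau n t s := h1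
    rw [toda_equation ht hs hd, mul_comm (tau n t s), ← h2]
    field_simp
    ring

/-- The two logarithmic derivatives of `τ_{n+1} / τ_n` are `-x_{n+1} y_n` and `x_n y_{n+1}`, by the
next-to-top coefficient of the Szegő recursion for the matrix and its transpose. Both sides
therefore equal `x_n y_n x_{n+1} y_{n+1}`. -/
theorem hisakado {n : ℕ} (hd : tau n t s ≠ 0) (hd1 : tau (n + 1) t s ≠ 0) :
    (1 + pdS 1 (dlogT 1 (tau (n + 1))) t s) * (1 + pdS 1 (dlogT 1 (tau n)) t s)
      = -(dlogT 1 (fun t' s' => tau (n + 1) t' s' / tau n t' s') t s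
          * dlogS 1 (fun t' s' => tau (n + 1) t' s' / tau n t' s') t s) := by
  have hup : Function.update s 1 (s 1) = s := Function.update_eq_self _ _
  have hup' : Function.update t 1 (t 1) = t := Function.update_eq_self _ _
  have f1 : dlogS 1 (fun t' s' => tau (n + 1) t' s' / tau n t' s') t s
      = lowerFactor (mom t s).transpose (n + 1) 0 * lowerFactor (mom t s) n 0 := by
    have h3 := (hasDerivAt_tau_right_one ht hs hd1).div (hasDerivAt_tau_right_one ht hs hd)
      (by simpa [hup] using hd)
    have h4 := toeplitz_mom hs.neg ht.neg n (by rwa [tau_neg_neg ht hs])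
      (by rwa [tau_neg_neg ht hs])
    rw [mom_neg_neg ht hs, transpose_transpose] at h4
    rw [dlogS, pdS, pd]
    refine (congrArg (· / (tau (n + 1) t s / tau n t s)) h3.deriv).trans ?_
    simp only [hup]
    rw [h4]
    field_simp
    ring
  have f2 : dlogT 1 (fun t' s' => tau (n + 1) t' s' / tau n t' s') t s
      = -(lowerFactor (mom t s) (n + 1) 0 * lowerFactor (mom t s).transpose n 0) := by
    have h3 := (hasDerivAt_tau_left_one ht hs hd1).div (hasDerivAt_tau_left_one ht hs hd)
      (by simpa [hup'] using hd)
    have h4 := toeplitz_mom ht hs n hd hd1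
    rw [dlogT, pdT, pd]
    refine (congrArg (· / (tau (n + 1) t s / tau n t s)) h3.deriv).trans ?_
    simp only [hup']
    rw [h4]
    field_simp
    ring
  rw [f1, f2, one_add_pdS_dlogT ht hs hd, one_add_pdS_dlogT ht hs hd1]
  ring

end TauIdentities

/-! ### The discrete sinh-Gordon equation -/

section SinhGordon

/-- Near `w` the continuous branch varies by less than `1 < π`, so its increment is the principal
logarithm of `F z / F w`. This transfers analyticity from `F` to the branch. -/
theorem eventually_eq_log {q F : ℂ × ℂ → ℂ} {U : Set (ℂ × ℂ)} {w : ℂ × ℂ} (hU : U ∈ 𝓝 w)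
    (hq : ContinuousOn q U) (he : ∀ z ∈ U, Complex.exp (q z) = F z) :
    q =ᶠ[𝓝 w] fun z => q w + Complex.log (F z / F w) := by
  have h1 : ContinuousAt q w := hq.continuousAt hU
  have h2 : ∀ᶠ z in 𝓝 w, ‖q z - q w‖ < 1 := by
    have h3 : ContinuousAt (fun z => ‖q z - q w‖) w := (h1.sub continuousAt_const).norm
    exact h3.eventually_lt continuousAt_const (by simp)
  filter_upwards [hU, h2] with z hz h3
  have h4 := (Complex.abs_im_le_norm _).trans_lt h3
  rw [abs_lt] at h4
  rw [← he z hz, ← he w (mem_of_mem_nhds hU), ← Complex.exp_sub, Complex.log_exp]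
  · ring
  · linarith [Real.pi_gt_three]
  · linarith [Real.pi_gt_three]

theorem analyticAt_of_exp {q F : ℂ × ℂ → ℂ} {U : Set (ℂ × ℂ)} {w : ℂ × ℂ} (hU : U ∈ 𝓝 w)
    (hq : ContinuousOn q U) (he : ∀ z ∈ U, Complex.exp (q z) = F z) (hF : AnalyticAt ℂ F w) :
    AnalyticAt ℂ q w := by
  have hw := mem_of_mem_nhds hU
  have hne : F w ≠ 0 := he w hw ▸ Complex.exp_ne_zero _
  refine AnalyticAt.congr ?_ (eventually_eq_log hU hq he).symm
  refine analyticAt_const.add ((hF.div analyticAt_const hne).clog ?_)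
  rw [Pi.div_apply, div_self hne]
  exact Complex.one_mem_slitPlane

theorem dU_eq_fderiv {q : ℂ × ℂ → ℂ} {w : ℂ × ℂ} (hq : DifferentiableAt ℂ q w) :
    HasDerivAt (fun u => q (u, w.2)) (fderiv ℂ q w (1, 0)) w.1 := by
  have h1 : HasDerivAt (fun u : ℂ => (u, w.2)) ((1 : ℂ), (0 : ℂ)) w.1 :=
    (hasDerivAt_id w.1).prodMk (hasDerivAt_const _ _)
  exact HasFDerivAt.comp_hasDerivAt (l := q) w.1 (by exact hq.hasFDerivAt) h1

theorem dV_eq_fderiv {q : ℂ × ℂ → ℂ} {w : ℂ × ℂ} (hq : DifferentiableAt ℂ q w) :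
    HasDerivAt (fun v => q (w.1, v)) (fderiv ℂ q w (0, 1)) w.2 := by
  have h1 : HasDerivAt (fun v : ℂ => (w.1, v)) ((0 : ℂ), (1 : ℂ)) w.2 :=
    (hasDerivAt_const _ _).prodMk (hasDerivAt_id w.2)
  exact HasFDerivAt.comp_hasDerivAt (l := q) w.2 (by exact hq.hasFDerivAt) h1

theorem dU_dV_comm {q : ℂ × ℂ → ℂ} {w : ℂ × ℂ} (hq : AnalyticAt ℂ q w) :
    dU (dV q) w = dV (dU q) w := by
  have h1 : ∀ᶠ z in 𝓝 w, DifferentiableAt ℂ q z :=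
    hq.eventually_analyticAt.mono fun z hz => hz.differentiableAt
  have h2 : dU q =ᶠ[𝓝 w] fun z => fderiv ℂ q z (1, 0) := h1.mono fun z hz => (dU_eq_fderiv hz).deriv
  have h3 : dV q =ᶠ[𝓝 w] fun z => fderiv ℂ q z (0, 1) := h1.mono fun z hz => (dV_eq_fderiv hz).deriv
  have h4 : DifferentiableAt ℂ (fderiv ℂ q) w := hq.fderiv.differentiableAt
  have h5 : ∀ v : ℂ × ℂ, DifferentiableAt ℂ (fun z => fderiv ℂ q z v) w ∧
      ∀ v', fderiv ℂ (fun z => fderiv ℂ q z v) w v' = fderiv ℂ (fderiv ℂ q) w v' v := fun v => by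
    have h6 := h4.hasFDerivAt.clm_apply (hasFDerivAt_const v w)
    refine ⟨h6.differentiableAt, fun v' => ?_⟩
    rw [h6.fderiv]
    simp
  have cu : Tendsto (fun u : ℂ => (u, w.2)) (𝓝 w.1) (𝓝 w) := by
    have : ContinuousAt (fun u : ℂ => (u, w.2)) w.1 := by fun_prop
    exact this
  have cv : Tendsto (fun v : ℂ => (w.1, v)) (𝓝 w.2) (𝓝 w) := by
    have : ContinuousAt (fun v : ℂ => (w.1, v)) w.2 := by fun_prop
    exact this
  have e1 : dU (dV q) w = fderiv ℂ (fderiv ℂ q) w (1, 0) (0, 1) := by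
    rw [← (h5 _).2, ← (dU_eq_fderiv (h5 (0, 1)).1).deriv]
    exact EventuallyEq.deriv_eq (cu.eventually h3)
  have e2 : dV (dU q) w = fderiv ℂ (fderiv ℂ q) w (0, 1) (1, 0) := by
    rw [← (h5 _).2, ← (dV_eq_fderiv (h5 (1, 0)).1).deriv]
    exact EventuallyEq.deriv_eq (cv.eventually h2)
  rw [e1, e2]
  exact (hq.contDiffAt (n := 2)).isSymmSndFDerivAt (by simp) _ _

theorem dU_dV_log {q f g : ℂ × ℂ → ℂ} {U : Set (ℂ × ℂ)} {w : ℂ × ℂ} (hU : U ∈ 𝓝 w)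
    (hq : ContinuousOn q U) (he : ∀ z ∈ U, Complex.exp (q z) = g z / f z)
    (hf0 : f w ≠ 0) (hf : AnalyticAt ℂ f w) (hg : AnalyticAt ℂ g w) :
    dU (dV q) w = dV (fun z => dU g z / g z) w - dV (fun z => dU f z / f z) w := by
  have hg0 : g w ≠ 0 := by
    intro h0
    have := he w (mem_of_mem_nhds hU)
    rw [h0, zero_div] at this
    exact Complex.exp_ne_zero _ this
  have hqa := analyticAt_of_exp hU hq he (hg.div hf hf0)
  rw [dU_dV_comm hqa]
  have cv : Tendsto (fun v : ℂ => (w.1, v)) (𝓝 w.2) (𝓝 w) := by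
    have : ContinuousAt (fun v : ℂ => (w.1, v)) w.2 := by fun_prop
    exact this
  have h1 : dU q =ᶠ[𝓝 w] fun z => dU g z / g z - dU f z / f z := by
    filter_upwards [hqa.eventually_analyticAt, hf.eventually_analyticAt, hg.eventually_analyticAt,
      hf.continuousAt.eventually_ne hf0, hg.continuousAt.eventually_ne hg0,
      eventually_eventually_nhds.2 hU] with z a1 a2 a3 a4 a5 a6
    have b1 := (dU_eq_fderiv a1.differentiableAt)
    have b2 := (dU_eq_fderiv a2.differentiableAt)
    have b3 := (dU_eq_fderiv a3.differentiableAt)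
    have cu : Tendsto (fun u : ℂ => (u, z.2)) (𝓝 z.1) (𝓝 z) := by
      have : ContinuousAt (fun u : ℂ => (u, z.2)) z.1 := by fun_prop
      exact this
    have b4 : (fun u => Complex.exp (q (u, z.2))) =ᶠ[𝓝 z.1] fun u => g (u, z.2) / f (u, z.2) :=
      (cu.eventually a6).mono fun u hu => he _ hu
    have b5 := (b1.cexp).congr_of_eventuallyEq b4.symm
    have b6 := b5.unique (b3.div b2 a4)
    have b7 : Complex.exp (q (z.1, z.2)) = g (z.1, z.2) / f (z.1, z.2) := he _ a6.self_of_nhds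
    rw [dU, dU, dU, b1.deriv, b2.deriv, b3.deriv]
    rw [b7] at b6
    have b8 : f (z.1, z.2) ≠ 0 := a4
    have b9 : g (z.1, z.2) ≠ 0 := a5
    change _ = _ / g (z.1, z.2) - _ / f (z.1, z.2)
    field_simp at b6 ⊢
    linear_combination b6
  have h2 : ∀ f : ℂ × ℂ → ℂ, AnalyticAt ℂ f w → f w ≠ 0 →
      DifferentiableAt ℂ (fun v => dU f (w.1, v) / f (w.1, v)) w.2 := by
    intro f hf hf0
    have h3 : DifferentiableAt ℂ (fun z => fderiv ℂ f z (1, 0) / f z) w := by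
      simp only [div_eq_mul_inv]
      exact ((hf.fderiv.differentiableAt).clm_apply (differentiableAt_const _)).mul
        (hf.differentiableAt.inv hf0)
    have h4 : (fun z => dU f z / f z) =ᶠ[𝓝 w] fun z => fderiv ℂ f z (1, 0) / f z := by
      filter_upwards [hf.eventually_analyticAt] with z hz
      rw [dU, (dU_eq_fderiv hz.differentiableAt).deriv]
    exact ((dV_eq_fderiv h3).congr_of_eventuallyEq (cv.eventually h4)).differentiableAt
  have h5 : dV (dU q) w = deriv (fun v => dU g (w.1, v) / g (w.1, v)
      - dU f (w.1, v) / f (w.1, v)) w.2 := EventuallyEq.deriv_eq (cv.eventually h1)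
  rw [h5, deriv_fun_sub (h2 g hg hg0) (h2 f hf hf0)]
  rfl

theorem exp_sub_eq {a b f0 f1 f2 : ℂ} (h1 : f1 ≠ 0) (ha : Complex.exp a = f2 / f1)
    (hb : Complex.exp b = f1 / f0) : Complex.exp (a - b) = f0 * f2 / f1 ^ 2 := by
  have h2 : f0 ≠ 0 := by
    rintro rfl
    rw [div_zero] at hb
    exact Complex.exp_ne_zero _ hb
  rw [Complex.exp_sub, ha, hb]
  field_simp

/-- The mixed derivative of `q_n` is the difference `T (n + 1) - T n` of the mixed logarithmic
derivatives, and the right-hand side is the corresponding difference of quotients. Since `T 0 = 0`,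
the Toda identities are recovered from the differences by induction. -/
theorem toda_iff_sinhGordon (U : Set (ℂ × ℂ)) (f q : ℕ → ℂ × ℂ → ℂ) (hU : IsOpen U)
    (h0 : ∀ w ∈ U, f 0 w = 1) (hf : ∀ n, AnalyticOnNhd ℂ (f n) U) (hne : ∀ n, ∀ w ∈ U, f n w ≠ 0)
    (hq : ∀ n, ContinuousOn (q n) U)
    (he : ∀ n, ∀ w ∈ U, Complex.exp (q n w) = f (n + 1) w / f n w) :
    (∀ n, 1 ≤ n → ∀ w ∈ U, TodaAt f n w) ↔ ∀ n, ∀ w ∈ U, SinhGordonAt q n w := by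
  obtain ⟨T, hT⟩ : ∃ T : ℕ → ℂ × ℂ → ℂ, T = fun n w => dV (fun z => dU (f n) z / f n z) w := ⟨_, rfl⟩
  have h1 : ∀ n, ∀ w ∈ U, dU (dV (q n)) w = T (n + 1) w - T n w := fun n w hw => by
    rw [hT]
    exact dU_dV_log (hU.mem_nhds hw) (hq n) (he n) (hne n w hw) (hf n w hw) (hf (n + 1) w hw)
  have h2 : ∀ w ∈ U, T 0 w = 0 := fun w hw => by
    rw [hT]
    have h3 : (fun z => dU (f 0) z / f 0 z) =ᶠ[𝓝 w] fun _ => 0 := by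
      filter_upwards [hU.mem_nhds hw] with z hz
      have h4 : ∀ᶠ u in 𝓝 z.1, f 0 (u, z.2) = 1 := by
        have : ContinuousAt (fun u : ℂ => (u, z.2)) z.1 := by fun_prop
        exact (this.eventually (hU.mem_nhds hz)).mono fun u hu => h0 _ hu
      have h5 : dU (f 0) z = 0 := by
        rw [dU, EventuallyEq.deriv_eq (f := fun _ => (1 : ℂ)) h4, deriv_const]
      rw [h5, zero_div]
    have cv : ContinuousAt (fun v : ℂ => (w.1, v)) w.2 := by fun_prop
    have h6 : (fun v => dU (f 0) (w.1, v) / f 0 (w.1, v)) =ᶠ[𝓝 w.2] fun _ => (0 : ℂ) :=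
      cv.eventually h3
    simp only [dV]
    rw [h6.deriv_eq, deriv_const]
  have h3 : ∀ n, ∀ w ∈ U, TodaAt f (n + 1) w ↔ T (n + 1) w = -(f n w * f (n + 2) w / f (n + 1) w ^ 2) :=
    fun n w _ => by rw [TodaAt, hT]; rfl
  have h4 : ∀ n, ∀ w ∈ U, Complex.exp (q (n + 1) w - q n w) = f n w * f (n + 2) w / f (n + 1) w ^ 2 :=
    fun n w hw => exp_sub_eq (hne _ w hw) (he (n + 1) w hw) (he n w hw)
  have h5 : ∀ w ∈ U, SinhGordonAt q 0 w ↔ T 1 w - T 0 w = -(f 0 w * f 2 w / f 1 w ^ 2) :=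
    fun w hw => by rw [SinhGordonAt, h1 0 w hw, if_pos rfl, h4 0 w hw, zero_sub]
  have h6 : ∀ n, ∀ w ∈ U, SinhGordonAt q (n + 1) w ↔ T (n + 2) w - T (n + 1) w
      = f n w * f (n + 2) w / f (n + 1) w ^ 2 - f (n + 1) w * f (n + 3) w / f (n + 2) w ^ 2 :=
    fun n w hw => by
      rw [SinhGordonAt, h1 (n + 1) w hw, if_neg (by omega), h4 (n + 1) w hw, Nat.add_sub_cancel,
        h4 n w hw]
  constructor
  · intro h n w hw
    cases n with
    | zero =>
      rw [h5 w hw, h2 w hw, sub_zero]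
      exact (h3 0 w hw).1 (h 1 le_rfl w hw)
    | succ n =>
      rw [h6 n w hw, (h3 n w hw).1 (h _ (by omega) w hw),
        (h3 (n + 1) w hw).1 (h _ (by omega) w hw)]
      ring
  · intro h n hn w hw
    obtain ⟨n, rfl⟩ : ∃ m, n = m + 1 := ⟨n - 1, by omega⟩
    induction n with
    | zero =>
      have h7 := (h5 w hw).1 (h 0 w hw)
      rw [h2 w hw, sub_zero] at h7
      exact (h3 0 w hw).2 h7
    | succ n ih =>
      have h7 := (h6 n w hw).1 (h (n + 1) w hw)
      have h8 := (h3 n w hw).1 (ih (by omega))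
      rw [h3 (n + 1) w hw]
      rw [h8] at h7
      linear_combination h7

variable {t s : Times}

theorem analyticAt_tauSlice (ht : SummableTimes t) (hs : SummableTimes s) (n : ℕ) (w : ℂ × ℂ) :
    AnalyticAt ℂ (tauSlice t s n) w := by
  have hmem : ∀ t : Times, SummableTimes t → Memℓp t 1 := fun t ht =>
    (memℓp_gen_iff (by simp)).2 (by simpa [SummableTimes] using ht)
  obtain ⟨T, hT⟩ : ∃ T : lp (fun _ : ℕ+ => ℂ) 1, (T : ℕ+ → ℂ) = t := ⟨⟨t, hmem t ht⟩, rfl⟩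
  obtain ⟨S, hS⟩ : ∃ S : lp (fun _ : ℕ+ => ℂ) 1, (S : ℕ+ → ℂ) = s := ⟨⟨s, hmem s hs⟩, rfl⟩
  obtain ⟨e, he⟩ : ∃ e : lp (fun _ : ℕ+ => ℂ) 1, e = lp.single 1 1 1 := ⟨_, rfl⟩
  have hup : ∀ (T : lp (fun _ : ℕ+ => ℂ) 1) (u : ℂ),
      ((T + (u - (T : ℕ+ → ℂ) 1) • e : lp (fun _ : ℕ+ => ℂ) 1) : ℕ+ → ℂ)
        = Function.update (T : ℕ+ → ℂ) 1 u := fun T u => by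
    ext i
    rw [lp.coeFn_add, lp.coeFn_smul, Pi.add_apply, Pi.smul_apply, he, lp.single_apply]
    by_cases hi : i = 1
    · subst hi
      simp
    · rw [Function.update_of_ne hi, Pi.single_eq_of_ne hi, smul_zero, add_zero]
  have h1 : tauSlice t s n = (fun p : lp (fun _ : ℕ+ => ℂ) 1 × lp (fun _ : ℕ+ => ℂ) 1 =>
      tau n (p.1 : ℕ+ → ℂ) (p.2 : ℕ+ → ℂ)) ∘ fun w : ℂ × ℂ =>
        (T + (w.1 - (T : ℕ+ → ℂ) 1) • e, S + (w.2 - (S : ℕ+ → ℂ) 1) • e) := by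
    funext w
    simp only [Function.comp, tauSlice]
    rw [hup, hup, hT, hS]
  rw [h1]
  refine (analyticOnNhd_tau n _ (Set.mem_univ _)).comp_of_eq (AnalyticAt.prod ?_ ?_) rfl
  · exact analyticAt_const.add (((analyticAt_fst).sub analyticAt_const).smul analyticAt_const)
  · exact analyticAt_const.add (((analyticAt_snd).sub analyticAt_const).smul analyticAt_const)

theorem dV_dU_tauSlice (t s : Times) (n : ℕ) :
    dV (fun z => dU (tauSlice t s n) z / tauSlice t s n z) (t 1, s 1)
      = pdS 1 (dlogT 1 (tau n)) t s := by
  have hup : Function.update t 1 (t 1) = t := Function.update_eq_self _ _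
  simp only [dV, dU, tauSlice, pdS, pd, dlogT, pdT, hup]

theorem sinhGordon_tau (n : ℕ) (ht : SummableTimes t) (hs : SummableTimes s)
    (U : Set (ℂ × ℂ)) (q : ℕ → ℂ × ℂ → ℂ) (hU : U ∈ 𝓝 (t 1, s 1))
    (hq : ∀ m, n ≤ m + 1 → m ≤ n + 1 → ContinuousOn (q m) U ∧
      ∀ w ∈ U, tauSlice t s m w ≠ 0 ∧
        Complex.exp (q m w) = tauSlice t s (m + 1) w / tauSlice t s m w) :
    SinhGordonAt q n (t 1, s 1) := by
  have hw := mem_of_mem_nhds hU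
  have hslice : ∀ m, tauSlice t s m (t 1, s 1) = tau m t s := fun m => by
    simp only [tauSlice, Function.update_eq_self]
  have h1 := hq n (by omega) (by omega)
  have h2 := hq (n + 1) (by omega) (by omega)
  have e1 := dU_dV_log hU h1.1 (fun z hz => (h1.2 z hz).2) (h1.2 _ hw).1
    (analyticAt_tauSlice ht hs n _) (analyticAt_tauSlice ht hs (n + 1) _)
  rw [dV_dU_tauSlice, dV_dU_tauSlice] at e1
  have n1 : tau (n + 1) t s ≠ 0 := hslice (n + 1) ▸ (h2.2 _ hw).1
  have e2 := toda_equation ht hs n1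
  have e3 := exp_sub_eq (h2.2 _ hw).1 (h2.2 _ hw).2 (h1.2 _ hw).2
  rw [SinhGordonAt, e1, e2, e3, hslice, hslice, hslice]
  cases n with
  | zero =>
    have e4 : pdS 1 (dlogT 1 (tau 0)) t s = 0 := by
      rw [pdS_dlogT_one ht hs 1 (by rw [tau_zero]; exact one_ne_zero)]
      simp [subdiag]
    rw [e4, if_pos rfl]
    ring
  | succ n =>
    have h3 := hq n (by omega) (by omega)
    have n0 : tau (n + 1) t s ≠ 0 := hslice (n + 1) ▸ (h1.2 _ hw).1
    rw [toda_equation ht hs n0, if_neg (by omega), Nat.add_sub_cancel,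
      exp_sub_eq (h1.2 _ hw).1 (h1.2 _ hw).2 (h3.2 _ hw).2, hslice, hslice, hslice]
    ring

end SinhGordon

end ToeplitzLattice

namespace ToeplitzLattice

/-! ### The moment recursion and the Virasoro constraints -/

section MomentRecursion

open Finset Matrix

/-- The times weighted by their degree. -/
def degTimes (t : Times) : Times := fun i => (i : ℂ) * t i

theorem SummableTimes.of_degTimes {t : Times} (ht : SummableTimes (degTimes t)) :
    SummableTimes t := by
  refine Summable.of_nonneg_of_le (fun i => norm_nonneg _) (fun i => ?_) ht
  rw [degTimes, norm_mul, Complex.norm_natCast]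
  exact le_mul_of_one_le_left (norm_nonneg _) (by exact_mod_cast i.pos)

theorem degTimes_neg (t : Times) : degTimes (-t) = -degTimes t := by
  ext i; simp [degTimes]

variable {t s : Times} (ht : SummableTimes (degTimes t)) (hs : SummableTimes (degTimes s))

/-- The function `z V'(z)` on the circle. -/
noncomputable def potDeriv (t s : Times) : C(Circle, ℂ) :=
  pot (fun i => zp (i : ℕ)) (fun i => zp (-(i : ℕ))) (degTimes t) (-degTimes s)

include ht hs

/-- The termwise derivatives are dominated by `i ‖t_i‖ + i ‖s_i‖`, whence the weighted summability.
-/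
theorem hasDerivAt_V_circle (θ : ℝ) :
    HasDerivAt (fun θ : ℝ => V t s (Circle.exp θ))
      (Complex.I * potDeriv t s (Circle.exp θ)) θ := by
  have hz : ∀ (θ : ℝ) (j : ℤ), zp j (Circle.exp θ) = Complex.exp (j * Complex.I * θ) := fun θ j => by
    rw [zp_apply, Circle.coe_exp, ← Complex.exp_int_mul]
    ring_nf
  have hd : ∀ (θ : ℝ) (j : ℤ), HasDerivAt (fun θ : ℝ => zp j (Circle.exp θ))
      (Complex.I * (j * zp j (Circle.exp θ))) θ := fun θ j => by
    simp_rw [hz]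
    have h1 : HasDerivAt (fun θ : ℝ => (j * Complex.I * θ : ℂ)) (j * Complex.I) θ := by
      simpa using (Complex.ofRealCLM.hasDerivAt (x := θ)).const_mul (j * Complex.I)
    refine h1.cexp.congr_deriv ?_
    ring
  have hV : ∀ θ : ℝ, V t s (Circle.exp θ)
      = ∑' i : ℕ+, (t i * zp (i : ℕ) (Circle.exp θ) - s i * zp (-(i : ℕ)) (Circle.exp θ)) :=
    fun θ => tsum_congr fun i => by simp [zp_apply]
  have hP : ∀ θ : ℝ, Complex.I * potDeriv t s (Circle.exp θ)
      = ∑' i : ℕ+, (t i * (Complex.I * (((i : ℕ) : ℤ) * zp (i : ℕ) (Circle.exp θ)))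
        - s i * (Complex.I * ((-(i : ℕ) : ℤ) * zp (-(i : ℕ)) (Circle.exp θ)))) := fun θ => by
    have h1 := (summable_pot (b := fun i => zp (i : ℕ)) (c := fun i => zp (-(i : ℕ)))
      (fun _ => norm_zp_le _) (fun _ => norm_zp_le _) ht hs.neg)
    rw [potDeriv, pot, ← ContinuousMap.tsum_apply h1, ← tsum_mul_left]
    refine tsum_congr fun i => ?_
    simp [degTimes]
    ring
  simp_rw [hV]
  rw [hP]
  refine hasDerivAt_tsum (u := fun i => ‖degTimes t i‖ + ‖degTimes s i‖) (ht.add hs)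
    (fun i θ => ((hd θ _).const_mul _).sub ((hd θ _).const_mul _)) (fun i θ => ?_) (y₀ := 0) ?_ θ
  · have hn : ∀ j : ℤ, ‖zp j (Circle.exp θ)‖ = 1 := fun j => by simp [zp_apply]
    refine (norm_sub_le _ _).trans (add_le_add (le_of_eq ?_) (le_of_eq ?_))
    · rw [norm_mul, norm_mul, norm_mul, hn, degTimes, norm_mul]
      simp
      ring
    · rw [norm_mul, norm_mul, norm_mul, hn, degTimes, norm_mul]
      simp
      ring
  · have h1 := (summable_pot (b := fun i => zp (i : ℕ)) (c := fun i => zp (-(i : ℕ)))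
      (fun _ => norm_zp_le _) (fun _ => norm_zp_le _) ht.of_degTimes hs.of_degTimes)
    simpa using (ContinuousMap.hasSum_apply h1.hasSum (Circle.exp 0)).summable

/-- The integrand is, up to the factor `Complex.I`, the angular derivative of the periodic function
`z^k e^V`. -/
theorem mean_potDeriv (k : ℤ) :
    mean (((k : ℂ) • zp k + zp k * potDeriv t s) * wtC t s) = 0 := by
  have h1 : ∀ θ : ℝ, HasDerivAt (fun θ : ℝ => (zp k * wtC t s) (Circle.exp θ))
      (Complex.I * (((k : ℂ) • zp k + zp k * potDeriv t s) * wtC t s) (Circle.exp θ)) θ := by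
    intro θ
    have e1 : ∀ θ : ℝ, (zp k * wtC t s) (Circle.exp θ)
        = Complex.exp (k * Complex.I * θ + V t s (Circle.exp θ)) := fun θ => by
      rw [ContinuousMap.mul_apply, wtC_apply ht.of_degTimes hs.of_degTimes, Complex.exp_add,
        zp_apply, Circle.coe_exp, ← Complex.exp_int_mul]
      ring_nf
    have e2 : HasDerivAt (fun θ : ℝ => (k * Complex.I * θ : ℂ)) (k * Complex.I) θ := by
      simpa using (Complex.ofRealCLM.hasDerivAt (x := θ)).const_mul (k * Complex.I)
    have e3 := (e2.add (hasDerivAt_V_circle ht hs θ)).cexp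
    have e4 : (fun θ : ℝ => (zp k * wtC t s) (Circle.exp θ))
        = fun θ : ℝ => Complex.exp (k * Complex.I * θ + V t s (Circle.exp θ)) := funext e1
    rw [e4]
    refine e3.congr_deriv ?_
    simp only [Pi.add_apply]
    rw [← e1]
    simp only [ContinuousMap.mul_apply, ContinuousMap.add_apply, ContinuousMap.smul_apply,
      smul_eq_mul]
    ring
  have h2 := intervalIntegral.integral_eq_sub_of_hasDerivAt (a := 0) (b := 2 * π)
    (fun θ _ => h1 θ) (Continuous.intervalIntegrable (by fun_prop) _ _)
  rw [intervalIntegral.integral_const_mul, Circle.exp_two_pi, Circle.exp_zero, sub_self] at h2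
  rw [mean_apply, (mul_eq_zero.1 h2).resolve_left Complex.I_ne_zero, mul_zero]

theorem hasSum_mean_potDeriv (k : ℤ) :
    HasSum (fun i : ℕ+ => (i : ℂ) * t i * mu t s (k + i) + (i : ℂ) * s i * mu t s (k - i))
      (-(k * mu t s k)) := by
  have h1 := (summable_pot (b := fun i => zp (i : ℕ)) (c := fun i => zp (-(i : ℕ)))
      (fun _ => norm_zp_le _) (fun _ => norm_zp_le _) ht hs.neg).hasSum
  have h2 := mean.hasSum (((h1.mul_left (zp k)).mul_right (wtC t s)))
  have h3 := mean_potDeriv ht hs k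
  rw [add_mul, map_add, smul_mul_assoc, map_smul, smul_eq_mul] at h3
  have h4 : mean (zp k * pot (fun i => zp (i : ℕ)) (fun i => zp (-(i : ℕ))) (degTimes t)
      (-degTimes s) * wtC t s) = -(k * mu t s k) := by
    rw [mu]
    exact eq_neg_of_add_eq_zero_right h3
  rw [pot] at h4
  rw [h4] at h2
  convert h2 using 2 with i
  rw [mul_sub, sub_mul, map_sub, mul_smul_comm, mul_smul_comm, smul_mul_assoc, smul_mul_assoc,
    map_smul, map_smul, ← zp_add, ← zp_add, Pi.neg_apply, degTimes, degTimes, sub_eq_add_neg k]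
  simp only [mu, smul_eq_mul]
  ring

end MomentRecursion

section Virasoro

open Finset Matrix

theorem det_updateRow_eq_sum_adjugate {n : ℕ} (M : Matrix (Fin n) (Fin n) ℂ) (r : Fin n)
    (v : Fin n → ℂ) : (M.updateRow r v).det = ∑ l, v l * M.adjugate l r := by
  rw [← cramer_transpose_apply, cramer_eq_adjugate_mulVec, mulVec, dotProduct]
  refine sum_congr rfl fun l _ => ?_
  rw [← adjugate_transpose, transpose_apply, mul_comm]

/-- The derivatives of `τ_n` with respect to the times `t_j`, `j ≥ 1`, and `-s_{-j}`, `j ≤ -1`. -/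
noncomputable def tauShift (n : ℕ) (t s : Times) (j : ℤ) : ℂ :=
  ∑ r : Fin n, ∑ l : Fin n, mu t s (((r : ℕ) : ℤ) - (l : ℕ) + j) * (trunc n (mom t s)).adjugate l r

/-- The Euler-type counterpart of `tauShift`. -/
noncomputable def tauEuler (n : ℕ) (t s : Times) (j : ℤ) : ℂ :=
  ∑ r : Fin n, ∑ l : Fin n, ((((r : ℕ) : ℤ) - (l : ℕ) + j : ℤ) * mu t s (((r : ℕ) : ℤ) - (l : ℕ) + j))
    * (trunc n (mom t s)).adjugate l r

variable {t s : Times} {n : ℕ}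

theorem pd_tau_left (ht : SummableTimes t) (hs : SummableTimes s) (j : ℕ+) :
    HasDerivAt (fun u => tau n (Function.update t j u) s) (tauShift n t s j) (t j) := by
  refine (hasDerivAt_tau_left ht hs j n).congr_deriv (sum_congr rfl fun r _ => ?_)
  rw [det_updateRow_eq_sum_adjugate]
  refine sum_congr rfl fun l _ => ?_
  rw [mom_eq ht hs]
  congr 2
  push_cast
  ring

theorem pd_tau_right (ht : SummableTimes t) (hs : SummableTimes s) (j : ℕ+) :
    HasDerivAt (fun u => tau n t (-Function.update (-s) j u)) (tauShift n t s (-j)) ((-s) j) := by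
  have h1 := pd_tau_left (n := n) hs.neg ht.neg j
  have h2 : (fun u => tau n t (-Function.update (-s) j u))
      = fun u => tau n (Function.update (-s) j u) (-t) := funext fun u => by
    rw [← tau_neg_neg ht (hs.neg.update j u).neg, neg_neg]
  rw [h2]
  refine h1.congr_deriv ?_
  rw [tauShift, tauShift, sum_comm]
  refine sum_congr rfl fun l _ => sum_congr rfl fun r _ => ?_
  have h3 : trunc n (mom (-s) (-t)) = (trunc n (mom t s)).transpose := by
    rw [mom_neg_neg ht hs]
    rfl
  rw [h3, ← adjugate_transpose, transpose_apply, mu_neg_neg ht hs]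
  congr 2
  ring

theorem summable_deg_mul (ht : SummableTimes (degTimes t)) {F : ℕ+ → ℂ} {K : ℝ}
    (hF : ∀ i, ‖F i‖ ≤ K) : Summable fun i : ℕ+ => (i : ℂ) * t i * F i :=
  Summable.of_norm_bounded (Summable.mul_right K ht) fun i => by
    rw [norm_mul]
    exact mul_le_mul_of_nonneg_left (hF i) (norm_nonneg _)

theorem exists_norm_tauShift_le (n : ℕ) (t s : Times) : ∃ K, ∀ j, ‖tauShift n t s j‖ ≤ K := by
  refine ⟨∑ r : Fin n, ∑ l : Fin n, ‖mean‖ * ‖wtC t s‖ * ‖(trunc n (mom t s)).adjugate l r‖,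
    fun j => ?_⟩
  refine (norm_sum_le _ _).trans (sum_le_sum fun r _ => (norm_sum_le _ _).trans
    (sum_le_sum fun l _ => ?_))
  rw [norm_mul]
  exact mul_le_mul_of_nonneg_right (norm_mu_le _ _ _) (norm_nonneg _)

/-- The moment recursion at the index `r - l + k` is multiplied by the `(l, r)` entry of the
adjugate and summed. The bound on `tauShift`, uniform in the shift, allows the two series to be
separated. -/
theorem hasSum_tauShift (ht : SummableTimes (degTimes t)) (hs : SummableTimes (degTimes s)) (k : ℤ) :
    ∑' i : ℕ+, (i : ℂ) * t i * tauShift n t s (k + i)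
      + ∑' i : ℕ+, (i : ℂ) * s i * tauShift n t s (k - i) = -tauEuler n t s k := by
  obtain ⟨K, hK⟩ := exists_norm_tauShift_le n t s
  rw [← (summable_deg_mul ht fun i => hK _).tsum_add (summable_deg_mul hs fun i => hK _)]
  refine HasSum.tsum_eq ?_
  rw [tauEuler, ← sum_neg_distrib]
  simp_rw [tauShift, mul_sum, ← sum_add_distrib, ← sum_neg_distrib]
  refine hasSum_sum fun r _ => hasSum_sum fun l _ => ?_
  have h1 := (hasSum_mean_potDeriv ht hs (((r : ℕ) : ℤ) - (l : ℕ) + k)).mul_right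
    ((trunc n (mom t s)).adjugate l r)
  rw [neg_mul] at h1
  refine (congrArg (fun F => HasSum F _) (funext fun i => ?_)).mp h1
  rw [← add_assoc _ k, ← add_sub_assoc _ k]
  ring

theorem sum_sum_sub_mul (a b : Fin n → ℂ) (F : Fin n → Fin n → ℂ) :
    ∑ r, ∑ l, (a r - b l) * F r l = ∑ r, a r * ∑ l, F r l - ∑ l, b l * ∑ r, F r l := by
  have h1 : ∑ l, b l * ∑ r, F r l = ∑ r, ∑ l, b l * F r l := by
    simp_rw [mul_sum]
    exact sum_comm
  rw [h1, ← sum_sub_distrib]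
  refine sum_congr rfl fun r _ => ?_
  rw [mul_sum, ← sum_sub_distrib]
  exact sum_congr rfl fun l _ => sub_mul _ _ _

section

variable (ht : SummableTimes t) (hs : SummableTimes s)
include ht hs

theorem sum_mu_adjugate (r r' : Fin n) :
    ∑ l : Fin n, mu t s (((r' : ℕ) : ℤ) - (l : ℕ)) * (trunc n (mom t s)).adjugate l r
      = if r' = r then tau n t s else 0 := by
  have h1 := congrFun (congrFun (mul_adjugate (trunc n (mom t s))) r') r
  rw [mul_apply, Matrix.smul_apply, one_apply, smul_eq_mul, mul_ite, mul_one, mul_zero] at h1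
  rw [tau, ← h1]
  refine sum_congr rfl fun l _ => ?_
  rw [trunc, mom_eq ht hs]

theorem sum_adjugate_mu (l l' : Fin n) :
    ∑ r : Fin n, mu t s (((r : ℕ) : ℤ) - (l' : ℕ)) * (trunc n (mom t s)).adjugate l r
      = if l = l' then tau n t s else 0 := by
  have h1 := congrFun (congrFun (adjugate_mul (trunc n (mom t s))) l) l'
  rw [mul_apply, Matrix.smul_apply, one_apply, smul_eq_mul, mul_ite, mul_one, mul_zero] at h1
  rw [tau, ← h1]
  refine sum_congr rfl fun r _ => ?_
  rw [trunc, mom_eq ht hs, mul_comm]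

theorem tauShift_zero : tauShift n t s 0 = n * tau n t s := by
  simp_rw [tauShift, add_zero, sum_mu_adjugate ht hs, if_true]
  simp

theorem tauEuler_zero : tauEuler n t s 0 = 0 := by
  have h1 : tauEuler n t s 0 = ∑ r : Fin n, ((r : ℕ) : ℂ) * ∑ l : Fin n,
        mu t s (((r : ℕ) : ℤ) - (l : ℕ)) * (trunc n (mom t s)).adjugate l r
      - ∑ l : Fin n, ((l : ℕ) : ℂ) * ∑ r : Fin n,
        mu t s (((r : ℕ) : ℤ) - (l : ℕ)) * (trunc n (mom t s)).adjugate l r := by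
    rw [← sum_sum_sub_mul]
    refine sum_congr rfl fun r _ => sum_congr rfl fun l _ => ?_
    push_cast
    rw [add_zero]
    ring_nf
  rw [h1]
  simp_rw [sum_mu_adjugate ht hs, sum_adjugate_mu ht hs, if_true, sub_self]

/-- Write the factor `r - l + 1` as `n + (r + 1 - n) - l`. A row shifted by one is again a row of
the matrix, hence orthogonal to column `r` of the adjugate, unless `r = n - 1`, where the factor `r
+ 1 - n` vanishes. Likewise the shifted columns contribute only for `l = 0`, where the factor `l`
vanishes. -/
theorem tauEuler_one : tauEuler n t s 1 = n * tauShift n t s 1 := by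
  have h2 : ∀ r : Fin n, (((r : ℕ) : ℂ) + 1 - n) * ∑ l : Fin n,
      mu t s (((r : ℕ) : ℤ) - (l : ℕ) + 1) * (trunc n (mom t s)).adjugate l r = 0 := fun r => by
    by_cases hr : (r : ℕ) + 1 = n
    · have : ((r : ℕ) : ℂ) + 1 - n = 0 := by
        have := congrArg (Nat.cast (R := ℂ)) hr
        push_cast at this
        linear_combination this
      rw [this, zero_mul]
    · have h3 := sum_mu_adjugate ht hs r ⟨r + 1, by omega⟩
      rw [if_neg (by simp [Fin.ext_iff])] at h3
      have h4 : ∀ l : Fin n, (((r : ℕ) + 1 : ℕ) : ℤ) - (l : ℕ) = ((r : ℕ) : ℤ) - (l : ℕ) + 1 :=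
        fun l => by push_cast; ring
      simp only [h4] at h3
      rw [h3, mul_zero]
  have h5 : ∀ l : Fin n, ((l : ℕ) : ℂ) * ∑ r : Fin n,
      mu t s (((r : ℕ) : ℤ) - (l : ℕ) + 1) * (trunc n (mom t s)).adjugate l r = 0 := fun l => by
    rcases Nat.eq_zero_or_pos l with hl | hl
    · rw [hl, Nat.cast_zero, zero_mul]
    · have h3 := sum_adjugate_mu ht hs l ⟨l - 1, by omega⟩
      rw [if_neg (by simp [Fin.ext_iff]; omega)] at h3
      have h4 : ∀ r : Fin n, ((r : ℕ) : ℤ) - ((l : ℕ) - 1 : ℕ) = ((r : ℕ) : ℤ) - (l : ℕ) + 1 :=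
        fun r => by omega
      simp only [h4] at h3
      rw [h3, mul_zero]
  have h1 : tauEuler n t s 1 - n * tauShift n t s 1
      = ∑ r : Fin n, (((r : ℕ) : ℂ) + 1 - n) * ∑ l : Fin n,
        mu t s (((r : ℕ) : ℤ) - (l : ℕ) + 1) * (trunc n (mom t s)).adjugate l r
      - ∑ l : Fin n, ((l : ℕ) : ℂ) * ∑ r : Fin n,
        mu t s (((r : ℕ) : ℤ) - (l : ℕ) + 1) * (trunc n (mom t s)).adjugate l r := by
    rw [← sum_sum_sub_mul, tauEuler, tauShift, mul_sum, ← sum_sub_distrib]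
    refine sum_congr rfl fun r _ => ?_
    rw [mul_sum, ← sum_sub_distrib]
    refine sum_congr rfl fun l _ => ?_
    push_cast
    ring
  simp_rw [h2, h5] at h1
  rw [sum_const_zero, sub_self] at h1
  exact sub_eq_zero.1 h1

theorem tauEuler_neg_one : tauEuler n t s (-1) = -(n * tauShift n t s (-1)) := by
  have h2 : ∀ r : Fin n, ((r : ℕ) : ℂ) * ∑ l : Fin n,
      mu t s (((r : ℕ) : ℤ) - (l : ℕ) + -1) * (trunc n (mom t s)).adjugate l r = 0 := fun r => by
    rcases Nat.eq_zero_or_pos r with hr | hr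
    · rw [hr, Nat.cast_zero, zero_mul]
    · have h3 := sum_mu_adjugate ht hs r ⟨r - 1, by omega⟩
      rw [if_neg (by simp [Fin.ext_iff]; omega)] at h3
      have h4 : ∀ l : Fin n, (((r : ℕ) - 1 : ℕ) : ℤ) - (l : ℕ) = ((r : ℕ) : ℤ) - (l : ℕ) + -1 :=
        fun l => by omega
      simp only [h4] at h3
      rw [h3, mul_zero]
  have h5 : ∀ l : Fin n, (((l : ℕ) : ℂ) + 1 - n) * ∑ r : Fin n,
      mu t s (((r : ℕ) : ℤ) - (l : ℕ) + -1) * (trunc n (mom t s)).adjugate l r = 0 := fun l => by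
    by_cases hl : (l : ℕ) + 1 = n
    · have : ((l : ℕ) : ℂ) + 1 - n = 0 := by
        have := congrArg (Nat.cast (R := ℂ)) hl
        push_cast at this
        linear_combination this
      rw [this, zero_mul]
    · have h3 := sum_adjugate_mu ht hs l ⟨l + 1, by omega⟩
      rw [if_neg (by simp [Fin.ext_iff])] at h3
      have h4 : ∀ r : Fin n, ((r : ℕ) : ℤ) - (((l : ℕ) + 1 : ℕ) : ℤ) = ((r : ℕ) : ℤ) - (l : ℕ) + -1 :=
        fun r => by push_cast; ring
      simp only [h4] at h3
      rw [h3, mul_zero]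
  have h1 : tauEuler n t s (-1) + n * tauShift n t s (-1)
      = ∑ r : Fin n, ((r : ℕ) : ℂ) * ∑ l : Fin n,
        mu t s (((r : ℕ) : ℤ) - (l : ℕ) + -1) * (trunc n (mom t s)).adjugate l r
      - ∑ l : Fin n, (((l : ℕ) : ℂ) + 1 - n) * ∑ r : Fin n,
        mu t s (((r : ℕ) : ℤ) - (l : ℕ) + -1) * (trunc n (mom t s)).adjugate l r := by
    rw [← sum_sum_sub_mul, tauEuler, tauShift, mul_sum, ← sum_add_distrib]
    refine sum_congr rfl fun r _ => ?_
    rw [mul_sum, ← sum_add_distrib]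
    refine sum_congr rfl fun l _ => ?_
    push_cast
    ring
  simp_rw [h2, h5] at h1
  rw [sum_const_zero, sub_self] at h1
  exact eq_neg_of_add_eq_zero_left h1

end

/-- When the index is lowered by one, the term `i = 1` would carry the derivative of index `0`,
which the operator omits. The omitted term is `n t_1 τ_n` and is supplied by the multiplication part
of the operator. -/
theorem tsum_deg_pred {F : ℤ → ℂ} {K : ℝ} (ht : SummableTimes (degTimes t)) (hF : ∀ j, ‖F j‖ ≤ K) :
    ∑' i : ℕ+, (i : ℂ) * t i * (if 0 < -1 + (i : ℤ) then F (-1 + i) else 0)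
      = ∑' i : ℕ+, (i : ℂ) * t i * F (-1 + i) - t 1 * F 0 := by
  rw [eq_sub_iff_add_eq, (summable_deg_mul ht fun i => hF _).tsum_eq_add_tsum_ite 1, add_comm]
  congr 1
  · simp
  · refine tsum_congr fun i => ?_
    by_cases hi : i = 1
    · subst hi
      simp
    · have : (1 : ℕ) < i := lt_of_le_of_ne i.pos fun h => hi (PNat.coe_injective h.symm)
      rw [if_neg hi, if_pos (by omega)]

variable {f : Times → Times → ℂ} {c : ℂ}
  (hf : ∀ t s, SummableTimes t → SummableTimes s → f t s = c * tau n t s)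
include hf

/-- Agreement of `f` with `c τ_n` at summable times suffices for partial derivatives, because
changing one time preserves summability. The case in view is the circle integral with `c = n!`. -/
theorem pdZ_left (ht : SummableTimes t) (hs : SummableTimes s) (j : ℤ) :
    pdZ j (fun w => f w s) t = c * if 0 < j then tauShift n t s j else 0 := by
  rw [pdZ]
  split_ifs with hj
  · have h1 : (fun u => f (Function.update t ⟨j.toNat, by omega⟩ u) s)
        = fun u => c * tau n (Function.update t ⟨j.toNat, by omega⟩ u) s :=
      funext fun u => hf _ _ (ht.update _ u) hs
    change deriv (fun u => f (Function.update t ⟨j.toNat, by omega⟩ u) s) _ = _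
    rw [h1]
    refine ((pd_tau_left ht hs ⟨j.toNat, by omega⟩).const_mul c).deriv.trans ?_
    congr 2
    simp [hj.le]
  · rw [mul_zero]

theorem pdZ_right (ht : SummableTimes t) (hs : SummableTimes s) (j : ℤ) :
    pdZ j (fun w => f t (-w)) (-s) = c * if 0 < j then tauShift n t s (-j) else 0 := by
  rw [pdZ]
  split_ifs with hj
  · have h1 : (fun u => f t (-Function.update (-s) ⟨j.toNat, by omega⟩ u))
        = fun u => c * tau n t (-Function.update (-s) ⟨j.toNat, by omega⟩ u) :=
      funext fun u => hf _ _ ht (hs.neg.update _ u).neg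
    change deriv (fun u => f t (-Function.update (-s) ⟨j.toNat, by omega⟩ u)) _ = _
    rw [h1]
    refine ((pd_tau_right ht hs ⟨j.toNat, by omega⟩).const_mul c).deriv.trans ?_
    congr 2
    simp [hj.le]
  · rw [mul_zero]

theorem dConverges_of_tau (ht : SummableTimes (degTimes t)) (hs : SummableTimes (degTimes s))
    (k : ℤ) : DConverges k f t s := by
  obtain ⟨K, hK⟩ := exists_norm_tauShift_le n t s
  have hK0 : 0 ≤ K := (norm_nonneg _).trans (hK 0)
  have hb : ∀ (P : Prop) [Decidable P] (j : ℤ), ‖c * if P then tauShift n t s j else 0‖ ≤ ‖c‖ * K := by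
    intro P _ j
    rw [norm_mul]
    refine mul_le_mul_of_nonneg_left ?_ (norm_nonneg _)
    split_ifs
    · exact hK j
    · simpa using hK0
  constructor
  · simp_rw [pdZ_left hf ht.of_degTimes hs.of_degTimes]
    exact summable_deg_mul ht fun i => hb _ _
  · simp_rw [pdZ_right hf ht.of_degTimes hs.of_degTimes]
    have hs' : SummableTimes (degTimes (-s)) := by rw [degTimes_neg]; exact hs.neg
    exact summable_deg_mul hs' fun i => hb _ _

theorem virasoro_zero (ht : SummableTimes (degTimes t)) (hs : SummableTimes (degTimes s)) (θ : ℂ) :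
    D 0 θ n f t s = 0 := by
  have hP : ∀ i : ℕ+, (0 : ℤ) < i := fun i => by exact_mod_cast i.pos
  have h1 := hasSum_tauShift (n := n) ht hs 0
  rw [tauEuler_zero ht.of_degTimes hs.of_degTimes, neg_zero] at h1
  have e1 : ∀ i : ℕ+, (i : ℂ) * t i * (c * tauShift n t s i)
      = c * ((i : ℂ) * t i * tauShift n t s i) := fun i => by ring
  have e2 : ∀ i : ℕ+, (i : ℂ) * -s i * (c * tauShift n t s (-i))
      = -c * ((i : ℂ) * s i * tauShift n t s (-i)) := fun i => by ring
  simp only [zero_add, zero_sub] at h1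
  simp only [D, JJ2, J2, J1, J0, JJ1, pdZ_left hf ht.of_degTimes hs.of_degTimes,
    pdZ_right hf ht.of_degTimes hs.of_degTimes, neg_zero, zero_add, hP, if_true, Pi.neg_apply,
    e1, e2, tsum_mul_left, neg_neg]
  simp
  linear_combination c * h1

theorem virasoro_one (ht : SummableTimes (degTimes t)) (hs : SummableTimes (degTimes s)) :
    D 1 1 n f t s = 0 := by
  have hI : Ioo (0 : ℤ) 1 = ∅ := rfl
  have hP : ∀ i : ℕ+, (0 : ℤ) < 1 + i := fun i => by have := i.pos; omega
  obtain ⟨K, hK⟩ := exists_norm_tauShift_le n t s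
  have h1 := hasSum_tauShift (n := n) ht hs 1
  rw [tauEuler_one ht.of_degTimes hs.of_degTimes] at h1
  have h2 := tsum_deg_pred (F := fun j => tauShift n t s (-j)) hs fun j => hK _
  simp only [neg_zero, tauShift_zero ht.of_degTimes hs.of_degTimes] at h2
  have e0 : ∀ i : ℕ+, -(-1 + (i : ℤ)) = 1 - i := fun i => by ring
  have e1 : ∀ i : ℕ+, (i : ℂ) * t i * (c * tauShift n t s (1 + i))
      = c * ((i : ℂ) * t i * tauShift n t s (1 + i)) := fun i => by ring
  have e2 : ∀ i : ℕ+, (i : ℂ) * -s i * (c * if 0 < -1 + (i : ℤ) then tauShift n t s (1 - i) else 0)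
      = -c * ((i : ℂ) * s i * if 0 < -1 + (i : ℤ) then tauShift n t s (1 - i) else 0) :=
    fun i => by ring
  simp only [e0] at h2
  simp only [D, JJ2, J2, J1, J0, JJ1, pdZ_left hf ht.of_degTimes hs.of_degTimes,
    pdZ_right hf ht.of_degTimes hs.of_degTimes, hP, if_true, Pi.neg_apply, e0,
    e1, e2, tsum_mul_left, neg_neg, h2, tZ, hf t s ht.of_degTimes hs.of_degTimes]
  simp [hI]
  linear_combination c * h1

theorem virasoro_neg_one (ht : SummableTimes (degTimes t)) (hs : SummableTimes (degTimes s)) :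
    D (-1) 0 n f t s = 0 := by
  have hI : Ioo (0 : ℤ) 1 = ∅ := rfl
  have hP : ∀ i : ℕ+, (0 : ℤ) < 1 + i := fun i => by have := i.pos; omega
  obtain ⟨K, hK⟩ := exists_norm_tauShift_le n t s
  have h1 := hasSum_tauShift (n := n) ht hs (-1)
  rw [tauEuler_neg_one ht.of_degTimes hs.of_degTimes] at h1
  have h2 := tsum_deg_pred (F := fun j => tauShift n t s j) ht fun j => hK _
  simp only [tauShift_zero ht.of_degTimes hs.of_degTimes] at h2
  have e0 : ∀ i : ℕ+, -(1 + (i : ℤ)) = -1 - i := fun i => by ring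
  have e1 : ∀ i : ℕ+, (i : ℂ) * t i * (c * if 0 < -1 + (i : ℤ) then tauShift n t s (-1 + i) else 0)
      = c * ((i : ℂ) * t i * if 0 < -1 + (i : ℤ) then tauShift n t s (-1 + i) else 0) :=
    fun i => by ring
  have e2 : ∀ i : ℕ+, (i : ℂ) * -s i * (c * tauShift n t s (-1 - i))
      = -c * ((i : ℂ) * s i * tauShift n t s (-1 - i)) := fun i => by ring
  simp only [D, JJ2, J2, J1, J0, JJ1, pdZ_left hf ht.of_degTimes hs.of_degTimes,
    pdZ_right hf ht.of_degTimes hs.of_degTimes, hP, if_true, Pi.neg_apply, e0,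
    e1, e2, tsum_mul_left, neg_neg, h2, tZ, hf t s ht.of_degTimes hs.of_degTimes]
  simp [hI]
  linear_combination c * h1

end Virasoro

end ToeplitzLattice

/-! ### The `sl(2)` relations on polynomials -/

namespace ToeplitzLattice

open MvPolynomial

/-- The linear function `m X_{e(m)}`, zero for `m ≤ 0`. -/
noncomputable def degVar (e : ℕ+ → ℕ+ ⊕ ℕ+) (m : ℤ) : MvPolynomial (ℕ+ ⊕ ℕ+) ℂ :=
  if hm : 0 < m then C (m : ℂ) * X (e ⟨m.toNat, by omega⟩) else 0

theorem degVar_coe (e : ℕ+ → ℕ+ ⊕ ℕ+) (i : ℕ+) : degVar e i = C (i : ℂ) * X (e i) := by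
  rw [degVar, dif_pos (by exact_mod_cast i.pos)]
  congr 3

theorem degVar_of_nonpos (e : ℕ+ → ℕ+ ⊕ ℕ+) {m : ℤ} (hm : m ≤ 0) : degVar e m = 0 :=
  dif_neg (by omega)

/-- The derivation `∑ i X_{e(i)} ∂/∂X_{e(k+i)}`. -/
noncomputable def shiftDer (e : ℕ+ → ℕ+ ⊕ ℕ+) (k : ℤ) :
    Derivation ℂ (MvPolynomial (ℕ+ ⊕ ℕ+) ℂ) (MvPolynomial (ℕ+ ⊕ ℕ+) ℂ) :=
  mkDerivation ℂ (Function.extend e (fun j => degVar e (j - k)) 0)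

theorem shiftDer_X {e : ℕ+ → ℕ+ ⊕ ℕ+} (he : e.Injective) (k : ℤ) (j : ℕ+) :
    shiftDer e k (X (e j)) = degVar e (j - k) := by
  rw [shiftDer, mkDerivation_X, he.extend_apply]

theorem shiftDer_X_of_ne {e : ℕ+ → ℕ+ ⊕ ℕ+} (k : ℤ) {v : ℕ+ ⊕ ℕ+} (hv : ∀ j, e j ≠ v) :
    shiftDer e k (X v) = 0 := by
  rw [shiftDer, mkDerivation_X, Function.extend_apply' _ _ _ fun ⟨j, hj⟩ => hv j hj]
  rfl

/-- The partial derivative in the direction `e(j)`, zero for `j ≤ 0`. -/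
noncomputable def pderivZ (e : ℕ+ → ℕ+ ⊕ ℕ+) (j : ℤ) :
    Derivation ℂ (MvPolynomial (ℕ+ ⊕ ℕ+) ℂ) (MvPolynomial (ℕ+ ⊕ ℕ+) ℂ) :=
  if hj : 0 < j then pderiv (e ⟨j.toNat, by omega⟩) else 0

/-- Both sides are derivations in `p` over evaluation at `v`, so it suffices to treat the variables.
For a variable at most one term of the series is nonzero. -/
theorem hasSum_shiftDer {e : ℕ+ → ℕ+ ⊕ ℕ+} (he : e.Injective) (k : ℤ) (v : ℕ+ ⊕ ℕ+ → ℂ)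
    (p : MvPolynomial (ℕ+ ⊕ ℕ+) ℂ) :
    HasSum (fun i : ℕ+ => (i : ℂ) * v (e i) * eval v (pderivZ e (k + i) p))
      (eval v (shiftDer e k p)) := by
  induction p using MvPolynomial.induction_on with
  | C a => simp [derivation_C]
  | add p q hp hq => simpa only [map_add, mul_add] using hp.add hq
  | mul_X p u hp =>
    have hu : HasSum (fun i : ℕ+ => (i : ℂ) * v (e i) * eval v (pderivZ e (k + i) (X u)))
        (eval v (shiftDer e k (X u))) := by
      by_cases hj : ∃ j, e j = u
      · obtain ⟨j, rfl⟩ := hj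
        have hval : ∀ i : ℕ+, (k + i : ℤ) ≠ j → pderivZ e (k + i) (X (e j)) = 0 := by
          intro i hi
          rw [pderivZ]
          split_ifs with hp
          · refine pderiv_X_of_ne fun h => hi ?_
            rw [he h]
            simp [hp.le]
          · rfl
        rw [shiftDer_X he]
        by_cases hm : 0 < (j : ℤ) - k
        · obtain ⟨i, hi⟩ : ∃ i : ℕ+, (i : ℤ) = j - k :=
            ⟨⟨((j : ℤ) - k).toNat, by omega⟩, Int.toNat_of_nonneg hm.le⟩
          rw [← hi, degVar_coe]
          have hone : pderivZ e (k + i) (X (e j)) = 1 := by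
            have hj : (k + i : ℤ) = j := by omega
            rw [hj, pderivZ, dif_pos (by exact_mod_cast j.pos)]
            exact pderiv_X_self _
          have := hasSum_single (f := fun i : ℕ+ => (i : ℂ) * v (e i)
            * eval v (pderivZ e (k + i) (X (e j)))) i fun i' hi' => by
              rw [hval i' fun h => hi' (PNat.coe_injective (by omega)), map_zero, mul_zero]
          simpa [hone] using this
        · rw [degVar_of_nonpos e (by omega), map_zero]
          refine (congrArg (fun F => HasSum F _) (funext fun i : ℕ+ => ?_)).mpr hasSum_zero
          rw [hval i (by have := i.pos; omega), map_zero, mul_zero]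
      · push Not at hj
        rw [shiftDer_X_of_ne k hj, map_zero]
        have : ∀ i : ℕ+, pderivZ e (k + i) (X u) = 0 := fun i => by
          rw [pderivZ]
          split_ifs
          · exact pderiv_X_of_ne fun h => hj _ h.symm
          · rfl
        simpa only [this, map_zero, mul_zero] using hasSum_zero
    have := (hu.mul_left (eval v p)).add (hp.mul_left (v u))
    refine (congrArg₂ HasSum (funext fun i => ?_) ?_).mp this
    · simp only [Derivation.leibniz, smul_eq_mul, map_add, map_mul, eval_X]
      ring
    · simp only [Derivation.leibniz, smul_eq_mul, map_add, map_mul, eval_X]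

theorem hasDerivAt_eval_update (v : ℕ+ ⊕ ℕ+ → ℂ) (u : ℕ+ ⊕ ℕ+) (p : MvPolynomial (ℕ+ ⊕ ℕ+) ℂ) :
    HasDerivAt (fun a => eval (Function.update v u a) p) (eval v (pderiv u p)) (v u) := by
  induction p using MvPolynomial.induction_on with
  | C a => simpa using hasDerivAt_const (v u) a
  | add p q hp hq => simpa using hp.fun_add hq
  | mul_X p i hp =>
    have hi : HasDerivAt (fun a => Function.update v u a i) (eval v (pderiv u (X i))) (v u) := by
      by_cases hiu : i = u
      · subst hiu
        simpa using hasDerivAt_id' (v i)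
      · simpa [hiu, pderiv_X_of_ne hiu] using hasDerivAt_const (v u) (v i)
    simp only [map_mul, eval_X, Derivation.leibniz, smul_eq_mul, map_add]
    refine (hp.fun_mul hi).congr_deriv ?_
    rw [Function.update_eq_self]
    ring

theorem pd_polyFun_left (p : MvPolynomial (ℕ+ ⊕ ℕ+) ℂ) (t s : Times) (k : ℕ+) :
    pd k (fun w => polyFun p w s) t = polyFun (pderiv (Sum.inl k) p) t s := by
  have := hasDerivAt_eval_update (Sum.elim t s) (Sum.inl k) p
  simp_rw [Sum.update_elim_inl] at this
  exact this.deriv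

theorem pd_polyFun_right (p : MvPolynomial (ℕ+ ⊕ ℕ+) ℂ) (t s : Times) (k : ℕ+) :
    pd k (fun w => polyFun p t (-w)) (-s) = -polyFun (pderiv (Sum.inr k) p) t s := by
  have := hasDerivAt_eval_update (Sum.elim t s) (Sum.inr k) p
  simp_rw [Sum.update_elim_inr] at this
  have h2 : ∀ u : ℂ, -Function.update (-s) k u = Function.update s k (-u) := by
    intro u
    ext i
    by_cases hi : i = k
    · subst hi
      simp
    · simp [hi]
  have h4 : HasDerivAt (fun a => polyFun p t (Function.update s k a))
      (polyFun (pderiv (Sum.inr k) p) t s) (-((-s) k)) := by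
    rw [Pi.neg_apply, neg_neg]
    exact this
  simp_rw [pd, h2]
  exact ((h4.scomp _ (hasDerivAt_neg _)).congr_deriv (by simp)).deriv

theorem pdZ_polyFun_left (p : MvPolynomial (ℕ+ ⊕ ℕ+) ℂ) (t s : Times) (j : ℤ) :
    pdZ j (fun w => polyFun p w s) t = polyFun (pderivZ Sum.inl j p) t s := by
  rw [pdZ, pderivZ]
  split_ifs with hj
  · exact pd_polyFun_left p t s _
  · simp [polyFun]

theorem pdZ_polyFun_right (p : MvPolynomial (ℕ+ ⊕ ℕ+) ℂ) (t s : Times) (j : ℤ) :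
    pdZ j (fun w => polyFun p t (-w)) (-s) = -polyFun (pderivZ Sum.inr j p) t s := by
  rw [pdZ, pderivZ]
  split_ifs with hj
  · exact pd_polyFun_right p t s _
  · simp [polyFun]

theorem tsum_polyFun_left (p : MvPolynomial (ℕ+ ⊕ ℕ+) ℂ) (t s : Times) (k : ℤ) :
    ∑' i : ℕ+, (i : ℂ) * t i * pdZ (k + i) (fun w => polyFun p w s) t
      = polyFun (shiftDer Sum.inl k p) t s := by
  simp_rw [pdZ_polyFun_left]
  exact (hasSum_shiftDer Sum.inl_injective k (Sum.elim t s) p).tsum_eq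

theorem tsum_polyFun_right (p : MvPolynomial (ℕ+ ⊕ ℕ+) ℂ) (t s : Times) (k : ℤ) :
    ∑' i : ℕ+, (i : ℂ) * -s i * pdZ (k + i) (fun w => polyFun p t (-w)) (-s)
      = polyFun (shiftDer Sum.inr k p) t s := by
  simp_rw [pdZ_polyFun_right, mul_neg, neg_mul, neg_neg]
  exact (hasSum_shiftDer Sum.inr_injective k (Sum.elim t s) p).tsum_eq

/-- The derivation part of the three Virasoro operators. -/
noncomputable def virDer (n : ℕ) (k : ℤ) :
    Derivation ℂ (MvPolynomial (ℕ+ ⊕ ℕ+) ℂ) (MvPolynomial (ℕ+ ⊕ ℕ+) ℂ) :=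
  shiftDer Sum.inl k - shiftDer Sum.inr (-k)
    + (n : ℂ) • (if k = 1 then pderiv (Sum.inl 1) else if k = -1 then pderiv (Sum.inr 1) else 0)

theorem ioo_zero_one : Finset.Ioo (0 : ℤ) 1 = ∅ := rfl

theorem D_one_polyFun (n : ℕ) (p : MvPolynomial (ℕ+ ⊕ ℕ+) ℂ) :
    D 1 1 n (polyFun p) = polyFun (virDer n 1 p + C (n : ℂ) * X (Sum.inr 1) * p) := by
  ext t s
  have e := tsum_polyFun_right p t s (-1)
  have h1 : pdZ 1 (fun w => polyFun p w s) t = polyFun (pderiv (Sum.inl 1) p) t s :=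
    pdZ_polyFun_left p t s 1
  simp only [D, JJ2, JJ1, J2, J1, J0, tsum_polyFun_left, h1, Pi.neg_apply, e]
  simp [tZ, pdZ, virDer, polyFun, ioo_zero_one]
  ring_nf

theorem D_neg_one_polyFun (n : ℕ) (p : MvPolynomial (ℕ+ ⊕ ℕ+) ℂ) :
    D (-1) 0 n (polyFun p) = polyFun (virDer n (-1) p + C (n : ℂ) * X (Sum.inl 1) * p) := by
  ext t s
  have e := tsum_polyFun_right p t s 1
  have h1 : pdZ 1 (fun w => polyFun p t (-w)) (-s) = -polyFun (pderiv (Sum.inr 1) p) t s :=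
    pdZ_polyFun_right p t s 1
  simp only [D, JJ2, JJ1, J2, J1, J0, tsum_polyFun_left, neg_neg, h1, Pi.neg_apply, e]
  simp [tZ, pdZ, virDer, polyFun, ioo_zero_one]
  ring_nf

theorem D_zero_polyFun (n : ℕ) (θ : ℂ) (p : MvPolynomial (ℕ+ ⊕ ℕ+) ℂ) :
    D 0 θ n (polyFun p) = polyFun (virDer n 0 p) := by
  ext t s
  have e := tsum_polyFun_right p t s 0
  simp only [D, JJ2, JJ1, J2, J1, J0, tsum_polyFun_left, neg_zero, Pi.neg_apply, e]
  simp [tZ, pdZ, virDer, polyFun]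
  ring_nf

theorem virDer_one_inl_one (n : ℕ) : virDer n 1 (X (Sum.inl 1)) = C (n : ℂ) := by
  simp [virDer, shiftDer_X Sum.inl_injective, shiftDer_X_of_ne, degVar_of_nonpos, smul_eq_C_mul]

theorem virDer_inl_add_one (n : ℕ) (j : ℕ+) :
    virDer n 1 (X (Sum.inl (j + 1))) = C (j : ℂ) * X (Sum.inl j) := by
  have h2 : (Sum.inl (j + 1) : ℕ+ ⊕ ℕ+) ≠ Sum.inl 1 := fun h => by
    have := congrArg PNat.val (Sum.inl_injective h)
    simp at this
  simp [virDer, shiftDer_X Sum.inl_injective, shiftDer_X_of_ne, degVar_coe,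
    pderiv_X_of_ne h2]

theorem virDer_one_inr (n : ℕ) (j : ℕ+) :
    virDer n 1 (X (Sum.inr j)) = -(C ((j : ℂ) + 1) * X (Sum.inr (j + 1))) := by
  have hj : degVar Sum.inr ((j : ℤ) + 1) = C ((j : ℂ) + 1) * X (Sum.inr (j + 1)) := by
    rw [show (j : ℤ) + 1 = (j + 1 : ℕ+) by push_cast; rfl, degVar_coe]
    push_cast
    rfl
  simp [virDer, shiftDer_X Sum.inr_injective, shiftDer_X_of_ne, hj]

theorem virDer_zero_inl (n : ℕ) (j : ℕ+) :
    virDer n 0 (X (Sum.inl j)) = C (j : ℂ) * X (Sum.inl j) := by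
  simp [virDer, shiftDer_X Sum.inl_injective, shiftDer_X_of_ne, degVar_coe]

theorem virDer_zero_inr (n : ℕ) (j : ℕ+) :
    virDer n 0 (X (Sum.inr j)) = -(C (j : ℂ) * X (Sum.inr j)) := by
  simp [virDer, shiftDer_X Sum.inr_injective, shiftDer_X_of_ne, degVar_coe]

theorem virDer_neg_one_inr_one (n : ℕ) : virDer n (-1) (X (Sum.inr 1)) = C (n : ℂ) := by
  simp [virDer, shiftDer_X Sum.inr_injective, shiftDer_X_of_ne, degVar_of_nonpos, smul_eq_C_mul]

theorem virDer_inr_add_one (n : ℕ) (j : ℕ+) :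
    virDer n (-1) (X (Sum.inr (j + 1))) = -(C (j : ℂ) * X (Sum.inr j)) := by
  have h2 : (Sum.inr (j + 1) : ℕ+ ⊕ ℕ+) ≠ Sum.inr 1 := fun h => by
    have := congrArg PNat.val (Sum.inr_injective h)
    simp at this
  simp [virDer, shiftDer_X Sum.inr_injective, shiftDer_X_of_ne, degVar_coe,
    pderiv_X_of_ne h2]

theorem virDer_neg_one_inl (n : ℕ) (j : ℕ+) :
    virDer n (-1) (X (Sum.inl j)) = C ((j : ℂ) + 1) * X (Sum.inl (j + 1)) := by
  have hj : degVar Sum.inl ((j : ℤ) + 1) = C ((j : ℂ) + 1) * X (Sum.inl (j + 1)) := by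
    rw [show (j : ℤ) + 1 = (j + 1 : ℕ+) by push_cast; rfl, degVar_coe]
    push_cast
    rfl
  simp [virDer, shiftDer_X Sum.inl_injective, shiftDer_X_of_ne, hj]

theorem pnat_eq_one_or_add_one (j : ℕ+) : j = 1 ∨ ∃ k : ℕ+, j = k + 1 := by
  induction j using PNat.recOn with
  | one => exact Or.inl rfl
  | succ k _ => exact Or.inr ⟨k, rfl⟩

theorem virDer_commutators (n : ℕ) :
    ⁅virDer n 1, virDer n (-1)⁆ = (2 : ℂ) • virDer n 0 ∧
    ⁅virDer n 1, virDer n 0⁆ = virDer n 1 ∧ ⁅virDer n 0, virDer n (-1)⁆ = virDer n (-1) := by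
  refine ⟨?_, ?_, ?_⟩ <;>
  · refine derivation_ext ?_
    rintro (j | j) <;> obtain rfl | ⟨j, rfl⟩ := pnat_eq_one_or_add_one j <;>
    simp [Derivation.commutator_apply, virDer_one_inl_one, virDer_inl_add_one, virDer_one_inr,
      virDer_zero_inl, virDer_zero_inr, virDer_neg_one_inr_one, virDer_inr_add_one,
      virDer_neg_one_inl, Derivation.leibniz, derivation_C, smul_eq_C_mul, -map_natCast, -map_add,
      -map_one] <;>
    (try simp only [map_add, Derivation.map_one_eq_zero, derivation_C]) <;>
    (have h2 : (C 2 : MvPolynomial (ℕ+ ⊕ ℕ+) ℂ) = 2 := rfl) <;> (try simp only [h2]) <;> ring1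

/-- The operators for `k = 1` and `k = -1` are `virDer` plus multiplication by `n s_1` and `n t_1`.
Commuting the derivations past these multiplications produces `n² - n² = 0` in the first relation
and exactly the required multiplication terms in the other two. -/
theorem virasoro_sl2 (n : ℕ) (θ : ℂ) (p : MvPolynomial (ℕ+ ⊕ ℕ+) ℂ) (t s : Times) :
    D 1 1 n (D (-1) 0 n (polyFun p)) t s - D (-1) 0 n (D 1 1 n (polyFun p)) t s
        = 2 * D 0 θ n (polyFun p) t s ∧
      D 1 1 n (D 0 θ n (polyFun p)) t s - D 0 θ n (D 1 1 n (polyFun p)) t s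
        = D 1 1 n (polyFun p) t s ∧
      D 0 θ n (D (-1) 0 n (polyFun p)) t s - D (-1) 0 n (D 0 θ n (polyFun p)) t s
        = D (-1) 0 n (polyFun p) t s := by
  obtain ⟨c1, c2, c3⟩ := virDer_commutators n
  have e1 := congrArg (fun δ => polyFun (δ p) t s) c1
  have e2 := congrArg (fun δ => polyFun (δ p) t s) c2
  have e3 := congrArg (fun δ => polyFun (δ p) t s) c3
  have hsub : ∀ a b : MvPolynomial (ℕ+ ⊕ ℕ+) ℂ, polyFun (a - b) t s = polyFun a t s - polyFun b t s :=
    fun a b => by simp [polyFun]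
  have hadd : ∀ a b : MvPolynomial (ℕ+ ⊕ ℕ+) ℂ, polyFun (a + b) t s = polyFun a t s + polyFun b t s :=
    fun a b => by simp [polyFun]
  have hmul : ∀ a b : MvPolynomial (ℕ+ ⊕ ℕ+) ℂ, polyFun (a * b) t s = polyFun a t s * polyFun b t s :=
    fun a b => by simp [polyFun]
  have hneg : ∀ a : MvPolynomial (ℕ+ ⊕ ℕ+) ℂ, polyFun (-a) t s = -polyFun a t s :=
    fun a => by simp [polyFun]
  have hsm : ∀ (c : ℂ) (a : MvPolynomial (ℕ+ ⊕ ℕ+) ℂ), polyFun (c • a) t s = c * polyFun a t s :=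
    fun c a => by simp [polyFun, smul_eq_C_mul]
  have hC : ∀ a : ℂ, polyFun (C a) t s = a := fun a => by simp [polyFun]
  simp only [Derivation.commutator_apply, hsub, Derivation.smul_apply, hsm] at e1 e2 e3
  simp only [D_one_polyFun, D_neg_one_polyFun, D_zero_polyFun, map_add, Derivation.leibniz,
    smul_eq_mul, derivation_C, virDer_one_inl_one, virDer_neg_one_inr_one, virDer_zero_inl,
    virDer_zero_inr, hadd, hmul, hneg, hC, mul_zero, add_zero, PNat.one_coe, Nat.cast_one,
    one_mul, mul_neg]
  refine ⟨?_, ?_, ?_⟩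
  · linear_combination e1
  · linear_combination e2
  · linear_combination e3

end ToeplitzLattice

/-! ### Integration over the torus and Andréief's identity -/

namespace ToeplitzLattice

/-- Integration of continuous functions on a compact space against a finite measure. -/
noncomputable def intCLM {X : Type*} [TopologicalSpace X] [CompactSpace X] [MeasurableSpace X]
    [OpensMeasurableSpace X] (m : Measure X) [IsFiniteMeasure m] : C(X, ℂ) →L[ℂ] ℂ :=
  LinearMap.mkContinuous
    { toFun := fun f => ∫ x, f x ∂m
      map_add' := fun f g => integral_add (f.continuous.integrable_of_hasCompactSupport
        (HasCompactSupport.of_compactSpace _)) (g.continuous.integrable_of_hasCompactSupport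
        (HasCompactSupport.of_compactSpace _))
      map_smul' := fun c f => integral_const_mul c _ } (m.real Set.univ) fun f => by
    have := norm_integral_le_of_norm_le_const (μ := m) (f := f) (C := ‖f‖)
      (.of_forall fun x => f.norm_coe_le_norm x)
    rw [mul_comm]
    exact this

theorem intCLM_apply {X : Type*} [TopologicalSpace X] [CompactSpace X] [MeasurableSpace X]
    [OpensMeasurableSpace X] (m : Measure X) [IsFiniteMeasure m] (f : C(X, ℂ)) :
    intCLM m f = ∫ x, f x ∂m := rfl

noncomputable instance instMeasurableSpaceCircle : MeasurableSpace Circle := borel _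

instance instBorelSpaceCircle : BorelSpace Circle := ⟨rfl⟩

/-- The arc length on the unit circle. -/
noncomputable def arcLength : Measure Circle :=
  (volume.restrict (Set.Icc 0 (2 * π))).map Circle.exp

instance isFiniteMeasure_arcLength : IsFiniteMeasure arcLength := by
  unfold arcLength
  infer_instance

theorem mean_eq_integral (f : C(Circle, ℂ)) : mean f = (2 * π : ℂ)⁻¹ * ∫ z, f z ∂arcLength := by
  rw [mean_apply, arcLength, integral_map (by fun_prop) (by fun_prop),
    intervalIntegral.integral_of_le Real.two_pi_pos.le, integral_Icc_eq_integral_Ioc]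

/-- The mean over the torus `(S¹)ⁿ`. -/
noncomputable def torusMean (n : ℕ) : C(Fin n → Circle, ℂ) →L[ℂ] ℂ :=
  ((2 * π : ℂ) ^ n)⁻¹ • intCLM (Measure.pi fun _ : Fin n => arcLength)

/-- The function `∏ f_k(z_k)` on the torus. -/
noncomputable def torusProd {n : ℕ} (f : Fin n → C(Circle, ℂ)) : C(Fin n → Circle, ℂ) :=
  ∏ k, (f k).comp ⟨fun z => z k, continuous_apply k⟩

theorem torusProd_apply {n : ℕ} (f : Fin n → C(Circle, ℂ)) (z : Fin n → Circle) :
    torusProd f z = ∏ k, f k (z k) := by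
  simp [torusProd, ContinuousMap.prod_apply]

theorem torusMean_torusProd {n : ℕ} (f : Fin n → C(Circle, ℂ)) :
    torusMean n (torusProd f) = ∏ k, mean (f k) := by
  simp only [torusMean, smul_apply, intCLM_apply, torusProd_apply,
    mean_eq_integral, smul_eq_mul]
  rw [integral_fintype_prod_eq_prod (fun k z => f k z), Finset.prod_mul_distrib,
    Finset.prod_const, Finset.card_univ, Fintype.card_fin, inv_pow]

/-- The function `|Δ_n(z)|²` on the torus. -/
noncomputable def vanderSq (n : ℕ) : C(Fin n → Circle, ℂ) where
  toFun z := ((‖∏ k : Fin n, ∏ l ∈ Finset.Ioi k, ((z l : ℂ) - z k)‖ ^ 2 : ℝ) : ℂ)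
  continuous_toFun := by fun_prop

theorem vanderSq_eq (n : ℕ) : vanderSq n = ∑ σ : Equiv.Perm (Fin n), ∑ ρ : Equiv.Perm (Fin n),
    ((σ.sign : ℤ) * (ρ.sign : ℤ) : ℂ) • torusProd fun k => zp ((σ k : ℕ) - (ρ k : ℕ) : ℤ) := by
  ext z
  have h1 : ∏ k : Fin n, ∏ l ∈ Finset.Ioi k, ((z l : ℂ) - z k)
      = ∑ σ : Equiv.Perm (Fin n), (σ.sign : ℂ) * ∏ k, (z k : ℂ) ^ (σ k : ℕ) := by
    rw [← Matrix.det_vandermonde, ← Matrix.det_transpose, Matrix.det_apply']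
    rfl
  have h2 : (vanderSq n) z = (∏ k : Fin n, ∏ l ∈ Finset.Ioi k, ((z l : ℂ) - z k))
      * starRingEnd ℂ (∏ k : Fin n, ∏ l ∈ Finset.Ioi k, ((z l : ℂ) - z k)) := by
    rw [Complex.mul_conj']
    simp [vanderSq]
  rw [h2, h1, map_sum, Finset.sum_mul_sum]
  simp only [ContinuousMap.sum_apply, ContinuousMap.smul_apply, torusProd_apply, zp_apply,
    smul_eq_mul]
  refine Finset.sum_congr rfl fun σ _ => Finset.sum_congr rfl fun ρ _ => ?_
  rw [map_mul, map_prod, mul_mul_mul_comm, ← Finset.prod_mul_distrib]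
  congr 1
  · simp
  · refine Finset.prod_congr rfl fun k _ => ?_
    rw [zpow_sub₀ (Circle.coe_ne_zero _), zpow_natCast, zpow_natCast, map_pow, div_eq_mul_inv,
      ← inv_pow, ← Circle.coe_inv_eq_conj, Circle.coe_inv]

/-- Andréief's identity on the circle. -/
theorem torusMean_mul_vanderSq (n : ℕ) (f : C(Circle, ℂ)) :
    torusMean n ((torusProd fun _ => f) * vanderSq n)
      = n.factorial * Matrix.det (Matrix.of fun k l : Fin n =>
        mean (zp ((k : ℕ) - (l : ℕ) : ℤ) * f)) := by
  have h1 : ∀ g : Fin n → C(Circle, ℂ), (torusProd fun _ => f) * torusProd g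
      = torusProd fun k => g k * f := fun g => by
    ext z
    simp only [ContinuousMap.mul_apply, torusProd_apply, Finset.prod_mul_distrib, mul_comm]
  simp only [vanderSq_eq, Finset.mul_sum, mul_smul_comm, h1, map_sum, map_smul,
    torusMean_torusProd, smul_eq_mul]
  rw [Finset.sum_comm]
  -- For fixed `ρ` the sum over `σ` is the determinant with columns permuted by `ρ`. Its sign
  -- cancels that of `ρ`, so all `n!` terms agree.
  have h2 : ∀ ρ : Equiv.Perm (Fin n), ∑ σ : Equiv.Perm (Fin n), ((σ.sign : ℤ) * (ρ.sign : ℤ) : ℂ)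
      * ∏ k, mean (zp ((σ k : ℕ) - (ρ k : ℕ) : ℤ) * f)
      = Matrix.det (Matrix.of fun k l : Fin n => mean (zp ((k : ℕ) - (l : ℕ) : ℤ) * f)) := by
    intro ρ
    have h3 := Matrix.det_permute' ρ
      (Matrix.of fun k l : Fin n => mean (zp ((k : ℕ) - (l : ℕ) : ℤ) * f))
    rw [Matrix.det_apply'] at h3
    have h4 : ((ρ.sign : ℤ) : ℂ) * (ρ.sign : ℤ) = 1 := by
      rcases Int.units_eq_one_or ρ.sign with h | h <;> simp [h]
    calc _ = ((ρ.sign : ℤ) : ℂ) * ∑ σ : Equiv.Perm (Fin n), ((σ.sign : ℤ) : ℂ)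
          * ∏ k, mean (zp ((σ k : ℕ) - (ρ k : ℕ) : ℤ) * f) := by
          rw [Finset.mul_sum]
          exact Finset.sum_congr rfl fun σ _ => by ring
      _ = ((ρ.sign : ℤ) : ℂ) * (((ρ.sign : ℤ) : ℂ) * _) := congrArg _ h3
      _ = _ := by rw [← mul_assoc, h4, one_mul]
  rw [Finset.sum_congr rfl fun ρ _ => h2 ρ, Finset.sum_const, Finset.card_univ,
    Fintype.card_perm, Fintype.card_fin, nsmul_eq_mul]

theorem circleI_eq_torusMean {n : ℕ} {t s : Times} (ht : SummableTimes t) (hs : SummableTimes s) :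
    circleI n t s = torusMean n ((torusProd fun _ => wtC t s) * vanderSq n) := by
  have h1 : (volume.restrict (Set.Icc (0 : Fin n → ℝ) fun _ => 2 * π))
      = Measure.pi fun _ : Fin n => (volume.restrict (Set.Icc 0 (2 * π)) : Measure ℝ) := by
    rw [← Measure.restrict_pi_pi, Set.pi_univ_Icc]
    rfl
  have h2 : (Measure.pi fun _ : Fin n => arcLength)
      = (Measure.pi fun _ : Fin n => (volume.restrict (Set.Icc 0 (2 * π)) : Measure ℝ)).map
        fun θ k => Circle.exp (θ k) := by
    rw [Measure.pi_map_pi fun _ => by fun_prop]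
    rfl
  rw [circleI, torusIntegral, h1]
  simp only [torusMean, smul_apply, intCLM_apply, smul_eq_mul]
  have h6 : Continuous fun (θ : Fin n → ℝ) k => Circle.exp (θ k) := by fun_prop
  rw [h2, integral_map h6.measurable.aemeasurable (by fun_prop), mul_pow, mul_inv, mul_assoc,
    ← integral_const_mul]
  congr 1
  refine integral_congr_ae (.of_forall fun θ => ?_)
  have h3 : ∀ k, torusMap (0 : Fin n → ℂ) (1 : Fin n → ℝ) θ k = Circle.exp (θ k) := fun k => by
    simp [torusMap]
  have h4 : ∏ k : Fin n, (((1 : Fin n → ℝ) k : ℂ) * Complex.exp (θ k * Complex.I) * Complex.I)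
      = Complex.I ^ n * ∏ k, (Circle.exp (θ k) : ℂ) := by
    rw [Finset.prod_mul_distrib, Finset.prod_const, Finset.card_univ, Fintype.card_fin, mul_comm]
    simp
  have h5 : ∏ k : Fin n, (Circle.exp (θ k) : ℂ) ≠ 0 :=
    Finset.prod_ne_zero_iff.mpr fun k _ => Circle.coe_ne_zero _
  simp only [h3, ContinuousMap.mul_apply, torusProd_apply, wtC_apply ht hs,
    Finset.prod_div_distrib]
  rw [h4]
  simp only [vanderSq, ContinuousMap.coe_mk]
  field_simp

theorem circleI_eq {n : ℕ} {t s : Times} (ht : SummableTimes t) (hs : SummableTimes s) :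
    circleI n t s = n.factorial * tau n t s := by
  rw [circleI_eq_torusMean ht hs, torusMean_mul_vanderSq, tau_eq ht hs]
  rfl

theorem circleI_zero (t s : Times) : circleI 0 t s = 1 := by
  simp [circleI, torusIntegral_dim0]

end ToeplitzLattice

namespace ToeplitzLattice

/-! ### The generating function of the elementary Schur polynomials -/

/-- The power series `∑ t_i z^i`. -/
noncomputable def timeSeries (t : Times) : PowerSeries ℂ :=
  PowerSeries.mk fun i => if hi : 0 < i then t ⟨i, hi⟩ else 0

theorem eval_elemSchur (t : Times) (n : ℕ) : MvPolynomial.eval t (elemSchur n)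
    = ∑ k ∈ Finset.range (n + 1), (k.factorial : ℂ)⁻¹ * PowerSeries.coeff n (timeSeries t ^ k) := by
  have h1 : PowerSeries.map (MvPolynomial.eval t) (PowerSeries.mk fun i => if hi : 0 < i then
      (MvPolynomial.X (⟨i, hi⟩ : ℕ+) : MvPolynomial ℕ+ ℂ) else 0) = timeSeries t := by
    ext i
    simp only [timeSeries, PowerSeries.coeff_map, PowerSeries.coeff_mk]
    split_ifs
    · exact MvPolynomial.eval_X _
    · exact map_zero _
  simp only [elemSchur, map_sum, map_mul, MvPolynomial.eval_C, ← h1, ← map_pow,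
    PowerSeries.coeff_map]

theorem coeff_timeSeries_pow_eq_zero (t : Times) {k n : ℕ} (h : n < k) :
    PowerSeries.coeff n (timeSeries t ^ k) = 0 := by
  refine PowerSeries.coeff_of_lt_order _ (lt_of_lt_of_le ?_ (PowerSeries.le_order_pow _ _))
  have h1 : (1 : ENat) ≤ (timeSeries t).order := by
    refine PowerSeries.le_order _ _ fun i hi => ?_
    have : i = 0 := by exact_mod_cast Order.lt_one_iff.mp hi
    subst this
    simp [timeSeries]
  calc (n : ENat) < k := by exact_mod_cast h
    _ = k • 1 := by simp
    _ ≤ k • (timeSeries t).order := nsmul_le_nsmul_right h1 k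

section Banach

variable {A : Type*} [NormedCommRing A] [NormedAlgebra ℂ A] [CompleteSpace A] {u : A}
  (hu : ∀ i : ℕ, ‖u ^ i‖ ≤ 1) {t : Times} (ht : SummableTimes t)

theorem hasSum_pnat_iff {E : Type*} [AddCommMonoid E] [TopologicalSpace E] {f : ℕ → E} (h0 : f 0 = 0)
    {a : E} : HasSum (fun i : ℕ+ => f i) a ↔ HasSum f a := by
  refine PNat.coe_injective.hasSum_iff (f := f) fun i hi => ?_
  rcases Nat.eq_zero_or_pos i with h | h
  · rw [h, h0]
  · exact absurd ⟨⟨i, h⟩, rfl⟩ hi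

theorem coeff_timeSeries_coe (t : Times) (i : ℕ+) : PowerSeries.coeff (i : ℕ) (timeSeries t) = t i := by
  simp only [timeSeries, PowerSeries.coeff_mk, i.pos, dite_true]
  rfl

omit [CompleteSpace A] in
include hu in
theorem norm_smul_pow_le (c : ℂ) (i : ℕ) : ‖c • u ^ i‖ ≤ ‖c‖ := by
  rw [norm_smul]
  exact mul_le_of_le_one_right (norm_nonneg _) (hu i)

include hu ht in
-- Induction by Cauchy products. The bound by `(∑ ‖t i‖)^k` makes the double series over `k` and `n`
-- absolutely convergent after division by `k!`.
theorem hasSum_coeff_timeSeries_pow (k : ℕ) :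
    (Summable fun n => ‖PowerSeries.coeff n (timeSeries t ^ k)‖) ∧
    ∑' n, ‖PowerSeries.coeff n (timeSeries t ^ k)‖ ≤ (∑' i, ‖t i‖) ^ k ∧
    HasSum (fun n => PowerSeries.coeff n (timeSeries t ^ k) • u ^ n)
      ((∑' i : ℕ+, t i • u ^ (i : ℕ)) ^ k) := by
  have hT : HasSum (fun n => ‖PowerSeries.coeff n (timeSeries t)‖) (∑' i, ‖t i‖) := by
    rw [← hasSum_pnat_iff (by simp [timeSeries])]
    simp_rw [coeff_timeSeries_coe]
    exact ht.hasSum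
  induction k with
  | zero =>
    have h1 : ∀ n, n ≠ 0 → PowerSeries.coeff n (1 : PowerSeries ℂ) = 0 := fun n hn => by
      rw [PowerSeries.coeff_one, if_neg hn]
    have h2 := hasSum_single (f := fun n => ‖PowerSeries.coeff n (1 : PowerSeries ℂ)‖) 0
      fun n hn => by rw [h1 n hn, norm_zero]
    have h3 := hasSum_single (f := fun n => PowerSeries.coeff n (1 : PowerSeries ℂ) • u ^ n) 0
      fun n hn => by rw [h1 n hn, zero_smul]
    simp only [pow_zero]
    refine ⟨h2.summable, by rw [h2.tsum_eq]; simp, by simpa using h3⟩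
  | succ k ih =>
    obtain ⟨i1, i2, i3⟩ := ih
    have c1 : ∀ n, PowerSeries.coeff n (timeSeries t ^ (k + 1))
        = ∑ p ∈ Finset.HasAntidiagonal.antidiagonal n, PowerSeries.coeff p.1 (timeSeries t ^ k)
          * PowerSeries.coeff p.2 (timeSeries t) := fun n => by
      rw [pow_succ, PowerSeries.coeff_mul]
    have s1 : Summable fun n => ‖‖PowerSeries.coeff n (timeSeries t ^ k)‖‖ := by simpa using i1
    have s2 : Summable fun n => ‖‖PowerSeries.coeff n (timeSeries t)‖‖ := by simpa using hT.summable
    have s3 := summable_norm_sum_mul_antidiagonal_of_summable_norm s1 s2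
    have s3' : Summable fun n => ∑ p ∈ Finset.HasAntidiagonal.antidiagonal n,
        ‖PowerSeries.coeff p.1 (timeSeries t ^ k)‖ * ‖PowerSeries.coeff p.2 (timeSeries t)‖ :=
      s3.of_norm
    have b1 : ∀ n, ‖PowerSeries.coeff n (timeSeries t ^ (k + 1))‖ ≤ ∑ p ∈ Finset.HasAntidiagonal.antidiagonal n,
        ‖PowerSeries.coeff p.1 (timeSeries t ^ k)‖ * ‖PowerSeries.coeff p.2 (timeSeries t)‖ :=
      fun n => by
        rw [c1]
        exact (norm_sum_le _ _).trans (le_of_eq (Finset.sum_congr rfl fun p _ => norm_mul _ _))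
    have s4 := Summable.of_nonneg_of_le (fun n => norm_nonneg _) b1 s3'
    refine ⟨s4, ?_, ?_⟩
    · refine (s4.tsum_le_tsum b1 s3').trans ?_
      rw [← tsum_mul_tsum_eq_tsum_sum_antidiagonal_of_summable_norm s1 s2, hT.tsum_eq, pow_succ]
      exact mul_le_mul_of_nonneg_right i2 (tsum_nonneg fun _ => norm_nonneg _)
    · have hTu : HasSum (fun n => PowerSeries.coeff n (timeSeries t) • u ^ n)
          (∑' i : ℕ+, t i • u ^ (i : ℕ)) := by
        rw [← hasSum_pnat_iff (by simp [timeSeries])]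
        simp_rw [coeff_timeSeries_coe]
        exact (Summable.of_norm_bounded ht fun i => norm_smul_pow_le hu _ _).hasSum
      have n1 : Summable fun n => ‖PowerSeries.coeff n (timeSeries t ^ k) • u ^ n‖ :=
        .of_nonneg_of_le (fun _ => norm_nonneg _) (fun n => norm_smul_pow_le hu _ _) i1
      have n2 : Summable fun n => ‖PowerSeries.coeff n (timeSeries t) • u ^ n‖ :=
        .of_nonneg_of_le (fun _ => norm_nonneg _) (fun n => norm_smul_pow_le hu _ _) hT.summable
      have e1 := tsum_mul_tsum_eq_tsum_sum_antidiagonal_of_summable_norm n1 n2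
      rw [i3.tsum_eq, hTu.tsum_eq, ← pow_succ] at e1
      have e2 : ∀ n, PowerSeries.coeff n (timeSeries t ^ (k + 1)) • u ^ n
          = ∑ p ∈ Finset.HasAntidiagonal.antidiagonal n, (PowerSeries.coeff p.1 (timeSeries t ^ k) • u ^ p.1)
            * (PowerSeries.coeff p.2 (timeSeries t) • u ^ p.2) := fun n => by
        rw [c1, Finset.sum_smul]
        refine Finset.sum_congr rfl fun p hp => ?_
        rw [smul_mul_smul_comm, ← pow_add, Finset.HasAntidiagonal.mem_antidiagonal.mp hp]
      rw [e1]
      simp_rw [← e2]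
      exact (Summable.of_norm_bounded s4 fun n => norm_smul_pow_le hu _ _).hasSum

include hu ht in
/-- `∑_n s_n(t) u^n = e^{∑ t_i u^i}` in a Banach algebra. -/
theorem hasSum_elemSchur :
    (Summable fun n => ‖MvPolynomial.eval t (elemSchur n)‖) ∧
    HasSum (fun n => MvPolynomial.eval t (elemSchur n) • u ^ n)
      (NormedSpace.exp (∑' i : ℕ+, t i • u ^ (i : ℕ))) := by
  set c : ℕ → ℕ → ℂ := fun k n => (k.factorial : ℂ)⁻¹ * PowerSeries.coeff n (timeSeries t ^ k)
  have hz : ∀ n k, k ∉ Finset.range (n + 1) → c k n = 0 := fun n k hk => by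
    rw [Finset.mem_range, not_lt] at hk
    simp [c, coeff_timeSeries_pow_eq_zero t (show n < k by omega)]
  have hc : ∀ n, HasSum (fun k => c k n) (MvPolynomial.eval t (elemSchur n)) := fun n => by
    rw [eval_elemSchur]
    exact hasSum_sum_of_ne_finset_zero (hz n)
  have hcn : ∀ k, ∑' n, ‖c k n‖ ≤ (k.factorial : ℝ)⁻¹ * (∑' i, ‖t i‖) ^ k := fun k => by
    have := (hasSum_coeff_timeSeries_pow hu ht k).2.1
    simp only [c, norm_mul, tsum_mul_left]
    refine mul_le_mul (by simp) this (tsum_nonneg fun _ => norm_nonneg _) (by positivity)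
  -- Absolute summability of the double array permits summation in either order: along `k` first
  -- gives the elementary Schur polynomials, along `n` first the exponential series.
  have hsum : Summable fun p : ℕ × ℕ => ‖c p.1 p.2‖ := by
    rw [summable_prod_of_nonneg fun _ => norm_nonneg _]
    refine ⟨fun k => ?_, .of_nonneg_of_le (fun k => tsum_nonneg fun _ => norm_nonneg _) hcn ?_⟩
    · simp only [c, norm_mul]
      exact (hasSum_coeff_timeSeries_pow hu ht k).1.mul_left _
    · simpa [div_eq_inv_mul] using Real.summable_pow_div_factorial (∑' i, ‖t i‖)
  have hsum' : Summable fun p : ℕ × ℕ => ‖c p.2 p.1‖ := hsum.prod_symm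
  constructor
  · refine Summable.of_nonneg_of_le (fun n => norm_nonneg _) (fun n => ?_) hsum'.prod
    rw [← (hc n).tsum_eq]
    exact norm_tsum_le_tsum_norm (hsum'.prod_factor n)
  · have g1 : Summable fun p : ℕ × ℕ => c p.2 p.1 • u ^ p.1 :=
      .of_norm_bounded hsum' fun p => norm_smul_pow_le hu _ _
    have g2 : ∀ k, HasSum (fun n => c k n • u ^ n)
        ((k.factorial : ℂ)⁻¹ • (∑' i : ℕ+, t i • u ^ (i : ℕ)) ^ k) := fun k => by
      simp only [c, mul_smul]
      exact (hasSum_coeff_timeSeries_pow hu ht k).2.2.const_smul _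
    have g3 := g1.hasSum.prod_fiberwise fun n => (hc n).smul_const (u ^ n)
    have g4 := g1.prod_symm.hasSum.prod_fiberwise g2
    have g5 : HasSum (fun k => (k.factorial : ℂ)⁻¹ • (∑' i : ℕ+, t i • u ^ (i : ℕ)) ^ k)
        (NormedSpace.exp (∑' i : ℕ+, t i • u ^ (i : ℕ))) := by
      simpa [NormedSpace.expSeries_apply_eq] using
        NormedSpace.expSeries_hasSum_exp (𝕂 := ℂ) (∑' i : ℕ+, t i • u ^ (i : ℕ))
    have g6 : (∑' p : ℕ × ℕ, c p.2 p.1 • u ^ p.1) = NormedSpace.exp (∑' i : ℕ+, t i • u ^ (i : ℕ)) := by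
      rw [← g4.unique g5, ← (Equiv.prodComm ℕ ℕ).tsum_eq]
      rfl
    rwa [g6] at g3

end Banach

/-! ### Expansion of the moments -/

/-- The entries `s_{c-a}(t)`, zero for `c < a`. -/
noncomputable def schurEntry (t : Times) (a c : ℕ) : ℂ :=
  if a ≤ c then MvPolynomial.eval t (elemSchur (c - a)) else 0

theorem zp_pow (j : ℤ) (i : ℕ) : zp j ^ i = zp (j * i) := by
  ext z
  simp [zp_apply, zpow_mul]

theorem norm_zp_pow_le (j : ℤ) (i : ℕ) : ‖zp j ^ i‖ ≤ 1 := by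
  rw [zp_pow]
  exact norm_zp_le _

variable {t s : Times}

theorem hasSum_schurEntry (ht : SummableTimes t) (j : ℤ) (a : ℕ) :
    (Summable fun c => ‖schurEntry t a c‖) ∧
    HasSum (fun c => schurEntry t a c • zp (j * c))
      (zp (j * a) * NormedSpace.exp (∑' i : ℕ+, t i • zp (j * i))) := by
  have h1 := hasSum_elemSchur (norm_zp_pow_le j) ht
  have hinj : Function.Injective fun c : ℕ => c + a := add_left_injective a
  have hr : ∀ c, c ∉ Set.range (fun c : ℕ => c + a) → schurEntry t a c = 0 := fun c hc => by
    refine if_neg fun h => hc ⟨c - a, ?_⟩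
    simp [h]
  have he : ∀ c, schurEntry t a (c + a) = MvPolynomial.eval t (elemSchur c) := fun c => by
    simp [schurEntry]
  constructor
  · rw [← hinj.summable_iff fun c hc => by rw [hr c hc, norm_zero]]
    simpa [Function.comp_def, he] using h1.1
  · rw [← hinj.hasSum_iff fun c hc => by rw [hr c hc, zero_smul]]
    simp only [zp_pow] at h1
    refine (congrArg (fun F => HasSum F _) (funext fun c => ?_)).mp (h1.2.mul_left (zp (j * a)))
    simp only [Function.comp_apply, he, Nat.cast_add, mul_add]
    rw [mul_smul_comm, ← zp_add, add_comm]

theorem wtC_eq_exp_mul (ht : SummableTimes t) (hs : SummableTimes s) :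
    wtC t s = NormedSpace.exp (∑' i : ℕ+, t i • zp (1 * i))
      * NormedSpace.exp (∑' i : ℕ+, (-s) i • zp (-1 * i)) := by
  have hb : ∀ j : ℤ, ∀ i : ℕ+, ‖zp (j * i)‖ ≤ 1 := fun j i => norm_zp_le _
  rw [← NormedSpace.exp_add_of_commute (Commute.all _ _), wtC, wt, pot]
  congr 1
  rw [← (summable_smul_of_bounded (hb 1) ht).tsum_add (summable_smul_of_bounded (hb (-1)) hs.neg)]
  refine tsum_congr fun i => ?_
  simp [sub_eq_add_neg]

theorem mean_smul_mul_smul (x y : ℂ) (c d : ℕ) :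
    mean (x • zp (1 * c) * y • zp (-1 * d)) = if c = d then x * y else 0 := by
  rw [smul_mul_smul_comm, map_smul, ← zp_add, mean_zp, smul_eq_mul]
  by_cases h : c = d
  · rw [if_pos h, if_pos (by rw [h]; ring), mul_one]
  · rw [if_neg h, if_neg (by omega), mul_zero]

theorem hasSum_diagonal {E : Type*} [AddCommMonoid E] [TopologicalSpace E] {f : ℕ → E} {a : E}
    (hf : HasSum (fun p : ℕ × ℕ => if p.1 = p.2 then f p.1 else 0) a) : HasSum f a := by
  have hinj : Function.Injective fun c : ℕ => (c, c) := fun c d h => congrArg Prod.fst h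
  rw [← hinj.hasSum_iff] at hf
  · simpa [Function.comp_def] using hf
  · rintro ⟨c, d⟩ hcd
    refine if_neg fun h => hcd ⟨c, ?_⟩
    simp only at h
    rw [h]

theorem summable_norm_schurEntry_smul (ht : SummableTimes t) (j : ℤ) (a : ℕ) :
    Summable fun c => ‖schurEntry t a c • zp (j * c)‖ :=
  .of_nonneg_of_le (fun _ => norm_nonneg _) (fun c => by
    rw [norm_smul]
    exact mul_le_of_le_one_right (norm_nonneg _) (norm_zp_le _)) (hasSum_schurEntry ht j a).1

theorem hasSum_map_mul {A : Type*} [NormedCommRing A] [NormedAlgebra ℂ A] [CompleteSpace A]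
    (φ : A →L[ℂ] ℂ) {f g : ℕ → A} {x y : A} (hf : HasSum f x) (hg : HasSum g y)
    (nf : Summable fun i => ‖f i‖) (ng : Summable fun i => ‖g i‖) :
    HasSum (fun p : ℕ × ℕ => φ (f p.1 * g p.2)) (φ (x * y)) :=
  (hf.mul hg (summable_mul_of_summable_norm nf ng)).mapL φ

/-- The expansion `μ_{a-b} = ∑_c s_{c-a}(t) s_{c-b}(-s)` of the moments. -/
theorem hasSum_mu (ht : SummableTimes t) (hs : SummableTimes s) (a b : ℕ) :
    HasSum (fun c => schurEntry t a c * schurEntry (-s) b c) (mu t s (a - b)) := by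
  have h3 := hasSum_map_mul mean (hasSum_schurEntry ht 1 a).2 (hasSum_schurEntry hs.neg (-1) b).2
    (summable_norm_schurEntry_smul ht 1 a) (summable_norm_schurEntry_smul hs.neg (-1) b)
  have h6 : zp (1 * a) * zp (-1 * b) = zp (a - b) := by
    rw [← zp_add]
    congr 1
    ring
  rw [mul_mul_mul_comm, h6, ← wtC_eq_exp_mul ht hs] at h3
  refine hasSum_diagonal ((congrArg (fun F => HasSum F _) (funext fun p => ?_)).mp h3)
  refine (mean_smul_mul_smul _ _ p.1 p.2).trans ?_
  split_ifs with h
  · rw [h]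
  · rfl

end ToeplitzLattice

namespace ToeplitzLattice

/-! ### An infinite Cauchy–Binet formula -/

theorem summable_mul_of_summable_norm_norm {ι κ : Type*} {f : ι → ℂ} {g : κ → ℂ}
    (hf : Summable fun i => ‖f i‖) (hg : Summable fun i => ‖g i‖) :
    Summable fun p : ι × κ => ‖f p.1 * g p.2‖ := by
  simp only [norm_mul]
  exact hf.mul_of_nonneg hg (fun _ => norm_nonneg _) fun _ => norm_nonneg _

theorem hasSum_mul_of_summable_norm {ι κ : Type*} {f : ι → ℂ} {g : κ → ℂ}
    (hf : Summable fun i => ‖f i‖) (hg : Summable fun i => ‖g i‖) {b : ℂ} (hb : HasSum g b) :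
    HasSum (fun p : ι × κ => f p.1 * g p.2) ((∑' i, f i) * b) :=
  hf.of_norm.hasSum.mul hb (summable_mul_of_summable_norm_norm hf hg).of_norm

/-- The decomposition of a finite sequence into its head and its tail. -/
def consNatEquiv (n : ℕ) : ℕ × (Fin n → ℕ) ≃ (Fin (n + 1) → ℕ) where
  toFun p := Fin.cons (α := fun _ => ℕ) p.1 p.2
  invFun c := (c 0, fun k => c k.succ)
  left_inv p := by simp
  right_inv c := by
    funext k
    refine Fin.cases ?_ (fun k => ?_) k <;> simp

theorem hasSum_prod_succ {n : ℕ} {f : ℕ → ℂ} {g : (Fin n → ℕ) → ℂ} {F : (Fin (n + 1) → ℕ) → ℂ} {b : ℂ}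
    (hF : ∀ p : ℕ × (Fin n → ℕ), F (consNatEquiv n p) = f p.1 * g p.2)
    (hf : Summable fun i => ‖f i‖) (hg : Summable fun i => ‖g i‖) (hb : HasSum g b) :
    (Summable fun c => ‖F c‖) ∧ HasSum F ((∑' i, f i) * b) := by
  constructor
  · rw [← (consNatEquiv n).summable_iff]
    refine (summable_mul_of_summable_norm_norm hf hg).congr fun p => ?_
    rw [Function.comp_apply, hF]
  · rw [← (consNatEquiv n).hasSum_iff]
    have e1 : F ∘ consNatEquiv n = fun p => f p.1 * g p.2 := funext hF
    rw [e1]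
    exact hasSum_mul_of_summable_norm hf hg hb

theorem hasSum_prod_pi {n : ℕ} {g : Fin n → ℕ → ℂ} (hg : ∀ k, Summable fun c => ‖g k c‖) :
    (Summable fun c : Fin n → ℕ => ‖∏ k, g k (c k)‖) ∧
    HasSum (fun c : Fin n → ℕ => ∏ k, g k (c k)) (∏ k, ∑' c, g k c) := by
  induction n with
  | zero =>
    have h1 : ∀ c : Fin 0 → ℕ, ∏ k, g k (c k) = 1 := fun c => Fin.prod_univ_zero _
    refine ⟨(hasSum_unique _).summable, ?_⟩
    simp only [h1, Fin.prod_univ_zero]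
    exact hasSum_unique _
  | succ n ih =>
    obtain ⟨i1, i2⟩ := ih (g := fun k => g k.succ) fun k => hg k.succ
    rw [Fin.prod_univ_succ]
    refine hasSum_prod_succ (f := g 0) (g := fun c => ∏ k : Fin n, g k.succ (c k))
      (F := fun c => ∏ k, g k (c k)) (fun p => ?_) (hg 0) i1 i2
    rw [Fin.prod_univ_succ]
    rfl

/-- The determinant of `A Bᵀ` for `n × ∞` matrices `A` and `B` with absolutely summable rows. -/
theorem hasSum_det_mul {n : ℕ} {A B : Fin n → ℕ → ℂ} {M : Matrix (Fin n) (Fin n) ℂ}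
    (hAB : ∀ i j, Summable fun c => ‖A i c * B j c‖) (hM : ∀ i j, M i j = ∑' c, A i c * B j c) :
    HasSum (fun c : Fin n → ℕ => (Matrix.of fun i j => A i (c j)).det * ∏ k, B k (c k)) M.det := by
  have h1 : HasSum (fun c : Fin n → ℕ => ∑ σ : Equiv.Perm (Fin n), ((σ.sign : ℤ) : ℂ)
      * ∏ k, (A (σ k) (c k) * B k (c k))) M.det := by
    rw [Matrix.det_apply']
    refine hasSum_sum fun σ _ => HasSum.mul_left _ ?_
    simp only [hM]
    exact (hasSum_prod_pi (g := fun k c => A (σ k) c * B k c) fun k => hAB (σ k) k).2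
  refine (congrArg (fun F => HasSum F _) (funext fun c => ?_)).mp h1
  rw [Matrix.det_apply', Finset.sum_mul]
  refine Finset.sum_congr rfl fun σ _ => ?_
  rw [Finset.prod_mul_distrib, mul_assoc]
  rfl

/-! ### Young diagrams and strictly decreasing sequences -/

/-- The strictly decreasing sequence `λ_i + n - 1 - i`, `0 ≤ i < n`. -/
def betaSeq (n : ℕ) (lam : YoungDiagram) (i : Fin n) : ℕ := lam.rowLen i + (Fin.rev i : ℕ)

theorem betaSeq_strictAnti (n : ℕ) (lam : YoungDiagram) : StrictAnti (betaSeq n lam) := by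
  intro i j hij
  have h1 := lam.rowLen_anti i j hij.le
  have h2 : (Fin.rev j : ℕ) < Fin.rev i := Fin.rev_lt_rev.mpr hij
  simp only [betaSeq]
  omega

theorem rowLen_eq_zero {lam : YoungDiagram} {i : ℕ} (h : lam.colLen 0 ≤ i) : lam.rowLen i = 0 := by
  by_contra h0
  have : (i, 0) ∈ lam := YoungDiagram.mem_iff_lt_rowLen.mpr (Nat.pos_of_ne_zero h0)
  exact absurd (YoungDiagram.mem_iff_lt_colLen.mp this) (by omega)

theorem youngDiagram_ext {lam nu : YoungDiagram} (h : ∀ i, lam.rowLen i = nu.rowLen i) : lam = nu := by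
  ext ⟨i, j⟩
  rw [YoungDiagram.mem_cells, YoungDiagram.mem_cells, YoungDiagram.mem_iff_lt_rowLen,
    YoungDiagram.mem_iff_lt_rowLen, h]

theorem betaSeq_injective {n : ℕ} {lam nu : YoungDiagram} (hl : lam.colLen 0 ≤ n)
    (hn : nu.colLen 0 ≤ n) (h : betaSeq n lam = betaSeq n nu) : lam = nu := by
  refine youngDiagram_ext fun i => ?_
  by_cases hi : i < n
  · have := congrFun h ⟨i, hi⟩
    simp only [betaSeq] at this
    omega
  · rw [rowLen_eq_zero (by omega), rowLen_eq_zero (by omega)]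

theorem strictAnti_add_le {n : ℕ} {b : Fin n → ℕ} (hb : StrictAnti b) (k : ℕ) :
    ∀ i j : Fin n, (j : ℕ) = i + k → b j + k ≤ b i := by
  induction k with
  | zero => exact fun i j h => (congrArg b (Fin.ext h)).le
  | succ k ih =>
    intro i j h
    have h1 := ih i ⟨i + k, by omega⟩ rfl
    have h3 : (⟨i + k, by omega⟩ : Fin n) < j := Fin.lt_def.mpr (by
      change (i : ℕ) + k < j
      omega)
    have h2 := hb h3
    omega

/-- Subtracting the staircase `n - 1 - i` from a strictly decreasing sequence leaves a weakly
decreasing one, which serves as the list of row lengths. -/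
theorem exists_betaSeq_eq {n : ℕ} {b : Fin n → ℕ} (hb : StrictAnti b) :
    ∃ lam : YoungDiagram, lam.colLen 0 ≤ n ∧ betaSeq n lam = b := by
  have hge : ∀ i : Fin n, (Fin.rev i : ℕ) ≤ b i := fun i => by
    have h0 := i.isLt
    have h1 := strictAnti_add_le hb (Fin.rev i) i ⟨n - 1, by omega⟩ (by
      simp only [Fin.val_rev]
      omega)
    omega
  have hanti : Antitone fun i : Fin n => b i - (Fin.rev i : ℕ) := by
    intro i j hij
    have h1 := strictAnti_add_le hb (j - i) i j (by have := Fin.le_def.mp hij; omega)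
    have h2 := Fin.le_def.mp hij
    simp only [Fin.val_rev]
    omega
  refine ⟨YoungDiagram.ofRowLens _ hanti.sortedGE_ofFn, ?_, ?_⟩
  · by_contra hlt
    have : (n, 0) ∈ YoungDiagram.ofRowLens _ hanti.sortedGE_ofFn :=
      YoungDiagram.mem_iff_lt_colLen.mpr (by omega)
    obtain ⟨h, -⟩ := YoungDiagram.mem_ofRowLens.mp this
    simp at h
  · ext i
    have h1 := YoungDiagram.rowLen_ofRowLens (hw := hanti.sortedGE_ofFn) ⟨i, by simp⟩
    have h2 := hge i
    simp only [Fin.getElem_fin, List.getElem_ofFn] at h1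
    rw [betaSeq, h1]
    simp only [Fin.eta]
    omega

theorem schurEntry_self (t : Times) (a : ℕ) : schurEntry t a a = 1 := by
  rw [schurEntry, if_pos le_rfl, Nat.sub_self, eval_elemSchur]
  simp

theorem schurEntry_congr (t : Times) {a c a' c' : ℕ} (h : a + c' = a' + c) :
    schurEntry t a c = schurEntry t a' c' := by
  by_cases hc : a ≤ c
  · rw [schurEntry, schurEntry, if_pos hc, if_pos (by omega), show c - a = c' - a' by omega]
  · rw [schurEntry, schurEntry, if_neg hc, if_neg (by omega)]

/-- Enlarging the determinant by an empty row does not change it: the last row is then zero except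
for a final entry `1`. -/
theorem schur_eq_det {n : ℕ} {lam : YoungDiagram} (h : lam.colLen 0 ≤ n) (t : Times) :
    schur lam t = Matrix.det (Matrix.of fun i j : Fin n => schurEntry t i (lam.rowLen i + j)) := by
  induction n, h using Nat.le_induction with
  | base => rfl
  | succ n hn ih =>
    rw [ih, Matrix.det_succ_row _ (Fin.last n), Finset.sum_eq_single (Fin.last n)]
    · have h1 : schurEntry t n n = 1 := schurEntry_self t n
      simp only [Matrix.of_apply, Fin.val_last, rowLen_eq_zero hn, zero_add, h1, mul_one]
      rw [← two_mul, pow_mul, neg_one_sq, one_pow, one_mul]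
      congr 1
      ext i j
      simp
    · intro j _ hj
      have : (j : ℕ) < n := Fin.val_lt_last hj
      have h1 : schurEntry t n j = 0 := if_neg (by omega)
      simp [rowLen_eq_zero hn, h1]
    · simp

theorem det_schurEntry_betaSeq {n : ℕ} {lam : YoungDiagram} (h : lam.colLen 0 ≤ n) (t : Times) :
    Matrix.det (Matrix.of fun i j : Fin n => schurEntry t (Fin.rev i : ℕ) (betaSeq n lam j))
      = schur lam t := by
  rw [schur_eq_det h, ← Matrix.det_transpose]
  congr 1
  ext i j
  refine schurEntry_congr t ?_
  have e1 := Fin.val_rev i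
  have e2 := Fin.val_rev j
  simp only [betaSeq]
  omega

/-- The expansion of a function of injective sequences over Young diagrams and permutations. -/
theorem hasSum_youngDiagram {n : ℕ} {f : (Fin n → ℕ) → ℂ} {a : ℂ} (hf : HasSum f a)
    (h0 : ∀ c, ¬ Function.Injective c → f c = 0) :
    HasSum (fun lam : {lam : YoungDiagram // lam.colLen 0 ≤ n} =>
      ∑ σ : Equiv.Perm (Fin n), f (betaSeq n lam.1 ∘ σ)) a := by
  set Ψ : {lam : YoungDiagram // lam.colLen 0 ≤ n} × Equiv.Perm (Fin n) → (Fin n → ℕ) :=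
    fun p => betaSeq n p.1.1 ∘ p.2
  have hinj : Function.Injective Ψ := by
    rintro ⟨⟨lam, hl⟩, σ⟩ ⟨⟨nu, hn⟩, ρ⟩ h
    have h1 : betaSeq n lam ∘ σ = betaSeq n nu ∘ ρ := h
    have h2 : betaSeq n lam = betaSeq n nu := by
      rw [← (betaSeq_strictAnti n lam).range_inj (betaSeq_strictAnti n nu),
        ← σ.surjective.range_comp, h1, ρ.surjective.range_comp]
    obtain rfl := betaSeq_injective hl hn h2
    have h3 : σ = ρ := Equiv.ext fun k =>
      (betaSeq_strictAnti n lam).injective (congrFun h1 k)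
    rw [h3]
  have hrange : ∀ c, c ∉ Set.range Ψ → f c = 0 := by
    refine fun c hc => h0 c fun hci => hc ?_
    -- Sorting an injective sequence in decreasing order recovers its diagram, and the sorting
    -- permutation recovers `σ`.
    have hb : StrictAnti (c ∘ Tuple.sort c ∘ Fin.rev) :=
      ((Tuple.monotone_sort c).strictMono_of_injective
        (hci.comp (Tuple.sort c).injective)).comp_strictAnti Fin.rev_strictAnti
    obtain ⟨lam, hl, hlam⟩ := exists_betaSeq_eq hb
    refine ⟨⟨⟨lam, hl⟩, (Tuple.sort c).symm.trans Fin.revPerm⟩, ?_⟩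
    ext k
    simp [Ψ, hlam]
  exact ((hinj.hasSum_iff hrange).mpr hf).prod_fiberwise fun lam => hasSum_fintype _

/-- The expansion of `τ_n` in Schur polynomials. -/
theorem hasSum_schur {t s : Times} (ht : SummableTimes t) (hs : SummableTimes s) (n : ℕ) :
    HasSum (fun lam : {lam : YoungDiagram // lam.colLen 0 ≤ n} =>
      schur lam.1 t * schur lam.1 (-s)) (tau n t s) := by
  set A : Fin n → ℕ → ℂ := fun i => schurEntry t (Fin.rev i : ℕ)
  set B : Fin n → ℕ → ℂ := fun i => schurEntry (-s) (Fin.rev i : ℕ)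
  -- Reversing rows and columns makes the indices match the decreasing sequences `betaSeq`.
  have htau : tau n t s = Matrix.det (Matrix.of fun i j : Fin n =>
      mu t s ((Fin.rev i : ℕ) - (Fin.rev j : ℕ) : ℤ)) := by
    rw [tau_eq ht hs, ← Matrix.det_submatrix_equiv_self Fin.revPerm]
    rfl
  have hs1 : ∀ i, Summable fun c => ‖A i c‖ := fun i => (hasSum_schurEntry ht 1 _).1
  have hs2 : ∀ i, Summable fun c => ‖B i c‖ := fun i => (hasSum_schurEntry hs.neg 1 _).1
  have hs3 : ∀ i j, Summable fun c => ‖A i c * B j c‖ := fun i j => by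
    refine .of_nonneg_of_le (fun _ => norm_nonneg _) (fun c => ?_)
      ((hs1 i).mul_right (∑' c, ‖B j c‖))
    rw [norm_mul]
    exact mul_le_mul_of_nonneg_left ((hs2 j).le_tsum c fun _ _ => norm_nonneg _) (norm_nonneg _)
  have h1 := hasSum_det_mul (A := A) (B := B) (M := Matrix.of fun i j : Fin n =>
      mu t s ((Fin.rev i : ℕ) - (Fin.rev j : ℕ) : ℤ))
    (fun i j => hs3 i j) fun i j => (hasSum_mu ht hs _ _).tsum_eq.symm
  rw [← htau] at h1
  have h2 := hasSum_youngDiagram h1 fun c hc => by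
    rw [Function.Injective] at hc
    push Not at hc
    obtain ⟨i, j, hij, hne⟩ := hc
    rw [Matrix.det_zero_of_column_eq hne fun k => by simp [hij], zero_mul]
  refine (congrArg (fun F => HasSum F _) (funext fun lam => ?_)).mp h2
  have h3 : ∀ σ : Equiv.Perm (Fin n), Matrix.det (Matrix.of fun i j =>
      A i ((betaSeq n lam.1 ∘ σ) j)) = (σ.sign : ℤ) * schur lam.1 t := fun σ => by
    rw [← det_schurEntry_betaSeq lam.2, ← Matrix.det_permute']
    rfl
  have h4 : schur lam.1 (-s) = ∑ σ : Equiv.Perm (Fin n), ((σ.sign : ℤ) : ℂ)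
      * ∏ k, B k (betaSeq n lam.1 (σ k)) := by
    rw [← det_schurEntry_betaSeq lam.2, ← Matrix.det_transpose, Matrix.det_apply']
    rfl
  simp only [h3]
  rw [h4, Finset.mul_sum]
  refine Finset.sum_congr rfl fun σ _ => ?_
  simp only [Function.comp_apply]
  ring

end ToeplitzLattice

/-! ### Eigenvalues of unitary matrices -/

namespace ToeplitzLattice

open Polynomial in
-- Over `ℂ` the polynomial splits and the determinant is multiplicative, so it suffices to treat
-- constants and `X - a`, where the determinant is a value of the characteristic polynomial up to
-- sign. Applied to `x - X^k` it yields the characteristic polynomial of a power.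
theorem det_aeval {n : ℕ} (A : Matrix (Fin n) (Fin n) ℂ) (p : ℂ[X]) :
    (aeval A p).det = (A.charpoly.roots.map fun a => p.eval a).prod := by
  have hcard : A.charpoly.roots.card = n := by
    rw [← (IsAlgClosed.splits A.charpoly).natDegree_eq_card_roots, Matrix.charpoly_natDegree_eq_dim,
      Fintype.card_fin]
  have hlin : ∀ a : ℂ, (aeval A (X - C a)).det = (A.charpoly.roots.map fun b => (X - C a).eval b).prod := by
    intro a
    have h1 : aeval A (X - C a) = -(Matrix.scalar (Fin n) a - A) := by
      rw [map_sub, aeval_X, aeval_C, neg_sub]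
      rfl
    have h2 := (IsAlgClosed.splits A.charpoly).eval_eq_prod_roots_of_monic A.charpoly_monic a
    rw [h1, Matrix.det_neg, ← Matrix.eval_charpoly, h2, Fintype.card_fin]
    nth_rewrite 1 [← hcard]
    rw [← Multiset.card_map (fun b => a - b), ← Multiset.prod_map_neg]
    simp
  rw [(IsAlgClosed.splits p).eq_prod_roots]
  induction p.roots using Multiset.induction with
  | empty => simp [aeval_C, Matrix.algebraMap_eq_diagonal, hcard]
  | cons a s ih =>
    rw [Multiset.map_cons, Multiset.prod_cons, mul_left_comm, map_mul, Matrix.det_mul, ih, hlin,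
      ← Multiset.prod_map_mul]
    simp only [eval_mul]

open Polynomial in
theorem trace_pow_eq_sum_roots {n : ℕ} (A : Matrix (Fin n) (Fin n) ℂ) (k : ℕ) :
    (A ^ k).trace = (A.charpoly.roots.map fun a => a ^ k).sum := by
  have h1 : (A ^ k).charpoly = ((A.charpoly.roots.map fun a => a ^ k).map fun a => X - C a).prod := by
    refine Polynomial.funext fun x => ?_
    have h2 : Matrix.scalar (Fin n) x - A ^ k = aeval A (C x - X ^ k) := by
      rw [map_sub, map_pow, aeval_X, aeval_C]
      rfl
    rw [Matrix.eval_charpoly, h2, det_aeval, eval_multiset_prod]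
    simp [Multiset.map_map]
  rw [Matrix.trace_eq_sum_roots_charpoly, h1, roots_multiset_prod_X_sub_C]

open ComplexOrder in
theorem norm_eq_one_of_mem_roots_charpoly {n : ℕ} {A : Matrix (Fin n) (Fin n) ℂ}
    (hA : A ∈ Matrix.unitaryGroup (Fin n) ℂ) {a : ℂ} (ha : a ∈ A.charpoly.roots) : ‖a‖ = 1 := by
  have h1 := (Polynomial.mem_roots'.mp ha).2
  rw [Polynomial.IsRoot, Matrix.eval_charpoly] at h1
  obtain ⟨v, hv0, hv⟩ := Matrix.exists_mulVec_eq_zero_iff.mpr h1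
  have h2 : A.mulVec v = a • v := by
    rw [Matrix.sub_mulVec, sub_eq_zero] at hv
    rw [← hv]
    ext i
    simp [Matrix.mulVec_diagonal]
  have h3 : star (A.mulVec v) ⬝ᵥ A.mulVec v = star v ⬝ᵥ v := by
    rw [Matrix.star_mulVec, ← Matrix.dotProduct_mulVec, Matrix.mulVec_mulVec,
      ← Matrix.star_eq_conjTranspose, Matrix.mem_unitaryGroup_iff'.mp hA, Matrix.one_mulVec]
  have h4 : star v ⬝ᵥ v ≠ 0 := fun h => hv0 (dotProduct_star_self_eq_zero.mp h)
  rw [h2, star_smul, smul_dotProduct, dotProduct_smul, smul_smul, smul_eq_mul] at h3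
  have h5 : star a * a = 1 := mul_right_cancel₀ h4 (by rw [h3, one_mul])
  have h6 : ((‖a‖ ^ 2 : ℝ) : ℂ) = 1 := by
    rw [← h5, mul_comm]
    push_cast
    exact (Complex.mul_conj' a).symm
  have h7 : ‖a‖ ^ 2 = 1 := by exact_mod_cast h6
  exact (pow_eq_one_iff_of_nonneg (norm_nonneg a) two_ne_zero).mp h7

theorem exists_fin_map_eq {α : Type*} {n : ℕ} (R : Multiset α) (h : R.card = n) :
    ∃ v : Fin n → α, (Finset.univ : Finset (Fin n)).val.map v = R := by
  subst h
  refine ⟨fun i => R.toList.get (i.cast (by simp)), ?_⟩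
  rw [Fin.univ_val_map]
  conv_rhs => rw [← Multiset.coe_toList R]
  congr 1
  exact List.ext_getElem (by simp) fun i h1 h2 => by simp

/-- The traces of the powers of a unitary matrix are power sums of points of the unit circle. -/
theorem exists_trace_zpow_eq {n : ℕ} (M : Matrix.unitaryGroup (Fin n) ℂ) :
    ∃ z : Fin n → Circle, ∀ k : ℤ,
      ((M ^ k : Matrix.unitaryGroup (Fin n) ℂ) : Matrix (Fin n) (Fin n) ℂ).trace
        = ∑ i, (z i : ℂ) ^ k := by
  set R := (M : Matrix (Fin n) (Fin n) ℂ).charpoly.roots with hR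
  have hcard : R.card = n := by
    rw [hR, ← (IsAlgClosed.splits _).natDegree_eq_card_roots, Matrix.charpoly_natDegree_eq_dim,
      Fintype.card_fin]
  obtain ⟨v, hv⟩ : ∃ v : Fin n → ℂ, (Finset.univ : Finset (Fin n)).val.map v = R :=
    exists_fin_map_eq R hcard
  have hv1 : ∀ i, ‖v i‖ = 1 := fun i => by
    refine norm_eq_one_of_mem_roots_charpoly M.2 ?_
    rw [← hR, ← hv]
    exact Multiset.mem_map_of_mem _ (Finset.mem_univ i)
  have hnat : ∀ k : ℕ, ((M : Matrix (Fin n) (Fin n) ℂ) ^ k).trace = ∑ i, v i ^ k := fun k => by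
    rw [trace_pow_eq_sum_roots, ← hR, ← hv, Multiset.map_map]
    rfl
  refine ⟨fun i => ⟨v i, mem_sphere_zero_iff_norm.mpr (hv1 i)⟩, fun k => ?_⟩
  obtain ⟨m, rfl | rfl⟩ := k.eq_nat_or_neg
  · simp only [zpow_natCast]
    exact hnat m
  · simp only [zpow_neg, zpow_natCast]
    have h1 : (((M ^ m)⁻¹ : Matrix.unitaryGroup (Fin n) ℂ) : Matrix (Fin n) (Fin n) ℂ)
        = ((M : Matrix (Fin n) (Fin n) ℂ) ^ m).conjTranspose := rfl
    rw [h1, Matrix.trace_conjTranspose, hnat, star_sum]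
    refine Finset.sum_congr rfl fun i _ => ?_
    rw [star_pow, ← inv_pow]
    congr 1
    exact (Complex.inv_eq_conj (hv1 i)).symm

end ToeplitzLattice

namespace ToeplitzLattice

/-! ### Loop equations for the Haar measure -/

/-- The signed sum `∑_{0 < l ≤ k} f(l)`, which is `-∑_{k < l ≤ 0} f(l)` for negative `k`. -/
noncomputable def stepSum {A : Type*} [AddCommGroup A] (k : ℤ) (f : ℤ → A) : A :=
  ∑ l ∈ Finset.Ioc 0 k, f l - ∑ l ∈ Finset.Ioc k 0, f l

section StepSum

variable {A : Type*} [AddCommGroup A]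

theorem stepSum_zero (f : ℤ → A) : stepSum 0 f = 0 := by simp [stepSum]

theorem stepSum_add_one (k : ℤ) (f : ℤ → A) : stepSum (k + 1) f = stepSum k f + f (k + 1) := by
  rcases le_or_gt 0 k with h | h
  · have h1 : Finset.Ioc 0 (k + 1) = insert (k + 1) (Finset.Ioc 0 k) := by
      ext l; simp only [Finset.mem_insert, Finset.mem_Ioc]; omega
    rw [stepSum, stepSum, h1, Finset.sum_insert (by simp),
      Finset.Ioc_eq_empty (by omega : ¬ k + 1 < 0), Finset.Ioc_eq_empty (by omega : ¬ k < 0)]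
    abel
  · have h1 : Finset.Ioc k 0 = insert (k + 1) (Finset.Ioc (k + 1) 0) := by
      ext l; simp only [Finset.mem_insert, Finset.mem_Ioc]; omega
    rw [stepSum, stepSum, h1, Finset.sum_insert (by simp),
      Finset.Ioc_eq_empty (by omega : ¬ 0 < k + 1),
      Finset.Ioc_eq_empty (by omega : ¬ 0 < k)]
    abel

theorem map_stepSum {B : Type*} [AddCommGroup B] (φ : A →+ B) (k : ℤ) (f : ℤ → A) :
    φ (stepSum k f) = stepSum k fun l => φ (f l) := by
  simp [stepSum, map_sum]

theorem stepSum_congr {k : ℤ} {f g : ℤ → A} (h : ∀ l, f l = g l) : stepSum k f = stepSum k g := by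
  rw [show f = g from funext h]

theorem sum_stepSum {ι : Type*} (s : Finset ι) (k : ℤ) (f : ι → ℤ → A) :
    ∑ i ∈ s, stepSum k (f i) = stepSum k fun l => ∑ i ∈ s, f i l := by
  simp only [stepSum, Finset.sum_sub_distrib]
  rw [Finset.sum_comm, Finset.sum_comm (s := s) (t := Finset.Ioc k 0)]

theorem stepSum_const (k : ℤ) (a : A) : stepSum k (fun _ => a) = k • a := by
  induction k using Int.induction_on with
  | zero => simp [stepSum_zero]
  | succ k ih => rw [stepSum_add_one, ih, add_smul, one_smul]
  | pred k ih =>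
    have h := stepSum_add_one (-(k : ℤ) - 1) (fun _ => a)
    rw [sub_add_cancel, ih] at h
    rw [sub_smul, one_smul, h, add_sub_cancel_right]

theorem mul_stepSum {R : Type*} [Ring R] (a : R) (k : ℤ) (f : ℤ → R) :
    a * stepSum k f = stepSum k fun l => a * f l :=
  map_stepSum (AddMonoidHom.mulLeft a) k f

end StepSum

variable {n : ℕ}

local notation "UG" n => Matrix.unitaryGroup (Fin n) ℂ

/-- The entries of `M^k` as functions on `U(n)`. -/
noncomputable def entry (k : ℤ) : Matrix (Fin n) (Fin n) C(UG n, ℂ) := fun i j =>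
  ⟨fun M => ((M ^ k : UG n) : Matrix (Fin n) (Fin n) ℂ) i j,
    ((continuous_subtype_val.comp (continuous_zpow k)).matrix_elem i j)⟩

theorem entry_apply (k : ℤ) (i j : Fin n) (M : UG n) :
    entry k i j M = ((M ^ k : UG n) : Matrix (Fin n) (Fin n) ℂ) i j := rfl

theorem entry_add (k l : ℤ) (i j : Fin n) :
    entry (k + l) i j = ∑ e, entry (n := n) k i e * entry l e j := by
  ext M
  simp only [entry_apply, zpow_add, ContinuousMap.sum_apply, ContinuousMap.mul_apply]
  rfl

theorem entry_zero (i j : Fin n) : entry (n := n) 0 i j = if i = j then 1 else 0 := by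
  ext M
  rw [entry_apply, zpow_zero]
  change (1 : Matrix (Fin n) (Fin n) ℂ) i j = _
  rw [Matrix.one_apply]
  split_ifs <;> rfl

/-- The one-parameter group of `U(n)` generated by a skew-Hermitian matrix. -/
noncomputable def expU (X : skewAdjoint (Matrix (Fin n) (Fin n) ℂ)) (ε : ℝ) : UG n :=
  ⟨NormedSpace.exp (ε • (X : Matrix (Fin n) (Fin n) ℂ)), by
    have h1 : star (ε • (X : Matrix (Fin n) (Fin n) ℂ)) = -(ε • (X : Matrix (Fin n) (Fin n) ℂ)) := by
      rw [star_smul, skewAdjoint.mem_iff.mp X.2]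
      simp
    rw [Matrix.mem_unitaryGroup_iff, Matrix.star_eq_conjTranspose, ← Matrix.exp_conjTranspose,
      ← Matrix.star_eq_conjTranspose, h1, ← Matrix.exp_add_of_commute _ _ (Commute.refl (ε • (X : Matrix (Fin n) (Fin n) ℂ))).neg_right,
      add_neg_cancel, NormedSpace.exp_zero]⟩

theorem expU_zero (X : skewAdjoint (Matrix (Fin n) (Fin n) ℂ)) : expU X 0 = 1 := by
  refine Subtype.ext ?_
  simp [expU]

theorem expU_neg (X : skewAdjoint (Matrix (Fin n) (Fin n) ℂ)) (ε : ℝ) : expU X (-ε) = (expU X ε)⁻¹ := by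
  refine eq_inv_of_mul_eq_one_left (Subtype.ext ?_)
  change NormedSpace.exp (-ε • (X : Matrix (Fin n) (Fin n) ℂ))
    * NormedSpace.exp (ε • (X : Matrix (Fin n) (Fin n) ℂ)) = 1
  rw [neg_smul, ← Matrix.exp_add_of_commute _ _ (Commute.refl (ε • (X : Matrix (Fin n) (Fin n) ℂ))).neg_left, neg_add_cancel,
    NormedSpace.exp_zero]

open scoped Matrix.Norms.Operator in
theorem hasDerivAt_expU (X : skewAdjoint (Matrix (Fin n) (Fin n) ℂ)) (i j : Fin n) :
    HasDerivAt (fun ε : ℝ => ((expU X ε : UG n) : Matrix (Fin n) (Fin n) ℂ) i j)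
      ((X : Matrix (Fin n) (Fin n) ℂ) i j) 0 := by
  have h1 := hasDerivAt_exp_smul_const (𝕂 := ℝ) (X : Matrix (Fin n) (Fin n) ℂ) (0 : ℝ)
  rw [zero_smul, NormedSpace.exp_zero, one_mul] at h1
  let φ : Matrix (Fin n) (Fin n) ℂ →L[ℝ] ℂ :=
    LinearMap.toContinuousLinearMap (Matrix.entryLinearMap ℝ ℂ i j)
  exact φ.hasFDerivAt.comp_hasDerivAt 0 h1

/-- Left translation of functions on `U(n)`. -/
noncomputable def translate (g : UG n) : C(UG n, ℂ) →ₐ[ℂ] C(UG n, ℂ) :=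
  ContinuousMap.compRightAlgHom ℂ ℂ ⟨fun M => g * M, by fun_prop⟩

theorem translate_apply (g : UG n) (F : C(UG n, ℂ)) (M : UG n) : translate g F M = F (g * M) := rfl

theorem translate_one (F : C(UG n, ℂ)) : translate 1 F = F := by
  ext M
  rw [translate_apply, one_mul]

/-- The left-invariant derivatives of `F`: the derivative of `F` in the direction `X` is
`∑ X_{cd} G_{cd}`. -/
def HasGradient (F : C(UG n, ℂ)) (G : Fin n → Fin n → C(UG n, ℂ)) : Prop :=
  ∀ X : skewAdjoint (Matrix (Fin n) (Fin n) ℂ), HasDerivAt (fun ε : ℝ => translate (expU X ε) F)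
    (∑ c, ∑ d, (X : Matrix (Fin n) (Fin n) ℂ) c d • G c d) 0

theorem hasGradient_algebraMap (a : ℂ) :
    HasGradient (algebraMap ℂ C(UG n, ℂ) a) fun _ _ => 0 := by
  intro X
  simp only [AlgHom.commutes, smul_zero, Finset.sum_const_zero]
  exact hasDerivAt_const _ _

theorem HasGradient.add {F F' : C(UG n, ℂ)} {G G' : Fin n → Fin n → C(UG n, ℂ)}
    (h : HasGradient F G) (h' : HasGradient F' G') :
    HasGradient (F + F') fun c d => G c d + G' c d := by
  intro X
  simp only [map_add, smul_add, Finset.sum_add_distrib]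
  exact (h X).fun_add (h' X)

theorem HasGradient.sum {ι : Type*} {s : Finset ι} {F : ι → C(UG n, ℂ)}
    {G : ι → Fin n → Fin n → C(UG n, ℂ)} (h : ∀ i ∈ s, HasGradient (F i) (G i)) :
    HasGradient (∑ i ∈ s, F i) fun c d => ∑ i ∈ s, G i c d := by
  intro X
  simp only [map_sum]
  refine (HasDerivAt.fun_sum fun i hi => h i hi X).congr_deriv ?_
  simp only [Finset.smul_sum]
  rw [Finset.sum_comm]
  exact Finset.sum_congr rfl fun c _ => Finset.sum_comm

theorem HasGradient.mul {F F' : C(UG n, ℂ)} {G G' : Fin n → Fin n → C(UG n, ℂ)}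
    (h : HasGradient F G) (h' : HasGradient F' G') :
    HasGradient (F * F') fun c d => G c d * F' + F * G' c d := by
  intro X
  simp only [map_mul]
  refine ((h X).fun_mul (h' X)).congr_deriv ?_
  rw [expU_zero, translate_one, translate_one]
  simp only [smul_add, Finset.sum_add_distrib, Finset.sum_mul, Finset.mul_sum, smul_mul_assoc,
    mul_smul_comm]

theorem HasGradient.congr {F : C(UG n, ℂ)} {G G' : Fin n → Fin n → C(UG n, ℂ)}
    (h : HasGradient F G) (hG : ∀ c d, G c d = G' c d) : HasGradient F G' := by
  rwa [show G' = G from funext fun c => funext fun d => (hG c d).symm]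

theorem hasGradient_entry_one (i j : Fin n) :
    HasGradient (entry 1 i j) fun c d => if c = i then entry 1 d j else 0 := by
  intro X
  have h1 : ∀ ε, translate (expU X ε) (entry 1 i j)
      = ∑ e, ((expU X ε : UG n) : Matrix (Fin n) (Fin n) ℂ) i e • entry 1 e j := fun ε => by
    ext M
    simp only [translate_apply, entry_apply, zpow_one, ContinuousMap.sum_apply,
      ContinuousMap.smul_apply, smul_eq_mul]
    rfl
  simp only [h1]
  refine (HasDerivAt.fun_sum fun e _ => (hasDerivAt_expU X i e).smul_const (entry 1 e j)).congr_deriv ?_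
  symm
  rw [Finset.sum_eq_single i (fun c _ hc => by simp [hc]) (by simp)]
  simp

theorem hasGradient_entry_neg_one (i j : Fin n) :
    HasGradient (entry (-1) i j) fun c d => if d = j then -entry (-1) i c else 0 := by
  intro X
  have h1 : ∀ ε, translate (expU X ε) (entry (-1) i j)
      = ∑ e, ((expU X (-ε) : UG n) : Matrix (Fin n) (Fin n) ℂ) e j • entry (-1) i e := fun ε => by
    ext M
    simp only [translate_apply, entry_apply, zpow_neg_one, mul_inv_rev, ContinuousMap.sum_apply,
      ContinuousMap.smul_apply, smul_eq_mul, expU_neg]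
    simp only [mul_comm]
    rfl
  have h2 : ∀ e, HasDerivAt (fun ε : ℝ => ((expU X (-ε) : UG n) : Matrix (Fin n) (Fin n) ℂ) e j)
      (-(X : Matrix (Fin n) (Fin n) ℂ) e j) 0 := fun e => by
    have h3 := hasDerivAt_expU X e j
    rw [← neg_zero] at h3
    exact (h3.scomp (0 : ℝ) (hasDerivAt_neg _)).congr_deriv (by simp)
  simp only [h1]
  refine (HasDerivAt.fun_sum fun e _ => (h2 e).smul_const (entry (-1) i e)).congr_deriv ?_
  refine Finset.sum_congr rfl fun c _ => ?_
  rw [Finset.sum_eq_single j (fun d _ hd => by simp [hd]) (by simp)]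
  simp

/-- Moving `M` to `exp(εX) M` and differentiating `M^k` inserts `X` once in each slot, giving the
terms `M^(k-l) X M^l` with `0 < l ≤ k`. The signed sum covers negative powers by the same formula.
-/
theorem hasGradient_entry (k : ℤ) : ∀ i j : Fin n, HasGradient (entry k i j)
    fun c d => stepSum k fun l => entry (k - l) i c * entry l d j := by
  induction k using Int.induction_on with
  | zero =>
    intro i j
    have h : entry 0 i j = algebraMap ℂ C(UG n, ℂ) (if i = j then 1 else 0) := by
      rw [entry_zero]
      split_ifs <;> simp
    rw [h]
    exact (hasGradient_algebraMap _).congr fun c d => (stepSum_zero _).symm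
  | succ k ih =>
    intro i j
    rw [add_comm (k : ℤ) 1, entry_add]
    refine (HasGradient.sum fun e _ => (hasGradient_entry_one i e).mul (ih e j)).congr fun c d => ?_
    rw [add_comm (1 : ℤ) k, stepSum_add_one, sub_self, entry_zero, Finset.sum_add_distrib, add_comm]
    congr 1
    · simp only [mul_stepSum, sum_stepSum]
      refine stepSum_congr fun l => ?_
      rw [show (k : ℤ) + 1 - l = 1 + (k - l) by ring, entry_add, Finset.sum_mul]
      exact Finset.sum_congr rfl fun e _ => (mul_assoc _ _ _).symm
    · by_cases h : c = i
      · rw [h]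
        simp [← entry_add, add_comm]
      · simp [h, Ne.symm h]
  | pred k ih =>
    intro i j
    rw [sub_eq_add_neg, add_comm (-(k : ℤ)) (-1), entry_add]
    refine (HasGradient.sum fun e _ => (hasGradient_entry_neg_one i e).mul (ih e j)).congr fun c d => ?_
    have h := stepSum_add_one (-(k : ℤ) - 1)
      (fun l => entry (-(k : ℤ) - 1 - l) i c * entry l d j : ℤ → C(UG n, ℂ))
    rw [sub_add_cancel] at h
    rw [add_comm (-1) (-(k : ℤ)), ← sub_eq_add_neg, ← add_right_cancel_iff, ← h,
      Finset.sum_add_distrib]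
    have h2 : ∑ e, (if d = e then -entry (-1) i c else 0) * entry (-(k : ℤ)) e j
        = -(entry (n := n) (-1) i c * entry (-(k : ℤ)) d j) := by
      rw [Finset.sum_eq_single d (fun e _ he => by simp [Ne.symm he]) (by simp)]
      simp
    have h3 : ∑ e, entry (n := n) (-1) i e * stepSum (-(k : ℤ)) (fun l => entry (-(k : ℤ) - l) e c
        * entry l d j) = stepSum (-(k : ℤ)) fun l => entry (-(k : ℤ) - 1 - l) i c * entry l d j := by
      simp only [mul_stepSum, sum_stepSum]
      refine stepSum_congr fun l => ?_
      rw [show -(k : ℤ) - 1 - l = -1 + (-k - l) by ring, entry_add, Finset.sum_mul]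
      exact Finset.sum_congr rfl fun e _ => (mul_assoc _ _ _).symm
    rw [h2, h3, show -(k : ℤ) - 1 - -k = -1 by ring]
    ring

instance isHaarMeasure_haarU (n : ℕ) : (haarU n).IsHaarMeasure := by
  unfold haarU
  infer_instance

instance isProbabilityMeasure_haarU (n : ℕ) : IsProbabilityMeasure (haarU n) := by
  refine ⟨?_⟩
  have := Measure.haarMeasure_self (K₀ := (⊤ : TopologicalSpace.PositiveCompacts (UG n)))
  simpa [haarU] using this

theorem intCLM_translate (g : UG n) (F : C(UG n, ℂ)) :
    intCLM (haarU n) (translate g F) = intCLM (haarU n) F :=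
  integral_mul_left_eq_self (fun M => F M) g

/-- Invariance of the Haar measure kills the integral of the derivative in every skew-Hermitian
direction. Each matrix unit `Y` is a complex combination of `Y - Y*` and `i (Y + Y*)`, so every
single component integrates to zero. -/
theorem HasGradient.integral_eq_zero {F : C(UG n, ℂ)} {G : Fin n → Fin n → C(UG n, ℂ)}
    (h : HasGradient F G) (c d : Fin n) : intCLM (haarU n) (G c d) = 0 := by
  let L : Matrix (Fin n) (Fin n) ℂ → ℂ := fun Y => ∑ c, ∑ d, Y c d * intCLM (haarU n) (G c d)
  have hL : ∀ X : skewAdjoint (Matrix (Fin n) (Fin n) ℂ), L X = 0 := fun X => by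
    have h1 := ((intCLM (haarU n)).restrictScalars ℝ).hasFDerivAt.comp_hasDerivAt (0 : ℝ) (h X)
    have h2 : (fun ε : ℝ => (intCLM (haarU n)) (translate (expU X ε) F))
        = fun _ => intCLM (haarU n) F := funext fun ε => intCLM_translate _ _
    have h3 := h1.unique (by
      change HasDerivAt (fun ε : ℝ => (intCLM (haarU n)) (translate (expU X ε) F)) 0 0
      rw [h2]
      exact hasDerivAt_const _ _)
    rw [← h3]
    change _ = intCLM (haarU n) _
    simp only [map_sum, map_smul, smul_eq_mul]
    rfl
  set Y : Matrix (Fin n) (Fin n) ℂ := Matrix.single c d 1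
  have hY : L Y = intCLM (haarU n) (G c d) := by
    simp only [L, Y, Matrix.single_apply]
    rw [Finset.sum_eq_single c (fun a _ ha => by simp [Ne.symm ha]) (by simp),
      Finset.sum_eq_single d (fun a _ ha => by simp [Ne.symm ha]) (by simp)]
    simp
  have s1 : Y - star Y ∈ skewAdjoint (Matrix (Fin n) (Fin n) ℂ) := by
    rw [skewAdjoint.mem_iff]
    simp
  have s2 : Complex.I • (Y + star Y) ∈ skewAdjoint (Matrix (Fin n) (Fin n) ℂ) := by
    rw [skewAdjoint.mem_iff, star_smul, star_add, star_star, add_comm (star Y)]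
    simp
    exact add_comm _ _
  have e1 := hL ⟨_, s1⟩
  have e2 := hL ⟨_, s2⟩
  simp only [L, Matrix.sub_apply, Matrix.smul_apply, Matrix.add_apply, sub_mul, smul_eq_mul,
    add_mul, mul_assoc, ← Finset.mul_sum, Finset.sum_sub_distrib, Finset.sum_add_distrib] at e1 e2
  have e3 := (mul_eq_zero.mp e2).resolve_left Complex.I_ne_zero
  rw [← hY]
  simp only [L]
  linear_combination (1 / 2 : ℂ) * e1 + (1 / 2 : ℂ) * e3

open MvPolynomial

/-- The polynomial `∑_{0 < l ≤ k} p_{k-l} p_l` in power sums. -/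
noncomputable def splitPoly (k : ℤ) : MvPolynomial ℤ ℂ := stepSum k fun l => X (k - l) * X l

/-- The derivation `p_m ↦ m p_{m+k}`. -/
noncomputable def powerDer (k : ℤ) : Derivation ℂ (MvPolynomial ℤ ℂ) (MvPolynomial ℤ ℂ) :=
  mkDerivation ℂ fun m => C (m : ℂ) * X (m + k)

/-- Polynomials in the traces of the powers, as functions on `U(n)`. -/
noncomputable def evalU (n : ℕ) : MvPolynomial ℤ ℂ →ₐ[ℂ] C(UG n, ℂ) :=
  aeval fun k => ∑ i, entry k i i

theorem exists_hasGradient_evalU (p : MvPolynomial ℤ ℂ) :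
    ∃ G, HasGradient (evalU n p) G ∧
      ∀ k, ∑ i, ∑ j, entry k i j * G i j = evalU n (powerDer k p) := by
  induction p using MvPolynomial.induction_on with
  | C a =>
    refine ⟨_, by rw [evalU, ← algebraMap_eq, AlgHom.commutes]; exact hasGradient_algebraMap a,
      fun k => ?_⟩
    simp [derivation_C]
  | add p q hp hq =>
    obtain ⟨G, h1, h2⟩ := hp
    obtain ⟨G', h1', h2'⟩ := hq
    refine ⟨_, by rw [map_add]; exact h1.add h1', fun k => ?_⟩
    simp only [mul_add, Finset.sum_add_distrib, map_add, h2, h2']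
  | mul_X p m hp =>
    obtain ⟨G, h1, h2⟩ := hp
    have h3 : HasGradient (evalU n (X m)) fun c d => m • entry m d c := by
      rw [evalU, aeval_X]
      refine (HasGradient.sum fun i _ => hasGradient_entry m i i).congr fun c d => ?_
      rw [sum_stepSum, ← stepSum_const]
      refine stepSum_congr fun l => ?_
      rw [show m = l + (m - l) by ring, entry_add]
      refine Finset.sum_congr rfl fun i _ => ?_
      rw [mul_comm]
      congr 3
      ring
    refine ⟨_, by rw [map_mul]; exact h1.mul h3, fun k => ?_⟩
    have h4 : ∑ i, ∑ j, entry (n := n) k i j * (m • entry m j i) = evalU n (C (m : ℂ) * X (m + k)) := by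
      rw [map_mul, evalU, aeval_X, ← algebraMap_eq, AlgHom.commutes, Finset.mul_sum, add_comm]
      refine Finset.sum_congr rfl fun i _ => ?_
      rw [entry_add, Finset.mul_sum]
      refine Finset.sum_congr rfl fun j _ => ?_
      rw [mul_smul_comm, ← Algebra.smul_def, Int.cast_smul_eq_zsmul]
    have h5 : evalU n (powerDer k (p * X m)) = evalU n p * evalU n (C (m : ℂ) * X (m + k))
        + evalU n (X m) * evalU n (powerDer k p) := by
      rw [Derivation.leibniz, smul_eq_mul, smul_eq_mul, map_add, map_mul, map_mul]
      congr 3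
      exact mkDerivation_X _ _ _
    rw [h5, ← h4, ← h2, Finset.mul_sum, Finset.mul_sum, ← Finset.sum_add_distrib]
    refine Finset.sum_congr rfl fun i _ => ?_
    rw [Finset.mul_sum, Finset.mul_sum, ← Finset.sum_add_distrib]
    refine Finset.sum_congr rfl fun j _ => ?_
    ring

/-- The loop equations on `U(n)`. -/
theorem loop_equation (p : MvPolynomial ℤ ℂ) (k : ℤ) :
    intCLM (haarU n) (evalU n (splitPoly k * p + powerDer k p)) = 0 := by
  obtain ⟨G, h1, h2⟩ := exists_hasGradient_evalU (n := n) p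
  -- The integrand is the divergence, summed over `(i, j)`, of the functions `(M^k)_{ij} p`. The
  -- derivative of the matrix entry splits into two traces, and that of `p` is contracted with
  -- `M^k`.
  have h3 : evalU n (splitPoly k * p + powerDer k p)
      = ∑ i, ∑ j, ((stepSum k fun l => entry (k - l) i i * entry l j j) * evalU n p
        + entry k i j * G i j) := by
    simp only [Finset.sum_add_distrib, h2, map_add, map_mul, ← Finset.sum_mul, sum_stepSum]
    congr 2
    rw [splitPoly]
    refine (map_stepSum (evalU n : MvPolynomial ℤ ℂ →+ C(UG n, ℂ)) k _).trans (stepSum_congr fun l => ?_)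
    simp only [evalU, AddMonoidHom.coe_coe, map_mul, aeval_X, Finset.sum_mul_sum]
  rw [h3, map_sum]
  refine Finset.sum_eq_zero fun i _ => ?_
  rw [map_sum]
  exact Finset.sum_eq_zero fun j _ => ((hasGradient_entry k i j).mul h1).integral_eq_zero i j

end ToeplitzLattice

namespace ToeplitzLattice

/-! ### Laurent polynomials on the torus -/

/-- Laurent polynomials in `z_1, …, z_n`. -/
abbrev Laurent (n : ℕ) : Type := AddMonoidAlgebra ℂ (Fin n → ℤ)

variable {n : ℕ}

open AddMonoidAlgebra (single)

theorem laurent_induction {P : Laurent n → Prop} (hadd : ∀ f g, P f → P g → P (f + g))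
    (hs : ∀ a c, P (single a c)) (f : Laurent n) : P f :=
  AddMonoidAlgebra.induction_linear f (by simpa using hs 0 0) hadd hs

/-- The linear map `z_i ∂/∂z_i`. -/
noncomputable def eulerLin (i : Fin n) : Laurent n →ₗ[ℂ] Laurent n where
  toFun f := .ofCoeff (Finsupp.onFinset f.coeff.support (fun a => (a i : ℂ) * f.coeff a)
    fun a ha => by
      rw [Finsupp.mem_support_iff]
      exact right_ne_zero_of_mul ha)
  map_add' f g := by
    ext a
    simp [mul_add]
  map_smul' c f := by
    ext a
    simp [mul_left_comm]

theorem coeff_eulerLin (i : Fin n) (f : Laurent n) (a : Fin n → ℤ) :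
    (eulerLin i f).coeff a = a i * f.coeff a := rfl

theorem eulerLin_single (i : Fin n) (a : Fin n → ℤ) (c : ℂ) :
    eulerLin i (single a c) = single a (a i * c) := by
  ext b
  rw [coeff_eulerLin, AddMonoidAlgebra.coeff_single, AddMonoidAlgebra.coeff_single]
  by_cases h : a = b
  · subst h
    simp
  · simp [h]

/-- The derivation `z_i ∂/∂z_i`. -/
noncomputable def euler (i : Fin n) : Derivation ℂ (Laurent n) (Laurent n) :=
  Derivation.mk' (eulerLin i) fun f g => by
    induction f using laurent_induction with
    | hadd f f' hf hf' => rw [add_mul, map_add, hf, hf', map_add, add_smul, smul_add]; abel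
    | hs a c =>
      induction g using laurent_induction with
      | hadd g g' hg hg' => rw [mul_add, map_add, hg, hg', map_add, add_smul, smul_add]; abel
      | hs b d =>
        simp only [AddMonoidAlgebra.single_mul_single, eulerLin_single, smul_eq_mul]
        rw [add_comm b a, ← AddMonoidAlgebra.single_add]
        congr 1
        simp only [Pi.add_apply]
        push_cast
        ring

theorem coeff_euler (i : Fin n) (f : Laurent n) (a : Fin n → ℤ) :
    (euler i f).coeff a = a i * f.coeff a := rfl

/-- The Laurent monomial `z_i^k`. -/
noncomputable def zPow (i : Fin n) (k : ℤ) : Laurent n := single (Pi.single i k) 1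

theorem zPow_add (i : Fin n) (k l : ℤ) : zPow i (k + l) = zPow i k * zPow i l := by
  rw [zPow, zPow, zPow, AddMonoidAlgebra.single_mul_single, Pi.single_add, one_mul]

theorem zPow_zero (i : Fin n) : zPow i 0 = 1 := by
  rw [zPow, Pi.single_zero]
  rfl

theorem euler_zPow (i j : Fin n) (k : ℤ) :
    euler i (zPow j k) = if i = j then (k : ℂ) • zPow j k else 0 := by
  change eulerLin i (zPow j k) = _
  rw [zPow, eulerLin_single]
  by_cases h : i = j
  · subst h
    simp
  · simp [h]

/-- The constant term. -/
noncomputable def constTerm (n : ℕ) : Laurent n →ₗ[ℂ] ℂ where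
  toFun f := f.coeff 0
  map_add' _ _ := rfl
  map_smul' _ _ := rfl

theorem constTerm_euler (i : Fin n) (f : Laurent n) : constTerm n (euler i f) = 0 := by
  change (euler i f).coeff 0 = 0
  rw [coeff_euler]
  simp

/-- The conjugate Laurent polynomial: the complex conjugate on the torus. -/
noncomputable def conjL : Laurent n →+* Laurent n :=
  (AddMonoidAlgebra.mapRingHom (Fin n → ℤ) (starRingEnd ℂ)).comp
    (AddMonoidAlgebra.mapDomainRingHom ℂ (negAddMonoidHom : (Fin n → ℤ) →+ (Fin n → ℤ)))

theorem conjL_single (a : Fin n → ℤ) (c : ℂ) : conjL (single a c) = single (-a) (starRingEnd ℂ c) := by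
  simp [conjL]

theorem euler_conjL (i : Fin n) (f : Laurent n) : euler i (conjL f) = -conjL (euler i f) := by
  induction f using laurent_induction with
  | hadd f g hf hg => rw [map_add, map_add, hf, hg, map_add, map_add, neg_add]
  | hs a c =>
    change eulerLin i _ = -conjL (eulerLin i _)
    rw [conjL_single, eulerLin_single, eulerLin_single, conjL_single, ← AddMonoidAlgebra.single_neg]
    simp

theorem coeff_conjL (f : Laurent n) (a : Fin n → ℤ) :
    (conjL f).coeff a = starRingEnd ℂ (f.coeff (-a)) := by
  induction f using laurent_induction with
  | hadd f g hf hg => simp [hf, hg]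
  | hs b c =>
    rw [conjL_single, AddMonoidAlgebra.coeff_single, AddMonoidAlgebra.coeff_single,
      Finsupp.single_apply, Finsupp.single_apply]
    by_cases h : -b = a
    · rw [if_pos h, if_pos (by rw [← h, neg_neg])]
    · rw [if_neg h, if_neg fun h' => h (by rw [h', neg_neg]), map_zero]

theorem constTerm_mul_conjL (f : Laurent n) :
    constTerm n (f * conjL f) = ((∑ a ∈ f.coeff.support, ‖f.coeff a‖ ^ 2 : ℝ) : ℂ) := by
  have h1 : ∀ g : Laurent n, constTerm n (g * conjL f)
      = ∑ a ∈ g.coeff.support, g.coeff a * starRingEnd ℂ (f.coeff a) := by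
    intro g
    change (g * conjL f).coeff 0 = _
    rw [AddMonoidAlgebra.coeff_mul_apply_left]
    simp [Finsupp.sum, coeff_conjL]
  rw [h1]
  push_cast
  exact Finset.sum_congr rfl fun a _ => Complex.mul_conj' _

/-- Each constant term is the sum of the squared absolute values of the coefficients. This
positivity replaces integration over the torus. -/
theorem eq_zero_of_sum_constTerm_eq_zero {ι : Type*} {s : Finset ι} {f : ι → Laurent n}
    (h : ∑ i ∈ s, constTerm n (f i * conjL (f i)) = 0) : ∀ i ∈ s, f i = 0 := by
  simp only [constTerm_mul_conjL] at h
  have h1 : ∑ i ∈ s, ∑ a ∈ (f i).coeff.support, ‖(f i).coeff a‖ ^ 2 = 0 := by exact_mod_cast h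
  intro i hi
  have h2 := (Finset.sum_eq_zero_iff_of_nonneg fun i _ =>
    Finset.sum_nonneg fun a _ => sq_nonneg _).mp h1 i hi
  ext a
  by_contra ha
  have h3 := (Finset.sum_eq_zero_iff_of_nonneg fun a _ => sq_nonneg _).mp h2 a
    (Finsupp.mem_support_iff.mpr ha)
  exact ha (norm_eq_zero.mp (pow_eq_zero_iff two_ne_zero |>.mp h3))

/-- The Vandermonde product. -/
noncomputable def vander (n : ℕ) : Laurent n :=
  ∏ k : Fin n, ∏ l ∈ Finset.Ioi k, (zPow l 1 - zPow k 1)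

/-- The density `Δ(z) Δ(z⁻¹)`. -/
noncomputable def vanderL (n : ℕ) : Laurent n := vander n * conjL (vander n)

theorem conjL_zPow (i : Fin n) (k : ℤ) : conjL (zPow i k) = zPow i (-k) := by
  rw [zPow, conjL_single, map_one, zPow, Pi.single_neg]

theorem vander_ne_zero (n : ℕ) : vander n ≠ 0 := by
  refine Finset.prod_ne_zero_iff.mpr fun k _ => Finset.prod_ne_zero_iff.mpr fun l hl => ?_
  rw [sub_ne_zero]
  intro h
  have h1 := congrFun ((AddMonoidAlgebra.single_left_injective one_ne_zero) h) l
  have h2 : l ≠ k := (Finset.mem_Ioi.mp hl).ne'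
  simp [h2] at h1

theorem vanderL_ne_zero (n : ℕ) : vanderL n ≠ 0 := by
  intro h
  have h1 := eq_zero_of_sum_constTerm_eq_zero (s := {()}) (f := fun _ => vander n)
    (by rw [Finset.sum_singleton]; change constTerm n (vanderL n) = 0; rw [h, map_zero]) () (by simp)
  exact vander_ne_zero n h1

theorem constTerm_vanderL_ne_zero (n : ℕ) : constTerm n (vanderL n) ≠ 0 := fun h =>
  vander_ne_zero n (eq_zero_of_sum_constTerm_eq_zero (s := {()}) (f := fun _ => vander n)
    (by rw [Finset.sum_singleton]; exact h) () (by simp))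

/-- The vector field `∑ z_i^k z_i ∂/∂z_i`. -/
noncomputable def wittDer (k : ℤ) : Derivation ℂ (Laurent n) (Laurent n) := ∑ i, zPow i k • euler i

theorem wittDer_apply (k : ℤ) (f : Laurent n) : wittDer k f = ∑ i, zPow i k * euler i f := by
  have h : ∀ s : Finset (Fin n), (∑ i ∈ s, zPow i k • euler i) f = ∑ i ∈ s, zPow i k * euler i f := by
    intro s
    induction s using Finset.induction_on with
    | empty => rfl
    | insert a s ha ih =>
      rw [Finset.sum_insert ha, Finset.sum_insert ha, Derivation.add_apply, ih]
      rfl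
  exact h Finset.univ

theorem wittDer_zPow (k : ℤ) (j : Fin n) (m : ℤ) :
    wittDer k (zPow j m) = (m : ℂ) • zPow j (m + k) := by
  rw [wittDer_apply, Finset.sum_eq_single j (fun i _ hi => by simp [euler_zPow, hi]) (by simp),
    euler_zPow, if_pos rfl, mul_smul_comm, ← zPow_add, add_comm]

theorem derivation_prod {A ι : Type*} [CommRing A] [Algebra ℂ A] [DecidableEq ι]
    (δ : Derivation ℂ A A) (s : Finset ι) (f g : ι → A) (h : ∀ i ∈ s, δ (f i) = g i * f i) :
    δ (∏ i ∈ s, f i) = (∑ i ∈ s, g i) * ∏ i ∈ s, f i := by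
  induction s using Finset.induction_on with
  | empty => simp
  | insert a s ha ih =>
    rw [Finset.prod_insert ha, Finset.sum_insert ha, Derivation.leibniz,
      ih fun i hi => h i (Finset.mem_insert_of_mem hi), h a (Finset.mem_insert_self _ _)]
    simp only [smul_eq_mul]
    ring

/-- A telescoping geometric sum. The induction also runs through negative `k`, because `b 1` is
invertible. -/
theorem sub_mul_stepSum_of_add {A : Type*} [CommRing A] {a b : ℤ → A}
    (ha : ∀ k l, a (k + l) = a k * a l) (hb : ∀ k l, b (k + l) = b k * b l) (ha0 : a 0 = 1)
    (hb0 : b 0 = 1) (k : ℤ) :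
    (a 1 - b 1) * stepSum k (fun l => a l * b (k - l)) = (a k - b k) * a 1 := by
  have hstep : ∀ k : ℤ, stepSum (k + 1) (fun l => a l * b (k + 1 - l))
      = b 1 * stepSum k (fun l => a l * b (k - l)) + a k * a 1 := fun k => by
    rw [stepSum_add_one, mul_stepSum, sub_self, hb0, mul_one, ha]
    congr 1
    refine stepSum_congr fun l => ?_
    rw [show k + 1 - l = 1 + (k - l) by ring, hb]
    ring
  have hunit : b (-1) * b 1 = 1 := by rw [← hb, neg_add_cancel, hb0]
  induction k using Int.induction_on with
  | zero => rw [stepSum_zero, ha0, hb0]; ring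
  | succ k ih =>
    rw [hstep, ha, hb]
    linear_combination b 1 * ih
  | pred k ih =>
    have h1 := hstep (-(k : ℤ) - 1)
    have h2 := ha (-(k : ℤ) - 1) 1
    have h3 := hb (-(k : ℤ) - 1) 1
    rw [sub_add_cancel] at h1 h2 h3
    rw [h1, h2, h3] at ih
    generalize stepSum (-(k : ℤ) - 1) (fun l => a l * b (-(k : ℤ) - 1 - l)) = c at ih ⊢
    linear_combination b (-1) * ih - ((a 1 - b 1) * c
      - (a (-(k : ℤ) - 1) - b (-(k : ℤ) - 1)) * a 1) * hunit

theorem sub_mul_stepSum (i j : Fin n) (k : ℤ) :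
    (zPow i 1 - zPow j 1) * stepSum k (fun l => zPow i l * zPow j (k - l))
      = (zPow i k - zPow j k) * zPow i 1 :=
  sub_mul_stepSum_of_add (zPow_add i) (zPow_add j) (zPow_zero i) (zPow_zero j) k

theorem wittDer_factor (i j : Fin n) (k : ℤ) :
    wittDer k (1 - zPow i 1 * zPow j (-1))
      = stepSum k (fun l => zPow i l * zPow j (k - l)) * (1 - zPow i 1 * zPow j (-1)) := by
  have h1 := sub_mul_stepSum i j k
  have hunit : zPow j 1 * zPow j (-1) = 1 := by rw [← zPow_add, add_neg_cancel, zPow_zero]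
  rw [map_sub, Derivation.map_one_eq_zero, Derivation.leibniz, wittDer_zPow, wittDer_zPow,
    zPow_add, zPow_add]
  simp only [smul_eq_mul, Int.cast_one, Int.cast_neg, neg_smul, one_smul]
  linear_combination zPow j (-1) * h1
    + stepSum k (fun l => zPow i l * zPow j (k - l)) * hunit

theorem vanderL_eq (n : ℕ) : vanderL n = ∏ k : Fin n, ∏ l ∈ Finset.Ioi k,
    ((1 - zPow l 1 * zPow k (-1)) * (1 - zPow k 1 * zPow l (-1))) := by
  rw [vanderL, vander, map_prod, ← Finset.prod_mul_distrib]
  refine Finset.prod_congr rfl fun k _ => ?_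
  rw [map_prod, ← Finset.prod_mul_distrib]
  refine Finset.prod_congr rfl fun l _ => ?_
  have h : ∀ j : Fin n, zPow j 1 * zPow j (-1) = 1 := fun j => by
    rw [← zPow_add, add_neg_cancel, zPow_zero]
  rw [map_sub, conjL_zPow, conjL_zPow]
  linear_combination (1 - zPow k 1 * zPow k (-1)) * h l

open MvPolynomial

/-- Polynomials in the power sums, as Laurent polynomials. -/
noncomputable def evalL (n : ℕ) : MvPolynomial ℤ ℂ →ₐ[ℂ] Laurent n := aeval fun k => ∑ i, zPow i k

theorem evalL_X (k : ℤ) : evalL n (X k) = ∑ i, zPow i k := aeval_X _ _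

theorem evalL_splitPoly (k : ℤ) : evalL n (splitPoly k)
    = ∑ i, ∑ j, stepSum k fun l => zPow i l * zPow j (k - l) := by
  simp only [sum_stepSum]
  refine (map_stepSum (evalL n : MvPolynomial ℤ ℂ →+ Laurent n) k _).trans (stepSum_congr fun l => ?_)
  simp only [AddMonoidHom.coe_coe, map_mul, evalL_X, ← Finset.sum_mul_sum]
  exact mul_comm _ _

/-- Each factor of the density is multiplied by a geometric sum (`wittDer_factor`), so the
logarithmic derivative is a sum over ordered pairs of distinct indices. Completing it by the
diagonal terms `k z_i^k` gives the product of power sums in `splitPoly`. -/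
theorem wittDer_vanderL (k : ℤ) : wittDer k (vanderL n)
    = (evalL n (splitPoly k) - (k : ℂ) • evalL n (X k)) * vanderL n := by
  set q : Fin n → Fin n → Laurent n := fun i j => stepSum k fun l => zPow i l * zPow j (k - l)
  have h1 : wittDer k (vanderL n) = (∑ i : Fin n, ∑ j ∈ Finset.Ioi i, (q j i + q i j)) * vanderL n := by
    rw [vanderL_eq]
    refine derivation_prod _ _ _ _ fun i _ => derivation_prod _ _ _ _ fun j _ => ?_
    rw [Derivation.leibniz, wittDer_factor, wittDer_factor]
    simp only [smul_eq_mul, q]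
    ring
  rw [h1]
  congr 1
  rw [evalL_splitPoly, evalL_X, Finset.sum_sum_Ioi_add_eq_sum_sum_off_diag (fun i j => q i j),
    eq_sub_iff_add_eq, Finset.smul_sum, ← Finset.sum_add_distrib, Finset.sum_comm]
  refine Finset.sum_congr rfl fun i _ => ?_
  have h2 : q i i = (k : ℂ) • zPow i k := by
    simp only [q]
    rw [stepSum_congr (g := fun _ => zPow i k) fun l => by rw [← zPow_add]; congr 1; ring,
      stepSum_const, Int.cast_smul_eq_zsmul]
  rw [← h2, add_comm]
  exact (Fintype.sum_eq_add_sum_compl i fun j => q j i).symm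

theorem evalL_powerDer (k : ℤ) (p : MvPolynomial ℤ ℂ) :
    evalL n (powerDer k p) = wittDer k (evalL n p) := by
  induction p using MvPolynomial.induction_on with
  | C a =>
    rw [powerDer, derivation_C, map_zero, evalL, ← algebraMap_eq, AlgHom.commutes,
      Derivation.map_algebraMap]
  | add p q hp hq => simp only [map_add, hp, hq]
  | mul_X p m hp =>
    have h1 : evalL n (powerDer k (X m)) = wittDer k (evalL n (X m)) := by
      rw [powerDer, mkDerivation_X, evalL_X, map_sum, map_mul, evalL_X, evalL, ← algebraMap_eq,
        AlgHom.commutes, ← Algebra.smul_def, Finset.smul_sum]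
      exact Finset.sum_congr rfl fun i _ => (wittDer_zPow k i m).symm
    simp only [Derivation.leibniz, map_mul, map_add, smul_eq_mul, h1, hp]

theorem sum_euler_zPow_mul (k : ℤ) (f : Laurent n) :
    ∑ i, euler i (zPow i k * f) = (k : ℂ) • evalL n (X k) * f + wittDer k f := by
  simp only [Derivation.leibniz, euler_zPow, if_true, smul_eq_mul, Finset.sum_add_distrib,
    wittDer_apply, evalL_X, Finset.smul_sum, Finset.sum_mul]
  rw [add_comm]
  congr 1
  exact Finset.sum_congr rfl fun i _ => mul_comm _ _

/-- The divergence identity behind the loop equations on the torus. -/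
theorem sum_euler_evalL (k : ℤ) (p : MvPolynomial ℤ ℂ) :
    ∑ i, euler i (zPow i k * (evalL n p * vanderL n))
      = evalL n (splitPoly k * p + powerDer k p) * vanderL n := by
  rw [sum_euler_zPow_mul, Derivation.leibniz, wittDer_vanderL, ← evalL_powerDer, map_add, map_mul]
  simp only [smul_eq_mul]
  ring

end ToeplitzLattice

namespace ToeplitzLattice

/-! ### Uniqueness of the solution of the loop equations -/

open MvPolynomial

open AddMonoidAlgebra (single)

variable {n : ℕ}

/-- `HasWeight d p`: the polynomial `p` has degree at most `d`, where `X_m` has degree `|m|`. -/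
inductive HasWeight : ℕ → MvPolynomial ℤ ℂ → Prop
  | const (d : ℕ) (c : ℂ) : HasWeight d (C c)
  | add {d : ℕ} {p q : MvPolynomial ℤ ℂ} (hp : HasWeight d p) (hq : HasWeight d q) :
      HasWeight d (p + q)
  | mulX {d a : ℕ} {m : ℤ} {p : MvPolynomial ℤ ℂ} (hm : m.natAbs ≤ a) (hp : HasWeight d p) :
      HasWeight (d + a) (X m * p)

namespace HasWeight

theorem mono {d e : ℕ} {p : MvPolynomial ℤ ℂ} (hp : HasWeight d p) : d ≤ e → HasWeight e p := by
  induction hp with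
  | const d c => exact fun _ => const e c
  | add _ _ h1 h2 => exact fun h => (h1 h).add (h2 h)
  | @mulX d a m p hm hp _ =>
    intro h
    obtain ⟨b, rfl⟩ : ∃ b, e = d + (a + b) := ⟨e - (d + a), by omega⟩
    exact mulX (by omega) hp

theorem mul {d e : ℕ} {p q : MvPolynomial ℤ ℂ} (hp : HasWeight d p) (hq : HasWeight e q) :
    HasWeight (d + e) (p * q) := by
  induction hp with
  | const d c =>
    refine HasWeight.mono ?_ (Nat.le_add_left e d)
    induction hq with
    | const e c' => rw [← C_mul]; exact const _ _
    | add _ _ h1 h2 => rw [mul_add]; exact h1.add h2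
    | mulX hm _ h => rw [mul_left_comm]; exact mulX hm h
  | add _ _ h1 h2 => rw [add_mul]; exact h1.add h2
  | mulX hm _ h => rw [mul_assoc, add_right_comm]; exact mulX hm h

theorem X_of_le {m : ℤ} {a : ℕ} (hm : m.natAbs ≤ a) : HasWeight a (X m) := by
  simpa using mulX hm (const 0 1)

theorem smul {d : ℕ} {p : MvPolynomial ℤ ℂ} (hp : HasWeight d p) (c : ℂ) : HasWeight d (c • p) := by
  rw [MvPolynomial.smul_eq_C_mul]
  simpa using (const 0 c).mul hp

theorem sub {d : ℕ} {p q : MvPolynomial ℤ ℂ} (hp : HasWeight d p) (hq : HasWeight d q) :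
    HasWeight d (p - q) := by
  simpa [sub_eq_add_neg] using hp.add (hq.smul (-1))

theorem sum {ι : Type*} {s : Finset ι} {d : ℕ} {p : ι → MvPolynomial ℤ ℂ}
    (h : ∀ i ∈ s, HasWeight d (p i)) : HasWeight d (∑ i ∈ s, p i) :=
  Finset.sum_induction _ _ (fun _ _ => add) (by simpa using const d 0) h

theorem splitPoly (k : ℤ) : HasWeight k.natAbs (splitPoly k) := by
  refine sub (sum fun l hl => ?_) (sum fun l hl => ?_) <;> rw [Finset.mem_Ioc] at hl <;>
  · refine HasWeight.mono ((X_of_le (le_refl (k - l).natAbs)).mul (X_of_le (le_refl l.natAbs))) ?_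
    omega

theorem powerDer {d : ℕ} {p : MvPolynomial ℤ ℂ} (hp : HasWeight d p) (k : ℤ) :
    HasWeight (d + k.natAbs) (powerDer k p) := by
  induction hp with
  | const d c => rw [ToeplitzLattice.powerDer, derivation_C]; simpa using const _ 0
  | add _ _ h1 h2 => rw [map_add]; exact h1.add h2
  | @mulX d a m p hm hp h =>
    rw [Derivation.leibniz, ToeplitzLattice.powerDer, mkDerivation_X, smul_eq_mul, smul_eq_mul]
    refine add ?_ ?_
    · rw [add_right_comm]
      exact mulX hm h
    · refine HasWeight.mono (hp.mul ((const 0 (m : ℂ)).mul (X_of_le (le_refl (m + k).natAbs)))) ?_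
      omega

theorem exists_hasWeight (p : MvPolynomial ℤ ℂ) : ∃ d, HasWeight d p := by
  induction p using MvPolynomial.induction_on with
  | C c => exact ⟨0, const 0 c⟩
  | add p q hp hq =>
    obtain ⟨a, ha⟩ := hp
    obtain ⟨b, hb⟩ := hq
    exact ⟨max a b, (ha.mono (le_max_left _ _)).add (hb.mono (le_max_right _ _))⟩
  | mul_X p m hp =>
    obtain ⟨a, ha⟩ := hp
    exact ⟨_, ha.mul (X_of_le le_rfl)⟩

end HasWeight

/-- The span of the Laurent monomials with exponents between `-d` and `d`. -/
noncomputable def boxL (n d : ℕ) : Submodule ℂ (Laurent n) :=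
  Submodule.span ℂ ((fun a => single a 1) '' Set.Icc (fun _ : Fin n => -(d : ℤ)) fun _ => (d : ℤ))

instance finiteDimensional_boxL (n d : ℕ) : FiniteDimensional ℂ (boxL n d) :=
  FiniteDimensional.span_of_finite ℂ ((Set.finite_Icc _ _).image _)

theorem zPow_mul_mem_boxL {d a : ℕ} {m : ℤ} (hm : m.natAbs ≤ a) (i : Fin n) {f : Laurent n}
    (hf : f ∈ boxL n d) : zPow i m * f ∈ boxL n (d + a) := by
  induction hf using Submodule.span_induction with
  | mem f hf =>
    obtain ⟨b, hb, rfl⟩ := hf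
    rw [zPow, AddMonoidAlgebra.single_mul_single, mul_one]
    refine Submodule.subset_span ⟨_, ?_, rfl⟩
    have h1 : ∀ j, -(a : ℤ) ≤ (Pi.single i m : Fin n → ℤ) j ∧ (Pi.single i m : Fin n → ℤ) j ≤ a := by
      intro j
      by_cases h : j = i
      · subst h
        rw [Pi.single_eq_same]
        omega
      · rw [Pi.single_eq_of_ne h]
        omega
    refine ⟨fun j => ?_, fun j => ?_⟩
    · have : -(d : ℤ) ≤ b j := hb.1 j
      have := h1 j
      simp only [Pi.add_apply, Nat.cast_add]
      omega
    · have : b j ≤ (d : ℤ) := hb.2 j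
      have := h1 j
      simp only [Pi.add_apply, Nat.cast_add]
      omega
  | zero => rw [mul_zero]; exact zero_mem _
  | add f g _ _ hf hg => rw [mul_add]; exact add_mem hf hg
  | smul c f _ hf => rw [mul_smul_comm]; exact Submodule.smul_mem _ _ hf

theorem HasWeight.evalL_mem {d : ℕ} {p : MvPolynomial ℤ ℂ} (hp : HasWeight d p) :
    evalL n p ∈ boxL n d := by
  induction hp with
  | const d c =>
    rw [evalL, ← algebraMap_eq, AlgHom.commutes, Algebra.algebraMap_eq_smul_one]
    refine Submodule.smul_mem _ _ (Submodule.subset_span ⟨0, ⟨fun _ => ?_, fun _ => ?_⟩, rfl⟩) <;> simp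
  | add _ _ h1 h2 => rw [map_add]; exact add_mem h1 h2
  | mulX hm _ h =>
    rw [map_mul, evalL_X, Finset.sum_mul]
    exact sum_mem fun i _ => zPow_mul_mem_boxL hm i h

/-- The symmetric Laurent polynomials of weight at most `d`. -/
noncomputable def symL (n d : ℕ) : Submodule ℂ (Laurent n) where
  carrier := {f | ∃ p, HasWeight d p ∧ evalL n p = f}
  add_mem' := by
    rintro _ _ ⟨p, hp, rfl⟩ ⟨q, hq, rfl⟩
    exact ⟨p + q, hp.add hq, map_add _ _ _⟩
  zero_mem' := ⟨C 0, .const d 0, by rw [map_zero, map_zero]⟩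
  smul_mem' := by
    rintro c _ ⟨p, hp, rfl⟩
    exact ⟨c • p, hp.smul c, map_smul _ _ _⟩

instance finiteDimensional_symL (n d : ℕ) : FiniteDimensional ℂ (symL n d) :=
  Submodule.finiteDimensional_of_le (S₂ := boxL n d) (by
    rintro _ ⟨p, hp, rfl⟩
    exact hp.evalL_mem)

/-- The span of the polynomials whose means vanish by the loop equations. -/
noncomputable def loopSpan : Submodule ℂ (MvPolynomial ℤ ℂ) :=
  Submodule.span ℂ (Set.range fun x : ℤ × MvPolynomial ℤ ℂ => splitPoly x.1 * x.2 + powerDer x.1 x.2)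

/-- For `p = X_m p'` the derivative of `X_m` along `z_i` is `m z_i^m`, so that part is the
divergence behind a loop equation for `g p'`. The remaining part is the same statement for `p'` with
`g` replaced by `X_m g`, which is why `g` is carried along. The weight does not grow, so the
operator preserves a finite-dimensional space. -/
theorem exists_mem_loopSpan {d : ℕ} {p : MvPolynomial ℤ ℂ} (hp : HasWeight d p) :
    ∀ (a : ℕ) (g : MvPolynomial ℤ ℂ), HasWeight a g → ∃ r ∈ loopSpan, HasWeight (a + d) r ∧
      ∀ n, ∑ i, euler i (euler i (evalL n p) * (evalL n g * vanderL n)) = evalL n r * vanderL n := by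
  induction hp with
  | const d c =>
    intro a g hg
    refine ⟨0, zero_mem _, by simpa using HasWeight.const _ 0, fun n => ?_⟩
    simp only [evalL, ← algebraMap_eq, AlgHom.commutes, Derivation.map_algebraMap, zero_mul, map_zero,
      Finset.sum_const_zero]
  | add _ _ h1 h2 =>
    intro a g hg
    obtain ⟨r1, hr1, hw1, he1⟩ := h1 a g hg
    obtain ⟨r2, hr2, hw2, he2⟩ := h2 a g hg
    refine ⟨r1 + r2, add_mem hr1 hr2, hw1.add hw2, fun n => ?_⟩
    simp only [map_add, add_mul, Finset.sum_add_distrib, he1, he2]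
  | @mulX d b m p hm hp ih =>
    intro a g hg
    obtain ⟨r, hr, hw, he⟩ := ih (b + a) (X m * g) (by rw [add_comm]; exact hg.mulX hm)
    have hgp : HasWeight (a + d) (g * p) := hg.mul hp
    refine ⟨(m : ℂ) • (splitPoly m * (g * p) + powerDer m (g * p)) + r,
      add_mem (Submodule.smul_mem _ _ (Submodule.subset_span ⟨(m, g * p), rfl⟩)) hr,
      ((((HasWeight.splitPoly m).mul hgp).mono (by omega)).add
        ((hgp.powerDer m).mono (by omega))).smul _ |>.add (hw.mono (by omega)), fun n => ?_⟩
    rw [map_add, add_mul, ← he n, map_smul, smul_mul_assoc, ← sum_euler_evalL, Finset.smul_sum,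
      ← Finset.sum_add_distrib]
    refine Finset.sum_congr rfl fun i _ => ?_
    rw [← Derivation.map_smul, ← map_add]
    congr 1
    have h1 : euler i (evalL n (X m)) = (m : ℂ) • zPow i m := by
      rw [evalL_X, map_sum, Finset.sum_eq_single i (fun j _ hj => by simp [euler_zPow, hj.symm])
        (by simp), euler_zPow, if_pos rfl]
    rw [map_mul (evalL n), map_mul (evalL n), map_mul (evalL n), Derivation.leibniz, h1]
    simp only [smul_eq_mul, Algebra.smul_def]
    ring

/-- Pairing with the conjugate of `f` and integrating by parts gives the Dirichlet form, a sum of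
squared norms of `(euler i f) * vander n`. The Vandermonde product can be cancelled, as it is
nonzero. -/
theorem euler_eq_zero_of_sum_eq_zero {f : Laurent n}
    (h : ∑ i, euler i (euler i f * vanderL n) = 0) (i : Fin n) : euler i f = 0 := by
  have h1 : ∑ i : Fin n, constTerm n ((euler i f * vander n) * conjL (euler i f * vander n)) = 0 := by
    have h2 : ∀ i : Fin n, (euler i f * vander n) * conjL (euler i f * vander n)
        = euler i (euler i f * vanderL n) * conjL f - euler i (euler i f * vanderL n * conjL f) := by
      intro i
      rw [Derivation.leibniz (euler i) (euler i f * vanderL n) (conjL f), euler_conjL, map_mul, vanderL]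
      simp only [smul_eq_mul]
      ring
    simp only [h2, map_sub, constTerm_euler, sub_zero]
    rw [← map_sum, ← Finset.sum_mul, h, zero_mul, map_zero]
  have h3 := eq_zero_of_sum_constTerm_eq_zero (s := Finset.univ) h1 i (Finset.mem_univ i)
  exact (mul_eq_zero.mp h3).resolve_right (vander_ne_zero n)

theorem eq_const_of_euler_eq_zero {f : Laurent n} (h : ∀ i, euler i f = 0) :
    f = algebraMap ℂ (Laurent n) (constTerm n f) := by
  rw [Algebra.algebraMap_eq_smul_one]
  ext a
  change f.coeff a = constTerm n f * (1 : Laurent n).coeff a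
  rw [AddMonoidAlgebra.one_def, AddMonoidAlgebra.coeff_single, Finsupp.single_apply]
  by_cases ha : 0 = a
  · subst ha
    rw [if_pos rfl, mul_one]
    rfl
  · obtain ⟨i, hi⟩ := Function.ne_iff.mp (Ne.symm ha)
    have h1 := congrArg (fun g : Laurent n => g.coeff a) (h i)
    simp only [coeff_euler] at h1
    rw [if_neg ha, mul_zero]
    exact (mul_eq_zero.mp h1).resolve_left (by exact_mod_cast hi)

/-- Every symmetric Laurent polynomial is a constant modulo the loop equations. -/
theorem exists_evalL_eq_const_add (n : ℕ) (p : MvPolynomial ℤ ℂ) :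
    ∃ c : ℂ, ∃ r ∈ loopSpan, evalL n p = evalL n (C c + r) := by
  obtain ⟨d, hd⟩ := HasWeight.exists_hasWeight p
  have hex : ∀ f : symL n d, ∃ r ∈ loopSpan, evalL n r ∈ symL n d ∧
      ∑ i, euler i (euler i (f : Laurent n) * vanderL n) = evalL n r * vanderL n := by
    rintro ⟨_, q, hq, rfl⟩
    obtain ⟨r, hr, hw, he⟩ := exists_mem_loopSpan hq 0 (C 1) (.const 0 1)
    refine ⟨r, hr, ⟨r, by simpa using hw, rfl⟩, ?_⟩
    rw [← he n, map_one, map_one]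
    simp only [one_mul]
  choose r hr hmem he using hex
  have hcancel : ∀ f g : Laurent n, f * vanderL n = g * vanderL n → f = g := fun f g h =>
    mul_right_cancel₀ (vanderL_ne_zero n) h
  -- The radial Laplacian of the density. The chosen representatives `r f` need not be linear in
  -- `f`, but their values are determined by cancelling the density.
  let T : symL n d →ₗ[ℂ] symL n d :=
    { toFun := fun f => ⟨evalL n (r f), hmem f⟩
      map_add' := fun f g => by
        refine Subtype.ext (hcancel _ _ ?_)
        simp only [Submodule.coe_add, add_mul, ← he, map_add, Finset.sum_add_distrib]
      map_smul' := fun c f => by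
        refine Subtype.ext (hcancel _ _ ?_)
        simp only [Submodule.coe_smul, smul_mul_assoc, ← he, Derivation.map_smul, Finset.smul_sum,
          RingHom.id_apply] }
  have hT : ∀ f, ((T f : symL n d) : Laurent n) = evalL n (r f) := fun f => rfl
  have hker : ∀ f, T f = 0 → (f : Laurent n) = algebraMap ℂ (Laurent n) (constTerm n f) := by
    intro f hf
    have h0 : evalL n (r f) = 0 := by rw [← hT, hf]; rfl
    exact eq_const_of_euler_eq_zero (euler_eq_zero_of_sum_eq_zero (by rw [he, h0, zero_mul]))
  -- If `T (T f) = 0` then `T f` is a constant. Its mean against the density is that of a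
  -- divergence, hence zero, while the density has nonzero mean, so the constant vanishes.
  have hker2 : LinearMap.ker (T ∘ₗ T) ≤ LinearMap.ker T := by
    intro f hf
    have h1 := hker (T f) hf
    have h2 : constTerm n ((T f : Laurent n) * vanderL n) = 0 := by
      rw [hT, ← he, map_sum]
      exact Finset.sum_eq_zero fun i _ => constTerm_euler i _
    rw [h1, Algebra.algebraMap_eq_smul_one, smul_mul_assoc, one_mul, map_smul, smul_eq_mul] at h2
    have h3 := (mul_eq_zero.mp h2).resolve_right (constTerm_vanderL_ne_zero n)
    rw [h3, map_zero] at h1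
    exact Subtype.ext h1
  have hdisj : Disjoint (LinearMap.ker T) (LinearMap.range T) := by
    rw [Submodule.disjoint_def]
    rintro _ h1 ⟨g, rfl⟩
    exact hker2 h1
  -- Kernel and range are disjoint and the space is finite-dimensional. Every element is thus a
  -- constant plus an element of the range, and the range comes from the loop equations.
  have htop : LinearMap.ker T ⊔ LinearMap.range T = ⊤ := by
    refine Submodule.eq_top_of_finrank_eq ?_
    have h1 := Submodule.finrank_sup_add_finrank_inf_eq (LinearMap.ker T) (LinearMap.range T)
    rw [hdisj.eq_bot, finrank_bot, add_zero] at h1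
    rw [h1, add_comm, LinearMap.finrank_range_add_finrank_ker]
  obtain ⟨u, hu, v, ⟨w, rfl⟩, huv⟩ := Submodule.mem_sup.mp
    (htop ▸ Submodule.mem_top : (⟨evalL n p, p, hd, rfl⟩ : symL n d) ∈ _)
  refine ⟨constTerm n u, r w, hr w, ?_⟩
  have h1 := congrArg Subtype.val huv
  refine h1.symm.trans ?_
  rw [map_add]
  change (u : Laurent n) + evalL n (r w) = _
  congr 1
  exact (hker u hu).trans ((evalL n).commutes _).symm

end ToeplitzLattice

namespace ToeplitzLattice

/-! ### The Weyl integration formula for symmetric functions -/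

open MvPolynomial

open AddMonoidAlgebra (single)

variable {n : ℕ}

local notation "UG" n => Matrix.unitaryGroup (Fin n) ℂ

/-- The evaluation of Laurent polynomials on the torus. -/
noncomputable def evalT (n : ℕ) : Laurent n →ₐ[ℂ] C(Fin n → Circle, ℂ) :=
  AddMonoidAlgebra.lift ℂ C(Fin n → Circle, ℂ) (Fin n → ℤ)
    { toFun := fun a => torusProd fun i => zp (Multiplicative.toAdd a i)
      map_one' := by
        ext z
        simp [torusProd_apply, zp_zero]
      map_mul' := fun a b => by
        ext z
        simp only [toAdd_mul, Pi.add_apply, torusProd_apply, zp_add, ContinuousMap.mul_apply,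
          Finset.prod_mul_distrib] }

theorem evalT_single (a : Fin n → ℤ) (c : ℂ) :
    evalT n (single a c) = c • torusProd fun i => zp (a i) :=
  AddMonoidAlgebra.lift_single _ _ _

theorem evalT_single_apply (a : Fin n → ℤ) (c : ℂ) (z : Fin n → Circle) :
    evalT n (single a c) z = c * ∏ i, (z i : ℂ) ^ a i := by
  simp only [evalT_single, ContinuousMap.smul_apply, torusProd_apply, zp_apply, smul_eq_mul]

theorem evalT_zPow_apply (i : Fin n) (k : ℤ) (z : Fin n → Circle) :
    evalT n (zPow i k) z = (z i : ℂ) ^ k := by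
  rw [zPow, evalT_single_apply, one_mul, Finset.prod_eq_single i]
  · rw [Pi.single_eq_same]
  · intro j _ hj
    rw [Pi.single_eq_of_ne hj, zpow_zero]
  · simp

theorem evalT_conjL_apply (f : Laurent n) (z : Fin n → Circle) :
    evalT n (conjL f) z = starRingEnd ℂ (evalT n f z) := by
  induction f using laurent_induction with
  | hadd f g hf hg => simp only [map_add, ContinuousMap.add_apply, hf, hg]
  | hs a c =>
    rw [conjL_single, evalT_single_apply, evalT_single_apply, map_mul, map_prod]
    congr 1
    refine Finset.prod_congr rfl fun i _ => ?_
    rw [map_zpow₀, ← Circle.coe_inv_eq_conj, Circle.coe_inv, inv_zpow', Pi.neg_apply]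

theorem evalT_vanderL (n : ℕ) : evalT n (vanderL n) = vanderSq n := by
  ext z
  have h1 : evalT n (vander n) z = ∏ k : Fin n, ∏ l ∈ Finset.Ioi k, ((z l : ℂ) - z k) := by
    simp only [vander, map_prod, ContinuousMap.prod_apply, map_sub, ContinuousMap.sub_apply,
      evalT_zPow_apply, zpow_one]
  rw [vanderL, map_mul, ContinuousMap.mul_apply, evalT_conjL_apply, Complex.mul_conj', h1]
  simp [vanderSq]

theorem torusMean_evalT (f : Laurent n) : torusMean n (evalT n f) = constTerm n f := by
  induction f using laurent_induction with
  | hadd f g hf hg => simp only [map_add, hf, hg]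
  | hs a c =>
    rw [evalT_single, map_smul, torusMean_torusProd]
    change _ = (single a c).coeff 0
    rw [AddMonoidAlgebra.coeff_single, Finsupp.single_apply]
    simp only [mean_zp]
    split_ifs with h
    · subst h
      simp
    · obtain ⟨i, hi⟩ := Function.ne_iff.mp h
      rw [Finset.prod_eq_zero (Finset.mem_univ i) (if_neg hi), smul_zero]

theorem torusMean_vanderSq (n : ℕ) : torusMean n (vanderSq n) = n.factorial := by
  have h1 := torusMean_mul_vanderSq n 1
  have h2 : (torusProd fun _ : Fin n => (1 : C(Circle, ℂ))) = 1 := by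
    ext z
    simp [torusProd_apply]
  have h3 : (Matrix.of fun k l : Fin n => mean (zp ((k : ℕ) - (l : ℕ) : ℤ) * 1)) = 1 := by
    ext k l
    simp [mean_zp, Matrix.one_apply, sub_eq_zero, Fin.ext_iff]
  rwa [h2, one_mul, h3, Matrix.det_one, mul_one] at h1

/-- The traces of the powers of a unitary matrix are the power sums of its eigenvalues, a point of
the torus. A relation between power sums on the torus therefore holds on the group. -/
theorem evalL_eq_zero_imp {p : MvPolynomial ℤ ℂ} (hp : evalL n p = 0) : evalU n p = 0 := by
  ext M
  obtain ⟨z, hz⟩ := exists_trace_zpow_eq M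
  have h1 : ((ContinuousMap.evalAlgHom ℂ ℂ M).comp (evalU n))
      = ((ContinuousMap.evalAlgHom ℂ ℂ z).comp ((evalT n).comp (evalL n))) := by
    refine MvPolynomial.algHom_ext fun k => ?_
    simp only [AlgHom.comp_apply, evalU, aeval_X, evalL_X, map_sum]
    refine Eq.trans ?_ ((hz k).trans (Finset.sum_congr rfl fun i _ => (evalT_zPow_apply i k z).symm))
    rfl
  have h2 := DFunLike.congr_fun h1 p
  simp only [AlgHom.comp_apply, hp, map_zero] at h2
  exact h2

/-- Both functionals vanish on the span of the loop equations and take the value `1` on the constant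
`1`. Modulo that span every polynomial is a constant. -/
theorem weyl_polynomial (n : ℕ) (p : MvPolynomial ℤ ℂ) :
    intCLM (haarU n) (evalU n p)
      = (n.factorial : ℂ)⁻¹ * torusMean n (evalT n (evalL n p) * vanderSq n) := by
  obtain ⟨c, r, hr, hc⟩ := exists_evalL_eq_const_add n p
  have h0 : ∀ r ∈ loopSpan, intCLM (haarU n) (evalU n r) = 0 ∧ constTerm n (evalL n r * vanderL n) = 0 := by
    intro r hr
    induction hr using Submodule.span_induction with
    | mem r hr =>
      obtain ⟨⟨k, q⟩, rfl⟩ := hr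
      refine ⟨loop_equation q k, ?_⟩
      rw [← sum_euler_evalL, map_sum]
      exact Finset.sum_eq_zero fun i _ => constTerm_euler i _
    | zero => simp
    | add f g _ _ hf hg => simp only [map_add, add_mul, hf.1, hf.2, hg.1, hg.2, add_zero, and_self]
    | smul a f _ hf => simp only [map_smul, smul_mul_assoc, hf.1, hf.2, smul_zero, and_self]
  have h1 : evalU n p = evalU n (C c + r) := by
    rw [← sub_eq_zero, ← map_sub]
    exact evalL_eq_zero_imp (by rw [map_sub, hc, sub_self])
  have h2 : evalL n (C c) = c • 1 := by
    rw [evalL, ← algebraMap_eq, AlgHom.commutes, Algebra.algebraMap_eq_smul_one]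
  have h3 : evalU n (C c) = c • 1 := by
    rw [evalU, ← algebraMap_eq, AlgHom.commutes, Algebra.algebraMap_eq_smul_one]
  have h4 : intCLM (haarU n) (1 : C(UG n, ℂ)) = 1 := by
    simp [intCLM_apply]
  rw [← evalT_vanderL, ← map_mul, torusMean_evalT, h1, hc, map_add, map_add, map_add, add_mul,
    map_add, (h0 r hr).1, (h0 r hr).2, h2, h3, map_smul, h4, smul_mul_assoc, one_mul, map_smul,
    ← torusMean_evalT, evalT_vanderL, torusMean_vanderSq]
  have : (n.factorial : ℂ) ≠ 0 := by exact_mod_cast n.factorial_ne_zero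
  simp only [smul_eq_mul, add_zero]
  field_simp

/-- The power sums, on `U(n)` and on the torus simultaneously. -/
noncomputable def powerSum (n : ℕ) (k : ℤ) : C((UG n) ⊕ (Fin n → Circle), ℂ) where
  toFun := Sum.elim (⇑(∑ i, entry k i i : C(UG n, ℂ))) (⇑(∑ i, evalT n (zPow i k) : C(Fin n → Circle, ℂ)))
  continuous_toFun := (map_continuous _).sumElim (map_continuous _)

theorem powerSum_inl (k : ℤ) (M : UG n) :
    powerSum n k (Sum.inl M) = ((M ^ k : UG n) : Matrix (Fin n) (Fin n) ℂ).trace := by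
  change (∑ i, entry k i i : C(UG n, ℂ)) M = _
  rw [ContinuousMap.sum_apply]
  rfl

theorem powerSum_inr (k : ℤ) (z : Fin n → Circle) :
    powerSum n k (Sum.inr z) = ∑ i, (z i : ℂ) ^ k := by
  change (∑ i, evalT n (zPow i k) : C(Fin n → Circle, ℂ)) z = _
  simp only [ContinuousMap.sum_apply, evalT_zPow_apply]

theorem norm_powerSum_le (n : ℕ) (k : ℤ) : ‖powerSum n k‖ ≤ n := by
  refine (ContinuousMap.norm_le _ (Nat.cast_nonneg n)).mpr ?_
  have h1 : ∀ f : Fin n → ℂ, (∀ i, ‖f i‖ ≤ 1) → ‖∑ i, f i‖ ≤ n := fun f hf =>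
    (norm_sum_le_of_le _ fun i _ => hf i).trans (by simp)
  rintro (M | z)
  · rw [powerSum_inl]
    exact h1 _ fun i => entry_norm_bound_of_unitary (M ^ k).2 i i
  · rw [powerSum_inr]
    exact h1 _ fun i => by rw [norm_zpow, Circle.norm_coe, one_zpow]

/-- The restriction to `U(n)`. -/
noncomputable def restrictU (n : ℕ) : C((UG n) ⊕ (Fin n → Circle), ℂ) →ₐ[ℂ] C(UG n, ℂ) :=
  ContinuousMap.compRightAlgHom ℂ ℂ ⟨Sum.inl, continuous_inl⟩

/-- The restriction to the torus. -/
noncomputable def restrictT (n : ℕ) : C((UG n) ⊕ (Fin n → Circle), ℂ) →ₐ[ℂ] C(Fin n → Circle, ℂ) :=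
  ContinuousMap.compRightAlgHom ℂ ℂ ⟨Sum.inr, continuous_inr⟩

/-- The closed algebra generated by the power sums. -/
noncomputable def classFun (n : ℕ) : Subalgebra ℂ C((UG n) ⊕ (Fin n → Circle), ℂ) :=
  (aeval (powerSum n)).range.topologicalClosure

theorem isClosed_classFun (n : ℕ) : IsClosed (classFun n : Set C((UG n) ⊕ (Fin n → Circle), ℂ)) :=
  Subalgebra.isClosed_topologicalClosure _

theorem powerSum_mem (n : ℕ) (k : ℤ) : powerSum n k ∈ classFun n :=
  Subalgebra.le_topologicalClosure _ ⟨X k, aeval_X _ _⟩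

/-- The Weyl integration formula. -/
theorem weyl_integration {F : C((UG n) ⊕ (Fin n → Circle), ℂ)} (hF : F ∈ classFun n) :
    intCLM (haarU n) (restrictU n F)
      = (n.factorial : ℂ)⁻¹ * torusMean n (restrictT n F * vanderSq n) := by
  have hU : Continuous (restrictU n) := ContinuousMap.continuous_precomp _
  have hT : Continuous (restrictT n) := ContinuousMap.continuous_precomp _
  -- On the disjoint union of the group and the torus, a uniform limit of polynomials in the power
  -- sums is approximated on both pieces by the same polynomials, so the closed condition passes to
  -- the limit.
  have hcl : IsClosed {F : C((UG n) ⊕ (Fin n → Circle), ℂ) | intCLM (haarU n) (restrictU n F)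
      = (n.factorial : ℂ)⁻¹ * torusMean n (restrictT n F * vanderSq n)} :=
    isClosed_eq ((intCLM (haarU n)).continuous.comp hU)
      (continuous_const.mul ((torusMean n).continuous.comp (hT.mul continuous_const)))
  refine closure_minimal ?_ hcl hF
  rintro _ ⟨p, rfl⟩
  have h1 : (restrictU n).comp (aeval (powerSum n)) = evalU n :=
    MvPolynomial.algHom_ext fun k => by
      ext M
      simp only [AlgHom.comp_apply, evalU, aeval_X]
      rfl
  have h2 : (restrictT n).comp (aeval (powerSum n)) = (evalT n).comp (evalL n) :=
    MvPolynomial.algHom_ext fun k => by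
      ext z
      simp only [AlgHom.comp_apply, aeval_X, evalL_X, map_sum]
      rfl
  have e1 := DFunLike.congr_fun h1 p
  have e2 := DFunLike.congr_fun h2 p
  rw [AlgHom.comp_apply] at e1 e2
  change intCLM (haarU n) (restrictU n (aeval (powerSum n) p)) = (n.factorial : ℂ)⁻¹ * torusMean n
    (restrictT n (aeval (powerSum n) p) * vanderSq n)
  rw [e1, e2]
  exact weyl_polynomial n p

/-- The weight `e^{V}`, on `U(n)` and on the torus simultaneously. -/
noncomputable def wtX (n : ℕ) (t s : Times) : C((UG n) ⊕ (Fin n → Circle), ℂ) :=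
  wt (fun i => powerSum n (i : ℕ)) (fun i => powerSum n (-(i : ℕ))) t s

theorem wtX_mem (n : ℕ) (t s : Times) : wtX n t s ∈ classFun n := by
  have hpot : pot (fun i => powerSum n (i : ℕ)) (fun i => powerSum n (-(i : ℕ))) t s ∈ classFun n := by
    by_cases h : Summable fun i : ℕ+ => t i • powerSum n (i : ℕ) - s i • powerSum n (-(i : ℕ))
    · exact (isClosed_classFun n).mem_of_tendsto h.hasSum (.of_forall fun u => sum_mem fun i _ =>
        sub_mem (Subalgebra.smul_mem _ (powerSum_mem n _) _) (Subalgebra.smul_mem _ (powerSum_mem n _) _))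
    · rw [pot, tsum_eq_zero_of_not_summable h]
      exact zero_mem _
  exact NormedSpace.exp_mem (R := ℂ) (isClosed_classFun n) hpot

theorem trPow_eq (M : UG n) (i : ℕ) :
    trPow M i = ((M ^ (i : ℤ) : UG n) : Matrix (Fin n) (Fin n) ℂ).trace := by
  rw [trPow, zpow_natCast]
  rfl

theorem trPowConj_eq (M : UG n) (i : ℕ) :
    trPowConj M i = ((M ^ (-i : ℤ) : UG n) : Matrix (Fin n) (Fin n) ℂ).trace := by
  have h1 : (M : Matrix (Fin n) (Fin n) ℂ).map (starRingEnd ℂ)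
      = ((M⁻¹ : UG n) : Matrix (Fin n) (Fin n) ℂ).transpose := rfl
  rw [trPowConj, h1, ← Matrix.transpose_pow, Matrix.trace_transpose, zpow_neg, zpow_natCast, ← inv_pow]
  rfl

variable {t s : Times}

theorem wtX_inl (ht : SummableTimes t) (hs : SummableTimes s) (M : UG n) :
    wtX n t s (Sum.inl M) = weightU t s M := by
  rw [wtX, wt_apply (fun _ => norm_powerSum_le n _) (fun _ => norm_powerSum_le n _) ht hs, weightU]
  simp only [powerSum_inl, trPow_eq, trPowConj_eq]

theorem wtX_inr (ht : SummableTimes t) (hs : SummableTimes s) (z : Fin n → Circle) :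
    wtX n t s (Sum.inr z) = ∏ i, wtC t s (z i) := by
  have hb : ∀ i : ℕ+, ‖zp (i : ℕ)‖ ≤ 1 := fun _ => norm_zp_le _
  have hc : ∀ i : ℕ+, ‖zp (-(i : ℕ))‖ ≤ 1 := fun _ => norm_zp_le _
  rw [wtX, wt_apply (fun _ => norm_powerSum_le n _) (fun _ => norm_powerSum_le n _) ht hs]
  simp only [wtC, wt_apply hb hc ht hs]
  rw [← Complex.exp_sum, ← Summable.tsum_finsetSum]
  · congr 1
    refine tsum_congr fun i => ?_
    simp only [powerSum_inr, zp_apply, Finset.sum_sub_distrib, Finset.mul_sum]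
  · exact fun i _ => ((summable_pot hb hc ht hs).map (ContinuousMap.evalCLM ℂ (z i))
      (ContinuousMap.evalCLM ℂ (z i)).continuous)

/-- A class function whose restriction to the torus is a product `∏ g(z_i)` multiplies the symbol of
the Toeplitz determinant by `g`, by Weyl's formula and Andréief's identity. It is used with `g = 1`
and with `g(z) = -z^(±1)`. -/
theorem integral_weightU (ht : SummableTimes t) (hs : SummableTimes s) (g : C(Circle, ℂ))
    {G : C((UG n) ⊕ (Fin n → Circle), ℂ)} (hG : G ∈ classFun n)
    (hg : ∀ z, G (Sum.inr z) = ∏ i, g (z i)) :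
    ∫ M, G (Sum.inl M) * weightU t s M ∂haarU n
      = Matrix.det (Matrix.of fun k l : Fin n => mean (zp ((k : ℕ) - (l : ℕ) : ℤ) * (g * wtC t s))) := by
  have h1 := weyl_integration (mul_mem hG (wtX_mem n t s))
  have h2 : restrictT n (G * wtX n t s) = torusProd fun _ => g * wtC t s := by
    ext z
    change G (Sum.inr z) * wtX n t s (Sum.inr z) = _
    simp only [hg, wtX_inr ht hs, torusProd_apply, ContinuousMap.mul_apply, Finset.prod_mul_distrib]
  rw [h2, torusMean_mul_vanderSq, inv_mul_cancel_left₀ (by exact_mod_cast n.factorial_ne_zero)] at h1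
  rw [← h1, intCLM_apply]
  refine integral_congr_ae (.of_forall fun M => ?_)
  change _ = G (Sum.inl M) * wtX n t s (Sum.inl M)
  rw [wtX_inl ht hs]

theorem tau_eq_integral (ht : SummableTimes t) (hs : SummableTimes s) (n : ℕ) :
    tau n t s = ∫ M, weightU t s M ∂haarU n := by
  have h1 := integral_weightU (n := n) ht hs 1 (one_mem _) fun z => by simp
  simp only [ContinuousMap.one_apply, one_mul] at h1
  rw [h1, tau_eq ht hs]
  rfl

end ToeplitzLattice

namespace ToeplitzLattice

/-! ### The elementary Schur polynomials of power sums -/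

theorem eval_elemSchur_of_le (t : Times) {n N : ℕ} (h : n ≤ N) : MvPolynomial.eval t (elemSchur n)
    = ∑ k ∈ Finset.range (N + 1), (k.factorial : ℂ)⁻¹ * PowerSeries.coeff n (timeSeries t ^ k) := by
  rw [eval_elemSchur]
  refine Finset.sum_subset (Finset.range_mono (by omega)) fun k _ hk => ?_
  rw [Finset.mem_range, not_lt] at hk
  rw [coeff_timeSeries_pow_eq_zero t (by omega), mul_zero]

/-- The recurrence `(n + 1) s_{n+1} = ∑ s_i · (j + 1) t_{j+1}` over `i + j = n`. -/
theorem succ_mul_eval_elemSchur (t : Times) (n : ℕ) :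
    MvPolynomial.eval t (elemSchur (n + 1)) * (n + 1)
      = ∑ p ∈ Finset.HasAntidiagonal.antidiagonal n, MvPolynomial.eval t (elemSchur p.1)
        * PowerSeries.coeff p.2 (PowerSeries.derivative ℂ (timeSeries t)) := by
  have h1 : ∀ p ∈ Finset.HasAntidiagonal.antidiagonal n, MvPolynomial.eval t (elemSchur p.1)
      * PowerSeries.coeff p.2 (PowerSeries.derivative ℂ (timeSeries t))
      = ∑ k ∈ Finset.range (n + 1), (k.factorial : ℂ)⁻¹ * (PowerSeries.coeff p.1 (timeSeries t ^ k)
        * PowerSeries.coeff p.2 (PowerSeries.derivative ℂ (timeSeries t))) := fun p hp => by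
    have := Finset.HasAntidiagonal.mem_antidiagonal.mp hp
    rw [eval_elemSchur_of_le t (show p.1 ≤ n by omega), Finset.sum_mul]
    exact Finset.sum_congr rfl fun k _ => mul_assoc _ _ _
  rw [Finset.sum_congr rfl h1, Finset.sum_comm, eval_elemSchur, Finset.sum_range_succ', add_mul,
    Finset.sum_mul]
  simp only [← Finset.mul_sum, ← PowerSeries.coeff_mul]
  rw [pow_zero, PowerSeries.coeff_one, if_neg (by omega), mul_zero, zero_mul, add_zero]
  refine Finset.sum_congr rfl fun k _ => ?_
  have h2 : PowerSeries.coeff n (PowerSeries.derivative ℂ (timeSeries t ^ (k + 1)))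
      = PowerSeries.coeff (n + 1) (timeSeries t ^ (k + 1)) * (n + 1) := PowerSeries.coeff_derivative _ _
  rw [mul_assoc, ← h2, Derivation.leibniz_pow, Nat.add_sub_cancel, smul_eq_mul, map_nsmul, nsmul_eq_mul,
    Nat.factorial_succ]
  have h3 : (k.factorial : ℂ) ≠ 0 := by exact_mod_cast k.factorial_ne_zero
  have h4 : ((k : ℂ) + 1) ≠ 0 := by exact_mod_cast k.succ_ne_zero
  push_cast
  field_simp

/-- The geometric series `∑ z^k`. -/
theorem mk_pow_mul_one_sub (z : ℂ) :
    PowerSeries.mk (fun k => z ^ k) * (1 - PowerSeries.C z * PowerSeries.X) = 1 := by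
  ext k
  cases k with
  | zero => simp [mul_sub, ← mul_assoc]
  | succ k =>
    rw [mul_sub, mul_one, map_sub, ← mul_assoc, PowerSeries.coeff_succ_mul_X, PowerSeries.coeff_mul_C,
      PowerSeries.coeff_mk, PowerSeries.coeff_mk, PowerSeries.coeff_one, if_neg k.succ_ne_zero]
    ring

variable {n : ℕ}

/-- The generating function of the elementary Schur polynomials at negative power sums. -/
theorem eval_elemSchur_powerSum (w : Fin n → ℂ) (m : ℕ) :
    MvPolynomial.eval (fun i : ℕ+ => -(1 / (i : ℂ)) * ∑ j, w j ^ (i : ℕ)) (elemSchur m)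
      = PowerSeries.coeff m (∏ j, (1 - PowerSeries.C (w j) * PowerSeries.X)) := by
  set t : Times := fun i : ℕ+ => -(1 / (i : ℂ)) * ∑ j, w j ^ (i : ℕ) with ht
  set P : PowerSeries ℂ := ∏ j, (1 - PowerSeries.C (w j) * PowerSeries.X) with hP
  -- The product has the same logarithmic derivative as the exponential generating function. Both
  -- coefficient sequences thus satisfy the recurrence of `succ_mul_eval_elemSchur` with the same
  -- initial value.
  have h1 : PowerSeries.derivative ℂ P = (PowerSeries.derivative ℂ (timeSeries t)) * P := by
    rw [hP, derivation_prod _ _ _ (fun j => -(PowerSeries.C (w j) * PowerSeries.mk fun k => w j ^ k))]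
    · congr 1
      ext k
      rw [PowerSeries.coeff_derivative, map_sum]
      have h2 := coeff_timeSeries_coe t k.succPNat
      rw [Nat.succPNat_coe] at h2
      rw [h2]
      simp only [map_neg, PowerSeries.coeff_C_mul, PowerSeries.coeff_mk, ht, Nat.succPNat_coe,
        Finset.sum_neg_distrib, Nat.succ_eq_add_one, pow_succ']
      have h4 : ((k : ℂ) + 1) ≠ 0 := by exact_mod_cast k.succ_ne_zero
      push_cast
      field_simp
    · intro j _
      rw [neg_mul, mul_assoc, mk_pow_mul_one_sub, mul_one, map_sub, Derivation.map_one_eq_zero,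
        zero_sub, ← PowerSeries.smul_eq_C_mul, Derivation.map_smul, PowerSeries.derivative_X,
        PowerSeries.smul_eq_C_mul, mul_one]
  induction m using Nat.strong_induction_on with
  | _ m ih =>
    cases m with
    | zero =>
      rw [eval_elemSchur, hP, PowerSeries.coeff_zero_eq_constantCoeff, map_prod]
      simp
    | succ m =>
      have h4 : ((m : ℂ) + 1) ≠ 0 := by exact_mod_cast m.succ_ne_zero
      refine mul_right_cancel₀ h4 ?_
      rw [succ_mul_eval_elemSchur, ← PowerSeries.coeff_derivative, h1, mul_comm, PowerSeries.coeff_mul]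
      refine Finset.sum_congr rfl fun p hp => ?_
      have := Finset.HasAntidiagonal.mem_antidiagonal.mp hp
      rw [ih p.1 (by omega)]

/-- This is the top coefficient of a product of `n` linear factors. At the eigenvalues of a unitary
matrix it is multiplicative, which makes `integral_weightU` applicable. -/
theorem eval_elemSchur_powerSum_self (w : Fin n → ℂ) :
    MvPolynomial.eval (fun i : ℕ+ => -(1 / (i : ℂ)) * ∑ j, w j ^ (i : ℕ)) (elemSchur n)
      = ∏ j, -w j := by
  rw [eval_elemSchur_powerSum]
  have h1 : (∏ j, (1 - PowerSeries.C (w j) * PowerSeries.X) : PowerSeries ℂ)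
      = ((∏ j, (1 - Polynomial.C (w j) * Polynomial.X) : Polynomial ℂ) : PowerSeries ℂ) := by
    rw [← Polynomial.coeToPowerSeries.ringHom_apply, map_prod]
    simp
  have h2 := Polynomial.coeff_prod_of_natDegree_le (Finset.univ : Finset (Fin n))
    (fun j => 1 - Polynomial.C (w j) * Polynomial.X) 1 fun j _ => by compute_degree
  rw [Finset.card_univ, Fintype.card_fin, mul_one] at h2
  rw [h1, Polynomial.coeff_coe, h2]
  refine Finset.prod_congr rfl fun j _ => ?_
  rw [Polynomial.coeff_sub, Polynomial.coeff_C_mul, Polynomial.coeff_X_one, Polynomial.coeff_one,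
    if_neg one_ne_zero]
  ring

/-! ### Differential operators acting on exponential integrals -/

theorem aeval_continuousMap_apply {X ι : Type*} [TopologicalSpace X] (f : ι → C(X, ℂ))
    (p : MvPolynomial ι ℂ) (x : X) :
    MvPolynomial.aeval f p x = MvPolynomial.eval (fun i => f i x) p := by
  have h1 : (ContinuousMap.evalAlgHom ℂ ℂ x).comp (MvPolynomial.aeval f)
      = MvPolynomial.aeval fun i => f i x :=
    MvPolynomial.algHom_ext fun i => by simp
  exact DFunLike.congr_fun h1 p

/-- Each `D i` acts on `φ(c W)` as multiplication of `c` by `a i`. As `A` is commutative, the order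
of composition is immaterial, and a polynomial in the operators becomes the same polynomial in the
`a i`. -/
theorem diffOp_eq_aeval {A : Type*} [NormedCommRing A] [NormedAlgebra ℂ A] (φ : A →L[ℂ] ℂ)
    {f : Times → Times → ℂ} {W : Times → Times → A}
    {D : ℕ+ → (Times → Times → ℂ) → (Times → Times → ℂ)} {a : ℕ+ → A}
    (hf : ∀ t s, SummableTimes t → SummableTimes s → f t s = φ (W t s))
    (hD : ∀ i (g : Times → Times → ℂ) (c : A),
      (∀ t s, SummableTimes t → SummableTimes s → g t s = φ (c * W t s)) →
      ∀ t s, SummableTimes t → SummableTimes s → D i g t s = φ (a i * c * W t s))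
    (p : MvPolynomial ℕ+ ℂ) {t s : Times} (ht : SummableTimes t) (hs : SummableTimes s) :
    diffOp p D f t s = φ (MvPolynomial.aeval a p * W t s) := by
  have h1 : ∀ l : List ℕ+, ∀ t s, SummableTimes t → SummableTimes s →
      l.foldr D f t s = φ ((l.map a).prod * W t s) := by
    intro l
    induction l with
    | nil => intro t s ht hs; simpa using hf t s ht hs
    | cons i l ih =>
      intro t s ht hs
      rw [List.foldr_cons, hD i _ _ ih t s ht hs, List.map_cons, List.prod_cons]
  rw [diffOp, MvPolynomial.aeval_def, MvPolynomial.eval₂_eq, Finset.sum_mul, map_sum]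
  refine Finset.sum_congr rfl fun m _ => ?_
  rw [h1 _ t s ht hs, ← Algebra.smul_def, smul_mul_assoc, map_smul, smul_eq_mul]
  congr 3
  rw [← Multiset.prod_coe, ← Multiset.map_coe, Multiset.sort_eq, Finsupp.toMultiset_map,
    Finsupp.prod_toMultiset, Finsupp.prod_mapDomain_index (fun _ => pow_zero _) fun _ _ _ => pow_add _ _ _]
  rfl

section Derivatives

variable {X : Type*} [TopologicalSpace X] [CompactSpace X] (φ : C(X, ℂ) →L[ℂ] ℂ)
  {b c : ℕ+ → C(X, ℂ)} {B : ℝ} (hb : ∀ i, ‖b i‖ ≤ B) (hc : ∀ i, ‖c i‖ ≤ B)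

include hb hc

theorem pdT_eq_of_wt {g : Times → Times → ℂ} {a : C(X, ℂ)}
    (hg : ∀ t s, SummableTimes t → SummableTimes s → g t s = φ (a * wt b c t s)) (i : ℕ+) {t s : Times}
    (ht : SummableTimes t) (hs : SummableTimes s) : pdT i g t s = φ (b i * a * wt b c t s) := by
  have h1 := φ.hasFDerivAt.comp_hasDerivAt _ ((hasDerivAt_wt_left hb hc ht hs i).const_mul a)
  simp only [pdT, pd, hg _ _ (ht.update i _) hs]
  refine h1.deriv.trans ?_
  congr 1
  ring

theorem pdS_eq_of_wt {g : Times → Times → ℂ} {a : C(X, ℂ)}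
    (hg : ∀ t s, SummableTimes t → SummableTimes s → g t s = φ (a * wt b c t s)) (i : ℕ+) {t s : Times}
    (ht : SummableTimes t) (hs : SummableTimes s) : pdS i g t s = φ (-c i * a * wt b c t s) := by
  have h1 := φ.hasFDerivAt.comp_hasDerivAt _ ((hasDerivAt_wt_right hb hc ht hs i).const_mul a)
  simp only [pdS, pd, hg _ _ ht (hs.update i _)]
  refine h1.deriv.trans ?_
  congr 1
  ring

end Derivatives

/-! ### Integral formulas for `x_n` and `y_n` -/

/-- Cramer's rule replaces row `0` by minus row `n`. A cyclic rotation brings the rows into the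
order `1, …, n`, and its sign, together with the minus signs of all rows on the right, leaves a
single minus sign. -/
theorem lowerFactor_zero_mul_det {K : Type*} [Field K] {m : Matrix ℕ ℕ K} {n : ℕ}
    (hd : (trunc n m).det ≠ 0) :
    lowerFactor m n 0 * (trunc n m).det = (Matrix.of fun i j : Fin n => -m (i + 1) j).det := by
  cases n with
  | zero => simp [lowerFactor_self]
  | succ n =>
    set A : Matrix (Fin (n + 1)) (Fin (n + 1)) K := Matrix.of fun i j => m (i + 1) j
    set U := (trunc (n + 1) m).updateRow 0 fun l => m (n + 1) l
    have h1 : U.submatrix (finRotate (n + 1)) id = A := by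
      ext i j
      rw [Matrix.submatrix_apply, id]
      refine Fin.lastCases ?_ (fun i => ?_) i
      · rw [finRotate_last]
        simp [U, A]
      · rw [finRotate_apply, Fin.coeSucc_eq_succ]
        simp [U, A, trunc]
    have h2 := Matrix.det_permute (finRotate (n + 1)) U
    rw [h1, sign_finRotate, Nat.add_sub_cancel] at h2
    have h3 := lowerFactor_mul_det hd 0
    have h4 : (fun l : Fin (n + 1) => -m (n + 1) l) = (-1 : K) • fun l : Fin (n + 1) => m (n + 1) l := by
      ext l
      simp
    rw [h4, Matrix.det_updateRow_smul] at h3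
    have h5 : (Matrix.of fun i j : Fin (n + 1) => -m (i + 1) j) = -A := rfl
    rw [h5, Matrix.det_neg, Fintype.card_fin, h2]
    refine h3.trans ?_
    push_cast
    rw [← mul_assoc, ← pow_add, show n + 1 + n = 2 * n + 1 by ring, pow_succ, pow_mul]
    simp [U]

local notation "UG" n => Matrix.unitaryGroup (Fin n) ℂ

/-- The polynomial `s_n(-p_1, -p_2 / 2, …)` in the power sums `p_i` of the `ε`-th powers. -/
noncomputable def schurX (n : ℕ) (ε : ℤ) : C((UG n) ⊕ (Fin n → Circle), ℂ) :=
  MvPolynomial.aeval (fun i : ℕ+ => (-(1 / (i : ℂ))) • powerSum n (ε * (i : ℕ))) (elemSchur n)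

theorem schurX_mem (n : ℕ) (ε : ℤ) : schurX n ε ∈ classFun n := by
  rw [schurX]
  induction elemSchur n using MvPolynomial.induction_on with
  | C c =>
    rw [← MvPolynomial.algebraMap_eq, AlgHom.commutes]
    exact Subalgebra.algebraMap_mem _ c
  | add p q hp hq => rw [map_add]; exact add_mem hp hq
  | mul_X p i hp =>
    rw [map_mul, MvPolynomial.aeval_X]
    exact mul_mem hp (Subalgebra.smul_mem _ (powerSum_mem n _) _)

theorem schurX_inr (ε : ℤ) (z : Fin n → Circle) :
    schurX n ε (Sum.inr z) = ∏ i, (-zp ε : C(Circle, ℂ)) (z i) := by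
  rw [schurX, aeval_continuousMap_apply]
  simp only [ContinuousMap.smul_apply, powerSum_inr, smul_eq_mul, zpow_mul, zpow_natCast]
  rw [eval_elemSchur_powerSum_self]
  simp only [ContinuousMap.neg_apply, zp_apply]

theorem schurX_inl_one (M : UG n) : schurX n 1 (Sum.inl M)
    = MvPolynomial.eval (fun i : ℕ+ => -(1 / (i : ℂ)) * trPow M i) (elemSchur n) := by
  rw [schurX, aeval_continuousMap_apply]
  simp only [ContinuousMap.smul_apply, powerSum_inl, smul_eq_mul, trPow_eq, one_mul]

theorem schurX_inl_neg_one (M : UG n) : schurX n (-1) (Sum.inl M)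
    = MvPolynomial.eval (fun i : ℕ+ => -(1 / (i : ℂ)) * trPowConj M i) (elemSchur n) := by
  rw [schurX, aeval_continuousMap_apply]
  simp only [ContinuousMap.smul_apply, powerSum_inl, smul_eq_mul, trPowConj_eq, neg_one_mul]

variable {t s : Times} (ht : SummableTimes t) (hs : SummableTimes s)

include ht hs

theorem integral_schurX (n : ℕ) (ε : ℤ) :
    ∫ M, schurX n ε (Sum.inl M) * weightU t s M ∂haarU n
      = (Matrix.of fun k l : Fin n => -mu t s ((k : ℕ) - (l : ℕ) + ε)).det := by
  rw [integral_weightU ht hs _ (schurX_mem n ε) (schurX_inr ε)]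
  congr 1
  ext k l
  rw [Matrix.of_apply, Matrix.of_apply, mu, zp_add, neg_mul, mul_neg, map_neg, mul_assoc]

theorem x_eq_integral (hd : ∀ n, tau n t s ≠ 0) (n : ℕ) : x n t s = 1 / tau n t s
    * ∫ M, schurX n 1 (Sum.inl M) * weightU t s M ∂haarU n := by
  have hd' : (trunc n (mom t s)).det ≠ 0 := hd n
  rw [integral_schurX ht hs, one_div, inv_mul_eq_div, eq_div_iff (hd n), x_eq, S1_eq]
  refine (lowerFactor_zero_mul_det hd').trans ?_
  congr 1
  ext k l
  rw [Matrix.of_apply, Matrix.of_apply, mom_eq ht hs]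
  congr 2
  push_cast
  ring

theorem y_eq_integral (hd : ∀ n, tau n t s ≠ 0) (n : ℕ) : y n t s = 1 / tau n t s
    * ∫ M, schurX n (-1) (Sum.inl M) * weightU t s M ∂haarU n := by
  have hd' : (trunc n (mom t s).transpose).det ≠ 0 := by
    rw [det_trunc_transpose]
    exact hd n
  have h1 : tau n t s = (trunc n (mom t s).transpose).det := (det_trunc_transpose _ _).symm
  rw [integral_schurX ht hs, one_div, inv_mul_eq_div, eq_div_iff (hd n), y_eq ht hs hd, h1]
  rw [lowerFactor_zero_mul_det hd', ← Matrix.det_transpose]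
  congr 1
  ext k l
  rw [Matrix.transpose_apply, Matrix.of_apply, Matrix.of_apply, Matrix.transpose_apply, mom_eq ht hs]
  congr 2
  push_cast
  ring

/-- Integration over `U(n)`, as a functional on functions on `U(n)` and the torus. -/
noncomputable def intX (n : ℕ) : C((UG n) ⊕ (Fin n → Circle), ℂ) →L[ℂ] ℂ :=
  (intCLM (haarU n)).comp ⟨(restrictU n).toLinearMap, ContinuousMap.continuous_precomp _⟩

theorem intX_mul_wtX (F : C((UG n) ⊕ (Fin n → Circle), ℂ)) :
    intX n (F * wtX n t s) = ∫ M, F (Sum.inl M) * weightU t s M ∂haarU n := by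
  refine integral_congr_ae (.of_forall fun M => ?_)
  change F (Sum.inl M) * wtX n t s (Sum.inl M) = _
  rw [wtX_inl ht hs]

theorem tau_eq_intX (n : ℕ) : tau n t s = intX n (wtX n t s) := by
  have h1 := intX_mul_wtX ht hs (1 : C((UG n) ⊕ (Fin n → Circle), ℂ))
  simp only [ContinuousMap.one_apply, one_mul] at h1
  rw [h1, tau_eq_integral ht hs]

theorem diffOp_pdT_tau (n : ℕ) :
    diffOp (elemSchur n) (fun i f t' s' => -(1 / (i : ℂ)) * pdT i f t' s') (tau n) t s
      = ∫ M, schurX n 1 (Sum.inl M) * weightU t s M ∂haarU n := by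
  rw [← intX_mul_wtX ht hs]
  refine diffOp_eq_aeval (intX n) (W := wtX n) (fun t s ht hs => tau_eq_intX ht hs n)
    (fun i g c hg t s ht hs => ?_) _ ht hs
  rw [pdT_eq_of_wt (intX n) (fun _ => norm_powerSum_le n _) (fun _ => norm_powerSum_le n _) hg i ht hs,
    ← smul_eq_mul, ← map_smul, ← smul_mul_assoc, ← smul_mul_assoc, one_mul]
  rfl

theorem diffOp_pdS_tau (n : ℕ) :
    diffOp (elemSchur n) (fun i f t' s' => 1 / (i : ℂ) * pdS i f t' s') (tau n) t s
      = ∫ M, schurX n (-1) (Sum.inl M) * weightU t s M ∂haarU n := by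
  rw [← intX_mul_wtX ht hs]
  refine diffOp_eq_aeval (intX n) (W := wtX n) (fun t s ht hs => tau_eq_intX ht hs n)
    (fun i g c hg t s ht hs => ?_) _ ht hs
  rw [pdS_eq_of_wt (intX n) (fun _ => norm_powerSum_le n _) (fun _ => norm_powerSum_le n _) hg i ht hs,
    ← smul_eq_mul, ← map_smul, ← smul_mul_assoc, ← smul_mul_assoc, neg_one_mul, neg_smul, smul_neg]
  rfl

end ToeplitzLattice

/-! ### The main theorem -/

open ToeplitzLattice in
theorem theorem3p5 :
    -- the integral and sum formulas for `τ_n = det m_n`, and analyticity of `τ_n` on `ℓ¹ × ℓ¹`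
    (∀ t s : Times, circleI 0 t s = 1) ∧
    (∀ (n : ℕ) (t s : Times), Summable (fun i => ‖t i‖) → Summable (fun i => ‖s i‖) →
      tau n t s = 1 / (n.factorial : ℂ) * circleI n t s ∧
      tau n t s = ∫ M, weightU t s M ∂(haarU n) ∧
      HasSum (fun lam : {lam : YoungDiagram // lam.colLen 0 ≤ n} =>
        schur lam.1 t * schur lam.1 (-s)) (tau n t s)) ∧
    (∀ n : ℕ, AnalyticOnNhd ℂ (fun p : lp (fun _ : ℕ+ => ℂ) 1 × lp (fun _ : ℕ+ => ℂ) 1 =>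
      tau n (p.1 : ℕ+ → ℂ) (p.2 : ℕ+ → ℂ)) Set.univ) ∧
    -- (i) Virasoro constraints
    (∀ (n : ℕ) (t s : Times), Summable (fun i : ℕ+ => (i : ℝ) * ‖t i‖) →
      Summable (fun i : ℕ+ => (i : ℝ) * ‖s i‖) →
      (∀ k : ℤ, k = -1 ∨ k = 0 ∨ k = 1 → DConverges k (circleI n) t s) ∧
      D (-1) 0 n (circleI n) t s = 0 ∧
      (∀ θ : ℂ, D 0 θ n (circleI n) t s = 0) ∧
      D 1 1 n (circleI n) t s = 0) ∧
    -- the three operators span an algebra `sl(2)`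
    (∀ (n : ℕ) (θ : ℂ) (p : MvPolynomial (ℕ+ ⊕ ℕ+) ℂ) (t s : Times),
      D 1 1 n (D (-1) 0 n (polyFun p)) t s - D (-1) 0 n (D 1 1 n (polyFun p)) t s
        = 2 * D 0 θ n (polyFun p) t s ∧
      D 1 1 n (D 0 θ n (polyFun p)) t s - D 0 θ n (D 1 1 n (polyFun p)) t s
        = D 1 1 n (polyFun p) t s ∧
      D 0 θ n (D (-1) 0 n (polyFun p)) t s - D (-1) 0 n (D 0 θ n (polyFun p)) t s
        = D (-1) 0 n (polyFun p) t s) ∧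
    -- the factorization `m_∞ = S₁⁻¹ S₂` and the bi-orthogonal polynomials
    (∀ t s : Times, Summable (fun i => ‖t i‖) → Summable (fun i => ‖s i‖) →
      (∀ n, tau n t s ≠ 0) →
      LowerUnipotent (S1 t s) ∧ Upper (S2 t s) ∧ (∀ n, S2 t s n n = h n t s) ∧
      imul (S1 t s) (triInv (S1 t s)) = 1 ∧ imul (triInv (S1 t s)) (S1 t s) = 1 ∧
      imul (S2 t s) (triInv (S2 t s)) = 1 ∧ imul (triInv (S2 t s)) (S2 t s) = 1 ∧
      imul (S1 t s) (mom t s) = S2 t s ∧ mom t s = imul (triInv (S1 t s)) (S2 t s) ∧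
      (∀ A B : Matrix ℕ ℕ ℂ, LowerUnipotent A → Upper B → imul A (mom t s) = B →
        A = S1 t s ∧ B = S2 t s) ∧
      (∀ n, (p1 n t s).Monic ∧ (p1 n t s).natDegree = n ∧
        (p2 n t s).Monic ∧ (p2 n t s).natDegree = n) ∧
      (∀ n m, ip t s (fun z => (p1 n t s).eval z) (fun z => (p2 m t s).eval z)
        = if n = m then h n t s else 0)) ∧
    -- (ii) the 2-Toda lattice
    (∀ t s : Times, Summable (fun i => ‖t i‖) → Summable (fun i => ‖s i‖) →
      (∀ n, tau n t s ≠ 0) → ∀ (k : ℕ+) (a b : ℕ),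
      HasDerivAt (fun u => L1 (Function.update t k u) s a b)
        (icomm (plusPart (ipow (L1 t s) k)) (L1 t s) a b) (t k) ∧
      HasDerivAt (fun u => L2 (Function.update t k u) s a b)
        (icomm (plusPart (ipow (L1 t s) k)) (L2 t s) a b) (t k) ∧
      HasDerivAt (fun u => L1 t (Function.update s k u) a b)
        (icomm (minusPart (ipow (L2 t s) k)) (L1 t s) a b) (s k) ∧
      HasDerivAt (fun u => L2 t (Function.update s k u) a b)
        (icomm (minusPart (ipow (L2 t s) k)) (L2 t s) a b) (s k)) ∧
    -- the two 2d-Toda identities for `τ_n`, `n ≥ 1`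
    (∀ (n : ℕ) (t s : Times), 1 ≤ n → Summable (fun i => ‖t i‖) → Summable (fun i => ‖s i‖) →
      tau n t s ≠ 0 →
      pdS 1 (dlogT 1 (tau n)) t s
        = -(tau (n - 1) t s * tau (n + 1) t s / tau n t s ^ 2) ∧
      (tau (n - 1) t s ≠ 0 →
        pdS 2 (dlogT 1 (tau n)) t s
          = -2 * dlogS 1 (fun t' s' => tau n t' s' / tau (n - 1) t' s') t s
              * pdS 1 (dlogT 1 (tau n)) t s
            - pdS 1 (pdS 1 (dlogT 1 (tau n))) t s)) ∧
    -- the discrete sinh-Gordon equation for `q_n = log (τ_{n+1} / τ_n)`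
    (∀ (n : ℕ) (t s : Times), Summable (fun i => ‖t i‖) → Summable (fun i => ‖s i‖) →
      ∀ (U : Set (ℂ × ℂ)) (q : ℕ → ℂ × ℂ → ℂ), U ∈ nhds (t 1, s 1) →
      (∀ m, n ≤ m + 1 → m ≤ n + 1 → ContinuousOn (q m) U ∧
        ∀ w ∈ U, tauSlice t s m w ≠ 0 ∧
          Complex.exp (q m w) = tauSlice t s (m + 1) w / tauSlice t s m w) →
      SinhGordonAt q n (t 1, s 1)) ∧
    -- equivalence of the first 2d-Toda identity and the discrete sinh-Gordon equation
    (∀ (U : Set (ℂ × ℂ)) (f q : ℕ → ℂ × ℂ → ℂ), IsOpen U → (∀ w ∈ U, f 0 w = 1) →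
      (∀ n, AnalyticOnNhd ℂ (f n) U) → (∀ n, ∀ w ∈ U, f n w ≠ 0) →
      (∀ n, ContinuousOn (q n) U) →
      (∀ n, ∀ w ∈ U, Complex.exp (q n w) = f (n + 1) w / f n w) →
      ((∀ n, 1 ≤ n → ∀ w ∈ U, TodaAt f n w) ↔ ∀ n, ∀ w ∈ U, SinhGordonAt q n w)) ∧
    -- (iii) the rank two structure and the formulas for `x_n`, `y_n`
    (∀ t s : Times, Summable (fun i => ‖t i‖) → Summable (fun i => ‖s i‖) →
      (∀ n, tau n t s ≠ 0) →
      (∀ a b, (h a t s)⁻¹ * L1 t s a b * h b t s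
        = rankTwo1 (fun n => x n t s) (fun n => y n t s) a b) ∧
      (∀ a b, L2 t s a b = rankTwo2 (fun n => x n t s) (fun n => y n t s) a b) ∧
      (∀ n, h (n + 1) t s / h n t s = 1 - x (n + 1) t s * y (n + 1) t s) ∧
      (∀ n, x n t s = 1 / tau n t s * ∫ M, MvPolynomial.eval
          (fun i : ℕ+ => -(1 / (i : ℂ)) * trPow M i) (elemSchur n) * weightU t s M ∂(haarU n)) ∧
      (∀ n, x n t s
        = diffOp (elemSchur n) (fun i f t' s' => -(1 / (i : ℂ)) * pdT i f t' s') (tau n) t s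
          / tau n t s) ∧
      (∀ n, y n t s = 1 / tau n t s * ∫ M, MvPolynomial.eval
          (fun i : ℕ+ => -(1 / (i : ℂ)) * trPowConj M i) (elemSchur n)
            * weightU t s M ∂(haarU n)) ∧
      (∀ n, y n t s
        = diffOp (elemSchur n) (fun i f t' s' => 1 / (i : ℂ) * pdS i f t' s') (tau n) t s
          / tau n t s)) ∧
    -- the Toeplitz lattice, with its initial and boundary conditions
    (∀ i : ℕ+, LocallyFinite (H1 i) ∧ LocallyFinite (H2 i)) ∧
    (∀ t s : Times, Summable (fun i => ‖t i‖) → Summable (fun i => ‖s i‖) →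
      (∀ n, tau n t s ≠ 0) → ∀ i n : ℕ+,
      HasDerivAt (fun u => x n (Function.update t i u) s)
        ((1 - x n t s * y n t s) * atXY t s (dForm (H1 i) (Sum.inr n))) (t i) ∧
      HasDerivAt (fun u => y n (Function.update t i u) s)
        (-(1 - x n t s * y n t s) * atXY t s (dForm (H1 i) (Sum.inl n))) (t i) ∧
      HasDerivAt (fun u => x n t (Function.update s i u))
        ((1 - x n t s * y n t s) * atXY t s (dForm (H2 i) (Sum.inr n))) (s i) ∧
      HasDerivAt (fun u => y n t (Function.update s i u))
        (-(1 - x n t s * y n t s) * atXY t s (dForm (H2 i) (Sum.inl n))) (s i)) ∧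
    (∀ n : ℕ, 1 ≤ n → x n 0 0 = 0 ∧ y n 0 0 = 0) ∧
    (∀ t s : Times, Summable (fun i => ‖t i‖) → Summable (fun i => ‖s i‖) →
      (∀ n, tau n t s ≠ 0) → x 0 t s = 1 ∧ y 0 t s = 1) ∧
    -- the Poisson brackets of the traces
    (∀ i j : ℕ+,
      (BracketConverges (H1 i) (H1 j) ∧ bracket (H1 i) (H1 j) = 0) ∧
      (BracketConverges (H2 i) (H2 j) ∧ bracket (H2 i) (H2 j) = 0) ∧
      (BracketConverges (H1 i) (H2 j) ∧
        bracket (H1 i) (H2 j) = MvPowerSeries.C (if i = j then 1 else 0))) ∧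
    -- Hisakado's identity
    (∀ (n : ℕ) (t s : Times), Summable (fun i => ‖t i‖) → Summable (fun i => ‖s i‖) →
      tau n t s ≠ 0 → tau (n + 1) t s ≠ 0 →
      (1 + pdS 1 (dlogT 1 (tau (n + 1))) t s) * (1 + pdS 1 (dlogT 1 (tau n)) t s)
        = -(dlogT 1 (fun t' s' => tau (n + 1) t' s' / tau n t' s') t s
            * dlogS 1 (fun t' s' => tau (n + 1) t' s' / tau n t' s') t s)) := by
  refine ⟨circleI_zero, fun n t s ht hs => ⟨?_, ?_, hasSum_schur ht hs n⟩, analyticOnNhd_tau,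
    fun n t s ht hs => ?_, virasoro_sl2, fun t s ht hs hd => factorization ht hs hd,
    fun t s ht hs hd k a b => toda_lattice ht hs hd k a b, fun n t s hn ht hs hd => ?_,
    fun n t s ht hs U q hU hq => sinhGordon_tau n ht hs U q hU hq, toda_iff_sinhGordon,
    fun t s ht hs hd => ⟨h_inv_mul_L1_mul_h ht hs hd, fun a b => by rw [L2_eq ht hs hd],
      h_succ_div ht hs hd, ?_⟩, locallyFinite_H,
    fun t s ht hs hd i n => toeplitz_lattice ht hs hd i n, fun n hn => x_y_zero_zero hn,
    fun t s ht hs hd => ⟨x_zero t s, y_zero ht hs hd⟩,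
    fun i j => ⟨⟨(bracket_H1_H1 i j).1, by rw [(bracket_H1_H1 i j).2, map_zero]⟩,
      ⟨(bracket_H2_H2 i j).1, by rw [(bracket_H2_H2 i j).2, map_zero]⟩, bracket_H1_H2 i j⟩,
    fun n t s ht hs hd hd1 => hisakado ht hs hd hd1⟩
  case refine_1 =>
    rw [circleI_eq ht hs, one_div, inv_mul_cancel_left₀ (by exact_mod_cast n.factorial_ne_zero)]
  case refine_3 =>
    have hf : ∀ t s, SummableTimes t → SummableTimes s → circleI n t s = n.factorial * tau n t s :=
      fun t s ht hs => circleI_eq ht hs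
    have ht' : SummableTimes (degTimes t) := by simpa [SummableTimes, degTimes] using ht
    have hs' : SummableTimes (degTimes s) := by simpa [SummableTimes, degTimes] using hs
    exact ⟨fun k _ => dConverges_of_tau hf ht' hs' k, virasoro_neg_one hf ht' hs',
      virasoro_zero hf ht' hs', virasoro_one hf ht' hs'⟩
  case refine_4 =>
    obtain ⟨n, rfl⟩ : ∃ m, n = m + 1 := ⟨n - 1, by omega⟩
    exact ⟨toda_equation ht hs hd, fun hd0 => second_toda_equation ht hs hd hd0⟩
  case refine_2 => exact tau_eq_integral ht hs n
  case refine_5 =>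
    simp only [← schurX_inl_one, ← schurX_inl_neg_one, diffOp_pdT_tau ht hs, diffOp_pdS_tau ht hs]
    exact ⟨x_eq_integral ht hs hd, fun n => by rw [x_eq_integral ht hs hd, one_div_mul_eq_div],
      y_eq_integral ht hs hd, fun n => by rw [y_eq_integral ht hs hd, one_div_mul_eq_div]⟩
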